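/- **Setting.** Let $d,m\ge 1$ and $k\ge 0$ be integers and let $\Omega\subset\mathbb R^d$ be a polytopal domain (nonempty, connected, and the interior of a finite union of closed nondegenerate $d$-simplices). Write $(a,b)_Y=\int_Y b^{\mathsf H}a$. Let $\mathcal K\in L^\infty(\Omega;\mathbb C^{m\times m})$ and, for $1\le i\le d$, let $\mathcal A^i\in L^\infty\cap C^{0,1/2}(\Omega;\mathbb C^{m\times m})$ be Hermitian, with $\nabla\cdot\mathcal A=\sum_i\partial_i\mathcal A^i\in L^\infty(\Omega;\mathbb C^{m\times m})$. Assume that $\mathcal K+\mathcal K^{\mathsf H}-\nabla\cdot\mathcal A\ge 2\mathfrak r_\flat I$ a.e. in $\Omega$ for some $\mathfrak r_\flat>0$. Matrices are normed by the operator norm induced by the Hermitian norm of $\mathbb C^m$. Set $A_1=\sum_i\mathcal A^i\partial_i$, $A=\mathcal K+A_1$, $\tilde A=\mathcal K^{\mathsf H}-\nabla\cdot\mathcal A-A_1$, $\mathfrak r_\sharp=\|\mathcal K\|_{L^\infty(\Omega)}+\|\nabla\cdot\mathcal A\|_{L^\infty(\Omega)}$ and $\rho=\mathfrak r_\sharp/\mathfrak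 r_\flat$. Let $\mathcal N=\sum_i n_i\mathcal A^i$ on $\partial\Omega$, with $n$ the outward unit normal, and let $\mathcal M\in L^\infty(\partial\Omega;\mathbb C^{m\times m})$ satisfy, a.e. on $\partial\Omega$, $\Re(\xi^{\mathsf H}\mathcal M\xi)\ge0$ for all $\xi\in\mathbb C^m$ and $\ker(\mathcal M-\mathcal N)+\ker(\mathcal M+\mathcal N)=\mathbb C^m$. Let $V=\{v\in L^2(\Omega;\mathbb C^m): A_1v\in L^2(\Omega;\mathbb C^m)\}$ with the graph norm, let $V'$ be the space of bounded antilinear functionals on $V$, and define $N:V\to V'$ by $\langle Nw,v\rangle=(Aw,v)_\Omega-(w,\tilde Av)_\Omega$. Let $M:V\to V'$ be linear, bounded and monotone ($\Re\langle Mv,v\rangle\ge0$), with $\ker(N-M)+\ker(N+M)=V$ and $\langle Mw,v\rangle=(\mathcal Mw,v)_{\partial\Omega}$ for all $w,v\in V\cap H^s(\Omega;\mathbb C^m)$, $s>\frac12$. Put $V_0=\ker(M-N)$. **Mesh and discrete spaces.** Let $(\mathcal T_h,\mathcal F_h)$ be a polytopal mesh of $\Omega$: a finite set of disjoint nonempty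 polytopal elements $T$ whose closures cover $\overline\Omega$, and a finite set of disjoint nonempty faces $F$, each a connected relatively open subset of a hyperplane whose relative boundary has zero $(d-1)$-dimensional measure. Each face is contained either in $\partial T_1\cap\partial T_2$ for two distinct elements or in $\partial T\cap\partial\Omega$ for one element, and $\bigcup_T\partial T=\bigcup_F\overline F$. Each face has a fixed unit normal $n_F$, pointing out of $\Omega$ if $F$ lies in $\partial\Omega$. Let $\mathcal F_h^{\rm b}$ be the set of faces contained in $\partial\Omega$, let $\mathcal F_T$ be the set of faces contained in $\partial T$, and for $F\in\mathcal F_T$ let $\omega_{TF}\in\{\pm1\}$ be such that $\omega_{TF}n_F$ points out of $T$. Let $h_T$ be the diameter of $T$, $\mathcal N_F=\sum_i n_{F,i}\mathcal A^i_{|F}$, $\mathcal M_F=\mathcal M_{|F}$, $\mathfrak A_T=\max_i\|\mathcal A^i\|_{L^\infty(T)}$ and $\mathfrak t_T=\max(\mathfrak A_Th_T^{-1},\mathfrak r_\flat)^{-1}$. For $Y\in\mathcal T_h\cup\mathcal F_h$, let $\mathcal P^k(Y;\mathbb C^m)$ be the space of restrictions to $Y$ of $\mathbb C^m$-valued polynomials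 of total degree at most $k$, and let $\pi_Y^k$ be the $L^2(Y)$-orthogonal projector on it. Let $\underline U_h^k$ be the space of families $\underline v_h=((v_T)_{T\in\mathcal T_h},(v_F)_{F\in\mathcal F_h})$ with $v_Y\in\mathcal P^k(Y;\mathbb C^m)$, let $v_h$ be the function equal to $v_T$ on each $T$, and for $w\in H^s(\Omega;\mathbb C^m)$, $s>\frac12$, let $\underline I_h^kw=((\pi_T^kw)_T,(\pi_F^kw)_F)$. **Stabilization.** Let $\mathcal S^{\rm i}_{TF}\in L^\infty(F;\mathbb C^{m\times m})$ ($T\in\mathcal T_h$, $F\in\mathcal F_T$) and $\mathcal S^{\rm b}_F\in L^\infty(F;\mathbb C^{m\times m})$ ($F\in\mathcal F^{\rm b}_h$) be Hermitian nonnegative fields and let $C_S$ be a real number such that, for all $T\in\mathcal T_h$ and $F\in\mathcal F_T$, $$(\mathcal S^{\rm i}_{TF}v,v)_F\le C_S\,\mathfrak A_T\|v\|_{L^2(F)}^2\quad\forall v\in\mathcal P^k(F;\mathbb C^m),$$ $$|(w,\mathcal N_Fv)_F|\le C_S\,\mathfrak A_T^{1/2}\|w\|_{L^2(F)}(\mathcal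 S^{\rm i}_{TF}v,v)_F^{1/2}\quad\forall w,v\in L^2(F;\mathbb C^m),$$ and, for all $F\in\mathcal F_h^{\rm b}$, with $T_F$ the element having $F$ as a face, $\ker(\mathcal M_F-\mathcal N_F)\subset\ker(\mathcal M_F+\mathcal S^{\rm b}_F-\mathcal N_F)$ a.e. on $F$ and $$|((\mathcal M_F+\mathcal S^{\rm b}_F+\mathcal N_F)w,v)_F|\le C_S\,\mathfrak A_{T_F}^{1/2}\|w\|_{L^2(F)}\bigl(\Re((\mathcal M_F+\mathcal S^{\rm b}_F)v,v)_F\bigr)^{1/2}\quad\forall w,v\in L^2(F;\mathbb C^m).$$ Let $j_h(\underline w_h,\underline v_h)=\sum_T\sum_{F\in\mathcal F_T}(\mathcal S^{\rm i}_{TF}(w_F-w_T),v_F-v_T)_F$, $$\begin{aligned}a_h(\underline w_h,\underline v_h)={}&\sum_T(Aw_T,v_T)_T+\mathfrak r_\flat\sum_Th_T\sum_{F\in\mathcal F_T}(w_F-w_T,v_F-v_T)_F+\sum_T\sum_{F\in\mathcal F_T}\omega_{TF}\Bigl(\mathcal N_F(w_F-w_T),\tfrac{v_F+v_T}2\Bigr)_F\\&+\tfrac12\sum_{F\in\mathcal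 F_h^{\rm b}}((\mathcal M_F+\mathcal S_F^{\rm b}-\mathcal N_F)w_F,v_F)_F+j_h(\underline w_h,\underline v_h),\end{aligned}$$ $$\begin{aligned}\|\underline v_h\|_h^2={}&\mathfrak r_\flat\sum_T\Bigl(\|v_T\|_{L^2(T)}^2+h_T\sum_{F\in\mathcal F_T}\|v_F-v_T\|_{L^2(F)}^2\Bigr)+\tfrac12\sum_{F\in\mathcal F_h^{\rm b}}\Re((\mathcal M_F+\mathcal S_F^{\rm b})v_F,v_F)_F\\&+j_h(\underline v_h,\underline v_h)+\sum_T\mathfrak t_T\|A_1v_T\|_{L^2(T)}^2,\end{aligned}$$ and let $\|\cdot\|_{h,*}$ be the norm dual to $\|\cdot\|_h$. **Lemma (estimate of the consistency error).** For every $C_S$ there is a constant $C>0$, depending only on $C_S$, such that in the above setting, for all $s>\frac12$ and all $w\in V_0\cap H^s(\Omega;\mathbb C^m)$, the consistency error $\mathcal E_h(w;\underline v_h)=(Aw,v_h)_\Omega-a_h(\underline I_h^kw,\underline v_h)$ satisfies $$\|\mathcal E_h(w;\cdot)\|_{h,*}\le C\Bigl(\sum_{T\in\mathcal T_h}(\mathfrak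 r_\sharp\rho+\mathfrak t_T^{-1})\|w-\pi_T^kw\|_{L^2(T)}^2+\sum_{T\in\mathcal T_h}(\mathfrak A_T+\mathfrak r_\flat h_T)\|w-\pi_T^kw\|_{L^2(\partial T)}^2\Bigr)^{1/2}.$$ -/

import Mathlib

open MeasureTheory Set Filter Topology
open scoped ENNReal NNReal Matrix ContDiff
open scoped Matrix.Norms.L2Operator ComplexOrder

noncomputable section

namespace Friedrichs

/-- Points of `ℝ^d`, with the Euclidean norm. -/
abbrev Pt (d : ℕ) := EuclideanSpace ℝ (Fin d)

/-- Vectors of `ℂ^m`, with the Hermitian norm. -/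
abbrev Vc (m : ℕ) := EuclideanSpace ℂ (Fin m)

/-- Complex `m × m` matrices, normed by the operator norm induced by the Hermitian norm. -/
abbrev Mat (m : ℕ) := Matrix (Fin m) (Fin m) ℂ

variable {d m : ℕ}

/-- The matrix-vector product on `ℂ^m`. -/
def act (B : Mat m) (v : Vc m) : Vc m := Matrix.toEuclideanCLM (n := Fin m) (𝕜 := ℂ) B v

/-- The `i`-th partial derivative of a (smooth) function on `ℝ^d`. -/
def partialD {F : Type*} [NormedAddCommGroup F] [NormedSpace ℝ F]
    (i : Fin d) (f : Pt d → F) (x : Pt d) : F :=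
  fderiv ℝ f x (EuclideanSpace.single i 1)

/-- The surface measure, i.e. the `(d-1)`-dimensional Hausdorff measure normalised so that it is
Lebesgue measure on hyperplanes (counting measure if `d = 1`). -/
def surf (d : ℕ) : Measure (Pt d) := Measure.euclideanHausdorffMeasure (d - 1)

/-- The inner product `(a, b)_μ = ∫ b^H a dμ`, linear in the first argument. -/
def ip (μ : Measure (Pt d)) (a b : Pt d → Vc m) : ℂ := ∫ x, inner ℂ (b x) (a x) ∂μ

/-- The square of the `L²(μ; ℂ^m)`-norm. -/
def normSq (μ : Measure (Pt d)) (a : Pt d → Vc m) : ℝ := ∫ x, ‖a x‖ ^ 2 ∂μ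

/-- The `L^∞`-norm of a matrix field over `S`. -/
def supNorm (S : Set (Pt d)) (B : Pt d → Mat m) : ℝ :=
  (eLpNorm B ∞ (volume.restrict S)).toReal

/-! ### Sobolev spaces and traces -/

/-- Smooth functions with compact support contained in `Ω`. -/
def IsTest {F : Type*} [NormedAddCommGroup F] [NormedSpace ℝ F]
    (Ω : Set (Pt d)) (φ : Pt d → F) : Prop :=
  ContDiff ℝ ∞ φ ∧ HasCompactSupport φ ∧ tsupport φ ⊆ Ω

/-- `g` is the weak `i`-th partial derivative of `w` in `Ω`. -/
def IsWeakPartial (Ω : Set (Pt d)) (i : Fin d) (w g : Pt d → Vc m) : Prop :=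
  ∀ ψ : Pt d → ℝ, IsTest Ω ψ →
    ∫ x in Ω, partialD i ψ x • w x = - ∫ x in Ω, ψ x • g x

/-- The square of the Sobolev-Slobodeckij seminorm of order `θ ∈ (0,1)`. -/
def slobodeckijSq (Ω : Set (Pt d)) (θ : ℝ) (w : Pt d → Vc m) : ℝ≥0∞ :=
  ∫⁻ x in Ω, ∫⁻ y in Ω, ‖w x - w y‖ₑ ^ 2 / (edist x y) ^ ((d : ℝ) + 2 * θ)

/-- Membership in `H^{n+θ}(Ω; ℂ^m)`, with `n` a natural number and `0 ≤ θ < 1`: all weak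
derivatives of order at most `n` are square integrable and, if `θ > 0`, those of order `n` have a
finite Slobodeckij seminorm of order `θ`. -/
def MemSobolevAux (Ω : Set (Pt d)) : ℕ → ℝ → (Pt d → Vc m) → Prop
  | 0, θ, w => MemLp w 2 (volume.restrict Ω) ∧ (0 < θ → slobodeckijSq Ω θ w < ⊤)
  | n + 1, θ, w => MemLp w 2 (volume.restrict Ω) ∧
      ∀ i : Fin d, ∃ g : Pt d → Vc m, IsWeakPartial Ω i w g ∧ MemSobolevAux Ω n θ g

/-- Membership in the Sobolev-Slobodeckij space `H^s(Ω; ℂ^m)`, `s ≥ 0`. -/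
def MemSobolev (Ω : Set (Pt d)) (s : ℝ) (w : Pt d → Vc m) : Prop :=
  MemSobolevAux Ω ⌊s⌋₊ (Int.fract s) w

/-- The trace of `w ∈ H^s(Ω; ℂ^m)`, `s > 1/2`, on the hyperplanar pieces of `closure Ω`: its value
at almost every point `x` is the limit of the mean values of `w` over `B(x, r) ∩ Ω` as `r → 0`. -/
def trace (Ω : Set (Pt d)) (w : Pt d → Vc m) (x : Pt d) : Vc m :=
  limUnder (𝓝[>] (0 : ℝ)) fun r => ⨍ y in Metric.ball x r ∩ Ω, w y

/-! ### Polytopal sets and meshes -/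

/-- A nonempty polytopal set: the interior of a finite union of closed (nondegenerate)
`d`-simplices. -/
def IsPolytopal (S : Set (Pt d)) : Prop :=
  S.Nonempty ∧ ∃ I : Finset (Affine.Simplex ℝ (Pt d) d),
    S = interior (⋃ s ∈ I, convexHull ℝ (range s.points))

/-- `n` is the outward unit normal to `S` at `x`: near `x`, the set `S` is the open half-space
opposite to `n`. For polytopal sets it exists at almost every boundary point. -/
def IsOutwardNormal (S : Set (Pt d)) (x n : Pt d) : Prop :=
  ‖n‖ = 1 ∧ ∃ r > 0, S ∩ Metric.ball x r = {y ∈ Metric.ball x r | inner ℝ n (y - x) < 0}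

open Classical in
/-- The outward unit normal field on `∂S` (zero where it is not defined). -/
def outwardNormal (S : Set (Pt d)) (x : Pt d) : Pt d :=
  if h : ∃ n, IsOutwardNormal S x n then h.choose else 0

/-- A polytopal mesh of `Ω`, with the orientations of its faces. -/
structure PolytopalMesh (Ω : Set (Pt d)) where
  /-- The mesh elements. -/
  elems : Finset (Set (Pt d))
  /-- The mesh faces. -/
  faces : Finset (Set (Pt d))
  polytopal : ∀ T ∈ elems, IsPolytopal T
  elems_disjoint : ∀ T₁ ∈ elems, ∀ T₂ ∈ elems, T₁ ≠ T₂ → Disjoint T₁ T₂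
  cover : closure Ω = ⋃ T ∈ elems, closure T
  /-- The fixed unit normal of each face. -/
  normal : faces → Pt d
  normal_unit : ∀ F, ‖normal F‖ = 1
  faces_nonempty : ∀ F ∈ faces, F.Nonempty
  faces_connected : ∀ F ∈ faces, IsConnected F
  /-- A face is a relatively open subset of a hyperplane, orthogonal to its normal. -/
  faces_hyperplane : ∀ F : faces, ∃ (c : ℝ) (U : Set (Pt d)), IsOpen U ∧
    (F : Set (Pt d)) = U ∩ {y | inner ℝ (normal F) y = c}
  /-- The relative boundary of a face has zero surface measure. -/
  faces_boundary : ∀ F ∈ faces, surf d (closure F \ F) = 0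
  faces_disjoint : ∀ F₁ ∈ faces, ∀ F₂ ∈ faces, F₁ ≠ F₂ → Disjoint F₁ F₂
  /-- A face is either an interface or a boundary face. -/
  interface_or_boundary : ∀ F ∈ faces,
    (∃ T₁ ∈ elems, ∃ T₂ ∈ elems, T₁ ≠ T₂ ∧ F ⊆ frontier T₁ ∩ frontier T₂) ∨
    (∃ T ∈ elems, F ⊆ frontier T ∩ frontier Ω)
  /-- The faces partition the mesh skeleton. -/
  skeleton : ⋃ T ∈ elems, frontier T = ⋃ F ∈ faces, closure F
  /-- The orientation `ω_{TF} ∈ {1, -1}` of a face relative to an element. -/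
  orient : elems → faces → ℝ
  orient_eq : ∀ T F, orient T F = 1 ∨ orient T F = -1
  /-- `ω_{TF} n_F` points out of `T`. -/
  orient_normal : ∀ (T : elems) (F : faces), (F : Set (Pt d)) ⊆ frontier (T : Set (Pt d)) →
    ∀ᵐ x ∂(surf d).restrict F, IsOutwardNormal (T : Set (Pt d)) x (orient T F • normal F)
  /-- On boundary faces, `n_F` points out of `Ω`. -/
  boundary_normal : ∀ F : faces, (F : Set (Pt d)) ⊆ frontier Ω →
    ∀ᵐ x ∂(surf d).restrict F, IsOutwardNormal Ω x (normal F)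

namespace PolytopalMesh

variable {Ω : Set (Pt d)} (𝓜 : PolytopalMesh Ω)

open Classical in
/-- The faces that lie on the boundary of the element `T`. -/
def facesOf (T : 𝓜.elems) : Finset 𝓜.faces :=
  Finset.univ.filter fun F => (F : Set (Pt d)) ⊆ frontier (T : Set (Pt d))

open Classical in
/-- The boundary faces. -/
def bdryFaces : Finset 𝓜.faces :=
  Finset.univ.filter fun F => (F : Set (Pt d)) ⊆ frontier Ω

/-- Lebesgue measure on an element. -/
def vol (T : 𝓜.elems) : Measure (Pt d) := volume.restrict (T : Set (Pt d))

/-- Surface measure on a face. -/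
def srf (F : 𝓜.faces) : Measure (Pt d) := (surf d).restrict (F : Set (Pt d))

/-- Surface measure on the boundary of an element. -/
def bsrf (T : 𝓜.elems) : Measure (Pt d) := (surf d).restrict (frontier (T : Set (Pt d)))

/-- The diameter of an element. -/
def h (T : 𝓜.elems) : ℝ := Metric.diam (T : Set (Pt d))

end PolytopalMesh

/-! ### Friedrichs systems -/

/-- `D` is the weak divergence `∑ ∂_i A^i` in `Ω` of the family `A` of matrix fields. -/
def IsWeakDivergence (Ω : Set (Pt d)) (A : Fin d → Pt d → Mat m) (D : Pt d → Mat m) : Prop :=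
  ∀ ψ : Pt d → ℝ, IsTest Ω ψ → ∀ a b : Fin m,
    ∫ x in Ω, ∑ i, ((partialD i ψ x : ℝ) : ℂ) * A i x a b = - ∫ x in Ω, (ψ x : ℂ) * D x a b

/-- The data of a Friedrichs system on `Ω`. The fields `A i`, of class `C^{0,1/2}` on `Ω`, are
identified with their unique Hölder continuous extension to `closure Ω`. -/
structure System (Ω : Set (Pt d)) (m : ℕ) where
  K : Pt d → Mat m
  A : Fin d → Pt d → Mat m
  divA : Pt d → Mat m
  /-- The boundary field. -/
  M : Pt d → Mat m
  rflat : ℝ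
  K_mem : MemLp K ∞ (volume.restrict Ω)
  A_mem : ∀ i, MemLp (A i) ∞ (volume.restrict Ω)
  A_holder : ∀ i, ∃ C : ℝ≥0, HolderOnWith C (1 / 2) (A i) (closure Ω)
  A_hermitian : ∀ i, ∀ x ∈ Ω, (A i x).IsHermitian
  divA_mem : MemLp divA ∞ (volume.restrict Ω)
  divA_weak : IsWeakDivergence Ω A divA
  rflat_pos : 0 < rflat
  lower_bound : ∀ᵐ x ∂volume.restrict Ω,
    (K x + (K x)ᴴ - divA x - ((2 * rflat : ℝ) : ℂ) • (1 : Mat m)).PosSemidef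
  M_mem : MemLp M ∞ ((surf d).restrict (frontier Ω))
  M_nonneg : ∀ᵐ x ∂(surf d).restrict (frontier Ω), ∀ ξ : Vc m,
    0 ≤ (inner ℂ ξ (act (M x) ξ)).re
  M_ker : ∀ᵐ x ∂(surf d).restrict (frontier Ω),
    LinearMap.ker (Matrix.toEuclideanLin
        (M x - ∑ i, (outwardNormal Ω x i : ℂ) • A i x)) ⊔
      LinearMap.ker (Matrix.toEuclideanLin
        (M x + ∑ i, (outwardNormal Ω x i : ℂ) • A i x)) = ⊤

theorem memLp_act {S : Set (Pt d)} {B : Pt d → Mat m} {v : Pt d → Vc m}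
    (hB : MemLp B ∞ (volume.restrict S)) (hv : MemLp v 2 (volume.restrict S)) :
    MemLp (fun x => act (B x) (v x)) 2 (volume.restrict S) := by
  have h1 : Continuous fun B : Mat m => Matrix.toEuclideanCLM (n := Fin m) (𝕜 := ℂ) B :=
    (AddMonoidHomClass.isometry_of_norm (Matrix.toEuclideanCLM (n := Fin m) (𝕜 := ℂ))
      fun _ => rfl).continuous
  have h2 := h1.comp_aestronglyMeasurable hB.1
  have hm : AEStronglyMeasurable (fun x => act (B x) (v x)) (volume.restrict S) :=
    isBoundedBilinearMap_apply.continuous.comp_aestronglyMeasurable (h2.prodMk hv.1)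
  refine MemLp.of_le_mul (c := (eLpNorm B ∞ (volume.restrict S)).toReal) hv hm ?_
  have hb : ∀ᵐ x ∂volume.restrict S, ‖B x‖ₑ ≤ eLpNorm B ∞ (volume.restrict S) := by
    rw [eLpNorm_exponent_top]; exact ae_le_eLpNormEssSup
  filter_upwards [hb] with x hx
  have h2 : ‖B x‖ ≤ (eLpNorm B ∞ (volume.restrict S)).toReal := by
    have := ENNReal.toReal_mono hB.2.ne hx
    rwa [toReal_enorm] at this
  calc ‖act (B x) (v x)‖ ≤ ‖B x‖ * ‖v x‖ := by
        rw [Matrix.cstar_norm_def]; exact ContinuousLinearMap.le_opNorm _ _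
    _ ≤ _ := by gcongr

theorem IsTest.memLp {S : Set (Pt d)} {φ : Pt d → Vc m} (h : IsTest S φ) :
    MemLp φ 2 (volume.restrict S) :=
  h.1.continuous.memLp_of_hasCompactSupport h.2.1

theorem IsTest.memLp_partialD {S : Set (Pt d)} {φ : Pt d → Vc m} (h : IsTest S φ) (i : Fin d) :
    MemLp (partialD i φ) 2 (volume.restrict S) := by
  have hc : Continuous (partialD i φ) :=
    (h.1.continuous_fderiv (by simp)).clm_apply continuous_const
  have hs : HasCompactSupport (partialD i φ) := h.2.1.fderiv_apply (𝕜 := ℝ) _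
  exact hc.memLp_of_hasCompactSupport hs

theorem ip_integrable {μ : Measure (Pt d)} {a b : Pt d → Vc m} (ha : MemLp a 2 μ)
    (hb : MemLp b 2 μ) : Integrable (fun x => inner ℂ (b x) (a x)) μ := by
  have h := L2.integrable_inner (𝕜 := ℂ) (hb.toLp b) (ha.toLp a)
  refine h.congr ?_
  filter_upwards [hb.coeFn_toLp, ha.coeFn_toLp] with x h1 h2
  rw [h1, h2]

theorem ip_add_left {μ : Measure (Pt d)} {a a' b : Pt d → Vc m} (ha : MemLp a 2 μ)
    (ha' : MemLp a' 2 μ) (hb : MemLp b 2 μ) : ip μ (a + a') b = ip μ a b + ip μ a' b := by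
  unfold ip
  rw [← integral_add (ip_integrable ha hb) (ip_integrable ha' hb)]
  simp

theorem ip_smul_left {μ : Measure (Pt d)} (c : ℂ) (a b : Pt d → Vc m) :
    ip μ (c • a) b = c * ip μ a b := by
  unfold ip
  rw [← integral_const_mul]
  simp

theorem ip_congr_left {μ : Measure (Pt d)} {a a' : Pt d → Vc m} (b : Pt d → Vc m)
    (h : a =ᵐ[μ] a') : ip μ a b = ip μ a' b := by
  refine integral_congr_ae ?_
  filter_upwards [h] with x hx
  rw [hx]

namespace System

variable {Ω : Set (Pt d)} (𝓢 : System Ω m)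

/-- `A_1 v = ∑ A^i ∂_i v` for smooth `v`. -/
def A1 (v : Pt d → Vc m) (x : Pt d) : Vc m := ∑ i, act (𝓢.A i x) (partialD i v x)

/-- `A v = K v + A_1 v` for smooth `v`. -/
def opA (v : Pt d → Vc m) (x : Pt d) : Vc m := act (𝓢.K x) (v x) + 𝓢.A1 v x

/-- `g = A_1 w` weakly in `Ω`, i.e. `(g, φ)_Ω = -(w, (∇·A) φ + A_1 φ)_Ω` for all smooth
compactly supported `φ`. -/
def IsWeakA1 (w g : Pt d → Vc m) : Prop :=
  ∀ φ : Pt d → Vc m, IsTest Ω φ →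
    ip (volume.restrict Ω) g φ =
      - ip (volume.restrict Ω) w (fun x => act (𝓢.divA x) (φ x) + 𝓢.A1 φ x)

theorem memLp_adjoint {φ : Pt d → Vc m} (h : IsTest Ω φ) :
    MemLp (fun x => act (𝓢.divA x) (φ x) + 𝓢.A1 φ x) 2 (volume.restrict Ω) := by
  refine (memLp_act 𝓢.divA_mem h.memLp).add ?_
  exact memLp_finsetSum _ fun i _ => memLp_act (𝓢.A_mem i) (h.memLp_partialD i)

/-- The graph space `V` of the elements `w` of `L²(Ω; ℂ^m)` such that `A_1 w ∈ L²(Ω; ℂ^m)`. -/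
def graphSpace : Submodule ℂ (Lp (Vc m) 2 (volume.restrict Ω)) where
  carrier := {w | ∃ g : Lp (Vc m) 2 (volume.restrict Ω), 𝓢.IsWeakA1 w g}
  zero_mem' := by
    refine ⟨0, fun φ _ => ?_⟩
    have h : ∀ b : Pt d → Vc m,
        ip (volume.restrict Ω) (0 : Lp (Vc m) 2 (volume.restrict Ω)) b = 0 := fun b => by
      rw [ip_congr_left b (Lp.coeFn_zero (Vc m) 2 (volume.restrict Ω))]
      simp [ip]
    rw [h, h, neg_zero]
  add_mem' := by
    rintro w w' ⟨g, hg⟩ ⟨g', hg'⟩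
    refine ⟨g + g', fun φ hφ => ?_⟩
    rw [ip_congr_left _ (Lp.coeFn_add g g'), ip_congr_left _ (Lp.coeFn_add w w'),
      ip_add_left (Lp.memLp g) (Lp.memLp g') hφ.memLp,
      ip_add_left (Lp.memLp w) (Lp.memLp w') (𝓢.memLp_adjoint hφ), hg φ hφ, hg' φ hφ]
    ring
  smul_mem' := by
    rintro c w ⟨g, hg⟩
    refine ⟨c • g, fun φ hφ => ?_⟩
    rw [ip_congr_left _ (Lp.coeFn_smul c g), ip_congr_left _ (Lp.coeFn_smul c w),
      ip_smul_left, ip_smul_left, hg φ hφ]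
    ring

/-- `A_1 w` for `w ∈ V`. -/
def weakA1 (w : 𝓢.graphSpace) : Lp (Vc m) 2 (volume.restrict Ω) :=
  Classical.choose (show ∃ g : Lp (Vc m) 2 (volume.restrict Ω), 𝓢.IsWeakA1 w.1 g from w.2)

/-- `A w = K w + A_1 w` for `w ∈ V`. -/
def weakA (w : 𝓢.graphSpace) (x : Pt d) : Vc m := act (𝓢.K x) (w.1 x) + 𝓢.weakA1 w x

/-- `Ã w = K^H w - (∇·A) w - A_1 w` for `w ∈ V`. -/
def weakAt (w : 𝓢.graphSpace) (x : Pt d) : Vc m :=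
  act (𝓢.K x)ᴴ (w.1 x) - act (𝓢.divA x) (w.1 x) - 𝓢.weakA1 w x

/-- The graph norm of `V`. -/
def graphNorm (w : 𝓢.graphSpace) : ℝ := Real.sqrt (‖w.1‖ ^ 2 + ‖𝓢.weakA1 w‖ ^ 2)

/-- The boundary operator `⟨N w, v⟩ = (A w, v)_Ω - (w, Ã v)_Ω`. -/
def opN (w v : 𝓢.graphSpace) : ℂ :=
  ip (volume.restrict Ω) (𝓢.weakA w) v.1 - ip (volume.restrict Ω) w.1 (𝓢.weakAt v)

/-- The bounded monotone operator `M : V → V'` (with `V'` the space of antilinear functionals) that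
enforces the boundary condition weakly, and which for functions with traces is represented by the
boundary field of the system. -/
structure BoundaryOperator where
  toFun : 𝓢.graphSpace →ₗ[ℂ] 𝓢.graphSpace →ₗ⋆[ℂ] ℂ
  bounded : ∃ C : ℝ, ∀ w v, ‖toFun w v‖ ≤ C * 𝓢.graphNorm w * 𝓢.graphNorm v
  monotone : ∀ w, 0 ≤ (toFun w w).re
  ker_add_ker : ∀ u : 𝓢.graphSpace, ∃ u₁ u₂ : 𝓢.graphSpace, u = u₁ + u₂ ∧
    (∀ v, 𝓢.opN u₁ v - toFun u₁ v = 0) ∧ (∀ v, 𝓢.opN u₂ v + toFun u₂ v = 0)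
  represented : ∀ s : ℝ, 1 / 2 < s → ∀ w v : 𝓢.graphSpace,
    MemSobolev Ω s w.1 → MemSobolev Ω s v.1 →
    toFun w v = ip ((surf d).restrict (frontier Ω))
      (fun x => act (𝓢.M x) (trace Ω w.1 x)) (trace Ω v.1)

/-- Membership in `V_0 = Ker (M - N)`. -/
def MemV0 (𝓑 : 𝓢.BoundaryOperator) (w : 𝓢.graphSpace) : Prop :=
  ∀ v, 𝓑.toFun w v - 𝓢.opN w v = 0

/-- `‖K‖_{L^∞(Ω)} + ‖∇·A‖_{L^∞(Ω)}`. -/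
def rsharp : ℝ := supNorm Ω 𝓢.K + supNorm Ω 𝓢.divA

/-- `ρ = r_♯ / r_♭`. -/
def rho : ℝ := 𝓢.rsharp / 𝓢.rflat

end System

/-! ### The hybrid scheme -/

/-- Polynomial maps `ℝ^d → ℂ^m` of total degree at most `k`. -/
def polySpace (d m k : ℕ) : Submodule ℂ (Pt d → Vc m) where
  carrier := {v | ∃ p : Fin m → MvPolynomial (Fin d) ℂ, (∀ j, (p j).totalDegree ≤ k) ∧
    ∀ x j, v x j = MvPolynomial.eval (fun i => ((x i : ℝ) : ℂ)) (p j)}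
  zero_mem' := ⟨0, by simp, by simp⟩
  add_mem' := by
    rintro v v' ⟨p, hp, hv⟩ ⟨p', hp', hv'⟩
    refine ⟨p + p', fun j => (MvPolynomial.totalDegree_add _ _).trans (max_le (hp j) (hp' j)),
      fun x j => ?_⟩
    simp [hv, hv']
  smul_mem' := by
    rintro c v ⟨p, hp, hv⟩
    refine ⟨c • p, fun j => (MvPolynomial.totalDegree_smul_le _ _).trans (hp j), fun x j => ?_⟩
    simp [hv]

open Classical in
/-- The `L²(μ)`-orthogonal projection of `w` on polynomials of total degree at most `k` (as a
function on the support of `μ`; zero if there is none). -/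
def proj (k : ℕ) (μ : Measure (Pt d)) (w : Pt d → Vc m) : polySpace d m k :=
  if h : ∃ p : polySpace d m k, ∀ q : polySpace d m k, ip μ (fun x => w x - p.1 x) q.1 = 0
  then h.choose else 0

/-- Hybrid vectors: a polynomial of degree at most `k` for each element and for each face. The
polynomials attached to an element `T`, resp. a face `F`, only matter through their restriction to
`closure T`, resp. `F`. -/
abbrev HybridSpace {Ω : Set (Pt d)} (𝓜 : PolytopalMesh Ω) (m k : ℕ) :=
  (𝓜.elems → polySpace d m k) × (𝓜.faces → polySpace d m k)

section Scheme

variable {Ω : Set (Pt d)} {k : ℕ} (𝓜 : PolytopalMesh Ω) (𝓢 : System Ω m)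

/-- The interpolator `I_h^k`. -/
def interp (k : ℕ) (w : Pt d → Vc m) : HybridSpace 𝓜 m k :=
  (fun T => proj k (𝓜.vol T) w, fun F => proj k (𝓜.srf F) (trace Ω w))

open Classical in
/-- The piecewise polynomial field `v_h`, equal to `v_T` on each element `T`. -/
def broken (v : HybridSpace 𝓜 m k) (x : Pt d) : Vc m :=
  ∑ T : 𝓜.elems, if x ∈ (T : Set (Pt d)) then (v.1 T).1 x else 0

/-- The jump `v_F - v_T`. -/
def jump (v : HybridSpace 𝓜 m k) (T : 𝓜.elems) (F : 𝓜.faces) (x : Pt d) : Vc m :=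
  (v.2 F).1 x - (v.1 T).1 x

/-- `N_F = ∑ n_{F,i} A^i` on the face `F`. -/
def faceN (F : 𝓜.faces) (x : Pt d) : Mat m := ∑ i, (𝓜.normal F i : ℂ) • 𝓢.A i x

/-- The maximum over `i` of the `L^∞(T)`-norms of `A^i`. -/
def Aref (T : 𝓜.elems) : ℝ := ⨆ i, supNorm (T : Set (Pt d)) (𝓢.A i)

/-- `t_T = max(A_T / h_T, r_♭)⁻¹`. -/
def tT (T : 𝓜.elems) : ℝ := (max (Aref 𝓜 𝓢 T / 𝓜.h T) 𝓢.rflat)⁻¹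

/-- A pair of families of bounded Hermitian nonnegative stabilization fields `S_{TF}^i`, `S_F^b`,
satisfying the stabilization assumption with hidden constant `CS`. -/
structure Stabilization (k : ℕ) (CS : ℝ) where
  Si : 𝓜.elems → 𝓜.faces → Pt d → Mat m
  Sb : 𝓜.faces → Pt d → Mat m
  Si_mem : ∀ T, ∀ F ∈ 𝓜.facesOf T, MemLp (Si T F) ∞ (𝓜.srf F)
  Si_pos : ∀ T, ∀ F ∈ 𝓜.facesOf T, ∀ᵐ x ∂𝓜.srf F, (Si T F x).PosSemidef
  Si_bounded : ∀ T, ∀ F ∈ 𝓜.facesOf T, ∀ v : polySpace d m k,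
    (ip (𝓜.srf F) (fun x => act (Si T F x) (v.1 x)) v.1).re ≤
      CS * (Aref 𝓜 𝓢 T * normSq (𝓜.srf F) v.1)
  Si_control : ∀ T, ∀ F ∈ 𝓜.facesOf T, ∀ w v : Pt d → Vc m,
    MemLp w 2 (𝓜.srf F) → MemLp v 2 (𝓜.srf F) →
    ‖ip (𝓜.srf F) w (fun x => act (faceN 𝓜 𝓢 F x) (v x))‖ ≤
      CS * (Real.sqrt (Aref 𝓜 𝓢 T) * Real.sqrt (normSq (𝓜.srf F) w) *
        Real.sqrt (ip (𝓜.srf F) (fun x => act (Si T F x) (v x)) v).re)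
  Sb_mem : ∀ F ∈ 𝓜.bdryFaces, MemLp (Sb F) ∞ (𝓜.srf F)
  Sb_pos : ∀ F ∈ 𝓜.bdryFaces, ∀ᵐ x ∂𝓜.srf F, (Sb F x).PosSemidef
  Sb_ker : ∀ F ∈ 𝓜.bdryFaces, ∀ᵐ x ∂𝓜.srf F, ∀ ξ : Vc m,
    act (𝓢.M x - faceN 𝓜 𝓢 F x) ξ = 0 → act (𝓢.M x + Sb F x - faceN 𝓜 𝓢 F x) ξ = 0
  Sb_control : ∀ T, ∀ F ∈ 𝓜.bdryFaces, F ∈ 𝓜.facesOf T → ∀ w v : Pt d → Vc m,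
    MemLp w 2 (𝓜.srf F) → MemLp v 2 (𝓜.srf F) →
    ‖ip (𝓜.srf F) (fun x => act (𝓢.M x + Sb F x + faceN 𝓜 𝓢 F x) (w x)) v‖ ≤
      CS * (Real.sqrt (Aref 𝓜 𝓢 T) * Real.sqrt (normSq (𝓜.srf F) w) *
        Real.sqrt (ip (𝓜.srf F) (fun x => act (𝓢.M x + Sb F x) (v x)) v).re)

variable {𝓜 𝓢} {CS : ℝ} (𝓙 : Stabilization 𝓜 𝓢 k CS)

/-- The stabilization form `j_h`. -/
def jh (w v : HybridSpace 𝓜 m k) : ℂ :=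
  ∑ T, ∑ F ∈ 𝓜.facesOf T,
    ip (𝓜.srf F) (fun x => act (𝓙.Si T F x) (jump 𝓜 w T F x)) (jump 𝓜 v T F)

/-- The discrete sesquilinear form `a_h`. -/
def ah (w v : HybridSpace 𝓜 m k) : ℂ :=
  (∑ T, ip (𝓜.vol T) (𝓢.opA (w.1 T).1) (v.1 T).1)
  + (𝓢.rflat : ℂ) * (∑ T, (𝓜.h T : ℂ) *
      ∑ F ∈ 𝓜.facesOf T, ip (𝓜.srf F) (jump 𝓜 w T F) (jump 𝓜 v T F))
  + (∑ T, ∑ F ∈ 𝓜.facesOf T, (𝓜.orient T F : ℂ) *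
      ip (𝓜.srf F) (fun x => act (faceN 𝓜 𝓢 F x) (jump 𝓜 w T F x))
        (fun x => (1 / 2 : ℂ) • ((v.2 F).1 x + (v.1 T).1 x)))
  + (1 / 2 : ℂ) * (∑ F ∈ 𝓜.bdryFaces,
      ip (𝓜.srf F) (fun x => act (𝓢.M x + 𝓙.Sb F x - faceN 𝓜 𝓢 F x) ((w.2 F).1 x)) (v.2 F).1)
  + jh 𝓙 w v

/-- The square of the norm of hybrid vectors
`r_♭ ∑_T (‖v_T‖²_T + h_T ∑_F ‖v_F - v_T‖²_F) + ½ |v|²_b + |v|²_j + ∑_T t_T ‖A_1 v_T‖²_T`. -/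
def tnormSq (v : HybridSpace 𝓜 m k) : ℝ :=
  𝓢.rflat * (∑ T, (normSq (𝓜.vol T) (v.1 T).1 +
      𝓜.h T * ∑ F ∈ 𝓜.facesOf T, normSq (𝓜.srf F) (jump 𝓜 v T F)))
  + (1 / 2) * (∑ F ∈ 𝓜.bdryFaces,
      (ip (𝓜.srf F) (fun x => act (𝓢.M x + 𝓙.Sb F x) ((v.2 F).1 x)) (v.2 F).1).re)
  + (jh 𝓙 v v).re
  + ∑ T, tT 𝓜 𝓢 T * normSq (𝓜.vol T) (𝓢.A1 (v.1 T).1)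

/-- The norm of hybrid vectors. -/
def tnorm (v : HybridSpace 𝓜 m k) : ℝ := Real.sqrt (tnormSq 𝓙 v)

/-- The dual norm of a functional `E` on hybrid vectors: the supremum of `|E v| / ‖v‖`. Hybrid
vectors all of whose components vanish contribute `0 / 0 = 0` whenever `E` vanishes on them. -/
def dualNorm (E : HybridSpace 𝓜 m k → ℂ) : ℝ≥0∞ :=
  ⨆ v : HybridSpace 𝓜 m k, ‖E v‖ₑ / ENNReal.ofReal (tnorm 𝓙 v)

/-- The consistency error `E_h(w; v) = (A w, v_h)_Ω - a_h(I_h^k w, v)`. -/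
def consistencyError (w : 𝓢.graphSpace) (v : HybridSpace 𝓜 m k) : ℂ :=
  ip (volume.restrict Ω) (𝓢.weakA w) (broken 𝓜 v) - ah 𝓙 (interp 𝓜 k w.1) v

end Scheme

end Friedrichs

end

open Friedrichs

/-!
The consistency error is first written as a sum of pairings of an approximation error of `w` with a
part of `v` that the norm of hybrid vectors controls (`System.ip_weakA_sub_ah`). To this end `A w`
and `A π_T w` are integrated by parts on every element. The face terms which then involve `v_F` alone
do not depend on the element, and the orientations make them cancel on the interfaces
(`PolytopalMesh.sum_orient_mul`). On the boundary faces, membership in `V₀` puts the trace of `w` in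
the kernel of `M - N` (`System.MemV0.ae_act_trace_eq_zero`), hence in that of `M + S^b - N`, so that
what is left is half of the form of `M + S^b + N`, applied to `w - π_F w` and `v_F`. The assumptions
on the stabilization and the Cauchy-Schwarz inequality bound each term, and the face errors are
dominated by `w - π_T w` because projections are best approximations (`norm_consistencyError_le`).

The analytic content is the integration by parts (`System.hasIBP`): `w` is only known to have `A_1 w`
in `L²` and to be in `H^s` with `s > 1/2`, the coefficients are only continuous, and polytopal sets
need not be Lipschitz domains. No extension or density theorem is used; everything rests on averages.

* On a convex set, a function with finite Slobodeckij seminorm of order `θ > 1/2` has mean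
  oscillations `oscAt` that decay geometrically along the dyadic scales, in mean square on any
  hyperplane. Their sum `oscSum` is therefore square integrable there
  (`lintegral_sq_oscSum_lt_top`), and where it is finite all the averages of the function near the
  point have the same limit (`exists_hasKernelLimit`). This gives the trace and its integrability
  (`HasTraceReg.ae_trace`, `HasTraceReg.memLp_trace`).
* Outside the intersections of finitely many transversal hyperplanes, a polytopal set is locally a
  half-ball (`exists_isFlatAt`). Near such a point, the weak definition of `A_1 w` is tested with
  functions cut off in a thin layer along the boundary; the layer integrals are averages of `w`, and
  tend to the integral of its trace (`HasTraceReg.tendsto_layer`, `System.hasIBP_of_isFlatAt`).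
* The intersection of two transversal hyperplanes has codimension two, and its neighbourhoods of
  width `1 / N` have measure of order `1 / N ^ 2` (`exists_volume_edgeNhd_le`). This is just enough
  to remove it by cut-offs, since `w` is square integrable (`System.hasIBP_of_edgeCut`).

The passage from an element to its faces needs that the latter cover its boundary up to null sets
(`PolytopalMesh.frontier_ae_eq`): a face that is not contained in the boundary of an element cannot
meet it in positive measure, as both sides of the face are already occupied.
-/

open MeasureTheory Set Filter Topology
open scoped ENNReal NNReal Matrix ContDiff
open scoped Matrix.Norms.L2Operator ComplexOrder

noncomputable section

namespace Friedrichs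

variable {d m : ℕ}

/-! ### Surface measure on hyperplanes -/

/-- The hyperplane with normal `n` and offset `c`. -/
def hyp (n : Pt d) (c : ℝ) : Set (Pt d) := {y | inner ℝ n y = c}

theorem finrank_orthogonal_unit {n : Pt d} (hn : ‖n‖ = 1) :
    Module.finrank ℝ (ℝ ∙ n)ᗮ = d - 1 := by
  have h1 := (ℝ ∙ n).finrank_add_finrank_orthogonal
  have h2 : Module.finrank ℝ (ℝ ∙ n) = 1 :=
    finrank_span_singleton (by rintro rfl; simp at hn)
  rw [h2, finrank_euclideanSpace_fin] at h1
  omega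

theorem isClosed_hyp (n : Pt d) (c : ℝ) : IsClosed (hyp n c) :=
  isClosed_eq (by fun_prop) continuous_const

theorem range_hyp {n : Pt d} (hn : ‖n‖ = 1) (c : ℝ) :
    range (fun x : (ℝ ∙ n)ᗮ => c • n + (x : Pt d)) = hyp n c := by
  ext y
  simp only [mem_range, hyp, mem_ofPred_eq]
  constructor
  · rintro ⟨x, rfl⟩
    have := Submodule.mem_orthogonal_singleton_iff_inner_right.1 x.2
    rw [inner_add_right, this, inner_smul_right, real_inner_self_eq_norm_sq, hn]
    simp
  · intro h
    refine ⟨⟨y - c • n, Submodule.mem_orthogonal_singleton_iff_inner_right.2 ?_⟩, by simp⟩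
    rw [inner_sub_right, h, inner_smul_right, real_inner_self_eq_norm_sq, hn]
    simp

/-- A hyperplane is an isometric copy of the orthogonal complement of its normal, so that the
surface measure on it is a Lebesgue measure. -/
theorem surf_restrict_hyp {n : Pt d} (hn : ‖n‖ = 1) (c : ℝ) :
    (surf d).restrict (hyp n c) =
      (volume : Measure (ℝ ∙ n)ᗮ).map (fun x : (ℝ ∙ n)ᗮ => c • n + (x : Pt d)) := by
  have hiso : Isometry (fun x : (ℝ ∙ n)ᗮ => c • n + (x : Pt d)) := by
    intro x y
    simp [edist_add_left, Subtype.edist_eq]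
  have := hiso.map_euclideanHausdorffMeasure (d := d - 1)
  rw [range_hyp hn] at this
  rw [surf, ← this, ← InnerProductSpace.euclideanHausdorffMeasure_eq_volume,
    finrank_orthogonal_unit hn]

theorem surf_hyp_ball {n : Pt d} (hn : ‖n‖ = 1) {c : ℝ} {p : Pt d} (hp : p ∈ hyp n c) {r : ℝ}
    (hr : 0 < r) :
    (surf d).restrict (hyp n c) (Metric.ball p r) =
      ENNReal.ofReal (r ^ (d - 1)) * volume (Metric.ball (0 : (ℝ ∙ n)ᗮ) 1) := by
  rw [surf_restrict_hyp hn, Measure.map_apply (by fun_prop) Metric.isOpen_ball.measurableSet]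
  rw [← range_hyp hn] at hp
  obtain ⟨q, rfl⟩ := hp
  have : (fun x : (ℝ ∙ n)ᗮ => c • n + (x : Pt d)) ⁻¹' Metric.ball (c • n + (q : Pt d)) r =
      Metric.ball q r := by
    ext x; simp [Subtype.dist_eq]
  rw [this, Measure.addHaar_ball_of_pos _ _ hr, finrank_orthogonal_unit hn]

/-- Fubini coordinates along a hyperplane and its unit normal. -/
theorem measurePreserving_slab {n : Pt d} (hn : ‖n‖ = 1) (p : Pt d) :
    MeasurePreserving (fun z : (ℝ ∙ n)ᗮ × ℝ => p + (z.1 : Pt d) + z.2 • n) := by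
  have h1 := ((ℝ ∙ n).measurePreserving_measurableEquivProd p).symm
  rw [InnerProductSpace.euclideanHausdorffMeasure_eq_volume] at h1
  have h2 := (LinearIsometryEquiv.toSpanUnitSingleton (𝕜 := ℝ) n hn).measurePreserving
  have h3 : MeasurePreserving (Prod.swap : (ℝ ∙ n)ᗮ × ℝ → ℝ × (ℝ ∙ n)ᗮ) volume volume :=
    Measure.measurePreserving_swap
  have h4 := h2.prod (MeasurePreserving.id (volume : Measure (ℝ ∙ n)ᗮ))
  have h5 := h1.comp (h4.comp h3)
  refine (congrArg (fun f => MeasurePreserving f volume volume) (funext fun z => ?_)).mp h5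
  simp only [Function.comp_apply, Submodule.measurableEquivProd_symm_apply, Prod.map_apply,
    Prod.swap, vadd_eq_add, id]
  rw [show ((LinearIsometryEquiv.toSpanUnitSingleton (𝕜 := ℝ) n hn) z.2 : Pt d) = z.2 • n from rfl]
  abel

theorem measurableEmbedding_slab {n : Pt d} (hn : ‖n‖ = 1) (p : Pt d) :
    MeasurableEmbedding (fun z : (ℝ ∙ n)ᗮ × ℝ => p + (z.1 : Pt d) + z.2 • n) := by
  refine Continuous.measurableEmbedding (by fun_prop) ?_
  rintro ⟨x, t⟩ ⟨y, u⟩ h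
  have hx := Submodule.mem_orthogonal_singleton_iff_inner_right.1 x.2
  have hy := Submodule.mem_orthogonal_singleton_iff_inner_right.1 y.2
  have h' := congrArg (fun v => inner ℝ n v) h
  simp only [inner_add_right, hx, hy, inner_smul_right, real_inner_self_eq_norm_sq, hn] at h'
  have htu : t = u := by linarith
  subst htu
  have : (x : Pt d) = y := by simpa using h
  ext1
  · exact Subtype.ext this
  · rfl

theorem volume_ball_orthogonal_pos (n : Pt d) :
    0 < (volume : Measure (ℝ ∙ n)ᗮ).real (Metric.ball 0 1) :=
  ENNReal.toReal_pos (Metric.isOpen_ball.measure_pos _ ⟨0, by simp⟩).ne' measure_ball_lt_top.ne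

theorem isFiniteMeasureOnCompacts_surf_hyp {n : Pt d} (hn : ‖n‖ = 1) (c : ℝ) :
    IsFiniteMeasureOnCompacts ((surf d).restrict (hyp n c)) := by
  refine ⟨fun K hK => ?_⟩
  have hp : c • n ∈ hyp n c := by
    simp [hyp, inner_smul_right, hn]
  obtain ⟨r, hr, hKr⟩ := hK.isBounded.subset_ball_lt 0 (c • n)
  refine (measure_mono hKr).trans_lt ?_
  rw [surf_hyp_ball hn hp hr]
  exact ENNReal.mul_lt_top ENNReal.ofReal_lt_top measure_ball_lt_top

/-- The surface of a hyperplane in a ball of radius `r` is at most of order `r ^ (d - 1)`. -/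
theorem surf_hyp_ball_le {n : Pt d} (hn : ‖n‖ = 1) {c : ℝ} (p : Pt d) {r : ℝ} (hr : 0 < r) :
    (surf d).restrict (hyp n c) (Metric.ball p r) ≤
      ENNReal.ofReal (r ^ (d - 1)) * volume (Metric.ball (0 : (ℝ ∙ n)ᗮ) 1) := by
  set q := p - (inner ℝ n p - c) • n with hq
  have hqm : q ∈ hyp n c := by
    simp [hyp, hq, inner_sub_right, inner_smul_right, hn]
  rw [← surf_hyp_ball hn hqm hr, Measure.restrict_apply Metric.isOpen_ball.measurableSet,
    Measure.restrict_apply Metric.isOpen_ball.measurableSet]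
  refine measure_mono ?_
  rintro x ⟨hx, hxc⟩
  refine ⟨?_, hxc⟩
  simp only [Metric.mem_ball, dist_eq_norm] at hx ⊢
  refine lt_of_le_of_lt ?_ hx
  have hxp : x - p = (x - q) + (-(inner ℝ n p - c)) • n := by
    rw [hq]; module
  have horth : inner ℝ (x - q) ((-(inner ℝ n p - c)) • n) = 0 := by
    simp only [hyp, mem_ofPred_eq] at hxc hqm
    rw [inner_smul_right, real_inner_comm n (x - q), inner_sub_right, hxc, hqm]
    simp
  have := norm_add_sq_eq_norm_sq_add_norm_sq_of_inner_eq_zero _ _ horth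
  rw [← hxp] at this
  nlinarith [norm_nonneg (x - p), norm_nonneg (x - q),
    mul_self_nonneg ‖(-(inner ℝ n p - c)) • n‖]

/-- Two different hyperplanes meet in a set without surface. -/
theorem surf_hyp_inter {n n' : Pt d} (hn : ‖n‖ = 1) (hn' : ‖n'‖ = 1) (h1 : n' ≠ n)
    (h2 : n' ≠ -n) (c c' : ℝ) : surf d (hyp n c ∩ hyp n' c') = 0 := by
  rw [inter_comm, ← Measure.restrict_apply (isClosed_hyp n' c').measurableSet,
    surf_restrict_hyp hn, Measure.map_apply (by fun_prop) (isClosed_hyp n' c').measurableSet]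
  -- the orthogonal projection of `n'` on the hyperplane does not vanish
  set L : (ℝ ∙ n)ᗮ →ₗ[ℝ] ℝ := (innerₛₗ ℝ n').comp (ℝ ∙ n)ᗮ.subtype with hL
  have hLne : LinearMap.ker L ≠ ⊤ := by
    intro htop
    have hall : ∀ x : (ℝ ∙ n)ᗮ, inner ℝ n' (x : Pt d) = 0 := fun x => by
      have : x ∈ LinearMap.ker L := htop ▸ Submodule.mem_top
      simpa [hL] using this
    have hmem : n' ∈ (ℝ ∙ n)ᗮᗮ := by
      rw [Submodule.mem_orthogonal]
      intro u hu
      rw [real_inner_comm]; exact hall ⟨u, hu⟩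
    rw [Submodule.orthogonal_orthogonal, Submodule.mem_span_singleton] at hmem
    obtain ⟨a, rfl⟩ := hmem
    rw [norm_smul, hn, mul_one, Real.norm_eq_abs] at hn'
    rcases (abs_eq zero_le_one).1 hn' with rfl | rfl
    · simp at h1
    · simp at h2
  have hs : ((fun x : (ℝ ∙ n)ᗮ => c • n + (x : Pt d)) ⁻¹' hyp n' c') =
      {x | L x = c' - c * inner ℝ n' n} := by
    ext x
    simp only [mem_preimage, hyp, mem_ofPred_eq, inner_add_right, inner_smul_right]
    simp only [hL, LinearMap.comp_apply, Submodule.subtype_apply, innerₛₗ_apply_apply]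
    constructor <;> intro h <;> linarith
  rw [hs]
  by_cases he : ∃ x0, L x0 = c' - c * inner ℝ n' n
  · obtain ⟨x0, hx0⟩ := he
    have : {x | L x = c' - c * inner ℝ n' n} = (fun x => -x0 + x) ⁻¹' (LinearMap.ker L : Set _) := by
      ext x
      simp only [mem_ofPred_eq, mem_preimage, SetLike.mem_coe, LinearMap.mem_ker, map_add, map_neg,
        hx0]
      constructor <;> intro h <;> linarith
    rw [this, measure_preimage_add]
    exact Measure.addHaar_submodule _ _ hLne
  · have : {x | L x = c' - c * inner ℝ n' n} = ∅ := by
      ext x; simp only [mem_ofPred_eq, mem_empty_iff_false, iff_false]; exact fun h => he ⟨x, h⟩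
    simp [this]

theorem volume_hyp {n : Pt d} (hn : ‖n‖ = 1) (c : ℝ) : volume (hyp n c) = 0 := by
  have hne : LinearMap.ker (innerₛₗ ℝ n : Pt d →ₗ[ℝ] ℝ) ≠ ⊤ := by
    intro htop
    have : n ∈ LinearMap.ker (innerₛₗ ℝ n : Pt d →ₗ[ℝ] ℝ) := htop ▸ Submodule.mem_top
    simp at this
    simp [this] at hn
  have : hyp n c = (fun x => -(c • n) + x) ⁻¹' (LinearMap.ker (innerₛₗ ℝ n : Pt d →ₗ[ℝ] ℝ) : Set _) := by
    ext x
    simp only [hyp, mem_ofPred_eq, mem_preimage, SetLike.mem_coe, LinearMap.mem_ker,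
      innerₛₗ_apply_apply, inner_add_right, inner_neg_right, inner_smul_right,
      real_inner_self_eq_norm_sq, hn]
    constructor <;> intro h <;> linarith
  rw [this, measure_preimage_add]
  exact Measure.addHaar_submodule _ _ hne

/-! ### Sobolev-Slobodeckij regularity -/

section WeakTranslate

variable {F : Type*} [NormedAddCommGroup F]

theorem IsTest.comp_sub {E : Set (Pt d)} {ψ : Pt d → ℝ} (hψ : IsTest E ψ) {E' : Set (Pt d)}
    (a : Pt d) (h : ∀ y ∈ tsupport ψ, y + a ∈ E') : IsTest E' (fun y => ψ (y - a)) := by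
  have he : (fun y => ψ (y - a)) = ψ ∘ (Homeomorph.subRight a) := rfl
  refine ⟨hψ.1.comp (contDiff_id.sub contDiff_const), ?_, ?_⟩
  · rw [he]; exact hψ.2.1.comp_homeomorph _
  · rw [he, tsupport_comp_eq_preimage]
    intro y hy
    have := h _ hy
    simpa using this

theorem integrable_comp_add_smul {v : Pt d → F} (hv : StronglyMeasurable v) (hvi : Integrable v)
    (h : Pt d) : Integrable (fun p : Pt d × ℝ => v (p.1 + p.2 • h))
      ((volume : Measure (Pt d)).prod (volume.restrict (Ioc (0 : ℝ) 1))) := by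
  have hm : AEStronglyMeasurable (fun p : Pt d × ℝ => v (p.1 + p.2 • h))
      ((volume : Measure (Pt d)).prod (volume.restrict (Ioc (0 : ℝ) 1))) :=
    (hv.comp_measurable (by fun_prop : Measurable fun p : Pt d × ℝ => p.1 + p.2 • h))
      |>.aestronglyMeasurable
  rw [integrable_prod_iff' hm]
  refine ⟨Eventually.of_forall fun t => hvi.comp_add_right (t • h), ?_⟩
  have : (fun t : ℝ => ∫ x, ‖v (x + t • h)‖) = fun _ => ∫ x, ‖v x‖ := by
    funext t
    exact integral_add_right_eq_self (fun x => ‖v x‖) (t • h)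
  simp only [this]
  exact integrable_const _

/-- The fundamental theorem of calculus for a weak directional derivative in a convex open set.
Both sides are tested against smooth functions, where the translations and the derivative fall on
the test function. -/
theorem ae_sub_eq_integral_of_weak_deriv [NormedSpace ℝ F] [CompleteSpace F]
    {E : Set (Pt d)} (hE : IsOpen E) (hEc : Convex ℝ E)
    {w v : Pt d → F} {h : Pt d} (hwi : Integrable w)
    (hv : StronglyMeasurable v) (hvi : Integrable v)
    (hweak : ∀ ψ : Pt d → ℝ, IsTest E ψ →
      ∫ y, fderiv ℝ ψ y h • w y = - ∫ y, ψ y • v y) :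
    ∀ᵐ y, y ∈ E → y + h ∈ E → w (y + h) - w y = ∫ t in Ioc (0 : ℝ) 1, v (y + t • h) := by
  have hvp := integrable_comp_add_smul hv hvi h
  have hJ : Integrable (fun y => ∫ t in Ioc (0 : ℝ) 1, v (y + t • h)) := hvp.integral_prod_left
  have hU : IsOpen (E ∩ {y | y + h ∈ E}) :=
    hE.inter (hE.preimage (by fun_prop : Continuous fun y : Pt d => y + h))
  have hfi : Integrable (fun y => w (y + h) - w y - ∫ t in Ioc (0 : ℝ) 1, v (y + t • h)) :=
    ((hwi.comp_add_right h).sub hwi).sub hJ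
  have key := hU.ae_eq_zero_of_integral_contDiff_smul_eq_zero
    (hfi.locallyIntegrable.locallyIntegrableOn _) (fun ψ hψ hψc hψs => ?_)
  · filter_upwards [key] with y hy h1 h2
    exact sub_eq_zero.1 (hy ⟨h1, h2⟩)
  -- the translates of the test function stay in `E`, by convexity
  have hst : ∀ t ∈ Ioc (0 : ℝ) 1, IsTest E (fun y => ψ (y - t • h)) := by
    intro t ht
    refine IsTest.comp_sub (E := univ) ⟨hψ, hψc, subset_univ _⟩ _ fun y hy => ?_
    obtain ⟨h1, h2⟩ := hψs hy
    have := hEc h1 h2 (sub_nonneg.2 ht.2) ht.1.le (by ring)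
    convert this using 1
    module
  have hψb : ∀ f : Pt d → F, Integrable f → Integrable (fun y => ψ y • f y) := fun f hf => by
    obtain ⟨C, hC⟩ := hψc.exists_bound_of_continuous hψ.continuous
    exact hf.bdd_smul C hψ.continuous.aestronglyMeasurable (Eventually.of_forall hC)
  have hψb' : ∀ f : Pt d → F, Integrable f → Integrable (fun y => ψ (y - h) • f y) := fun f hf => by
    obtain ⟨C, hC⟩ := hψc.exists_bound_of_continuous hψ.continuous
    exact hf.bdd_smul C (hψ.continuous.comp (by fun_prop)).aestronglyMeasurable
      (Eventually.of_forall fun y => hC _)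
  have hDc : Continuous fun p : Pt d × ℝ => fderiv ℝ ψ (p.1 - p.2 • h) h :=
    ((hψ.continuous_fderiv (by simp)).comp (by fun_prop)).clm_apply continuous_const
  have hDi : Integrable (fun p : Pt d × ℝ => fderiv ℝ ψ (p.1 - p.2 • h) h • w p.1)
      ((volume : Measure (Pt d)).prod (volume.restrict (Ioc (0 : ℝ) 1))) := by
    obtain ⟨C, hC⟩ := (hψc.fderiv_apply (𝕜 := ℝ) h).exists_bound_of_continuous
      ((hψ.continuous_fderiv (by simp)).clm_apply continuous_const)
    exact (hwi.comp_fst _).bdd_smul C hDc.aestronglyMeasurable (Eventually.of_forall fun p => hC _)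
  have hFTC : ∀ y, ψ (y - h) - ψ y = - ∫ t in Ioc (0 : ℝ) 1, fderiv ℝ ψ (y - t • h) h := by
    intro y
    have hd : ∀ t ∈ uIcc (0 : ℝ) 1, HasDerivAt (fun t : ℝ => ψ (y - t • h))
        (-(fderiv ℝ ψ (y - t • h) h)) t := by
      intro t _
      have h1 : HasDerivAt (fun t : ℝ => y - t • h) (-h) t := by
        simpa using ((hasDerivAt_id t).smul_const h).const_sub y
      have h2 := ((hψ.differentiable (by simp)) (y - t • h)).hasFDerivAt.comp_hasDerivAt t h1
      rw [map_neg] at h2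
      exact h2
    have hcont : Continuous fun t : ℝ => -(fderiv ℝ ψ (y - t • h) h) :=
      (hDc.comp (by fun_prop : Continuous fun t : ℝ => (y, t))).neg
    have := intervalIntegral.integral_eq_sub_of_hasDerivAt hd (hcont.intervalIntegrable _ _)
    rw [intervalIntegral.integral_of_le zero_le_one, integral_neg] at this
    simpa using this.symm
  have e1 : ∫ y, ψ y • (w (y + h) - w y) = ∫ y, (ψ (y - h) - ψ y) • w y := by
    have := integral_add_right_eq_self (μ := volume) (fun y => ψ (y - h) • w y) h
    simp only [add_sub_cancel_right] at this
    simp only [smul_sub, sub_smul]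
    rw [integral_sub (hψb _ (hwi.comp_add_right h)) (hψb _ hwi), this,
      integral_sub (hψb' _ hwi) (hψb _ hwi)]
  have e2 : ∫ y, (ψ (y - h) - ψ y) • w y =
      - ∫ t in Ioc (0 : ℝ) 1, ∫ y, fderiv ℝ ψ (y - t • h) h • w y := by
    rw [← integral_integral_swap hDi, ← integral_neg]
    refine integral_congr_ae (Eventually.of_forall fun y => ?_)
    dsimp only
    rw [hFTC y, neg_smul, integral_smul_const]
  have e3 : ∀ t ∈ Ioc (0 : ℝ) 1, ∫ y, fderiv ℝ ψ (y - t • h) h • w y =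
      - ∫ y, ψ y • v (y + t • h) := by
    intro t ht
    have := hweak _ (hst t ht)
    have hd : ∀ y, fderiv ℝ (fun y => ψ (y - t • h)) y = fderiv ℝ ψ (y - t • h) := fun y =>
      fderiv_comp_sub _
    simp only [hd] at this
    rw [this, ← integral_add_right_eq_self (μ := volume) (fun y => ψ (y - t • h) • v y) (t • h)]
    simp
  have e4 : ∫ y, ψ y • (∫ t in Ioc (0 : ℝ) 1, v (y + t • h)) =
      ∫ t in Ioc (0 : ℝ) 1, ∫ y, ψ y • v (y + t • h) := by
    have hi : Integrable (fun p : Pt d × ℝ => ψ p.1 • v (p.1 + p.2 • h))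
        ((volume : Measure (Pt d)).prod (volume.restrict (Ioc (0 : ℝ) 1))) := by
      obtain ⟨C, hC⟩ := hψc.exists_bound_of_continuous hψ.continuous
      exact hvp.bdd_smul C (hψ.continuous.comp continuous_fst).aestronglyMeasurable
        (Eventually.of_forall fun p => hC _)
    rw [← integral_integral_swap hi]
    simp only [integral_smul]
  calc ∫ y, ψ y • (w (y + h) - w y - ∫ t in Ioc (0 : ℝ) 1, v (y + t • h))
      = (∫ y, ψ y • (w (y + h) - w y)) - ∫ y, ψ y • (∫ t in Ioc (0 : ℝ) 1, v (y + t • h)) := by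
        refine (integral_congr_ae (Eventually.of_forall fun y => smul_sub _ _ _)).trans ?_
        exact integral_sub (hψb _ ((hwi.comp_add_right h).sub hwi)) (hψb _ hJ)
    _ = 0 := by
        rw [e1, e2, e4, sub_eq_zero, ← integral_neg]
        refine setIntegral_congr_fun measurableSet_Ioc fun t ht => ?_
        rw [e3 t ht, neg_neg]

end WeakTranslate

/-- The integral of `‖h‖ ^ (2 - d - 2 θ)` near the origin is finite as long as `θ < 1`. -/
theorem lintegral_ball_sq_div_rpow (hd : 1 ≤ d) {θ : ℝ} (hθ : θ < 1) {R : ℝ} (hR : 0 < R) :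
    ∫⁻ h in Metric.ball (0 : Pt d) R, ‖h‖ₑ ^ 2 / ‖h‖ₑ ^ ((d : ℝ) + 2 * θ) < ⊤ := by
  have : Nonempty (Fin d) := ⟨⟨0, hd⟩⟩
  have : Nontrivial (Pt d) := inferInstance
  have h1 : IntegrableOn (fun y : ℝ => y ^ (Module.finrank ℝ (Pt d) - 1) •
      y ^ (2 - ((d : ℝ) + 2 * θ))) (Ioo 0 R) := by
    have h2 : IntegrableOn (fun y : ℝ => y ^ (1 - 2 * θ)) (Ioo 0 R) :=
      intervalIntegral.integrableOn_Ioo_rpow_iff hR |>.2 (by linarith)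
    refine h2.congr_fun ?_ measurableSet_Ioo
    intro y hy
    simp only [finrank_euclideanSpace_fin, smul_eq_mul]
    rw [← Real.rpow_natCast, ← Real.rpow_add hy.1, Nat.cast_sub hd]
    congr 1
    push_cast; ring
  -- polar coordinates
  have h3 := (integrableOn_fun_norm_addHaar (volume : Measure (Pt d))).2 h1
  have h4 := h3.2
  refine lt_of_le_of_lt (lintegral_mono_ae ?_) h4
  have h0 : ∀ᵐ h : Pt d ∂volume.restrict (Metric.ball (0 : Pt d) R), h ≠ 0 := by
    refine ae_restrict_of_ae ?_
    rw [ae_iff]; simp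
  filter_upwards [h0] with h hh
  have hp : 0 < ‖h‖ := norm_pos_iff.2 hh
  rw [← ofReal_norm, ← ofReal_norm, ENNReal.ofReal_rpow_of_pos hp, ← ENNReal.ofReal_pow hp.le,
    ← ENNReal.ofReal_div_of_pos (by positivity)]
  refine ENNReal.ofReal_le_ofReal ?_
  rw [Real.norm_of_nonneg (by positivity), Real.rpow_sub hp]
  simp

/-- The Slobodeckij seminorm of order `θ < 1` is finite if differences are square integrable with
the order of the increment. -/
theorem slobodeckijSq_lt_top (hd : 1 ≤ d) {E : Set (Pt d)} (hE : MeasurableSet E)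
    (hEb : Bornology.IsBounded E) {θ : ℝ} (hθ : θ < 1) {w : Pt d → Vc m}
    (hw : StronglyMeasurable w) {K : ℝ≥0∞} (hK : K ≠ ⊤)
    (h : ∀ h, ∫⁻ x in {x | x ∈ E ∧ x + h ∈ E}, ‖w (x + h) - w x‖ₑ ^ 2 ≤ ‖h‖ₑ ^ 2 * K) :
    slobodeckijSq E θ w < ⊤ := by
  obtain ⟨R, hR, hER⟩ := hEb.subset_ball_lt 0 0
  set p : ℝ := (d : ℝ) + 2 * θ with hp
  have hmw : Measurable w := hw.measurable
  -- the inner integral is over the increments `h = y - x`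
  have e1 : slobodeckijSq E θ w = ∫⁻ x, ∫⁻ h, E.indicator 1 x *
      (E.indicator 1 (x + h) * (‖w x - w (x + h)‖ₑ ^ 2 / ‖h‖ₑ ^ p)) := by
    rw [slobodeckijSq, ← lintegral_indicator hE]
    refine lintegral_congr fun x => ?_
    by_cases hx : x ∈ E
    · simp only [indicator_of_mem hx, Pi.one_apply, one_mul]
      rw [← lintegral_indicator hE, ← lintegral_add_left_eq_self _ x]
      refine lintegral_congr fun y => ?_
      by_cases hy : x + y ∈ E
      · simp [hy, hp, edist_dist, dist_eq_norm, ofReal_norm]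
      · simp [hy]
    · simp [hx]
  have hmeas : Measurable fun q : Pt d × Pt d => E.indicator (1 : Pt d → ℝ≥0∞) q.1 *
      (E.indicator (1 : Pt d → ℝ≥0∞) (q.1 + q.2) *
        (‖w q.1 - w (q.1 + q.2)‖ₑ ^ 2 / ‖q.2‖ₑ ^ p)) := by
    have h1 : Measurable (E.indicator (1 : Pt d → ℝ≥0∞)) := measurable_one.indicator hE
    fun_prop
  rw [e1, lintegral_lintegral_swap hmeas.aemeasurable]
  -- the increments between points of `E` have length less than `2 R`
  have e2 : ∀ h, ∫⁻ x, E.indicator (1 : Pt d → ℝ≥0∞) x *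
      (E.indicator (1 : Pt d → ℝ≥0∞) (x + h) * (‖w x - w (x + h)‖ₑ ^ 2 / ‖h‖ₑ ^ p)) ≤
      (Metric.ball (0 : Pt d) (2 * R)).indicator (fun h => K * (‖h‖ₑ ^ 2 / ‖h‖ₑ ^ p)) h := by
    intro a
    by_cases ha : a ∈ Metric.ball (0 : Pt d) (2 * R)
    · rw [indicator_of_mem ha]
      have hSm : MeasurableSet {x | x ∈ E ∧ x + a ∈ E} :=
        hE.inter (hE.preimage (by fun_prop : Measurable fun x : Pt d => x + a))
      calc _ = ∫⁻ x in {x | x ∈ E ∧ x + a ∈ E}, ‖w (x + a) - w x‖ₑ ^ 2 * (‖a‖ₑ ^ p)⁻¹ := by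
            rw [← lintegral_indicator hSm]
            refine lintegral_congr fun x => ?_
            by_cases h1 : x ∈ E <;> by_cases h2 : x + a ∈ E <;>
              simp [h1, h2, div_eq_mul_inv, enorm_sub_rev (w x)]
        _ = (∫⁻ x in {x | x ∈ E ∧ x + a ∈ E}, ‖w (x + a) - w x‖ₑ ^ 2) * (‖a‖ₑ ^ p)⁻¹ :=
            lintegral_mul_const _ (by fun_prop)
        _ ≤ ‖a‖ₑ ^ 2 * K * (‖a‖ₑ ^ p)⁻¹ := by gcongr; exact h a
        _ = _ := by rw [div_eq_mul_inv]; ring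
    · rw [indicator_of_notMem ha, nonpos_iff_eq_zero]
      refine (lintegral_congr fun x => ?_).trans lintegral_zero
      by_cases h1 : x ∈ E
      · have h2 : x + a ∉ E := fun h2 => ha <| by
          have := hER h1; have := hER h2
          simp only [mem_ball_zero_iff] at *
          calc ‖a‖ = ‖(x + a) - x‖ := by simp
            _ ≤ ‖x + a‖ + ‖x‖ := norm_sub_le _ _
            _ < 2 * R := by linarith
        simp [h2]
      · simp [h1]
  refine (lintegral_mono e2).trans_lt ?_
  rw [lintegral_indicator Metric.isOpen_ball.measurableSet, lintegral_const_mul _ (by fun_prop)]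
  exact ENNReal.mul_lt_top hK.lt_top (lintegral_ball_sq_div_rpow hd hθ (by positivity))

theorem slobodeckijSq_mono {E E' : Set (Pt d)} (h : E ⊆ E') (θ : ℝ) (w : Pt d → Vc m) :
    slobodeckijSq E θ w ≤ slobodeckijSq E' θ w := by
  unfold slobodeckijSq
  refine (lintegral_mono_set h).trans (lintegral_mono fun x => lintegral_mono_set h)

theorem slobodeckijSq_congr_ae {E : Set (Pt d)} (θ : ℝ) {w w' : Pt d → Vc m}
    (h : w =ᵐ[volume.restrict E] w') : slobodeckijSq E θ w = slobodeckijSq E θ w' := by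
  unfold slobodeckijSq
  refine lintegral_congr_ae ?_
  filter_upwards [h] with x hx
  refine lintegral_congr_ae ?_
  filter_upwards [h] with y hy
  rw [hx, hy]

theorem fderiv_apply_eq_sum_partialD {F : Type*} [NormedAddCommGroup F] [NormedSpace ℝ F]
    (ψ : Pt d → F) (y h : Pt d) : fderiv ℝ ψ y h = ∑ i, h i • partialD i ψ y := by
  have : h = ∑ i, h i • EuclideanSpace.single i (1 : ℝ) := by
    ext j
    simp [Finset.sum_apply, Pi.single_apply]
  conv_lhs => rw [this]
  simp [partialD]

/-- The Cauchy-Schwarz inequality. -/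
theorem sq_lintegral_mul_le {α : Type*} [MeasurableSpace α] {μ : Measure α} {f g : α → ℝ≥0∞}
    (hf : AEMeasurable f μ) (hg : AEMeasurable g μ) :
    (∫⁻ a, f a * g a ∂μ) ^ 2 ≤ (∫⁻ a, f a ^ 2 ∂μ) * ∫⁻ a, g a ^ 2 ∂μ := by
  have h := ENNReal.lintegral_mul_le_Lp_mul_Lq μ Real.HolderConjugate.two_two hf hg
  simp only [Pi.mul_apply, ENNReal.rpow_two] at h
  calc _ ≤ ((∫⁻ a, f a ^ 2 ∂μ) ^ (1 / 2 : ℝ) * (∫⁻ a, g a ^ 2 ∂μ) ^ (1 / 2 : ℝ)) ^ 2 := by gcongr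
    _ = _ := by
      rw [mul_pow, ← ENNReal.rpow_natCast, ← ENNReal.rpow_natCast, ← ENNReal.rpow_mul,
        ← ENNReal.rpow_mul]
      norm_num

theorem sq_lintegral_le {α : Type*} [MeasurableSpace α] {μ : Measure α} {f : α → ℝ≥0∞}
    (hf : AEMeasurable f μ) : (∫⁻ a, f a ∂μ) ^ 2 ≤ μ univ * ∫⁻ a, f a ^ 2 ∂μ := by
  have := sq_lintegral_mul_le (f := fun _ => 1) aemeasurable_const hf
  simpa using this

theorem MemLp.lintegral_enorm_sq_lt_top {α F : Type*} [MeasurableSpace α] {μ : Measure α}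
    [NormedAddCommGroup F] {f : α → F} (hf : MemLp f 2 μ) : ∫⁻ a, ‖f a‖ₑ ^ 2 ∂μ < ⊤ := by
  have := lintegral_rpow_enorm_lt_top_of_eLpNorm_lt_top (by norm_num) (by norm_num) hf.2
  simpa using this

/-- A function with square integrable weak derivatives has finite Slobodeckij seminorms on convex
sets. -/
theorem slobodeckijSq_lt_top_of_isWeakPartial (hd : 1 ≤ d) {Ω E : Set (Pt d)} (hΩ : IsOpen Ω)
    (hΩb : Bornology.IsBounded Ω) (hE : IsOpen E) (hEc : Convex ℝ E) (hEΩ : E ⊆ Ω)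
    {θ : ℝ} (hθ : θ < 1) {w : Pt d → Vc m} (hw : StronglyMeasurable w)
    (hwL : MemLp w 2 (volume.restrict Ω)) {g : Fin d → Pt d → Vc m}
    (hg : ∀ i, MemLp (g i) 2 (volume.restrict Ω)) (hweak : ∀ i, IsWeakPartial Ω i w (g i)) :
    slobodeckijSq E θ w < ⊤ := by
  have hΩf : IsFiniteMeasure (volume.restrict Ω) := ⟨by
    rw [Measure.restrict_apply_univ]; exact hΩb.measure_lt_top⟩
  -- extension by zero, with strongly measurable representatives of the derivatives
  set w' := Ω.indicator w with hw'
  set g' : Fin d → Pt d → Vc m := fun i => Ω.indicator (AEStronglyMeasurable.mk (g i) (hg i).1) with hg'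
  have hg'ae : ∀ i, AEStronglyMeasurable.mk (g i) (hg i).1 =ᵐ[volume.restrict Ω] g i := fun i => (hg i).1.ae_eq_mk.symm
  have hmkL : ∀ i, MemLp (AEStronglyMeasurable.mk (g i) (hg i).1) 2 (volume.restrict Ω) := fun i =>
    (memLp_congr_ae (hg'ae i)).2 (hg i)
  have hg'm : ∀ i, StronglyMeasurable (g' i) := fun i =>
    (hg i).1.stronglyMeasurable_mk.indicator hΩ.measurableSet
  have hg'L : ∀ i, MemLp (g' i) 2 volume := fun i =>
    (memLp_indicator_iff_restrict hΩ.measurableSet).2 (hmkL i)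
  have hg'i : ∀ i, Integrable (g' i) := fun i => by
    have := (hmkL i).integrable (by norm_num)
    exact (integrable_indicator_iff hΩ.measurableSet).2 this
  have hw'i : Integrable w' :=
    (integrable_indicator_iff hΩ.measurableSet).2 (hwL.integrable (by norm_num))
  have hw'm : StronglyMeasurable w' := hw.indicator hΩ.measurableSet
  have hcong : slobodeckijSq E θ w = slobodeckijSq E θ w' := by
    refine slobodeckijSq_congr_ae θ ?_
    filter_upwards [ae_restrict_mem hE.measurableSet] with x hx
    simp [hw', hEΩ hx]
  rw [hcong]
  set q : Pt d → ℝ := fun y => ∑ i, ‖g' i y‖ with hq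
  have hqL : MemLp q 2 volume := memLp_finsetSum _ fun i _ => (hg'L i).norm
  refine slobodeckijSq_lt_top hd hE.measurableSet (hΩb.subset hEΩ) hθ hw'm
    (K := ∫⁻ y, ‖q y‖ₑ ^ 2) (MemLp.lintegral_enorm_sq_lt_top hqL).ne fun h => ?_
  -- the derivative in the direction `h`
  set v : Pt d → Vc m := fun y => ∑ i, h i • g' i y with hv
  have hvm : StronglyMeasurable v :=
    Finset.stronglyMeasurable_fun_sum _ fun i _ => (hg'm i).const_smul (h i)
  have hvi : Integrable v := integrable_finsetSum _ fun i _ => (hg'i i).smul (h i)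
  have hvq : ∀ y, ‖v y‖ₑ ≤ ‖h‖ₑ * ‖q y‖ₑ := by
    intro y
    rw [← ofReal_norm, ← ofReal_norm, ← ofReal_norm, ← ENNReal.ofReal_mul (norm_nonneg _)]
    refine ENNReal.ofReal_le_ofReal ?_
    rw [Real.norm_of_nonneg (Finset.sum_nonneg fun i _ => norm_nonneg _), Finset.mul_sum]
    refine (norm_sum_le _ _).trans (Finset.sum_le_sum fun i _ => ?_)
    rw [norm_smul]
    gcongr
    exact PiLp.norm_apply_le h i
  have hweak' : ∀ ψ : Pt d → ℝ, IsTest E ψ →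
      ∫ y, fderiv ℝ ψ y h • w' y = - ∫ y, ψ y • v y := by
    intro ψ hψ
    have hψΩ : IsTest Ω ψ := ⟨hψ.1, hψ.2.1, hψ.2.2.trans hEΩ⟩
    have hb : ∀ (χ : Pt d → ℝ), Continuous χ → HasCompactSupport χ → ∀ f : Pt d → Vc m,
        Integrable f → Integrable (fun y => χ y • f y) := fun χ hχ hχc f hf => by
      obtain ⟨C, hC⟩ := hχc.exists_bound_of_continuous hχ
      exact hf.bdd_smul C hχ.aestronglyMeasurable (Eventually.of_forall hC)
    have hDi : ∀ i, Integrable fun y => partialD i ψ y • w' y := fun i =>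
      hb _ ((hψ.1.continuous_fderiv (by simp)).clm_apply continuous_const)
        (hψ.2.1.fderiv_apply (𝕜 := ℝ) _) _ hw'i
    have h1 : ∀ i, ∫ y, partialD i ψ y • w' y = - ∫ y, ψ y • g' i y := by
      intro i
      have := hweak i ψ hψΩ
      have e1 : ∫ y, partialD i ψ y • w' y = ∫ y in Ω, partialD i ψ y • w y := by
        rw [← integral_indicator hΩ.measurableSet]
        congr 1; funext y
        by_cases hy : y ∈ Ω <;> simp [hw', hy]
      have e2 : ∫ y, ψ y • g' i y = ∫ y in Ω, ψ y • g i y := by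
        have e3 : ∫ y in Ω, ψ y • g i y =
            ∫ y in Ω, ψ y • AEStronglyMeasurable.mk (g i) (hg i).1 y := by
          refine integral_congr_ae ?_
          filter_upwards [hg'ae i] with y hy
          rw [hy]
        rw [e3, ← integral_indicator hΩ.measurableSet]
        congr 1; funext y
        by_cases hy : y ∈ Ω <;> simp [hg', hy]
      rw [e1, e2, this]
    calc ∫ y, fderiv ℝ ψ y h • w' y = ∫ y, ∑ i, h i • (partialD i ψ y • w' y) := by
          congr 1; funext y
          rw [fderiv_apply_eq_sum_partialD, Finset.sum_smul]
          simp only [smul_assoc]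
      _ = ∑ i, h i • ∫ y, partialD i ψ y • w' y := by
          have hI : ∀ i ∈ Finset.univ, Integrable (fun y => h i • partialD i ψ y • w' y) :=
            fun i _ => (hDi i).smul (h i)
          rw [integral_finsetSum _ hI]
          simp only [integral_smul]
      _ = - ∑ i, h i • ∫ y, ψ y • g' i y := by
          simp only [h1, smul_neg, Finset.sum_neg_distrib]
      _ = - ∫ y, ψ y • v y := by
          congr 1
          simp only [hv, Finset.smul_sum, smul_comm (ψ _)]
          have hI : ∀ i ∈ Finset.univ, Integrable (fun y => h i • ψ y • g' i y) :=
            fun i _ => (hb ψ hψ.1.continuous hψ.2.1 _ (hg'i i)).smul (h i)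
          rw [integral_finsetSum _ hI]
          simp only [integral_smul]
  have key := ae_sub_eq_integral_of_weak_deriv hE hEc hw'i hvm hvi hweak'
  have hSm : MeasurableSet {x | x ∈ E ∧ x + h ∈ E} :=
    (hE.inter (hE.preimage (by fun_prop : Continuous fun y : Pt d => y + h))).measurableSet
  -- Jensen's inequality on the segment, then invariance under translations
  have hjm : Measurable fun p : Pt d × ℝ => ‖v (p.1 + p.2 • h)‖ₑ ^ 2 := by
    have := hvm.measurable
    fun_prop
  calc ∫⁻ x in {x | x ∈ E ∧ x + h ∈ E}, ‖w' (x + h) - w' x‖ₑ ^ 2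
      ≤ ∫⁻ x in {x | x ∈ E ∧ x + h ∈ E}, ∫⁻ t in Ioc (0 : ℝ) 1, ‖v (x + t • h)‖ₑ ^ 2 := by
        refine lintegral_mono_ae ?_
        filter_upwards [ae_restrict_of_ae key, ae_restrict_mem hSm] with x hx hxS
        rw [hx hxS.1 hxS.2]
        have hm : Measurable fun t : ℝ => ‖v (x + t • h)‖ₑ := by
          have := hvm.measurable
          fun_prop
        have h2 := sq_lintegral_le (μ := volume.restrict (Ioc (0 : ℝ) 1)) hm.aemeasurable
        simp only [Measure.restrict_apply_univ, Real.volume_Ioc, sub_zero, ENNReal.ofReal_one,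
          one_mul] at h2
        refine le_trans ?_ h2
        gcongr
        exact enorm_integral_le_lintegral_enorm _
    _ ≤ ∫⁻ x, ∫⁻ t in Ioc (0 : ℝ) 1, ‖v (x + t • h)‖ₑ ^ 2 := setLIntegral_le_lintegral _ _
    _ = ∫⁻ t in Ioc (0 : ℝ) 1, ∫⁻ x, ‖v (x + t • h)‖ₑ ^ 2 :=
        lintegral_lintegral_swap hjm.aemeasurable
    _ = ∫⁻ x, ‖v x‖ₑ ^ 2 := by
        have : ∀ t : ℝ, ∫⁻ x, ‖v (x + t • h)‖ₑ ^ 2 = ∫⁻ x, ‖v x‖ₑ ^ 2 := fun t =>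
          lintegral_add_right_eq_self (fun x => ‖v x‖ₑ ^ 2) (t • h)
        simp [this]
    _ ≤ ∫⁻ x, ‖h‖ₑ ^ 2 * ‖q x‖ₑ ^ 2 := by
        refine lintegral_mono fun x => ?_
        rw [← mul_pow]
        gcongr
        exact hvq x
    _ = ‖h‖ₑ ^ 2 * ∫⁻ y, ‖q y‖ₑ ^ 2 := by
        rw [lintegral_const_mul']
        simp

/-- Fractional regularity of order `θ > 1/2` on convex subsets is all that the trace theory
uses. -/
theorem MemSobolev.exists_slobodeckijSq_lt_top (hd : 1 ≤ d) {Ω : Set (Pt d)} (hΩ : IsOpen Ω)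
    (hΩb : Bornology.IsBounded Ω) {s : ℝ} (hs : 1 / 2 < s) {w : Pt d → Vc m}
    (hwm : StronglyMeasurable w) (hw : MemSobolev Ω s w) :
    ∃ θ : ℝ, 1 / 2 < θ ∧ θ < 1 ∧ ∀ E ⊆ Ω, IsOpen E → Convex ℝ E → slobodeckijSq E θ w < ⊤ := by
  unfold MemSobolev at hw
  rcases hn : ⌊s⌋₊ with _ | n
  · rw [hn] at hw
    have hs1 : s < 1 := Nat.floor_eq_zero.1 hn
    have hfr : Int.fract s = s := Int.fract_eq_self.2 ⟨by linarith, hs1⟩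
    rw [hfr] at hw
    exact ⟨s, hs, hs1, fun E hE _ _ =>
      (slobodeckijSq_mono hE s w).trans_lt (hw.2 (by linarith))⟩
  · rw [hn] at hw
    choose g hg hg' using hw.2
    have hgL : ∀ i, MemLp (g i) 2 (volume.restrict Ω) := fun i => by
      have := hg' i
      cases n with
      | zero => exact this.1
      | succ n => exact this.1
    exact ⟨3 / 4, by norm_num, by norm_num, fun E hE hEo hEc =>
      slobodeckijSq_lt_top_of_isWeakPartial hd hΩ hΩb hEo hEc hE (by norm_num) hwm hw.1 hgL hg⟩

theorem isWeakPartial_partialD {Ω : Set (Pt d)} {φ : Pt d → Vc m}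
    (hφ : ContDiff ℝ ∞ φ) (i : Fin d) : IsWeakPartial Ω i φ (partialD i φ) := by
  intro ψ hψ
  have hD : Continuous (partialD i ψ) :=
    (hψ.1.continuous_fderiv (by simp)).clm_apply continuous_const
  have hDs : HasCompactSupport (partialD i ψ) := hψ.2.1.fderiv_apply (𝕜 := ℝ) _
  have hD' : Continuous (partialD i φ) :=
    (hφ.continuous_fderiv (by simp)).clm_apply continuous_const
  have h1 : ∀ f : Pt d → Vc m, ∀ χ : Pt d → ℝ, tsupport χ ⊆ tsupport ψ →
      ∫ x in Ω, χ x • f x = ∫ x, χ x • f x := fun f χ hχ => by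
    refine setIntegral_eq_integral_of_forall_compl_eq_zero fun x hx => ?_
    rw [image_eq_zero_of_notMem_tsupport fun h => hx (hψ.2.2 (hχ h)), zero_smul]
  rw [h1 φ (partialD i ψ) (tsupport_fderiv_apply_subset ℝ _), h1 _ _ subset_rfl]
  have := integral_smul_fderiv_eq_neg_fderiv_smul_of_integrable (μ := volume) (f := ψ) (g := φ)
    (v := EuclideanSpace.single i (1 : ℝ))
    ((hD.smul hφ.continuous).integrable_of_hasCompactSupport (hDs.smul_right))
    ((hψ.1.continuous.smul hD').integrable_of_hasCompactSupport (hψ.2.1.smul_right))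
    ((hψ.1.continuous.smul hφ.continuous).integrable_of_hasCompactSupport (hψ.2.1.smul_right))
    (fun x _ => hψ.1.differentiable (by simp) x) (fun x _ => hφ.differentiable (by simp) x)
  simp only [partialD]
  rw [this, neg_neg]

theorem memSobolevAux_of_contDiff (hd : 1 ≤ d) {Ω : Set (Pt d)} (hΩ : IsOpen Ω)
    (hΩb : Bornology.IsBounded Ω) (n : ℕ) {θ : ℝ} (hθ : θ < 1) :
    ∀ {w φ : Pt d → Vc m}, ContDiff ℝ ∞ φ → HasCompactSupport φ →
      w =ᵐ[volume.restrict Ω] φ → MemSobolevAux Ω n θ w := by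
  have hL : ∀ {w φ : Pt d → Vc m}, ContDiff ℝ ∞ φ → HasCompactSupport φ →
      w =ᵐ[volume.restrict Ω] φ → MemLp w 2 (volume.restrict Ω) := fun hφ hφc h =>
    (memLp_congr_ae h).2 (hφ.continuous.memLp_of_hasCompactSupport hφc)
  induction n with
  | zero =>
    intro w φ hφ hφc h
    refine ⟨hL hφ hφc h, fun _ => ?_⟩
    rw [slobodeckijSq_congr_ae θ h]
    obtain ⟨C, hC⟩ := hφ.lipschitzWith_of_hasCompactSupport hφc (by simp)
    refine slobodeckijSq_lt_top hd hΩ.measurableSet hΩb hθ hφ.continuous.stronglyMeasurable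
      (K := (C : ℝ≥0∞) ^ 2 * volume Ω)
      (ENNReal.mul_ne_top (by simp) hΩb.measure_lt_top.ne) fun a => ?_
    calc ∫⁻ x in {x | x ∈ Ω ∧ x + a ∈ Ω}, ‖φ (x + a) - φ x‖ₑ ^ 2
        ≤ ∫⁻ x in {x | x ∈ Ω ∧ x + a ∈ Ω}, (C * ‖a‖ₑ) ^ 2 := by
          refine lintegral_mono fun x => ?_
          gcongr
          have := hC (x + a) x
          simpa [edist_eq_enorm_sub] using this
      _ ≤ (C * ‖a‖ₑ) ^ 2 * volume Ω := by
          rw [setLIntegral_const]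
          gcongr
          exact fun x hx => hx.1
      _ = _ := by ring
  | succ n ih =>
    intro w φ hφ hφc h
    refine ⟨hL hφ hφc h, fun i => ⟨partialD i φ, ?_, ?_⟩⟩
    · intro ψ hψ
      rw [← isWeakPartial_partialD hφ i ψ hψ]
      refine integral_congr_ae ?_
      filter_upwards [h] with x hx
      rw [hx]
    · exact ih ((hφ.fderiv_right (by simp)).clm_apply contDiff_const)
        (hφc.fderiv_apply (𝕜 := ℝ) _) (Filter.EventuallyEq.rfl)

/-- Smooth functions with compact support have every Sobolev regularity, so that they may be used
as test functions in the representation of the boundary operator. -/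
theorem memSobolev_of_contDiff (hd : 1 ≤ d) {Ω : Set (Pt d)} (hΩ : IsOpen Ω)
    (hΩb : Bornology.IsBounded Ω) (s : ℝ) {w φ : Pt d → Vc m} (hφ : ContDiff ℝ ∞ φ)
    (hφc : HasCompactSupport φ) (h : w =ᵐ[volume.restrict Ω] φ) : MemSobolev Ω s w :=
  memSobolevAux_of_contDiff hd hΩ hΩb _ (Int.fract_lt_one s) hφ hφc h

/-! ### Mean oscillations -/

section

variable {F : Type*} [NormedAddCommGroup F]

/-- The mean oscillation, at scale `ρ`, of `w` in the part of `E` near `x`. -/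
def oscAt (E : Set (Pt d)) (w : Pt d → F) (ρ : ℝ) (x : Pt d) : ℝ≥0∞ :=
  ENNReal.ofReal (ρ ^ (2 * d))⁻¹ * ∫⁻ y in E, ∫⁻ z in E,
    (Metric.ball x ρ).indicator 1 y * ((Metric.ball x ρ).indicator 1 z * ‖w y - w z‖ₑ)

/-- The sum of the mean oscillations over the dyadic scales `R, R/2, R/4, …`. -/
def oscSum (E : Set (Pt d)) (w : Pt d → F) (R : ℝ) (x : Pt d) : ℝ≥0∞ :=
  ∑' j : ℕ, oscAt E w (R * (1 / 2) ^ j) x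

theorem measurable_ball_indicator (ρ : ℝ) :
    Measurable fun p : Pt d × Pt d => (Metric.ball p.1 ρ).indicator (1 : Pt d → ℝ≥0∞) p.2 := by
  have : (fun p : Pt d × Pt d => (Metric.ball p.1 ρ).indicator (1 : Pt d → ℝ≥0∞) p.2) =
      {p : Pt d × Pt d | dist p.2 p.1 < ρ}.indicator 1 := by
    funext p
    by_cases h : dist p.2 p.1 < ρ <;> simp [indicator, h]
  rw [this]
  exact measurable_one.indicator (isOpen_lt (by fun_prop) continuous_const).measurableSet

theorem measurable_oscAt [MeasurableSpace F] [BorelSpace F] [SecondCountableTopology F]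
    (E : Set (Pt d)) {w : Pt d → F} (hw : StronglyMeasurable w) (ρ : ℝ) :
    Measurable (oscAt E w ρ) := by
  have hm := hw.measurable
  unfold oscAt
  refine Measurable.const_mul ?_ _
  refine Measurable.lintegral_prod_right' (f := fun p : Pt d × Pt d => ∫⁻ z in E,
    (Metric.ball p.1 ρ).indicator 1 p.2 * ((Metric.ball p.1 ρ).indicator 1 z * ‖w p.2 - w z‖ₑ)) ?_
  refine Measurable.lintegral_prod_right' (f := fun q : (Pt d × Pt d) × Pt d =>
    (Metric.ball q.1.1 ρ).indicator (1 : Pt d → ℝ≥0∞) q.1.2 *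
      ((Metric.ball q.1.1 ρ).indicator (1 : Pt d → ℝ≥0∞) q.2 * ‖w q.1.2 - w q.2‖ₑ)) ?_
  have h1 := (measurable_ball_indicator (d := d) ρ).comp
    (by fun_prop : Measurable fun q : (Pt d × Pt d) × Pt d => (q.1.1, q.1.2))
  have h2 := (measurable_ball_indicator (d := d) ρ).comp
    (by fun_prop : Measurable fun q : (Pt d × Pt d) × Pt d => (q.1.1, q.2))
  exact h1.mul (h2.mul (by fun_prop))

theorem measurable_oscSum [MeasurableSpace F] [BorelSpace F] [SecondCountableTopology F]
    (E : Set (Pt d)) {w : Pt d → F} (hw : StronglyMeasurable w) (R : ℝ) :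
    Measurable (oscSum E w R) :=
  Measurable.ennreal_tsum fun _ => measurable_oscAt E hw _

/-- The Cauchy-Schwarz inequality on the square of the ball of radius `ρ`, on which the weight of
the Slobodeckij seminorm is bounded because points are at distance less than `2 ρ`. -/
theorem sq_oscAt_le (hd : 1 ≤ d) {E : Set (Pt d)} {θ : ℝ} (hθ : 0 < θ)
    {w : Pt d → Vc m} (hw : StronglyMeasurable w) {ρ : ℝ} (hρ : 0 < ρ) (x : Pt d) :
    oscAt E w ρ x ^ 2 ≤ ENNReal.ofReal (2 ^ ((d : ℝ) + 2 * θ) * ρ ^ (2 * θ - d)) *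
      volume (Metric.ball (0 : Pt d) 1) ^ 2 * ∫⁻ y in E, ∫⁻ z in E,
        (Metric.ball x ρ).indicator 1 y * (‖w y - w z‖ₑ ^ 2 / edist y z ^ ((d : ℝ) + 2 * θ)) := by
  have : Nonempty (Fin d) := ⟨⟨0, hd⟩⟩
  set p : ℝ := (d : ℝ) + 2 * θ with hp
  have hp0 : 0 < p := by positivity
  have hm := hw.measurable
  set B := Metric.ball x ρ with hB
  have hBm : MeasurableSet B := Metric.isOpen_ball.measurableSet
  have hind : Measurable (B.indicator (1 : Pt d → ℝ≥0∞)) := measurable_one.indicator hBm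
  set μ := (volume.restrict E).prod (volume.restrict E) with hμ
  -- the indicator of `B × B` is split into two factors for the Cauchy-Schwarz inequality
  set I : Pt d × Pt d → ℝ≥0∞ := fun q => B.indicator 1 q.1 * B.indicator 1 q.2 with hI
  have hIm : Measurable I := by fun_prop
  have hIsq : ∀ q, I q ^ 2 = I q := by
    intro q
    by_cases h1 : q.1 ∈ B <;> by_cases h2 : q.2 ∈ B <;> simp [hI, h1, h2]
  have e1 : ∫⁻ y in E, ∫⁻ z in E, B.indicator 1 y * (B.indicator 1 z * ‖w y - w z‖ₑ) =
      ∫⁻ q, I q * (I q * ‖w q.1 - w q.2‖ₑ) ∂μ := by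
    rw [lintegral_prod _ (by fun_prop)]
    refine lintegral_congr fun y => lintegral_congr fun z => ?_
    rw [← mul_assoc (I _), ← sq, hIsq, hI, mul_assoc]
  have e2 : ∫⁻ q, I q ^ 2 ∂μ ≤ (ENNReal.ofReal (ρ ^ d) * volume (Metric.ball (0 : Pt d) 1)) ^ 2 := by
    simp only [hIsq]
    rw [hI, lintegral_prod_mul hind.aemeasurable hind.aemeasurable, ← sq]
    gcongr
    rw [lintegral_indicator_one hBm]
    refine (Measure.restrict_apply_le _ _).trans ?_
    rw [hB, Measure.addHaar_ball_of_pos _ _ hρ, finrank_euclideanSpace_fin]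
  have e3 : ∫⁻ q, (I q * ‖w q.1 - w q.2‖ₑ) ^ 2 ∂μ ≤ ENNReal.ofReal ((2 * ρ) ^ p) *
      ∫⁻ y in E, ∫⁻ z in E, B.indicator 1 y * (‖w y - w z‖ₑ ^ 2 / edist y z ^ p) := by
    rw [lintegral_prod _ (by fun_prop), ← lintegral_const_mul' _ _ ENNReal.ofReal_ne_top]
    refine lintegral_mono fun y => ?_
    rw [← lintegral_const_mul' _ _ ENNReal.ofReal_ne_top]
    refine lintegral_mono fun z => ?_
    simp only [mul_pow, hIsq]
    by_cases h1 : y ∈ B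
    · by_cases h2 : z ∈ B
      · simp only [hI, h1, h2, indicator_of_mem, Pi.one_apply, one_mul]
        by_cases hyz : y = z
        · simp [hyz]
        · have h3 : edist y z ^ p ≤ ENNReal.ofReal ((2 * ρ) ^ p) := by
            rw [← ENNReal.ofReal_rpow_of_pos (by positivity)]
            refine ENNReal.rpow_le_rpow ?_ hp0.le
            rw [edist_dist]
            refine ENNReal.ofReal_le_ofReal ?_
            rw [hB, Metric.mem_ball] at h1 h2
            linarith [dist_triangle_right y z x]
          have h4 : edist y z ^ p ≠ 0 := by
            simp [ENNReal.rpow_eq_zero_iff, hp0, hyz]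
          have h5 : edist y z ^ p ≠ ⊤ := ENNReal.rpow_ne_top_of_nonneg hp0.le (edist_ne_top _ _)
          calc ‖w y - w z‖ₑ ^ 2 = edist y z ^ p * (‖w y - w z‖ₑ ^ 2 / edist y z ^ p) :=
                (ENNReal.mul_div_cancel h4 h5).symm
            _ ≤ _ := by gcongr
      · simp [hI, h2]
    · simp [hI, h1]
  have key := sq_lintegral_mul_le (μ := μ) (f := I) (g := fun q => I q * ‖w q.1 - w q.2‖ₑ)
    hIm.aemeasurable (by fun_prop)
  rw [oscAt, e1, mul_pow]
  refine (mul_le_mul_right (key.trans (mul_le_mul' e2 e3)) _).trans (le_of_eq ?_)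
  have e4 : ENNReal.ofReal (ρ ^ (2 * d))⁻¹ ^ 2 * (ENNReal.ofReal (ρ ^ d) ^ 2 *
      ENNReal.ofReal ((2 * ρ) ^ p)) = ENNReal.ofReal (2 ^ p * ρ ^ (2 * θ - d)) := by
    rw [← ENNReal.ofReal_pow (by positivity), ← ENNReal.ofReal_pow (by positivity),
      ← ENNReal.ofReal_mul (by positivity), ← ENNReal.ofReal_mul (by positivity)]
    congr 1
    have : ρ ^ (2 * θ - d) = ρ ^ p * ((ρ ^ d) ^ 2)⁻¹ := by
      rw [← pow_mul, ← Real.rpow_natCast, ← Real.rpow_neg hρ.le, ← Real.rpow_add hρ]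
      congr 1
      push_cast; ring
    rw [this, Real.mul_rpow (by norm_num) hρ.le, pow_mul']
    field_simp
  rw [← e4]
  ring

/-- The oscillations at scale `ρ` decay like `ρ ^ (θ - 1/2)` in mean square, for a measure that
gives to balls of radius `ρ` a mass of order `ρ ^ (d - 1)`. -/
theorem lintegral_sq_oscAt_le (hd : 1 ≤ d) {E : Set (Pt d)} {θ : ℝ} (hθ : 0 < θ)
    {w : Pt d → Vc m} (hw : StronglyMeasurable w) {ν : Measure (Pt d)} [SFinite ν] {κ : ℝ≥0∞}
    (hν : ∀ y r, 0 < r → ν (Metric.ball y r) ≤ ENNReal.ofReal (r ^ (d - 1)) * κ)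
    {ρ : ℝ} (hρ : 0 < ρ) :
    ∫⁻ x, oscAt E w ρ x ^ 2 ∂ν ≤ ENNReal.ofReal (ρ ^ (2 * θ - 1)) *
      (ENNReal.ofReal (2 ^ ((d : ℝ) + 2 * θ)) * volume (Metric.ball (0 : Pt d) 1) ^ 2 * κ *
        slobodeckijSq E θ w) := by
  have hm := hw.measurable
  set p : ℝ := (d : ℝ) + 2 * θ with hp
  have hfin : ENNReal.ofReal (2 ^ p * ρ ^ (2 * θ - d)) *
      volume (Metric.ball (0 : Pt d) 1) ^ 2 ≠ ⊤ :=
    ENNReal.mul_ne_top ENNReal.ofReal_ne_top (ENNReal.pow_ne_top measure_ball_lt_top.ne)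
  have hmeas : Measurable fun q : Pt d × Pt d => ∫⁻ z in E,
      (Metric.ball q.1 ρ).indicator 1 q.2 * (‖w q.2 - w z‖ₑ ^ 2 / edist q.2 z ^ p) := by
    refine Measurable.lintegral_prod_right' (f := fun r : (Pt d × Pt d) × Pt d =>
      (Metric.ball r.1.1 ρ).indicator (1 : Pt d → ℝ≥0∞) r.1.2 *
        (‖w r.1.2 - w r.2‖ₑ ^ 2 / edist r.1.2 r.2 ^ p)) ?_
    have h1 := (measurable_ball_indicator (d := d) ρ).comp
      (by fun_prop : Measurable fun q : (Pt d × Pt d) × Pt d => (q.1.1, q.1.2))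
    exact h1.mul (by fun_prop)
  -- after the order of integration is exchanged, the integral over `x` is the mass of a ball
  have hin : ∀ x y : Pt d, (Metric.ball x ρ).indicator (1 : Pt d → ℝ≥0∞) y =
      (Metric.ball y ρ).indicator 1 x := fun x y => by
    by_cases h : dist x y < ρ
    · simp [indicator, h, dist_comm y x]
    · simp [indicator, h, dist_comm y x]
  calc ∫⁻ x, oscAt E w ρ x ^ 2 ∂ν
      ≤ ∫⁻ x, (ENNReal.ofReal (2 ^ p * ρ ^ (2 * θ - d)) *
      volume (Metric.ball (0 : Pt d) 1) ^ 2 * ∫⁻ y in E, ∫⁻ z in E,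
        (Metric.ball x ρ).indicator 1 y * (‖w y - w z‖ₑ ^ 2 / edist y z ^ p)) ∂ν :=
        lintegral_mono fun x => sq_oscAt_le hd hθ hw hρ x
    _ = ENNReal.ofReal (2 ^ p * ρ ^ (2 * θ - d)) *
      volume (Metric.ball (0 : Pt d) 1) ^ 2 * ∫⁻ x, (∫⁻ y in E, ∫⁻ z in E,
        (Metric.ball x ρ).indicator 1 y * (‖w y - w z‖ₑ ^ 2 / edist y z ^ p)) ∂ν :=
        lintegral_const_mul' _ _ hfin
    _ = ENNReal.ofReal (2 ^ p * ρ ^ (2 * θ - d)) *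
      volume (Metric.ball (0 : Pt d) 1) ^ 2 * ∫⁻ y in E, (∫⁻ x, (∫⁻ z in E,
        (Metric.ball x ρ).indicator 1 y * (‖w y - w z‖ₑ ^ 2 / edist y z ^ p)) ∂ν) := by
        rw [lintegral_lintegral_swap hmeas.aemeasurable]
    _ ≤ ENNReal.ofReal (2 ^ p * ρ ^ (2 * θ - d)) *
      volume (Metric.ball (0 : Pt d) 1) ^ 2 * ∫⁻ y in E, (ENNReal.ofReal (ρ ^ (d - 1)) * κ) *
        ∫⁻ z in E, ‖w y - w z‖ₑ ^ 2 / edist y z ^ p := by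
        gcongr with y
        have h1 : ∀ x, ∫⁻ z in E,
            (Metric.ball x ρ).indicator 1 y * (‖w y - w z‖ₑ ^ 2 / edist y z ^ p) =
            (Metric.ball y ρ).indicator 1 x * ∫⁻ z in E, ‖w y - w z‖ₑ ^ 2 / edist y z ^ p := by
          intro x
          rw [hin, lintegral_const_mul]
          fun_prop
        simp only [h1]
        rw [lintegral_mul_const _ (measurable_one.indicator Metric.isOpen_ball.measurableSet),
          lintegral_indicator_one Metric.isOpen_ball.measurableSet]
        gcongr
        exact hν y ρ hρ
    _ ≤ ENNReal.ofReal (2 ^ p * ρ ^ (2 * θ - d)) *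
      volume (Metric.ball (0 : Pt d) 1) ^ 2 * ((ENNReal.ofReal (ρ ^ (d - 1)) * κ) *
        slobodeckijSq E θ w) := by
        gcongr
        rw [lintegral_const_mul]
        · exact le_rfl
        · refine Measurable.lintegral_prod_right' (f := fun r : Pt d × Pt d =>
            (‖w r.1 - w r.2‖ₑ ^ 2 / edist r.1 r.2 ^ p)) ?_
          fun_prop
    _ = _ := by
        have e4 : ENNReal.ofReal (2 ^ p * ρ ^ (2 * θ - d)) * ENNReal.ofReal (ρ ^ (d - 1)) =
            ENNReal.ofReal (ρ ^ (2 * θ - 1)) * ENNReal.ofReal (2 ^ p) := by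
          rw [← ENNReal.ofReal_mul (by positivity), ← ENNReal.ofReal_mul (by positivity)]
          congr 1
          have : ρ ^ (2 * θ - 1) = ρ ^ (2 * θ - d) * ρ ^ (d - 1) := by
            rw [← Real.rpow_natCast, ← Real.rpow_add hρ, Nat.cast_sub hd]
            congr 1
            push_cast; ring
          rw [this]; ring
        calc _ = (ENNReal.ofReal (2 ^ p * ρ ^ (2 * θ - d)) * ENNReal.ofReal (ρ ^ (d - 1))) *
            (volume (Metric.ball (0 : Pt d) 1) ^ 2 * κ * slobodeckijSq E θ w) := by ring
          _ = _ := by rw [e4]; ring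

theorem sq_tsum_mul_le (f g : ℕ → ℝ≥0∞) :
    (∑' j, f j * g j) ^ 2 ≤ (∑' j, f j ^ 2) * ∑' j, g j ^ 2 := by
  simp only [← lintegral_count]
  exact sq_lintegral_mul_le (measurable_of_countable _).aemeasurable
    (measurable_of_countable _).aemeasurable

/-- The sum of the mean oscillations is square integrable on hyperplanes, because `θ > 1/2`. -/
theorem lintegral_sq_oscSum_lt_top (hd : 1 ≤ d) {E : Set (Pt d)} {θ : ℝ} (hθ : 1 / 2 < θ)
    {w : Pt d → Vc m} (hw : StronglyMeasurable w) (hs : slobodeckijSq E θ w < ⊤)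
    {ν : Measure (Pt d)} [SFinite ν] {κ : ℝ≥0∞} (hκ : κ ≠ ⊤)
    (hν : ∀ y r, 0 < r → ν (Metric.ball y r) ≤ ENNReal.ofReal (r ^ (d - 1)) * κ)
    {R : ℝ} (hR : 0 < R) : ∫⁻ x, oscSum E w R x ^ 2 ∂ν < ⊤ := by
  set K : ℝ≥0∞ := ENNReal.ofReal (2 ^ ((d : ℝ) + 2 * θ)) * volume (Metric.ball (0 : Pt d) 1) ^ 2 *
    κ * slobodeckijSq E θ w with hK
  have hKt : K ≠ ⊤ := ENNReal.mul_ne_top (ENNReal.mul_ne_top (ENNReal.mul_ne_top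
    ENNReal.ofReal_ne_top (ENNReal.pow_ne_top measure_ball_lt_top.ne)) hκ) hs.ne
  set δ : ℝ := (2 * θ - 1) / 4 with hδ
  have hδ0 : 0 < δ := by rw [hδ]; linarith
  -- half of the decay of the oscillations is spent on the weights of a Cauchy-Schwarz inequality
  set q : ℝ := (1 / 2) ^ δ with hq
  have hq0 : 0 < q := by positivity
  have hq1 : q < 1 := Real.rpow_lt_one (by norm_num) (by norm_num) hδ0
  set r : ℝ≥0∞ := ENNReal.ofReal q with hr
  have hr0 : r ≠ 0 := by simp [hr, hq0]
  have hrt : r ≠ ⊤ := ENNReal.ofReal_ne_top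
  have hr1 : r < 1 := by rw [hr]; exact ENNReal.ofReal_lt_one.2 hq1
  have hr2 : r ^ 2 < 1 := pow_lt_one₀ zero_le hr1 (by norm_num)
  have hgeom : ∑' j : ℕ, (r ^ 2) ^ j ≠ ⊤ := by
    rw [ENNReal.tsum_geometric]
    exact ENNReal.inv_ne_top.2 (tsub_pos_of_lt hr2).ne'
  have h1 : ∀ x, oscSum E w R x ^ 2 ≤ (∑' j : ℕ, (r ^ 2) ^ j) *
      ∑' j : ℕ, ((r ^ j)⁻¹ * oscAt E w (R * (1 / 2) ^ j) x) ^ 2 := by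
    intro x
    have := sq_tsum_mul_le (fun j => r ^ j) fun j => (r ^ j)⁻¹ * oscAt E w (R * (1 / 2) ^ j) x
    have h2 : ∀ j : ℕ, r ^ j * ((r ^ j)⁻¹ * oscAt E w (R * (1 / 2) ^ j) x) =
        oscAt E w (R * (1 / 2) ^ j) x := fun j => by
      rw [← mul_assoc, ENNReal.mul_inv_cancel (pow_ne_zero _ hr0) (ENNReal.pow_ne_top hrt), one_mul]
    simp only [h2, ← pow_mul, mul_comm _ 2] at this ⊢
    exact this
  refine (lintegral_mono h1).trans_lt ?_
  rw [lintegral_const_mul' _ _ hgeom]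
  refine ENNReal.mul_lt_top hgeom.lt_top ?_
  rw [lintegral_tsum fun j => ((measurable_oscAt E hw _).const_mul _).pow_const 2 |>.aemeasurable]
  have h3 : ∀ j : ℕ, ∫⁻ x, ((r ^ j)⁻¹ * oscAt E w (R * (1 / 2) ^ j) x) ^ 2 ∂ν ≤
      (ENNReal.ofReal (R ^ (2 * θ - 1)) * K) * (r ^ 2) ^ j := by
    intro j
    simp only [mul_pow]
    rw [lintegral_const_mul _ ((measurable_oscAt E hw _).pow_const 2)]
    refine (mul_le_mul_right (lintegral_sq_oscAt_le (θ := θ) hd (by linarith) hw hν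
      (by positivity : 0 < R * (1 / 2) ^ j)) _).trans (le_of_eq ?_)
    rw [← hK]
    have h4 : ENNReal.ofReal ((R * (1 / 2) ^ j) ^ (2 * θ - 1)) =
        ENNReal.ofReal (R ^ (2 * θ - 1)) * (r ^ j) ^ 4 := by
      rw [hr, ← ENNReal.ofReal_pow hq0.le, ← ENNReal.ofReal_pow (by positivity),
        ← ENNReal.ofReal_mul (by positivity), Real.mul_rpow hR.le (by positivity), hq]
      congr 2
      rw [← Real.rpow_natCast, ← Real.rpow_natCast, ← Real.rpow_natCast,
        ← Real.rpow_mul (by positivity), ← Real.rpow_mul (by positivity),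
        ← Real.rpow_mul (by positivity), hδ]
      congr 1
      push_cast; ring
    have h5 : (r ^ j)⁻¹ ^ 2 * (r ^ j) ^ 4 = (r ^ 2) ^ j := by
      have : (r ^ j) ^ 4 = (r ^ j) ^ 2 * (r ^ j) ^ 2 := by ring
      rw [this, ← mul_assoc, ← mul_pow,
        ENNReal.inv_mul_cancel (pow_ne_zero _ hr0) (ENNReal.pow_ne_top hrt), one_pow, one_mul,
        ← pow_mul, ← pow_mul, mul_comm]
    rw [h4, ← h5]
    ring
  refine (ENNReal.tsum_le_tsum h3).trans_lt ?_
  rw [ENNReal.tsum_mul_left]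
  exact ENNReal.mul_lt_top (ENNReal.mul_lt_top ENNReal.ofReal_lt_top hKt.lt_top) hgeom.lt_top

theorem ae_oscSum_lt_top (hd : 1 ≤ d) {E : Set (Pt d)} {θ : ℝ} (hθ : 1 / 2 < θ)
    {w : Pt d → Vc m} (hw : StronglyMeasurable w) (hs : slobodeckijSq E θ w < ⊤)
    {ν : Measure (Pt d)} [SFinite ν] {κ : ℝ≥0∞} (hκ : κ ≠ ⊤)
    (hν : ∀ y r, 0 < r → ν (Metric.ball y r) ≤ ENNReal.ofReal (r ^ (d - 1)) * κ)
    {R : ℝ} (hR : 0 < R) : ∀ᵐ x ∂ν, oscSum E w R x < ⊤ := by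
  filter_upwards [ae_lt_top ((measurable_oscSum E hw R).pow_const 2)
    (lintegral_sq_oscSum_lt_top hd hθ hw hs hκ hν hR).ne] with x hx
  by_contra h
  rw [not_lt, top_le_iff] at h
  simp [h] at hx

/-! ### Averages near a point -/

variable [NormedSpace ℝ F]

/-- `k` is a weight of total mass one, living in the part of `E` at distance at most `ρ` from `x`
and of the order of magnitude of a uniform weight. -/
structure IsKernel (E : Set (Pt d)) (x : Pt d) (ρ C : ℝ) (k : Pt d → ℝ) : Prop where
  measurable : Measurable k
  bound : ∀ y, |k y| ≤ C * (ρ ^ d)⁻¹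
  supp : ∀ y, k y ≠ 0 → y ∈ Metric.ball x ρ ∩ E
  integral : ∫ y, k y = 1

theorem IsKernel.mono {E E' : Set (Pt d)} {x : Pt d} {ρ C : ℝ} {k : Pt d → ℝ}
    (h : IsKernel E x ρ C k) (hE : Metric.ball x ρ ∩ E ⊆ E') : IsKernel E' x ρ C k :=
  ⟨h.measurable, h.bound, fun y hy => ⟨(h.supp y hy).1, hE (h.supp y hy)⟩, h.integral⟩

theorem IsKernel.integrable {E : Set (Pt d)} {x : Pt d} {ρ C : ℝ} {k : Pt d → ℝ}
    (h : IsKernel E x ρ C k) : Integrable k := by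
  by_contra hk
  have := integral_undef hk
  rw [h.integral] at this
  exact one_ne_zero this

theorem IsKernel.integrable_smul {E : Set (Pt d)} {x : Pt d} {ρ C : ℝ} {k : Pt d → ℝ}
    (h : IsKernel E x ρ C k) (hE : MeasurableSet E) {w : Pt d → F} (hw : IntegrableOn w E) :
    Integrable fun y => k y • w y := by
  have h1 : (fun y => k y • w y) = fun y => k y • E.indicator w y := by
    funext y
    by_cases hy : y ∈ E
    · simp [hy]
    · have : k y = 0 := by
        by_contra h0
        exact hy (h.supp y h0).2
      simp [this]
  rw [h1]
  exact ((integrable_indicator_iff hE).2 hw).bdd_smul (C * (ρ ^ d)⁻¹)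
    h.measurable.aestronglyMeasurable (Eventually.of_forall h.bound)

/-- Two averages of `w` at comparable scales differ at most by a multiple of the mean oscillation.
-/
theorem IsKernel.enorm_sub_le [CompleteSpace F] [MeasurableSpace F] [BorelSpace F]
    [SecondCountableTopology F] {E : Set (Pt d)} {x : Pt d} {ρ ρ' σ C C' : ℝ} {k k' : Pt d → ℝ}
    (h : IsKernel E x ρ C k) (h' : IsKernel E x ρ' C' k') (hE : MeasurableSet E)
    {w : Pt d → F} (hw : StronglyMeasurable w) (hwE : IntegrableOn w E)
    (hρ : ρ ≤ σ) (hρ' : ρ' ≤ σ) (hσ : σ ≤ 4 * ρ) (hσ' : σ ≤ 4 * ρ') (hσ0 : 0 < σ)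
    (hC : 0 ≤ C) (hC' : 0 ≤ C') :
    ‖(∫ y, k y • w y) - ∫ y, k' y • w y‖ₑ ≤ ENNReal.ofReal (C * C' * 16 ^ d) * oscAt E w σ x := by
  have hm := hw.measurable
  have hkb : ∀ {τ D : ℝ} {l : Pt d → ℝ}, IsKernel E x τ D l → τ ≤ σ → σ ≤ 4 * τ → 0 ≤ D → ∀ y,
      ‖l y‖ₑ ≤ ENNReal.ofReal (D * 4 ^ d * (σ ^ d)⁻¹) *
        (E.indicator 1 y * (Metric.ball x σ).indicator 1 y) := by
    intro τ D l hl hτ hτ' hD y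
    have hτ0 : 0 < τ := by linarith
    by_cases h0 : l y = 0
    · simp [h0]
    · have h1 := hl.supp y h0
      have h2 : y ∈ Metric.ball x σ := Metric.ball_subset_ball hτ h1.1
      rw [indicator_of_mem h1.2, indicator_of_mem h2, Pi.one_apply, one_mul, mul_one,
        ← ofReal_norm, Real.norm_eq_abs]
      refine ENNReal.ofReal_le_ofReal ((hl.bound y).trans ?_)
      rw [mul_assoc]
      refine mul_le_mul_of_nonneg_left ?_ hD
      rw [← div_eq_mul_inv, le_div_iff₀ (by positivity), inv_mul_le_iff₀ (by positivity),
        mul_comm, ← mul_pow]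
      exact pow_le_pow_left₀ hσ0.le hτ' d
  have hi := h.integrable_smul hE hwE
  have hi' := h'.integrable_smul hE hwE
  -- since both kernels have mass one, the difference is a double average of `w y - w z`
  have e1 : ∀ y, k y • (w y - ∫ z, k' z • w z) = k y • ∫ z, k' z • (w y - w z) := by
    intro y
    congr 1
    simp only [smul_sub]
    rw [integral_sub (h'.integrable.smul_const _) hi', integral_smul_const, h'.integral, one_smul]
  have e2 : (∫ y, k y • w y) - ∫ y, k' y • w y = ∫ y, k y • ∫ z, k' z • (w y - w z) := by
    rw [← integral_congr_ae (Eventually.of_forall e1)]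
    simp only [smul_sub (k _)]
    rw [integral_sub hi (h.integrable.smul_const _), integral_smul_const, h.integral, one_smul]
  rw [e2]
  calc ‖∫ y, k y • ∫ z, k' z • (w y - w z)‖ₑ
      ≤ ∫⁻ y, ‖k y‖ₑ * ∫⁻ z, ‖k' z‖ₑ * ‖w y - w z‖ₑ := by
        refine (enorm_integral_le_lintegral_enorm _).trans (lintegral_mono fun y => ?_)
        rw [enorm_smul]
        gcongr
        refine (enorm_integral_le_lintegral_enorm _).trans (lintegral_mono fun z => ?_)
        rw [enorm_smul]
    _ ≤ ∫⁻ y, (ENNReal.ofReal (C * 4 ^ d * (σ ^ d)⁻¹) *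
        (E.indicator 1 y * (Metric.ball x σ).indicator 1 y)) * ∫⁻ z,
          (ENNReal.ofReal (C' * 4 ^ d * (σ ^ d)⁻¹) *
          (E.indicator 1 z * (Metric.ball x σ).indicator 1 z)) * ‖w y - w z‖ₑ := by
        gcongr with y z
        · exact hkb h hρ hσ hC y
        · exact hkb h' hρ' hσ' hC' z
    _ = (ENNReal.ofReal (C * 4 ^ d * (σ ^ d)⁻¹) * ENNReal.ofReal (C' * 4 ^ d * (σ ^ d)⁻¹)) *
        ∫⁻ y in E, ∫⁻ z in E,
        (Metric.ball x σ).indicator 1 y * ((Metric.ball x σ).indicator 1 z * ‖w y - w z‖ₑ) := by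
        generalize ha : ENNReal.ofReal (C * 4 ^ d * (σ ^ d)⁻¹) = a
        generalize hb : ENNReal.ofReal (C' * 4 ^ d * (σ ^ d)⁻¹) = b
        have hat : a ≠ ⊤ := ha ▸ ENNReal.ofReal_ne_top
        have hbt : b ≠ ⊤ := hb ▸ ENNReal.ofReal_ne_top
        rw [← lintegral_const_mul' _ _ (ENNReal.mul_ne_top hat hbt), ← lintegral_indicator hE]
        refine lintegral_congr fun y => ?_
        by_cases hy : y ∈ E
        · have hbt' : (Metric.ball x σ).indicator (1 : Pt d → ℝ≥0∞) y ≠ ⊤ := by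
            by_cases hb : y ∈ Metric.ball x σ <;> simp [hb]
          have e3 : ∫⁻ z, (b * (E.indicator 1 z * (Metric.ball x σ).indicator 1 z)) *
              ‖w y - w z‖ₑ = b * ∫⁻ z in E, (Metric.ball x σ).indicator 1 z * ‖w y - w z‖ₑ := by
            rw [← lintegral_indicator hE, ← lintegral_const_mul' _ _ hbt]
            refine lintegral_congr fun z => ?_
            by_cases hz : z ∈ E <;> simp [hz, mul_assoc]
          rw [indicator_of_mem hy, indicator_of_mem hy, Pi.one_apply, one_mul,
            lintegral_const_mul' _ _ hbt', e3]
          ring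
        · simp [hy]
    _ = _ := by
        rw [oscAt, ← ENNReal.ofReal_mul (by positivity), ← mul_assoc (ENNReal.ofReal _),
          ← ENNReal.ofReal_mul (by positivity)]
        congr 2
        rw [pow_mul', show (16 : ℝ) = 4 * 4 by norm_num, mul_pow]
        field_simp

/-- All the averages of `w` near `x` converge to `b` when their scale goes to zero. -/
def HasKernelLimit (E : Set (Pt d)) (w : Pt d → F) (x : Pt d) (b : F) : Prop :=
  ∀ (C : ℝ) (ρ : ℕ → ℝ) (k : ℕ → Pt d → ℝ), 0 ≤ C →
    (∀ᶠ i in atTop, IsKernel E x (ρ i) C (k i)) → Tendsto ρ atTop (𝓝[>] 0) →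
    Tendsto (fun i => ∫ y, k i y • w y) atTop (𝓝 b)

theorem exists_half_pow_mem {R ρ : ℝ} (hR : 0 < R) (hρ : 0 < ρ) (hρR : ρ ≤ R) :
    ∃ j : ℕ, ρ ≤ R * (1 / 2) ^ j ∧ R * (1 / 2) ^ j ≤ 4 * ρ := by
  obtain ⟨n, h1, h2⟩ := exists_nat_pow_near_of_lt_one (x := ρ / R) (y := 1 / 2) (by positivity)
    ((div_le_one hR).2 hρR) (by norm_num) (by norm_num)
  refine ⟨n, ?_, ?_⟩
  · rw [div_le_iff₀ hR] at h2; linarith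
  · rw [lt_div_iff₀ hR, pow_succ] at h1; linarith

/-- Where the mean oscillations are summable, the averages converge; the limit and all the averages
are controlled by a single average and the sum of the oscillations. -/
theorem exists_hasKernelLimit [CompleteSpace F] [MeasurableSpace F] [BorelSpace F]
    [SecondCountableTopology F] {E : Set (Pt d)} (hE : MeasurableSet E) {w : Pt d → F}
    (hw : StronglyMeasurable w) (hwE : IntegrableOn w E) {R : ℝ} (hR : 0 < R) {x : Pt d}
    (hx : oscSum E w R x < ⊤) {C : ℝ} (hC : 0 ≤ C) {k : ℕ → Pt d → ℝ} {j₀ : ℕ}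
    (hk : ∀ j ≥ j₀, IsKernel E x (R * (1 / 2) ^ j) C (k j)) :
    ∃ b, HasKernelLimit E w x b ∧
      ‖b‖ₑ ≤ ‖∫ y, k j₀ y • w y‖ₑ + ENNReal.ofReal (C * C * 16 ^ d) * oscSum E w R x ∧
      ∀ j ≥ j₀, ‖∫ y, k j y • w y‖ₑ ≤
        ‖∫ y, k j₀ y • w y‖ₑ + ENNReal.ofReal (C * C * 16 ^ d) * oscSum E w R x := by
  set a : ℕ → F := fun j => ∫ y, k (j₀ + j) y • w y with ha
  set D := ENNReal.ofReal (C * C * 16 ^ d) with hD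
  have hosc : ∑' j, oscAt E w (R * (1 / 2) ^ (j₀ + j)) x ≤ oscSum E w R x := by
    have := ENNReal.tsum_comp_le_tsum_of_injective (f := fun j => j₀ + j)
      (fun i j h => by simpa using h) (fun j => oscAt E w (R * (1 / 2) ^ j) x)
    exact this
  have hstep : ∀ j, edist (a j) (a (j + 1)) ≤ D * oscAt E w (R * (1 / 2) ^ (j₀ + j)) x := by
    intro j
    rw [edist_eq_enorm_sub]
    have hp : 0 < R * (1 / 2) ^ (j₀ + j) := by positivity
    have h2 : R * (1 / 2) ^ (j₀ + (j + 1)) = R * (1 / 2) ^ (j₀ + j) / 2 := by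
      rw [← add_assoc, pow_succ]; ring
    exact (hk _ (by omega)).enorm_sub_le (hk _ (by omega)) hE hw hwE le_rfl
      (by linarith) (by linarith) (by linarith) hp hC hC
  have hDt : D ≠ ⊤ := ENNReal.ofReal_ne_top
  have hsum : ∑' j, D * oscAt E w (R * (1 / 2) ^ (j₀ + j)) x ≠ ⊤ := by
    rw [ENNReal.tsum_mul_left]
    exact ENNReal.mul_ne_top hDt (hosc.trans_lt hx).ne
  -- the averages at dyadic scales form a Cauchy sequence
  have hcauchy : CauchySeq a := cauchySeq_of_edist_le_of_tsum_ne_top _ hstep hsum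
  obtain ⟨b, hb⟩ := cauchySeq_tendsto_of_complete hcauchy
  have hbound : ∀ n, ‖a n‖ₑ ≤ ‖a 0‖ₑ + D * oscSum E w R x := by
    intro n
    have h1 : edist (a 0) (a n) ≤ D * oscSum E w R x := by
      refine (edist_le_range_sum_of_edist_le n fun {j} _ => hstep j).trans ?_
      refine (ENNReal.sum_le_tsum _).trans ?_
      rw [ENNReal.tsum_mul_left]
      gcongr
    calc ‖a n‖ₑ = ‖a 0 - (a 0 - a n)‖ₑ := by congr 1; abel
      _ ≤ ‖a 0‖ₑ + ‖a 0 - a n‖ₑ := enorm_sub_le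
      _ ≤ _ := by rw [← edist_eq_enorm_sub]; gcongr
  refine ⟨b, ?_, ?_, ?_⟩
  · intro C' ρ k' hC' hk' hρ
    -- compare with the reference average at the next dyadic scale
    have hρ0 : ∀ᶠ i in atTop, 0 < ρ i ∧ ρ i < R * (1 / 2) ^ (j₀ + 2) := by
      have := hρ (Ioo_mem_nhdsGT (by positivity : (0 : ℝ) < R * (1 / 2) ^ (j₀ + 2)))
      exact this
    rw [EMetric.tendsto_nhds]
    intro ε hε
    have hosc0 : Tendsto (fun j => ENNReal.ofReal (C' * C * 16 ^ d) *
        oscAt E w (R * (1 / 2) ^ j) x) atTop (𝓝 0) := by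
      have h1 : Tendsto (fun j => oscAt E w (R * (1 / 2) ^ j) x) atTop (𝓝 0) :=
        ENNReal.tendsto_atTop_zero_of_tsum_ne_top hx.ne
      simpa using ENNReal.Tendsto.const_mul h1 (Or.inr ENNReal.ofReal_ne_top)
    have hhalf : (0 : ℝ≥0∞) < ε / 2 := ENNReal.half_pos hε.ne'
    obtain ⟨J, hJ⟩ := eventually_atTop.1
      ((hosc0.eventually_lt_const hhalf).and (EMetric.tendsto_nhds.1 hb _ hhalf))
    have hρJ : ∀ᶠ i in atTop, ρ i < R * (1 / 2) ^ (j₀ + J + 2) := by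
      have := hρ (Ioo_mem_nhdsGT (by positivity : (0 : ℝ) < R * (1 / 2) ^ (j₀ + J + 2)))
      filter_upwards [this] with i hi using hi.2
    filter_upwards [hk', hρ0, hρJ] with i hki hρi hρJi
    have hRi : ρ i ≤ R := by
      refine hρi.2.le.trans ?_
      exact mul_le_of_le_one_right hR.le (pow_le_one₀ (by norm_num) (by norm_num))
    obtain ⟨j, hj1, hj2⟩ := exists_half_pow_mem hR hρi.1 hRi
    have hjJ : j₀ + J ≤ j := by
      by_contra hlt
      have h3 : j + 1 ≤ j₀ + J := by omega
      have h4 : R * (1 / 2) ^ (j₀ + J) ≤ R * (1 / 2) ^ (j + 1) := by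
        refine mul_le_mul_of_nonneg_left ?_ hR.le
        exact pow_le_pow_of_le_one (by norm_num) (by norm_num) h3
      have h5 : R * (1 / 2) ^ (j₀ + J + 2) = R * (1 / 2) ^ (j₀ + J) / 4 := by
        rw [pow_add]; ring
      have h6 : R * (1 / 2) ^ (j + 1) = R * (1 / 2) ^ j / 2 := by
        rw [pow_succ]; ring
      have : 0 < R * (1 / 2) ^ j := by positivity
      linarith
    obtain ⟨n, rfl⟩ : ∃ n, j = j₀ + n := ⟨j - j₀, by omega⟩
    have h1 := hki.enorm_sub_le (hk (j₀ + n) (by omega)) hE hw hwE hj1 le_rfl hj2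
      (by linarith [show 0 < R * (1 / 2) ^ (j₀ + n) by positivity]) (by positivity) hC' hC
    calc edist (∫ y, k' i y • w y) b ≤ edist (∫ y, k' i y • w y) (a n) + edist (a n) b :=
          edist_triangle _ _ _
      _ < ε / 2 + ε / 2 := by
          refine ENNReal.add_lt_add ?_ (hJ n (by omega)).2
          rw [edist_eq_enorm_sub]
          exact h1.trans_lt (hJ (j₀ + n) (by omega)).1
      _ = ε := ENNReal.add_halves ε
  · have h2 : Tendsto (fun n => ‖a n‖ₑ) atTop (𝓝 ‖b‖ₑ) := (continuous_enorm.tendsto b).comp hb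
    exact le_of_tendsto' h2 hbound
  · intro j hj
    obtain ⟨n, rfl⟩ : ∃ n, j = j₀ + n := ⟨j - j₀, by omega⟩
    exact hbound n

end

/-! ### Polytopal sets -/

/-- The signed distance of `y` to the hyperplane with normal `ℓ.1` and offset `ℓ.2`. -/
def side (ℓ : Pt d × ℝ) (y : Pt d) : ℝ := inner ℝ ℓ.1 y - ℓ.2

theorem side_sub (ℓ : Pt d × ℝ) (y x : Pt d) : side ℓ y - side ℓ x = inner ℝ ℓ.1 (y - x) := by
  simp [side, inner_sub_right]

theorem continuous_side (ℓ : Pt d × ℝ) : Continuous (side ℓ) := by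
  unfold side; fun_prop

theorem mem_hyp_iff_side {ℓ : Pt d × ℝ} {y : Pt d} : y ∈ hyp ℓ.1 ℓ.2 ↔ side ℓ y = 0 := by
  simp [hyp, side, sub_eq_zero]

/-- Simplices are intersections of half-spaces. -/
theorem exists_side_simplex (hd : 1 ≤ d) (s : Affine.Simplex ℝ (Pt d) d) :
    ∃ N : Fin (d + 1) → Pt d × ℝ, (∀ i, ‖(N i).1‖ = 1) ∧
      convexHull ℝ (range s.points) = {x | ∀ i, 0 ≤ side (N i) x} ∧
      interior (convexHull ℝ (range s.points)) = {x | ∀ i, 0 < side (N i) x} := by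
  have htop : affineSpan ℝ (range s.points) = ⊤ := by
    rw [s.independent.affineSpan_eq_top_iff_card_eq_finrank_add_one]
    simp
  set b : AffineBasis (Fin (d + 1)) ℝ (Pt d) := ⟨s.points, s.independent, htop⟩ with hb
  have hbr : range s.points = range b := rfl
  have key : ∀ i, ∃ ℓ : Pt d × ℝ, ‖ℓ.1‖ = 1 ∧ ∃ a > 0, ∀ y, b.coord i y = a * side ℓ y := by
    intro i
    set f : Pt d →L[ℝ] ℝ := LinearMap.toContinuousLinearMap (b.coord i).linear with hf
    set v := (InnerProductSpace.toDual ℝ (Pt d)).symm f with hv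
    have hfv : ∀ y, inner ℝ v y = (b.coord i).linear y := fun y => by
      rw [hv, InnerProductSpace.toDual_symm_apply]; rfl
    have hcoord : ∀ y, b.coord i y = inner ℝ v y + b.coord i 0 := fun y => by
      rw [hfv]
      have := (b.coord i).map_vadd 0 y
      simpa using this
    have hv0 : v ≠ 0 := by
      intro h0
      have hne : ∃ j : Fin (d + 1), j ≠ i := by
        have : Nontrivial (Fin (d + 1)) := Fin.nontrivial_iff_two_le.2 (by omega)
        exact exists_ne i
      obtain ⟨j, hj⟩ := hne
      have h1 := hcoord (b i)
      have h2 := hcoord (b j)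
      rw [h0, inner_zero_left, zero_add] at h1 h2
      rw [b.coord_apply_eq] at h1
      rw [b.coord_apply_ne hj.symm] at h2
      linarith
    have hvp : 0 < ‖v‖ := norm_pos_iff.2 hv0
    refine ⟨(‖v‖⁻¹ • v, -(‖v‖⁻¹ * b.coord i 0)), ?_, ‖v‖, hvp, fun y => ?_⟩
    · simp [norm_smul, hvp.ne']
    · rw [hcoord, side, inner_smul_left]
      simp only [RCLike.conj_to_real]
      field_simp
      ring
  choose N hN a ha hNa using key
  refine ⟨N, hN, ?_, ?_⟩
  · rw [hbr, b.convexHull_eq_nonneg_coord]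
    ext x
    simp only [mem_ofPred_eq, hNa]
    exact forall_congr' fun i => mul_nonneg_iff_of_pos_left (ha i)
  · rw [hbr, b.interior_convexHull]
    ext x
    simp only [mem_ofPred_eq, hNa]
    exact forall_congr' fun i => mul_pos_iff_of_pos_left (ha i)

theorem isCompact_simplex (s : Affine.Simplex ℝ (Pt d) d) :
    IsCompact (convexHull ℝ (range s.points)) :=
  (finite_range _).isCompact_convexHull (𝕜 := ℝ)

/-- Membership in `U` only depends on the sides of the hyperplanes in `N`. -/
def SideDetermined (N : Set (Pt d × ℝ)) (U : Set (Pt d)) : Prop :=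
  ∀ y y', (∀ ℓ ∈ N, SignType.sign (side ℓ y) = SignType.sign (side ℓ y')) → y ∈ U → y' ∈ U

theorem SideDetermined.mono {N N' : Set (Pt d × ℝ)} {U : Set (Pt d)} (h : SideDetermined N U)
    (hN : N ⊆ N') : SideDetermined N' U := fun y y' hy => h y y' fun ℓ hℓ => hy ℓ (hN hℓ)

/-- A description of the polytopal set `T` by the finite set `N` of hyperplanes. -/
structure PolyDescr (T : Set (Pt d)) (N : Set (Pt d × ℝ)) (U : Set (Pt d)) : Prop where
  finite : N.Finite
  unit : ∀ ℓ ∈ N, ‖ℓ.1‖ = 1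
  compact : IsCompact U
  interior : T = interior U
  determined : SideDetermined N U

/-- The hyperplanes are those that carry the facets of the simplices. -/
theorem IsPolytopal.exists_polyDescr (hd : 1 ≤ d) {T : Set (Pt d)} (hT : IsPolytopal T) :
    ∃ N U, PolyDescr T N U := by
  obtain ⟨-, I, hI⟩ := hT
  choose N hN hN1 hN2 using exists_side_simplex (d := d) hd
  refine ⟨⋃ s ∈ I, range (N s), _, I.finite_toSet.biUnion fun s _ => finite_range _, ?_,
    I.finite_toSet.isCompact_biUnion fun s _ => isCompact_simplex s, hI, ?_⟩
  · intro ℓ hℓ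
    simp only [mem_iUnion, mem_range] at hℓ
    obtain ⟨s, -, i, rfl⟩ := hℓ
    exact hN s i
  · intro y y' h hy
    simp only [mem_iUnion] at hy ⊢
    obtain ⟨s, hs, hys⟩ := hy
    refine ⟨s, hs, ?_⟩
    rw [hN1, mem_ofPred_eq] at hys ⊢
    intro i
    have h1 := h (N s i) (by simp only [mem_iUnion, mem_range]; exact ⟨s, hs, i, rfl⟩)
    rw [← sign_nonneg_iff, ← h1, sign_nonneg_iff]
    exact hys i

theorem IsPolytopal.isOpen {T : Set (Pt d)} (hT : IsPolytopal T) : IsOpen T := by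
  obtain ⟨-, I, hI⟩ := hT
  rw [hI]; exact isOpen_interior

theorem IsPolytopal.isBounded {T : Set (Pt d)} (hT : IsPolytopal T) : Bornology.IsBounded T := by
  obtain ⟨-, I, hI⟩ := hT
  rw [hI]
  exact (I.finite_toSet.isCompact_biUnion fun s _ => isCompact_simplex s).isBounded.subset
    interior_subset

/-- Polytopal sets have no slits. -/
theorem IsPolytopal.interior_closure {T : Set (Pt d)} (hT : IsPolytopal T) :
    interior (closure T) = T := by
  have hTo := hT.isOpen
  obtain ⟨-, I, hI⟩ := hT
  refine subset_antisymm ?_ (interior_maximal subset_closure hTo)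
  have hc : IsClosed (⋃ s ∈ I, convexHull ℝ (range s.points)) :=
    (I.finite_toSet.isCompact_biUnion fun s _ => isCompact_simplex s).isClosed
  conv_rhs => rw [hI]
  refine interior_mono ?_
  rw [hI]
  exact closure_minimal interior_subset hc

/-- `T` is a half-ball near `x`, with outward normal `n`, and the larger set `Ω` is a ball or the
same half-ball. -/
structure IsFlatAt (T Ω : Set (Pt d)) (x n : Pt d) (r : ℝ) : Prop where
  unit : ‖n‖ = 1
  pos : 0 < r
  half : T ∩ Metric.ball x r = {y ∈ Metric.ball x r | inner ℝ n (y - x) < 0}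
  outer : Metric.ball x r ⊆ Ω ∨
    Ω ∩ Metric.ball x r = {y ∈ Metric.ball x r | inner ℝ n (y - x) < 0}

/-- The points that lie on two transversal hyperplanes. -/
def edgeSet (N : Set (Pt d × ℝ)) : Set (Pt d) :=
  {x | ∃ ℓ ∈ N, ∃ ℓ' ∈ N, ℓ'.1 ≠ ℓ.1 ∧ ℓ'.1 ≠ -ℓ.1 ∧ side ℓ x = 0 ∧ side ℓ' x = 0}

theorem half_ball_eq_of_subset {T : Set (Pt d)} {x n : Pt d} {r r' : ℝ} (hr : r' ≤ r)
    (h : T ∩ Metric.ball x r = {y ∈ Metric.ball x r | inner ℝ n (y - x) < 0}) :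
    T ∩ Metric.ball x r' = {y ∈ Metric.ball x r' | inner ℝ n (y - x) < 0} := by
  ext y
  constructor
  · rintro ⟨h1, h2⟩
    have : y ∈ T ∩ Metric.ball x r := ⟨h1, Metric.ball_subset_ball hr h2⟩
    rw [h] at this
    exact ⟨h2, this.2⟩
  · rintro ⟨h1, h2⟩
    have : y ∈ {y ∈ Metric.ball x r | inner ℝ n (y - x) < 0} :=
      ⟨Metric.ball_subset_ball hr h1, h2⟩
    rw [← h] at this
    exact ⟨this.1, h1⟩

/-- Points of an open set can be moved off a hyperplane, to a prescribed side. -/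
theorem exists_mem_ball_inner {x n : Pt d} (hn : ‖n‖ = 1) {r : ℝ} {y : Pt d}
    (hy : y ∈ Metric.ball x r) {V : Set (Pt d)} (hV : V ∈ 𝓝 y) (a : ℝ) (ha : a = 1 ∨ a = -1) :
    ∃ z ∈ V ∩ Metric.ball x r, 0 < a * (inner ℝ n (z - x) - inner ℝ n (y - x)) := by
  have hc : Tendsto (fun t : ℝ => y + (t * a) • n) (𝓝[>] 0) (𝓝 y) := by
    have : Continuous fun t : ℝ => y + (t * a) • n := by fun_prop
    have h := this.tendsto 0
    simp only [zero_mul, zero_smul, add_zero] at h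
    exact h.mono_left nhdsWithin_le_nhds
  have h1 := hc (inter_mem hV (Metric.isOpen_ball.mem_nhds hy))
  obtain ⟨t, ht, ht0⟩ := ((show ∀ᶠ t in 𝓝[>] (0 : ℝ), y + (t * a) • n ∈ V ∩ Metric.ball x r from h1).and
    self_mem_nhdsWithin).exists
  refine ⟨_, ht, ?_⟩
  have : inner ℝ n (y + (t * a) • n - x) - inner ℝ n (y - x) = t * a := by
    rw [← inner_sub_right]
    simp [inner_smul_right, hn]
  rw [this]
  have ht0' : 0 < t := ht0
  rcases ha with rfl | rfl <;> simpa using ht0'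

/-- A boundary point that does not lie on two transversal hyperplanes is flat: near it, membership
only depends on the side of one hyperplane, both sides cannot belong to the set, and one of them
does. -/
theorem PolyDescr.exists_half_ball {T U : Set (Pt d)} {N : Set (Pt d × ℝ)} (h : PolyDescr T N U)
    {x : Pt d} (hx : x ∈ frontier T) (hxe : x ∉ edgeSet N) :
    ∃ ℓ ∈ N, side ℓ x = 0 ∧ ∃ n, (n = ℓ.1 ∨ n = -ℓ.1) ∧ ∃ r > 0,
      T ∩ Metric.ball x r = {y ∈ Metric.ball x r | inner ℝ n (y - x) < 0} := by
  have hTo : IsOpen T := by rw [h.interior]; exact isOpen_interior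
  have hTU : T ⊆ U := by rw [h.interior]; exact interior_subset
  have hxT : x ∉ T := by
    rw [frontier, hTo.interior_eq] at hx; exact hx.2
  have hxc : x ∈ closure T := hx.1
  -- near `x`, only the hyperplanes through `x` matter
  have hnear : ∀ᶠ y in 𝓝 x, ∀ ℓ ∈ N, side ℓ x ≠ 0 →
      SignType.sign (side ℓ y) = SignType.sign (side ℓ x) := by
    rw [Filter.eventually_all_finite h.finite]
    intro ℓ _
    by_cases h0 : side ℓ x = 0
    · simp [h0]
    · rcases lt_or_gt_of_ne h0 with h1 | h1
      · filter_upwards [(continuous_side ℓ).continuousAt.eventually_lt_const h1] with y hy _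
        rw [sign_neg hy, sign_neg h1]
      · filter_upwards [(continuous_side ℓ).continuousAt.eventually_const_lt h1] with y hy _
        rw [sign_pos hy, sign_pos h1]
  obtain ⟨r, hr, hball⟩ := Metric.eventually_nhds_iff_ball.1 hnear
  obtain ⟨y₀, hy₀T, hy₀⟩ : (T ∩ Metric.ball x r).Nonempty := by
    rw [inter_comm]
    exact mem_closure_iff.1 hxc _ Metric.isOpen_ball (Metric.mem_ball_self hr)
  -- if no hyperplane passes through `x`, then `x` is an interior point
  have hex : ∃ ℓ ∈ N, side ℓ x = 0 := by
    by_contra hno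
    push Not at hno
    refine hxT ?_
    rw [h.interior, mem_interior]
    refine ⟨Metric.ball x r, fun y hy => ?_, Metric.isOpen_ball, Metric.mem_ball_self hr⟩
    refine h.determined y₀ y (fun ℓ hℓ => ?_) (hTU hy₀T)
    rw [hball y₀ hy₀ ℓ hℓ (hno ℓ hℓ), hball y hy ℓ hℓ (hno ℓ hℓ)]
  obtain ⟨ℓ, hℓ, hℓx⟩ := hex
  have hn1 := h.unit ℓ hℓ
  have hside : ∀ y, side ℓ y = inner ℝ ℓ.1 (y - x) := fun y => by
    rw [← side_sub, hℓx, sub_zero]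
  -- all the hyperplanes through `x` coincide, because `x` is not on an edge
  have hdet : ∀ y ∈ Metric.ball x r, ∀ y' ∈ Metric.ball x r,
      SignType.sign (side ℓ y) = SignType.sign (side ℓ y') → y ∈ U → y' ∈ U := by
    intro y hy y' hy' hs
    refine h.determined y y' fun ℓ' hℓ' => ?_
    by_cases h0 : side ℓ' x = 0
    · have h2 : ℓ'.1 = ℓ.1 ∨ ℓ'.1 = -ℓ.1 := by
        by_contra hno
        push Not at hno
        exact hxe ⟨ℓ, hℓ, ℓ', hℓ', hno.1, hno.2, hℓx, h0⟩
      have hside' : ∀ y, side ℓ' y = inner ℝ ℓ'.1 (y - x) := fun y => by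
        rw [← side_sub, h0, sub_zero]
      rw [hside', hside']
      rw [hside, hside] at hs
      rcases h2 with h2 | h2
      · rw [h2, hs]
      · rw [h2, inner_neg_left, inner_neg_left, Left.sign_neg, Left.sign_neg, hs]
    · rw [hball y hy ℓ' hℓ' h0, hball y' hy' ℓ' hℓ' h0]
  obtain ⟨y₁, ⟨hy₁T, hy₁⟩, hy₁0⟩ : ∃ y₁ ∈ T ∩ Metric.ball x r, inner ℝ ℓ.1 (y₁ - x) ≠ 0 := by
    by_cases h0 : inner ℝ ℓ.1 (y₀ - x) = 0
    · obtain ⟨z, hz, hz0⟩ := exists_mem_ball_inner hn1 hy₀ (hTo.mem_nhds hy₀T) 1 (Or.inl rfl)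
      refine ⟨z, hz, ?_⟩
      rw [h0] at hz0
      intro h1
      simp [h1] at hz0
    · exact ⟨y₀, ⟨hy₀T, hy₀⟩, h0⟩
  -- `n` points away from a point of `T`
  obtain ⟨n, hn, hny₁⟩ : ∃ n, (n = ℓ.1 ∨ n = -ℓ.1) ∧ inner ℝ n (y₁ - x) < 0 := by
    rcases lt_or_gt_of_ne hy₁0 with h1 | h1
    · exact ⟨ℓ.1, Or.inl rfl, h1⟩
    · exact ⟨-ℓ.1, Or.inr rfl, by rw [inner_neg_left]; linarith⟩
  have hnn : ‖n‖ = 1 := by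
    rcases hn with rfl | rfl
    · exact hn1
    · rwa [norm_neg]
  have hdet' : ∀ y ∈ Metric.ball x r, ∀ y' ∈ Metric.ball x r,
      SignType.sign (inner ℝ n (y - x)) = SignType.sign (inner ℝ n (y' - x)) → y ∈ U → y' ∈ U := by
    intro y hy y' hy' hs
    refine hdet y hy y' hy' ?_
    rw [hside, hside]
    rcases hn with rfl | rfl
    · exact hs
    · rw [inner_neg_left, inner_neg_left, Left.sign_neg, Left.sign_neg, neg_inj] at hs
      exact hs
  have hneg : ∀ y ∈ Metric.ball x r, inner ℝ n (y - x) < 0 → y ∈ U := fun y hy h1 =>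
    hdet' y₁ hy₁ y hy (by rw [sign_neg hny₁, sign_neg h1]) (hTU hy₁T)
  -- if `U` also met the other side, it would contain the two open sides, hence the ball, being
  -- closed, and `x` would be an interior point
  have hpos : ∀ y ∈ Metric.ball x r, 0 < inner ℝ n (y - x) → y ∉ U := by
    intro y hy h1 hyU
    refine hxT ?_
    rw [h.interior, mem_interior]
    refine ⟨Metric.ball x r, fun z hz => ?_, Metric.isOpen_ball, Metric.mem_ball_self hr⟩
    rcases lt_trichotomy (inner ℝ n (z - x)) 0 with h2 | h2 | h2
    · exact hneg z hz h2
    · by_contra hzU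
      obtain ⟨z', hz', hz'0⟩ := exists_mem_ball_inner hnn hz
        (h.compact.isClosed.isOpen_compl.mem_nhds hzU) (-1) (Or.inr rfl)
      exact hz'.1 (hneg z' hz'.2 (by linarith))
    · exact hdet' y hy z hz (by rw [sign_pos h1, sign_pos h2]) hyU
  refine ⟨ℓ, hℓ, hℓx, n, hn, r, hr, ?_⟩
  ext y
  constructor
  · rintro ⟨h1, h2⟩
    refine ⟨h2, ?_⟩
    by_contra h3
    rw [not_lt] at h3
    obtain ⟨z, hz, hz0⟩ := exists_mem_ball_inner hnn h2 (hTo.mem_nhds h1) 1 (Or.inl rfl)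
    exact hpos z hz.2 (by linarith) (hTU hz.1)
  · rintro ⟨h1, h2⟩
    refine ⟨?_, h1⟩
    rw [h.interior, mem_interior]
    refine ⟨{y ∈ Metric.ball x r | inner ℝ n (y - x) < 0}, fun z hz => hneg z hz.1 hz.2, ?_,
      h1, h2⟩
    exact Metric.isOpen_ball.inter
      (isOpen_lt (f := fun y => inner ℝ n (y - x)) (by fun_prop) continuous_const)

/-- Two polytopal sets, one in the other, are flat at all boundary points of the smaller one, but
those on two of finitely many hyperplanes. -/
theorem exists_isFlatAt (hd : 1 ≤ d) {T Ω : Set (Pt d)} (hT : IsPolytopal T)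
    (hΩ : IsPolytopal Ω) (hTΩ : T ⊆ Ω) :
    ∃ N : Set (Pt d × ℝ), N.Finite ∧ (∀ ℓ ∈ N, ‖ℓ.1‖ = 1) ∧
      ∀ x ∈ frontier T, x ∉ edgeSet N →
        ∃ ℓ ∈ N, side ℓ x = 0 ∧ ∃ n, (n = ℓ.1 ∨ n = -ℓ.1) ∧ ∃ r, IsFlatAt T Ω x n r := by
  obtain ⟨N₁, U₁, h₁⟩ := hT.exists_polyDescr hd
  obtain ⟨N₂, U₂, h₂⟩ := hΩ.exists_polyDescr hd
  have hfin : (N₁ ∪ N₂).Finite := h₁.finite.union h₂.finite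
  have hunit : ∀ ℓ ∈ N₁ ∪ N₂, ‖ℓ.1‖ = 1 := fun ℓ hℓ => hℓ.elim (h₁.unit ℓ) (h₂.unit ℓ)
  have h₁' : PolyDescr T (N₁ ∪ N₂) U₁ :=
    ⟨hfin, hunit, h₁.compact, h₁.interior, h₁.determined.mono subset_union_left⟩
  have h₂' : PolyDescr Ω (N₁ ∪ N₂) U₂ :=
    ⟨hfin, hunit, h₂.compact, h₂.interior, h₂.determined.mono subset_union_right⟩
  refine ⟨N₁ ∪ N₂, hfin, hunit, fun x hx hxe => ?_⟩
  obtain ⟨ℓ, hℓ, hℓx, n, hn, r, hr, hTr⟩ := h₁'.exists_half_ball hx hxe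
  have hnn : ‖n‖ = 1 := by
    rcases hn with rfl | rfl
    · exact hunit ℓ hℓ
    · rw [norm_neg]; exact hunit ℓ hℓ
  refine ⟨ℓ, hℓ, hℓx, n, hn, ?_⟩
  by_cases hxΩ : x ∈ Ω
  · obtain ⟨r', hr', hb⟩ := Metric.isOpen_iff.1 hΩ.isOpen x hxΩ
    exact ⟨min r r', hnn, lt_min hr hr', half_ball_eq_of_subset (min_le_left _ _) hTr,
      Or.inl ((Metric.ball_subset_ball (min_le_right _ _)).trans hb)⟩
  · have hxf : x ∈ frontier Ω := ⟨closure_mono hTΩ hx.1, by rwa [hΩ.isOpen.interior_eq]⟩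
    obtain ⟨ℓ', hℓ', hℓ'x, n', hn', r', hr', hΩr⟩ := h₂'.exists_half_ball hxf hxe
    have hnn' : n' = n ∨ n' = -n := by
      have h3 : ℓ'.1 = ℓ.1 ∨ ℓ'.1 = -ℓ.1 := by
        by_contra hno
        push Not at hno
        exact hxe ⟨ℓ, hℓ, ℓ', hℓ', hno.1, hno.2, hℓx, hℓ'x⟩
      rcases hn with rfl | rfl <;> rcases hn' with rfl | rfl <;> rcases h3 with h3 | h3 <;>
        simp [h3]
    have hr0 : 0 < min r r' := lt_min hr hr'
    have e1 := half_ball_eq_of_subset (min_le_left r r') hTr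
    have e2 := half_ball_eq_of_subset (min_le_right r r') hΩr
    rcases hnn' with rfl | rfl
    · exact ⟨min r r', hnn, hr0, e1, Or.inr e2⟩
    -- the two half-balls cannot be opposite, since `T ⊆ Ω`
    · exfalso
      obtain ⟨z, hz, hz0⟩ := exists_mem_ball_inner hnn (Metric.mem_ball_self hr0 : x ∈ _)
        univ_mem (-1) (Or.inr rfl)
      simp only [sub_self, inner_zero_right, sub_zero] at hz0
      have h4 : z ∈ T ∩ Metric.ball x (min r r') := by
        rw [e1]; exact ⟨hz.2, by linarith⟩
      have h5 : z ∈ Ω ∩ Metric.ball x (min r r') := ⟨hTΩ h4.1, h4.2⟩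
      rw [e2] at h5
      have h6 := h5.2
      rw [inner_neg_left] at h6
      linarith

/-! ### Traces -/

theorem oscAt_norm_le (E : Set (Pt d)) (w : Pt d → Vc m) (ρ : ℝ) (x : Pt d) :
    oscAt E (fun y => ‖w y‖) ρ x ≤ oscAt E w ρ x := by
  unfold oscAt
  gcongr with y z
  rw [← ofReal_norm, ← ofReal_norm]
  exact ENNReal.ofReal_le_ofReal (abs_norm_sub_norm_le _ _)

theorem oscSum_norm_le (E : Set (Pt d)) (w : Pt d → Vc m) (R : ℝ) (x : Pt d) :
    oscSum E (fun y => ‖w y‖) R x ≤ oscSum E w R x :=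
  ENNReal.tsum_le_tsum fun _ => oscAt_norm_le _ _ _ _

theorem HasKernelLimit.mono {E E' : Set (Pt d)} {w : Pt d → Vc m} {x : Pt d} {b : Vc m}
    (h : HasKernelLimit E w x b) {δ : ℝ} (hδ : 0 < δ) (hE : Metric.ball x δ ∩ E' ⊆ E) :
    HasKernelLimit E' w x b := by
  intro C ρ k hC hk hρ
  refine h C ρ k hC ?_ hρ
  filter_upwards [hk, hρ (Ioo_mem_nhdsGT hδ)] with i hi hρi
  refine hi.mono ?_
  rintro y ⟨h1, h2⟩
  exact hE ⟨Metric.ball_subset_ball (show ρ i < δ from hρi.2).le h1, h2⟩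

theorem tendsto_half_pow {R : ℝ} (hR : 0 < R) :
    Tendsto (fun j : ℕ => R * (1 / 2 : ℝ) ^ j) atTop (𝓝[>] 0) := by
  refine tendsto_nhdsWithin_iff.2 ⟨?_, Eventually.of_forall fun j => ?_⟩
  · simpa using (tendsto_pow_atTop_nhds_zero_of_lt_one (by norm_num)
      (by norm_num : (1 / 2 : ℝ) < 1)).const_mul R
  · exact (by positivity : 0 < R * (1 / 2 : ℝ) ^ j)

/-- Kernels exist at all small scales, so that there is at most one limit. -/
theorem HasKernelLimit.unique {E : Set (Pt d)} {w : Pt d → Vc m} {x : Pt d} {b b' : Vc m}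
    (h : HasKernelLimit E w x b) (h' : HasKernelLimit E w x b') {R C : ℝ} (hR : 0 < R)
    (hC : 0 ≤ C) {k : ℕ → Pt d → ℝ} {j₀ : ℕ}
    (hk : ∀ j ≥ j₀, IsKernel E x (R * (1 / 2) ^ j) C (k j)) : b = b' := by
  have hev : ∀ᶠ j in atTop, IsKernel E x (R * (1 / 2) ^ j) C (k j) :=
    eventually_atTop.2 ⟨j₀, hk⟩
  exact tendsto_nhds_unique (h C _ k hC hev (tendsto_half_pow hR))
    (h' C _ k hC hev (tendsto_half_pow hR))

/-- The uniform weight on a part `A` of `E`. -/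
def unifKernel (A : Set (Pt d)) (y : Pt d) : ℝ := A.indicator (fun _ => (volume.real A)⁻¹) y

theorem isKernel_unifKernel {A E : Set (Pt d)} {x : Pt d} {ρ C : ℝ} (hA : MeasurableSet A)
    (hAE : A ⊆ Metric.ball x ρ ∩ E) (hρ : 0 < ρ) (hC : 0 < C)
    (hvol : C⁻¹ * ρ ^ d ≤ volume.real A) : IsKernel E x ρ C (unifKernel A) := by
  have hpos : 0 < volume.real A := lt_of_lt_of_le (by positivity) hvol
  refine ⟨measurable_const.indicator hA, fun y => ?_, fun y hy => ?_, ?_⟩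
  · by_cases hy : y ∈ A
    · rw [unifKernel, indicator_of_mem hy, abs_of_pos (by positivity), inv_le_comm₀ hpos
        (by positivity), mul_inv, inv_inv]
      exact hvol
    · rw [unifKernel, indicator_of_notMem hy, abs_zero]
      positivity
  · by_contra h
    exact hy (indicator_of_notMem (fun h' => h (hAE h')) _)
  · have : volume A ≠ ⊤ := by
      intro h
      simp [Measure.real, h] at hpos
    simp only [unifKernel]
    rw [integral_indicator hA, setIntegral_const, smul_eq_mul, mul_inv_cancel₀ hpos.ne']

theorem integral_unifKernel_smul {A : Set (Pt d)} (hA : MeasurableSet A) (w : Pt d → Vc m) :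
    ∫ y, unifKernel A y • w y = ⨍ y in A, w y := by
  rw [setAverage_eq, ← integral_smul, ← integral_indicator hA]
  congr 1
  funext y
  by_cases hy : y ∈ A <;> simp [unifKernel, hy]

/-- The properties of the function `w` on which the trace theory rests. -/
structure HasTraceReg (Ω : Set (Pt d)) (w : Pt d → Vc m) (θ : ℝ) : Prop where
  meas : StronglyMeasurable w
  memLp : MemLp w 2 (volume.restrict Ω)
  half_lt : 1 / 2 < θ
  slob : ∀ E ⊆ Ω, IsOpen E → Convex ℝ E → slobodeckijSq E θ w < ⊤

theorem HasTraceReg.integrableOn {Ω E : Set (Pt d)} {w : Pt d → Vc m} {θ : ℝ}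
    (h : HasTraceReg Ω w θ) (hΩ : Bornology.IsBounded Ω) (hE : E ⊆ Ω) : IntegrableOn w E := by
  have : IsFiniteMeasure (volume.restrict Ω) :=
    ⟨by rw [Measure.restrict_apply_univ]; exact hΩ.measure_lt_top⟩
  exact IntegrableOn.mono_set (h.memLp.integrable (by norm_num)) hE

theorem HasTraceReg.ae_oscSum_lt_top (hd : 1 ≤ d) {Ω E : Set (Pt d)} {w : Pt d → Vc m} {θ : ℝ}
    (h : HasTraceReg Ω w θ) (hE : E ⊆ Ω) (hEo : IsOpen E) (hEc : Convex ℝ E)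
    {n : Pt d} (hn : ‖n‖ = 1) (c : ℝ) {R : ℝ} (hR : 0 < R) :
    ∀ᵐ x ∂(surf d).restrict (hyp n c), oscSum E w R x < ⊤ := by
  have : SFinite ((surf d).restrict (hyp n c)) := by
    rw [surf_restrict_hyp hn]; infer_instance
  exact Friedrichs.ae_oscSum_lt_top hd h.half_lt h.meas (h.slob E hE hEo hEc)
    (measure_ball_lt_top (μ := (volume : Measure (ℝ ∙ n)ᗮ)) (x := 0) (r := 1)).ne
    (fun y r hr => surf_hyp_ball_le hn y hr) hR

theorem HasTraceReg.lintegral_sq_oscSum_lt_top (hd : 1 ≤ d) {Ω E : Set (Pt d)} {w : Pt d → Vc m}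
    {θ : ℝ} (h : HasTraceReg Ω w θ) (hE : E ⊆ Ω) (hEo : IsOpen E) (hEc : Convex ℝ E)
    {n : Pt d} (hn : ‖n‖ = 1) (c : ℝ) {R : ℝ} (hR : 0 < R) :
    ∫⁻ x in hyp n c, oscSum E w R x ^ 2 ∂surf d < ⊤ := by
  have : SFinite ((surf d).restrict (hyp n c)) := by
    rw [surf_restrict_hyp hn]; infer_instance
  exact Friedrichs.lintegral_sq_oscSum_lt_top hd h.half_lt h.meas (h.slob E hE hEo hEc)
    (measure_ball_lt_top (μ := (volume : Measure (ℝ ∙ n)ᗮ)) (x := 0) (r := 1)).ne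
    (fun y r hr => surf_hyp_ball_le hn y hr) hR

theorem convex_half_ball (x n : Pt d) (r : ℝ) :
    Convex ℝ {y ∈ Metric.ball x r | inner ℝ n (y - x) < 0} := by
  have h1 : Convex ℝ {y | inner ℝ n (y - x) < 0} := by
    have : {y | inner ℝ n (y - x) < 0} = {y | inner ℝ n y < inner ℝ n x} := by
      ext y; simp [inner_sub_right]
    rw [this]
    exact convex_halfSpace_lt (innerₛₗ ℝ n).isLinear _
  exact (convex_ball x r).inter h1

theorem isOpen_half_ball (x n : Pt d) (r : ℝ) :
    IsOpen {y ∈ Metric.ball x r | inner ℝ n (y - x) < 0} :=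
  Metric.isOpen_ball.inter (isOpen_lt (f := fun y => inner ℝ n (y - x)) (by fun_prop)
    continuous_const)

theorem IsFlatAt.convex_outer {T Ω : Set (Pt d)} {x n : Pt d} {r : ℝ} (h : IsFlatAt T Ω x n r) :
    Convex ℝ (Ω ∩ Metric.ball x r) := by
  rcases h.outer with h1 | h1
  · rw [inter_eq_self_of_subset_right h1]; exact convex_ball x r
  · rw [h1]; exact convex_half_ball x n r

theorem IsFlatAt.isOpen_outer {T Ω : Set (Pt d)} {x n : Pt d} {r : ℝ} (h : IsFlatAt T Ω x n r) :
    IsOpen (Ω ∩ Metric.ball x r) := by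
  rcases h.outer with h1 | h1
  · rw [inter_eq_self_of_subset_right h1]; exact Metric.isOpen_ball
  · rw [h1]; exact isOpen_half_ball x n r

theorem IsFlatAt.mem_of_neg {T Ω : Set (Pt d)} {x n : Pt d} {r : ℝ} (h : IsFlatAt T Ω x n r)
    {y : Pt d} (hy : y ∈ Metric.ball x r) (hn : inner ℝ n (y - x) < 0) : y ∈ T ∧ y ∈ Ω := by
  have h1 : y ∈ {y ∈ Metric.ball x r | inner ℝ n (y - x) < 0} := ⟨hy, hn⟩
  refine ⟨(h.half ▸ h1 : y ∈ T ∩ Metric.ball x r).1, ?_⟩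
  rcases h.outer with h2 | h2
  · exact h2 hy
  · exact (h2 ▸ h1 : y ∈ Ω ∩ Metric.ball x r).1

theorem IsFlatAt.inner_of_mem {T Ω : Set (Pt d)} {x n : Pt d} {r : ℝ} (h : IsFlatAt T Ω x n r)
    {y : Pt d} (hy : y ∈ Metric.ball x r) (hT : y ∈ T) : inner ℝ n (y - x) < 0 := by
  have h1 : y ∈ T ∩ Metric.ball x r := ⟨hT, hy⟩
  rw [h.half] at h1
  exact h1.2

/-- Near a flat point, the boundary lies on the hyperplane. -/
theorem IsFlatAt.frontier_subset {T Ω : Set (Pt d)} {x n : Pt d} {r : ℝ} (h : IsFlatAt T Ω x n r)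
    (hT : IsOpen T) {y : Pt d} (hy : y ∈ Metric.ball x r) (hyT : y ∈ frontier T) :
    inner ℝ n (y - x) = 0 := by
  rw [frontier, hT.interior_eq] at hyT
  rcases lt_trichotomy (inner ℝ n (y - x)) 0 with h1 | h1 | h1
  · exact absurd (h.mem_of_neg hy h1).1 hyT.2
  · exact h1
  · exfalso
    have ho : IsOpen {y ∈ Metric.ball x r | 0 < inner ℝ n (y - x)} :=
      Metric.isOpen_ball.inter (isOpen_lt (g := fun y => inner ℝ n (y - x)) continuous_const
        (by fun_prop))
    obtain ⟨z, hz, hzT⟩ := mem_closure_iff.1 hyT.1 _ ho ⟨hy, h1⟩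
    exact absurd (h.inner_of_mem hz.1 hzT) (not_lt.2 hz.2.le)

/-- Near a flat point, the averages over balls that define the trace are averages of comparable
weight. -/
theorem IsFlatAt.isKernel_ball {T Ω : Set (Pt d)} {x₀ n : Pt d} {r : ℝ}
    (h : IsFlatAt T Ω x₀ n r) (hΩ : MeasurableSet Ω) {x : Pt d} (hx : x ∈ Metric.ball x₀ (r / 2))
    (hxn : inner ℝ n (x - x₀) = 0) {ρ : ℝ} (hρ : 0 < ρ) (hρr : ρ ≤ r / 2) :
    IsKernel (Ω ∩ Metric.ball x₀ r) x ρ (2 ^ d * (volume.real (Metric.ball (0 : Pt d) 1))⁻¹)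
      (unifKernel (Metric.ball x ρ ∩ Ω)) := by
  have hω : 0 < volume.real (Metric.ball (0 : Pt d) 1) :=
    ENNReal.toReal_pos (Metric.isOpen_ball.measure_pos _ ⟨0, by simp⟩).ne' measure_ball_lt_top.ne
  have hball : Metric.ball x ρ ⊆ Metric.ball x₀ r := by
    refine Metric.ball_subset_ball' ?_
    rw [Metric.mem_ball] at hx
    linarith
  refine isKernel_unifKernel (Metric.isOpen_ball.measurableSet.inter hΩ)
    (fun y hy => ⟨hy.1, hy.2, hball hy.1⟩) hρ (by positivity) ?_
  -- the set contains a ball of half the radius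
  have hsub : Metric.ball (x - (ρ / 2) • n) (ρ / 2) ⊆ Metric.ball x ρ ∩ Ω := by
    intro y hy
    have h1 : y ∈ Metric.ball x ρ := by
      refine Metric.ball_subset_ball' ?_ hy
      rw [dist_eq_norm, sub_sub_cancel_left, norm_neg, norm_smul, h.unit, mul_one,
        Real.norm_of_nonneg (by positivity)]
      linarith
    refine ⟨h1, (h.mem_of_neg (hball h1) ?_).2⟩
    have h2 : y - x₀ = (y - (x - (ρ / 2) • n)) + (x - x₀) - (ρ / 2) • n := by abel
    rw [h2, inner_sub_right, inner_add_right, hxn, inner_smul_right, real_inner_self_eq_norm_sq,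
      h.unit]
    have h3 := real_inner_le_norm n (y - (x - (ρ / 2) • n))
    rw [h.unit, one_mul] at h3
    rw [Metric.mem_ball, dist_eq_norm] at hy
    linarith
  have h4 : volume.real (Metric.ball (x - (ρ / 2) • n) (ρ / 2)) =
      (ρ / 2) ^ d * volume.real (Metric.ball (0 : Pt d) 1) := by
    rw [Measure.real, Measure.addHaar_ball_of_pos _ _ (by positivity), ENNReal.toReal_mul,
      ENNReal.toReal_ofReal (by positivity), finrank_euclideanSpace_fin]
    rfl
  have h5 : volume.real (Metric.ball (x - (ρ / 2) • n) (ρ / 2)) ≤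
      volume.real (Metric.ball x ρ ∩ Ω) :=
    measureReal_mono hsub ((measure_mono inter_subset_left).trans_lt measure_ball_lt_top).ne
  rw [h4] at h5
  refine le_trans (le_of_eq ?_) h5
  rw [mul_inv, inv_inv, div_pow]
  ring

/-- At almost all points near a flat boundary point, `w` has a trace. -/
theorem HasTraceReg.ae_trace_of_isFlatAt (hd : 1 ≤ d) {T Ω : Set (Pt d)} {w : Pt d → Vc m} {θ : ℝ}
    (h : HasTraceReg Ω w θ) (hΩ : IsOpen Ω) (hΩb : Bornology.IsBounded Ω) {x₀ n : Pt d} {r : ℝ}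
    (hf : IsFlatAt T Ω x₀ n r) :
    ∀ᵐ x ∂(surf d).restrict (hyp n (inner ℝ n x₀)), x ∈ Metric.ball x₀ (r / 2) →
      HasKernelLimit Ω w x (trace Ω w x) ∧
      Tendsto (fun ρ => ⨍ y in Metric.ball x ρ ∩ Ω, w y) (𝓝[>] 0) (𝓝 (trace Ω w x)) := by
  have hω : 0 < volume.real (Metric.ball (0 : Pt d) 1) :=
    ENNReal.toReal_pos (Metric.isOpen_ball.measure_pos _ ⟨0, by simp⟩).ne' measure_ball_lt_top.ne
  have hrp := hf.pos
  filter_upwards [h.ae_oscSum_lt_top hd inter_subset_left hf.isOpen_outer hf.convex_outer hf.unit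
    (inner ℝ n x₀) hf.pos, ae_restrict_mem (isClosed_hyp _ _).measurableSet] with x hosc hxh hx
  have hxn : inner ℝ n (x - x₀) = 0 := by
    rw [inner_sub_right, sub_eq_zero]; exact hxh
  have hk : ∀ j ≥ 1, IsKernel (Ω ∩ Metric.ball x₀ r) x (r * (1 / 2) ^ j)
      (2 ^ d * (volume.real (Metric.ball (0 : Pt d) 1))⁻¹)
      (unifKernel (Metric.ball x (r * (1 / 2) ^ j) ∩ Ω)) := fun j hj => by
    refine hf.isKernel_ball hΩ.measurableSet hx hxn (by positivity) ?_
    have : (1 / 2 : ℝ) ^ j ≤ 1 / 2 := pow_le_of_le_one (by norm_num) (by norm_num) (by omega)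
    nlinarith
  obtain ⟨b, hb, -⟩ := exists_hasKernelLimit hf.isOpen_outer.measurableSet h.meas
    (h.integrableOn hΩb inter_subset_left) hf.pos hosc (by positivity) hk
  have ht : Tendsto (fun ρ => ⨍ y in Metric.ball x ρ ∩ Ω, w y) (𝓝[>] 0) (𝓝 b) := by
    refine tendsto_of_seq_tendsto fun u hu => ?_
    have h2 : ∀ᶠ i in atTop, IsKernel (Ω ∩ Metric.ball x₀ r) x (u i)
        (2 ^ d * (volume.real (Metric.ball (0 : Pt d) 1))⁻¹)
        (unifKernel (Metric.ball x (u i) ∩ Ω)) := by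
      filter_upwards [hu (Ioo_mem_nhdsGT (half_pos hf.pos))] with i hi
      have hi' : u i ∈ Ioo 0 (r / 2) := hi
      exact hf.isKernel_ball hΩ.measurableSet hx hxn hi'.1 hi'.2.le
    have h3 := hb _ u _ (by positivity) h2 hu
    have h4 : Tendsto (fun i => ⨍ y in Metric.ball x (u i) ∩ Ω, w y) atTop (𝓝 b) := by
      simpa only [integral_unifKernel_smul
        (Metric.isOpen_ball.measurableSet.inter hΩ.measurableSet)] using h3
    exact h4
  have hbt : trace Ω w x = b := ht.limUnder_eq
  rw [hbt]
  refine ⟨hb.mono (half_pos hf.pos) ?_, ht⟩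
  rintro y ⟨h1, h2⟩
  refine ⟨h2, ?_⟩
  rw [Metric.mem_ball] at h1 hx ⊢
  linarith [dist_triangle y x x₀]

theorem surf_edgeSet {N : Set (Pt d × ℝ)} (hN : N.Finite) (hu : ∀ ℓ ∈ N, ‖ℓ.1‖ = 1) :
    surf d (edgeSet N) = 0 := by
  have : edgeSet N ⊆ ⋃ ℓ ∈ N, ⋃ ℓ' ∈ {ℓ' ∈ N | ℓ'.1 ≠ ℓ.1 ∧ ℓ'.1 ≠ -ℓ.1},
      hyp ℓ.1 ℓ.2 ∩ hyp ℓ'.1 ℓ'.2 := by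
    rintro x ⟨ℓ, hℓ, ℓ', hℓ', h1, h2, h3, h4⟩
    simp only [mem_iUnion]
    exact ⟨ℓ, hℓ, ℓ', ⟨hℓ', h1, h2⟩, mem_hyp_iff_side.2 h3, mem_hyp_iff_side.2 h4⟩
  refine measure_mono_null this ?_
  rw [measure_biUnion_null_iff hN.countable]
  intro ℓ hℓ
  rw [measure_biUnion_null_iff (hN.subset (sep_subset _ _)).countable]
  rintro ℓ' ⟨hℓ', h1, h2⟩
  exact surf_hyp_inter (hu ℓ hℓ) (hu ℓ' hℓ') h1 h2 _ _

/-- A property that holds almost everywhere near all flat boundary points holds almost everywhere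
on the boundary. -/
theorem ae_frontier_of_isFlatAt (hd : 1 ≤ d) {T Ω : Set (Pt d)} (hT : IsPolytopal T)
    (hΩ : IsPolytopal Ω) (hTΩ : T ⊆ Ω) {P : Pt d → Prop}
    (hP : ∀ x₀ ∈ frontier T, ∀ n r, IsFlatAt T Ω x₀ n r → ∃ δ > 0,
      ∀ᵐ x ∂(surf d).restrict (hyp n (inner ℝ n x₀)), x ∈ Metric.ball x₀ δ → x ∈ frontier T →
        P x) :
    ∀ᵐ x ∂(surf d).restrict (frontier T), P x := by
  obtain ⟨N, hN, hu, hflat⟩ := exists_isFlatAt hd hT hΩ hTΩ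
  rw [ae_restrict_iff' isClosed_frontier.measurableSet]
  have hnull : surf d {x ∈ frontier T | x ∉ edgeSet N ∧ ¬ P x} = 0 := by
    refine measure_null_of_locally_null _ ?_
    rintro x₀ ⟨hx₀, hx₀e, -⟩
    obtain ⟨ℓ, -, -, n, -, r, hf⟩ := hflat x₀ hx₀ hx₀e
    obtain ⟨δ, hδ, hae⟩ := hP x₀ hx₀ n r hf
    refine ⟨Metric.ball x₀ (min r δ) ∩ {x ∈ frontier T | x ∉ edgeSet N ∧ ¬ P x},
      inter_mem (mem_nhdsWithin_of_mem_nhds (Metric.ball_mem_nhds _ (lt_min hf.pos hδ)))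
        self_mem_nhdsWithin, ?_⟩
    rw [ae_restrict_iff' (isClosed_hyp _ _).measurableSet, ae_iff] at hae
    refine measure_mono_null ?_ hae
    rintro y ⟨hy, hyT, -, hyP⟩
    simp only [mem_ofPred_eq, Classical.not_imp]
    refine ⟨?_, Metric.ball_subset_ball (min_le_right _ _) hy, hyT, hyP⟩
    have := hf.frontier_subset hT.isOpen (Metric.ball_subset_ball (min_le_left _ _) hy) hyT
    rw [inner_sub_right, sub_eq_zero] at this
    exact this
  rw [ae_iff]
  refine measure_mono_null (t := edgeSet N ∪ {x ∈ frontier T | x ∉ edgeSet N ∧ ¬ P x}) ?_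
    (measure_union_null (surf_edgeSet hN hu) hnull)
  intro x hx
  simp only [mem_ofPred_eq, Classical.not_imp] at hx
  by_cases he : x ∈ edgeSet N
  · exact Or.inl he
  · exact Or.inr ⟨hx.1, he, hx.2⟩

/-- The trace exists almost everywhere on the boundary of a polytopal subset, as the limit of all
the averages. -/
theorem HasTraceReg.ae_trace (hd : 1 ≤ d) {T Ω : Set (Pt d)} {w : Pt d → Vc m} {θ : ℝ}
    (h : HasTraceReg Ω w θ) (hT : IsPolytopal T) (hΩ : IsPolytopal Ω) (hTΩ : T ⊆ Ω) :
    ∀ᵐ x ∂(surf d).restrict (frontier T), HasKernelLimit Ω w x (trace Ω w x) ∧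
      Tendsto (fun ρ => ⨍ y in Metric.ball x ρ ∩ Ω, w y) (𝓝[>] 0) (𝓝 (trace Ω w x)) := by
  refine ae_frontier_of_isFlatAt hd hT hΩ hTΩ fun x₀ _ n r hf => ⟨r / 2, half_pos hf.pos, ?_⟩
  filter_upwards [h.ae_trace_of_isFlatAt hd hΩ.isOpen hΩ.isBounded hf] with x hx h1 _
  exact hx h1

/-- A polytopal set contains finitely many convex cells whose closures cover its boundary. -/
theorem IsPolytopal.exists_cells {T : Set (Pt d)} (hT : IsPolytopal T) :
    ∃ 𝒮 : Set (Set (Pt d)), 𝒮.Finite ∧ (∀ E ∈ 𝒮, IsOpen E ∧ Convex ℝ E ∧ E.Nonempty ∧ E ⊆ T) ∧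
      frontier T ⊆ ⋃ E ∈ 𝒮, closure E := by
  obtain ⟨-, I, hI⟩ := hT
  set g : Affine.Simplex ℝ (Pt d) d → Set (Pt d) := fun s =>
    interior (convexHull ℝ (range s.points)) with hg
  have hne : ∀ s, (g s).Nonempty := fun s => by
    rw [hg]
    dsimp only
    rw [interior_convexHull_nonempty_iff_affineSpan_eq_top]
    exact s.independent.affineSpan_eq_top_iff_card_eq_finrank_add_one.2 (by simp)
  refine ⟨g '' I, I.finite_toSet.image g, ?_, ?_⟩
  · rintro _ ⟨s, hs, rfl⟩
    refine ⟨isOpen_interior, (convex_convexHull ℝ _).interior, hne s, ?_⟩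
    rw [hI]
    exact interior_mono (subset_biUnion_of_mem (u := fun s : Affine.Simplex ℝ (Pt d) d =>
      convexHull ℝ (range s.points)) hs)
  · have hc : IsClosed (⋃ s ∈ I, convexHull ℝ (range s.points)) :=
      (I.finite_toSet.isCompact_biUnion fun s _ => isCompact_simplex s).isClosed
    have h1 : frontier T ⊆ ⋃ s ∈ I, convexHull ℝ (range s.points) := by
      refine frontier_subset_closure.trans ?_
      rw [hI]
      exact closure_minimal interior_subset hc
    intro x hx
    have := h1 hx
    simp only [mem_iUnion] at this
    obtain ⟨s, hs, hxs⟩ := this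
    simp only [mem_iUnion]
    refine ⟨g s, ⟨s, hs, rfl⟩, ?_⟩
    rw [hg]
    dsimp only
    rw [(convex_convexHull ℝ _).closure_interior_eq_closure_of_nonempty_interior (hne s)]
    exact subset_closure hxs

/-- The homothetic copies of a convex cell, centred at a point of its closure, carry a sequence of
kernels that starts with the mean value on the whole cell. -/
theorem isKernel_homothety {E : Set (Pt d)} (hEo : IsOpen E) (hEc : Convex ℝ E)
    (hEn : E.Nonempty) {x : Pt d} (hx : x ∈ closure E) {D : ℝ} (hD : 0 < D)
    (hED : E ⊆ Metric.ball x D) (j : ℕ) :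
    IsKernel E x (D * (1 / 2) ^ j) (D ^ d * (volume.real E)⁻¹)
      (unifKernel (AffineMap.homothety x ((1 / 2 : ℝ) ^ j) '' E)) := by
  have hfin : volume E ≠ ⊤ := ((measure_mono hED).trans_lt measure_ball_lt_top).ne
  have hpos : 0 < volume.real E :=
    ENNReal.toReal_pos (hEo.measure_pos _ hEn).ne' hfin
  set t : ℝ := (1 / 2) ^ j with ht
  have ht0 : 0 < t := by positivity
  have ht1 : t ≤ 1 := pow_le_one₀ (by norm_num) (by norm_num)
  have hvol : volume.real (AffineMap.homothety x t '' E) = t ^ d * volume.real E := by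
    rw [Measure.real, Measure.addHaar_image_homothety, ENNReal.toReal_mul,
      finrank_euclideanSpace_fin, abs_of_pos (by positivity),
      ENNReal.toReal_ofReal (by positivity)]
    rfl
  refine isKernel_unifKernel ?_ ?_ (by positivity) (by positivity) ?_
  · exact (AffineMap.homothety_isOpenMap x t ht0.ne' E hEo).measurableSet
  · rintro _ ⟨y, hy, rfl⟩
    constructor
    · have := hED hy
      rw [Metric.mem_ball, dist_eq_norm] at this ⊢
      rw [AffineMap.homothety_apply, vsub_eq_sub, vadd_eq_add, add_sub_cancel_right, norm_smul,
        Real.norm_of_nonneg ht0.le, mul_comm]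
      exact mul_lt_mul_of_pos_right this ht0
    · rw [AffineMap.homothety_apply, vsub_eq_sub, vadd_eq_add]
      have h1 : t • (y - x) + x = (1 - t) • x + t • y := by
        rw [smul_sub, sub_smul, one_smul]; abel
      rw [h1]
      have := hEc.combo_closure_interior_mem_interior hx (by rwa [hEo.interior_eq])
        (a := 1 - t) (b := t) (by linarith) ht0 (by ring)
      rwa [hEo.interior_eq] at this
  · rw [hvol, mul_pow, mul_inv, inv_inv]
    refine le_of_eq ?_
    field_simp

/-- Where the trace exists and the oscillations are summable, the trace at a point in the closure
of a convex cell is bounded by the mean value on the cell and the oscillations. -/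
theorem HasTraceReg.enorm_trace_le {Ω E : Set (Pt d)} {w : Pt d → Vc m}
    {θ : ℝ} (h : HasTraceReg Ω w θ) (hΩb : Bornology.IsBounded Ω) (hE : E ⊆ Ω) (hEo : IsOpen E)
    (hEc : Convex ℝ E) (hEn : E.Nonempty) {D : ℝ} (hD : 0 < D) {x : Pt d} (hx : x ∈ closure E)
    (hED : E ⊆ Metric.ball x D) (ht : HasKernelLimit Ω w x (trace Ω w x))
    (hosc : oscSum E w D x < ⊤) :
    ‖trace Ω w x‖ₑ ≤ ‖⨍ y in E, w y‖ₑ + ENNReal.ofReal ((D ^ d * (volume.real E)⁻¹) *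
      (D ^ d * (volume.real E)⁻¹) * 16 ^ d) * oscSum E w D x := by
  have hk := isKernel_homothety hEo hEc hEn hx hD hED
  have hC : 0 ≤ D ^ d * (volume.real E)⁻¹ := by positivity
  obtain ⟨b, hb, hb1, -⟩ := exists_hasKernelLimit hEo.measurableSet h.meas
    (h.integrableOn hΩb hE) hD hosc hC (j₀ := 0) fun j _ => hk j
  have hbt : trace Ω w x = b :=
    (ht.mono zero_lt_one (inter_subset_right.trans hE)).unique hb hD hC (j₀ := 0) fun j _ => hk j
  have h0 : AffineMap.homothety x ((1 / 2 : ℝ) ^ 0) '' E = E := by simp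
  rw [h0, integral_unifKernel_smul hEo.measurableSet] at hb1
  rwa [hbt]

/-- The boundary of a polytopal set is contained in finitely many hyperplanes. -/
theorem IsPolytopal.frontier_subset_hyp (hd : 1 ≤ d) {T : Set (Pt d)} (hT : IsPolytopal T) :
    ∃ N : Set (Pt d × ℝ), N.Finite ∧ (∀ ℓ ∈ N, ‖ℓ.1‖ = 1) ∧
      frontier T ⊆ ⋃ ℓ ∈ N, hyp ℓ.1 ℓ.2 := by
  obtain ⟨N, hN, hu, hflat⟩ := exists_isFlatAt hd hT hT subset_rfl
  refine ⟨N, hN, hu, fun x hx => ?_⟩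
  simp only [mem_iUnion]
  by_cases he : x ∈ edgeSet N
  · obtain ⟨ℓ, hℓ, ℓ', hℓ', -, -, h3, -⟩ := he
    exact ⟨ℓ, hℓ, mem_hyp_iff_side.2 h3⟩
  · obtain ⟨ℓ, hℓ, h0, -⟩ := hflat x hx he
    exact ⟨ℓ, hℓ, mem_hyp_iff_side.2 h0⟩

theorem IsPolytopal.isFiniteMeasure_frontier (hd : 1 ≤ d) {T : Set (Pt d)} (hT : IsPolytopal T) :
    IsFiniteMeasure ((surf d).restrict (frontier T)) := by
  obtain ⟨N, hN, hu, hsub⟩ := hT.frontier_subset_hyp hd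
  have hc : IsCompact (frontier T) := by
    refine Metric.isCompact_of_isClosed_isBounded isClosed_frontier ?_
    exact (hT.isBounded.closure).subset frontier_subset_closure
  refine ⟨?_⟩
  rw [Measure.restrict_apply_univ]
  refine (measure_mono (subset_inter hsub subset_rfl)).trans_lt ?_
  rw [iUnion₂_inter]
  refine (measure_biUnion_lt_top hN fun ℓ hℓ => ?_)
  have := isFiniteMeasureOnCompacts_surf_hyp (hu ℓ hℓ) ℓ.2
  have h1 := hc.measure_lt_top (μ := (surf d).restrict (hyp ℓ.1 ℓ.2))
  rwa [Measure.restrict_apply hc.isClosed.measurableSet, inter_comm] at h1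

theorem IsPolytopal.volume_frontier (hd : 1 ≤ d) {T : Set (Pt d)} (hT : IsPolytopal T) :
    volume (frontier T) = 0 := by
  obtain ⟨N, hN, hu, hsub⟩ := hT.frontier_subset_hyp hd
  refine measure_mono_null hsub ((measure_biUnion_null_iff hN.countable).2 fun ℓ hℓ => ?_)
  exact volume_hyp (hu ℓ hℓ) _

theorem stronglyMeasurable_ballAverage {Ω : Set (Pt d)} (hΩ : MeasurableSet Ω) {w : Pt d → Vc m}
    (hw : StronglyMeasurable w) (ρ : ℝ) :
    StronglyMeasurable fun x => ⨍ y in Metric.ball x ρ ∩ Ω, w y := by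
  have hS : MeasurableSet {p : Pt d × Pt d | p.2 ∈ Metric.ball p.1 ρ ∩ Ω} := by
    have h1 : IsOpen {p : Pt d × Pt d | dist p.2 p.1 < ρ} := isOpen_lt (by fun_prop)
      continuous_const
    exact h1.measurableSet.inter (measurable_snd hΩ)
  have hm : ∀ x, MeasurableSet (Metric.ball x ρ ∩ Ω) := fun x =>
    Metric.isOpen_ball.measurableSet.inter hΩ
  have h1 : StronglyMeasurable fun x => ∫ y in Metric.ball x ρ ∩ Ω, w y := by
    have : (fun x => ∫ y in Metric.ball x ρ ∩ Ω, w y) = fun x => ∫ y,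
        {p : Pt d × Pt d | p.2 ∈ Metric.ball p.1 ρ ∩ Ω}.indicator (fun p => w p.2) (x, y) := by
      funext x
      rw [← integral_indicator (hm x)]
      rfl
    rw [this]
    exact StronglyMeasurable.integral_prod_right' ((hw.comp_measurable measurable_snd).indicator hS)
  have h2 : Measurable fun x => volume (Metric.ball x ρ ∩ Ω) := measurable_measure_prodMk_left hS
  simp only [setAverage_eq]
  exact (h2.ennreal_toReal.inv.stronglyMeasurable).smul h1

/-- Traces on the boundary of a polytopal set are square integrable. -/
theorem HasTraceReg.memLp_trace (hd : 1 ≤ d) {T Ω : Set (Pt d)} {w : Pt d → Vc m} {θ : ℝ}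
    (h : HasTraceReg Ω w θ) (hT : IsPolytopal T) (hΩ : IsPolytopal Ω) (hTΩ : T ⊆ Ω) :
    MemLp (trace Ω w) 2 ((surf d).restrict (frontier T)) := by
  have hae := h.ae_trace hd hT hΩ hTΩ
  have hmeas : AEStronglyMeasurable (trace Ω w) ((surf d).restrict (frontier T)) := by
    refine aestronglyMeasurable_of_tendsto_ae atTop
      (f := fun (j : ℕ) x => ⨍ y in Metric.ball x (1 * (1 / 2 : ℝ) ^ j) ∩ Ω, w y)
      (fun j => (stronglyMeasurable_ballAverage hΩ.isOpen.measurableSet h.meas _).aestronglyMeasurable)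
      ?_
    filter_upwards [hae] with x hx
    exact hx.2.comp (tendsto_half_pow one_pos)
  rw [memLp_two_iff_integrable_sq_norm hmeas]
  obtain ⟨N, hN, hu, hsub⟩ := hT.frontier_subset_hyp hd
  obtain ⟨𝒮, h𝒮, hE, hcov⟩ := hT.exists_cells
  obtain ⟨D, hD, hTD⟩ : ∃ D > 0, ∀ x ∈ closure T, T ⊆ Metric.ball x D := by
    refine ⟨Metric.diam (closure T) + 1, by positivity, fun x hx y hy => ?_⟩
    rw [Metric.mem_ball]
    have := Metric.dist_le_diam_of_mem hT.isBounded.closure (subset_closure hy) hx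
    linarith
  -- on each piece, there are a cell inside and a hyperplane around
  have hset : frontier T ⊆ ⋃ E ∈ 𝒮, ⋃ ℓ ∈ N, frontier T ∩ closure E ∩ hyp ℓ.1 ℓ.2 := by
    intro x hx
    have h1 := hcov hx
    have h2 := hsub hx
    simp only [mem_iUnion] at h1 h2 ⊢
    obtain ⟨E, hE, hxE⟩ := h1
    obtain ⟨ℓ, hℓ, hxℓ⟩ := h2
    exact ⟨E, hE, ℓ, hℓ, ⟨hx, hxE⟩, hxℓ⟩
  refine IntegrableOn.mono_set ?_ hset
  rw [integrableOn_finite_biUnion h𝒮]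
  intro E hES
  rw [integrableOn_finite_biUnion hN]
  intro ℓ hℓ
  obtain ⟨hEo, hEc, hEn, hET⟩ := hE E hES
  have hms : MeasurableSet (frontier T ∩ closure E ∩ hyp ℓ.1 ℓ.2) :=
    (isClosed_frontier.inter isClosed_closure |>.inter (isClosed_hyp _ _)).measurableSet
  have hle : (surf d).restrict (frontier T ∩ closure E ∩ hyp ℓ.1 ℓ.2) ≤
      (surf d).restrict (frontier T) :=
    Measure.restrict_mono (fun x hx => hx.1.1) le_rfl
  have hle2 : (surf d).restrict (frontier T ∩ closure E ∩ hyp ℓ.1 ℓ.2) ≤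
      (surf d).restrict (hyp ℓ.1 ℓ.2) := Measure.restrict_mono (fun x hx => hx.2) le_rfl
  have := hT.isFiniteMeasure_frontier hd
  have hfin : IsFiniteMeasure ((surf d).restrict (frontier T ∩ closure E ∩ hyp ℓ.1 ℓ.2)) :=
    isFiniteMeasure_of_le _ hle
  refine ⟨(hmeas.mono_measure hle).norm.pow 2, ?_⟩
  rw [hasFiniteIntegral_iff_enorm]
  set K := ENNReal.ofReal ((D ^ d * (volume.real E)⁻¹) * (D ^ d * (volume.real E)⁻¹) * 16 ^ d)
  set a := ‖⨍ y in E, w y‖ₑ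
  calc ∫⁻ x in frontier T ∩ closure E ∩ hyp ℓ.1 ℓ.2, ‖‖trace Ω w x‖ ^ 2‖ₑ ∂surf d
      ≤ ∫⁻ x in frontier T ∩ closure E ∩ hyp ℓ.1 ℓ.2,
          4 * (a ^ 2 + K ^ 2 * oscSum E w D x ^ 2) ∂surf d := by
        refine lintegral_mono_ae ?_
        filter_upwards [ae_mono hle hae, ae_restrict_mem hms, ae_mono hle2
          (h.ae_oscSum_lt_top hd (hET.trans hTΩ) hEo hEc (hu ℓ hℓ) ℓ.2 hD)] with x h1 h2 h3
        have h4 := h.enorm_trace_le hΩ.isBounded (hET.trans hTΩ) hEo hEc hEn hD h2.1.2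
          (hET.trans (hTD x (frontier_subset_closure h2.1.1))) h1.1 h3
        rw [enorm_pow, enorm_norm]
        refine (pow_le_pow_left₀ zero_le h4 2).trans ?_
        rw [← mul_pow]
        calc (a + K * oscSum E w D x) ^ 2 ≤ (2 * max a (K * oscSum E w D x)) ^ 2 := by
              gcongr
              rw [two_mul]
              exact add_le_add (le_max_left _ _) (le_max_right _ _)
          _ = 4 * max a (K * oscSum E w D x) ^ 2 := by rw [mul_pow]; norm_num
          _ ≤ 4 * (a ^ 2 + (K * oscSum E w D x) ^ 2) := by
              gcongr
              rcases max_cases a (K * oscSum E w D x) with h5 | h5 <;> rw [h5.1]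
              · exact le_self_add
              · exact le_add_self
    _ < ⊤ := by
        rw [lintegral_const_mul' _ _ (by simp), lintegral_add_left measurable_const,
          lintegral_const, lintegral_const_mul' _ _ (by simp [K])]
        refine ENNReal.mul_lt_top (by simp) (ENNReal.add_lt_top.2 ⟨?_, ?_⟩)
        · exact ENNReal.mul_lt_top (by simp [a]) (measure_lt_top _ _)
        · refine ENNReal.mul_lt_top (by simp [K]) ?_
          exact (lintegral_mono' hle2 le_rfl).trans_lt
            (h.lintegral_sq_oscSum_lt_top hd (hET.trans hTΩ) hEo hEc (hu ℓ hℓ) ℓ.2 hD)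

/-! ### Boundary layers -/

/-- A smooth step: `1` on `(-∞, -2]` and `0` on `[-1, ∞)`. -/
def step (τ : ℝ) : ℝ := Real.smoothTransition (-τ - 1)

/-- The opposite of the derivative of `step`. -/
def bump (τ : ℝ) : ℝ := deriv Real.smoothTransition (-τ - 1)

theorem contDiff_step : ContDiff ℝ ∞ step :=
  (Real.smoothTransition.contDiff (n := ⊤)).comp (contDiff_neg.sub contDiff_const)

theorem hasDerivAt_step (τ : ℝ) : HasDerivAt step (-bump τ) τ := by
  have h1 : HasDerivAt Real.smoothTransition (bump τ) (-τ - 1) :=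
    ((Real.smoothTransition.contDiff (n := 1)).differentiable (by simp) _).hasDerivAt
  have h2 : HasDerivAt (fun τ : ℝ => -τ - 1) (-1) τ := (hasDerivAt_neg τ).sub_const 1
  have h3 := h1.comp τ h2
  rw [mul_neg, mul_one] at h3
  exact h3

theorem step_nonneg (τ : ℝ) : 0 ≤ step τ := Real.smoothTransition.nonneg _

theorem step_le_one (τ : ℝ) : step τ ≤ 1 := Real.smoothTransition.le_one _

theorem step_of_le {τ : ℝ} (h : τ ≤ -2) : step τ = 1 :=
  Real.smoothTransition.one_of_one_le (by linarith)

theorem step_of_ge {τ : ℝ} (h : -1 ≤ τ) : step τ = 0 :=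
  Real.smoothTransition.zero_of_nonpos (by linarith)

theorem continuous_bump : Continuous bump :=
  ((Real.smoothTransition.contDiff (n := 1)).continuous_deriv le_rfl).comp (by fun_prop)

theorem bump_nonneg (τ : ℝ) : 0 ≤ bump τ := Real.smoothTransition.monotone.deriv_nonneg

theorem bump_eq_zero {τ : ℝ} (h : τ ∉ Icc (-2 : ℝ) (-1)) : bump τ = 0 := by
  rw [mem_Icc, not_and_or, not_le, not_le] at h
  rcases h with h | h
  · have : Real.smoothTransition =ᶠ[𝓝 (-τ - 1)] fun _ => 1 := by
      filter_upwards [Ioi_mem_nhds (show (1 : ℝ) < -τ - 1 by linarith)] with x hx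
      exact Real.smoothTransition.one_of_one_le (le_of_lt hx)
    rw [bump, this.deriv_eq, deriv_const]
  · have : Real.smoothTransition =ᶠ[𝓝 (-τ - 1)] fun _ => 0 := by
      filter_upwards [Iio_mem_nhds (show -τ - 1 < (0 : ℝ) by linarith)] with x hx
      exact Real.smoothTransition.zero_of_nonpos (le_of_lt hx)
    rw [bump, this.deriv_eq, deriv_const]

theorem hasCompactSupport_bump : HasCompactSupport bump :=
  HasCompactSupport.intro isCompact_Icc fun _ h => bump_eq_zero h

theorem integral_bump : ∫ τ, bump τ = 1 := by
  have h := integral_of_hasDerivAt_of_tendsto (f := fun τ => -step τ) (f' := bump) (m := -1) (n := 0)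
    (fun τ => by have := (hasDerivAt_step τ).neg; rw [neg_neg] at this; exact this)
    (continuous_bump.integrable_of_hasCompactSupport hasCompactSupport_bump) ?_ ?_
  · rw [h]; norm_num
  · refine tendsto_const_nhds.congr' ?_
    filter_upwards [eventually_le_atBot (-2 : ℝ)] with τ hτ
    rw [step_of_le hτ]
  · refine tendsto_const_nhds.congr' ?_
    filter_upwards [eventually_ge_atTop (-1 : ℝ)] with τ hτ
    rw [step_of_ge hτ, neg_zero]

theorem exists_bump_le : ∃ B, 0 < B ∧ ∀ τ, bump τ ≤ B := by
  obtain ⟨B, hB⟩ := continuous_bump.bounded_above_of_compact_support hasCompactSupport_bump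
  exact ⟨max B 1, by positivity, fun τ => (le_abs_self _).trans ((hB τ).trans (le_max_left _ _))⟩

/-- A nonnegative kernel of integral one, supported in a layer of thickness `ρ` at distance `ρ` from
the hyperplane orthogonal to `n`. -/
def layerKernel (n : Pt d) (ρ : ℝ) (z : Pt d) : ℝ :=
  ((volume : Measure (ℝ ∙ n)ᗮ).real (Metric.ball 0 1) * ρ ^ (d - 1))⁻¹ *
    (Metric.ball (0 : Pt d) ρ).indicator 1 (z - (inner ℝ n z : ℝ) • n) *
      (ρ⁻¹ * bump (inner ℝ n z / ρ))

theorem layerKernel_nonneg (n : Pt d) {ρ : ℝ} (hρ : 0 < ρ) (z : Pt d) : 0 ≤ layerKernel n ρ z := by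
  have := bump_nonneg (inner ℝ n z / ρ)
  have h2 : (0 : ℝ) ≤ (Metric.ball (0 : Pt d) ρ).indicator 1 (z - (inner ℝ n z : ℝ) • n) :=
    indicator_nonneg (fun _ _ => by simp) _
  unfold layerKernel
  positivity

theorem measurable_layerKernel (n : Pt d) (ρ : ℝ) : Measurable (layerKernel n ρ) := by
  have h1 : Measurable fun z : Pt d =>
      (Metric.ball (0 : Pt d) ρ).indicator (1 : Pt d → ℝ) (z - (inner ℝ n z : ℝ) • n) :=
    (measurable_one.indicator Metric.isOpen_ball.measurableSet).comp (by fun_prop)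
  have h2 : Measurable fun z : Pt d => bump (inner ℝ n z / ρ) :=
    continuous_bump.measurable.comp (by fun_prop)
  unfold layerKernel
  exact (measurable_const.mul h1).mul (measurable_const.mul h2)

theorem layerKernel_le (hd : 1 ≤ d) (n : Pt d) {ρ B : ℝ} (hρ : 0 < ρ) (hB : ∀ τ, bump τ ≤ B)
    (z : Pt d) : layerKernel n ρ z ≤
      ((volume : Measure (ℝ ∙ n)ᗮ).real (Metric.ball 0 1))⁻¹ * B * (ρ ^ d)⁻¹ := by
  have h0 := volume_ball_orthogonal_pos n
  have h1 := bump_nonneg (inner ℝ n z / ρ)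
  have h2 : (Metric.ball (0 : Pt d) ρ).indicator (1 : Pt d → ℝ) (z - (inner ℝ n z : ℝ) • n) ≤ 1 :=
    indicator_le_self' (fun _ _ => zero_le_one) _
  have h3 : ρ ^ d = ρ ^ (d - 1) * ρ := by rw [← pow_succ, Nat.sub_add_cancel hd]
  have hB' := hB (inner ℝ n z / ρ)
  calc layerKernel n ρ z ≤ ((volume : Measure (ℝ ∙ n)ᗮ).real (Metric.ball 0 1) * ρ ^ (d - 1))⁻¹ *
        1 * (ρ⁻¹ * B) := by
        unfold layerKernel
        gcongr
    _ = _ := by rw [h3, mul_inv, mul_inv]; ring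

theorem layerKernel_supp {n : Pt d} (hn : ‖n‖ = 1) {ρ : ℝ} (hρ : 0 < ρ) {z : Pt d}
    (hz : layerKernel n ρ z ≠ 0) : (inner ℝ n z : ℝ) < 0 ∧ ‖z‖ < 4 * ρ := by
  have h1 : bump (inner ℝ n z / ρ) ≠ 0 := fun h => hz (by simp [layerKernel, h])
  have h2 : z - (inner ℝ n z : ℝ) • n ∈ Metric.ball (0 : Pt d) ρ := by
    by_contra h
    exact hz (by simp only [layerKernel, indicator_of_notMem h]; ring)
  have h3 : inner ℝ n z / ρ ∈ Icc (-2 : ℝ) (-1) := by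
    by_contra h
    exact h1 (bump_eq_zero h)
  rw [mem_Icc, le_div_iff₀ hρ, div_le_iff₀ hρ] at h3
  rw [mem_ball_zero_iff] at h2
  refine ⟨by linarith, ?_⟩
  calc ‖z‖ = ‖(z - (inner ℝ n z : ℝ) • n) + (inner ℝ n z : ℝ) • n‖ := by rw [sub_add_cancel]
    _ ≤ ‖z - (inner ℝ n z : ℝ) • n‖ + ‖(inner ℝ n z : ℝ) • n‖ := norm_add_le _ _
    _ < ρ + 2 * ρ := by
        rw [norm_smul, hn, mul_one, Real.norm_eq_abs, abs_of_neg (by linarith)]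
        linarith
    _ ≤ 4 * ρ := by linarith

theorem integral_layerKernel (hd : 1 ≤ d) {n : Pt d} (hn : ‖n‖ = 1) {ρ : ℝ} (hρ : 0 < ρ)
    (x : Pt d) : ∫ y, layerKernel n ρ (y - x) = 1 := by
  have h0 := volume_ball_orthogonal_pos n
  rw [← (measurePreserving_slab hn x).integral_comp (measurableEmbedding_slab hn x)]
  have h1 : ∀ z : (ℝ ∙ n)ᗮ × ℝ, layerKernel n ρ (x + (z.1 : Pt d) + z.2 • n - x) =
      (((volume : Measure (ℝ ∙ n)ᗮ).real (Metric.ball 0 1) * ρ ^ (d - 1))⁻¹ *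
        (Metric.ball (0 : (ℝ ∙ n)ᗮ) ρ).indicator 1 z.1) * (ρ⁻¹ * bump (z.2 / ρ)) := by
    rintro ⟨z, t⟩
    have hz := Submodule.mem_orthogonal_singleton_iff_inner_right.1 z.2
    have h2 : x + (z : Pt d) + t • n - x = (z : Pt d) + t • n := by abel
    have h3 : (inner ℝ n ((z : Pt d) + t • n) : ℝ) = t := by
      rw [inner_add_right, hz, inner_smul_right, real_inner_self_eq_norm_sq, hn]; simp
    rw [h2, layerKernel, h3, add_sub_cancel_right]
    congr 2
  simp_rw [h1]
  rw [Measure.volume_eq_prod, integral_prod_mul (f := fun z : (ℝ ∙ n)ᗮ =>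
      ((volume : Measure (ℝ ∙ n)ᗮ).real (Metric.ball 0 1) * ρ ^ (d - 1))⁻¹ *
        (Metric.ball (0 : (ℝ ∙ n)ᗮ) ρ).indicator 1 z) (g := fun t => ρ⁻¹ * bump (t / ρ)),
    integral_const_mul, integral_const_mul,
    Measure.integral_comp_div, integral_bump, integral_indicator_one
    Metric.isOpen_ball.measurableSet]
  have h4 : (volume : Measure (ℝ ∙ n)ᗮ).real (Metric.ball 0 ρ) =
      ρ ^ (d - 1) * (volume : Measure (ℝ ∙ n)ᗮ).real (Metric.ball 0 1) := by
    rw [Measure.real, Measure.addHaar_ball_of_pos _ _ hρ, ENNReal.toReal_mul,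
      ENNReal.toReal_ofReal (by positivity), finrank_orthogonal_unit hn]
    rfl
  rw [h4, abs_of_pos hρ, smul_eq_mul]
  field_simp

/-- Integrating the kernels over a hyperplane yields the density of the layer. -/
theorem integral_hyp_layerKernel {n : Pt d} (hn : ‖n‖ = 1) (c : ℝ) {ρ : ℝ} (hρ : 0 < ρ)
    {S : Set (Pt d)} (hS : MeasurableSet S) {y : Pt d}
    (hy : Metric.ball (y - (inner ℝ n y - c) • n) ρ ⊆ S) :
    ∫ x in hyp n c ∩ S, layerKernel n ρ (y - x) ∂surf d = ρ⁻¹ * bump ((inner ℝ n y - c) / ρ) := by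
  have h0 := volume_ball_orthogonal_pos n
  set p := y - (inner ℝ n y - c) • n with hp
  have hpm : p ∈ hyp n c := by
    simp [hyp, hp, inner_sub_right, inner_smul_right, hn]
  have hms := (isClosed_hyp n c).measurableSet
  have h1 : ∀ x ∈ hyp n c ∩ S, layerKernel n ρ (y - x) = (Metric.ball p ρ).indicator (fun _ =>
      ((volume : Measure (ℝ ∙ n)ᗮ).real (Metric.ball 0 1) * ρ ^ (d - 1))⁻¹ *
        (ρ⁻¹ * bump ((inner ℝ n y - c) / ρ))) x := by
    rintro x ⟨hx, -⟩
    have h2 : (inner ℝ n (y - x) : ℝ) = inner ℝ n y - c := by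
      rw [inner_sub_right, show inner ℝ n x = c from hx]
    have h3 : y - x - (inner ℝ n y - c) • n = p - x := by rw [hp]; abel
    rw [layerKernel, h2, h3]
    by_cases h : x ∈ Metric.ball p ρ
    · rw [indicator_of_mem h, indicator_of_mem (by
        rw [mem_ball_zero_iff, ← dist_eq_norm, dist_comm]; exact h)]
      simp
    · rw [indicator_of_notMem h, indicator_of_notMem (by
        rw [mem_ball_zero_iff, ← dist_eq_norm, dist_comm]; exact h)]
      simp
  rw [setIntegral_congr_fun (hms.inter hS) h1, setIntegral_indicator
    Metric.isOpen_ball.measurableSet, inter_assoc, inter_eq_self_of_subset_right hy,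
    setIntegral_const, Measure.real, inter_comm, ← Measure.restrict_apply
    Metric.isOpen_ball.measurableSet, surf_hyp_ball hn hpm hρ, ENNReal.toReal_mul,
    ENNReal.toReal_ofReal (by positivity), smul_eq_mul]
  have h5 : ((volume : Measure (ℝ ∙ n)ᗮ) (Metric.ball 0 1)).toReal =
    (volume : Measure (ℝ ∙ n)ᗮ).real (Metric.ball 0 1) := rfl
  rw [h5]
  field_simp

theorem IsFlatAt.hyp_subset_frontier {T Ω : Set (Pt d)} {x₀ n : Pt d} {r : ℝ}
    (h : IsFlatAt T Ω x₀ n r) (hT : IsOpen T) {x : Pt d} (hx : x ∈ Metric.ball x₀ r)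
    (hxn : inner ℝ n (x - x₀) = 0) : x ∈ frontier T := by
  rw [frontier, hT.interior_eq]
  refine ⟨mem_closure_iff.2 fun o ho hxo => ?_, fun hxT => ?_⟩
  · have h1 : Tendsto (fun t : ℝ => x - t • n) (𝓝[>] 0) (𝓝 x) := by
      have : Continuous fun t : ℝ => x - t • n := by fun_prop
      simpa using (this.tendsto 0).mono_left nhdsWithin_le_nhds
    obtain ⟨t, ht⟩ := ((h1.eventually ((ho.inter Metric.isOpen_ball).mem_nhds ⟨hxo, hx⟩)).and
      self_mem_nhdsWithin).exists
    have ht0 : 0 < t := ht.2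
    refine ⟨x - t • n, ht.1.1, (h.mem_of_neg ht.1.2 ?_).1⟩
    rw [sub_right_comm, inner_sub_right, hxn, inner_smul_right, real_inner_self_eq_norm_sq, h.unit]
    linarith
  · exact (h.inner_of_mem hx hxT).ne hxn

theorem norm_sub_inner_smul_le {n : Pt d} (hn : ‖n‖ = 1) (z : Pt d) :
    ‖z - (inner ℝ n z : ℝ) • n‖ ≤ ‖z‖ := by
  rw [← sq_le_sq₀ (norm_nonneg _) (norm_nonneg _), norm_sub_sq_real, inner_smul_right, norm_smul, hn,
    real_inner_comm, mul_one, Real.norm_eq_abs, sq_abs]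
  nlinarith [sq_nonneg (inner ℝ n z : ℝ)]

/-- At a point of the hyperplane, the layer kernel is a weight of the same kind as the ones that
define the trace; its support stays on the inner side. -/
theorem IsFlatAt.isKernel_layer (hd : 1 ≤ d) {T Ω : Set (Pt d)} {x₀ n : Pt d} {r : ℝ}
    (h : IsFlatAt T Ω x₀ n r) {x : Pt d} (hx : x ∈ Metric.ball x₀ (r / 2))
    (hxn : inner ℝ n (x - x₀) = 0) {B : ℝ} (hB0 : 0 ≤ B) (hB : ∀ τ, bump τ ≤ B) (j : ℕ) :
    IsKernel (T ∩ Metric.ball x₀ r) x (r / 4 * (1 / 2) ^ j)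
      (((volume : Measure (ℝ ∙ n)ᗮ).real (Metric.ball 0 1))⁻¹ * B * 4 ^ d)
      (fun y => layerKernel n (r / 16 * (1 / 2) ^ j) (y - x)) := by
  have hr := h.pos
  have hρ : 0 < r / 16 * (1 / 2 : ℝ) ^ j := by positivity
  have hj : (1 / 2 : ℝ) ^ j ≤ 1 := pow_le_one₀ (by norm_num) (by norm_num)
  refine ⟨(measurable_layerKernel n _).comp (measurable_id.sub_const x), fun y => ?_,
    fun y hy => ?_, integral_layerKernel hd h.unit hρ x⟩
  · rw [abs_of_nonneg (layerKernel_nonneg n hρ _)]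
    refine (layerKernel_le hd n hρ hB _).trans (le_of_eq ?_)
    have : r / 4 * (1 / 2 : ℝ) ^ j = 4 * (r / 16 * (1 / 2 : ℝ) ^ j) := by ring
    rw [this, mul_pow 4, mul_inv]
    field_simp
  · obtain ⟨h1, h2⟩ := layerKernel_supp h.unit hρ hy
    have h3 : y ∈ Metric.ball x (r / 4 * (1 / 2) ^ j) := by
      rw [Metric.mem_ball, dist_eq_norm]
      linarith
    have h4 : y ∈ Metric.ball x₀ r := by
      rw [Metric.mem_ball] at h3 hx ⊢
      have : r / 4 * (1 / 2 : ℝ) ^ j ≤ r / 4 := mul_le_of_le_one_right (by positivity) hj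
      linarith [dist_triangle y x x₀]
    refine ⟨h3, (h.mem_of_neg h4 ?_).1, h4⟩
    have : y - x₀ = (y - x) + (x - x₀) := by abel
    rw [this, inner_add_right, hxn, add_zero]
    exact h1

/-- The integrals over a boundary layer converge to the integral of the trace. By Fubini, a layer
integral is the integral over the hyperplane of averages against the layer kernels; these converge
to the trace almost everywhere, and are dominated by the sum of the oscillations. -/
theorem HasTraceReg.tendsto_layer (hd : 1 ≤ d) {T Ω : Set (Pt d)} {w : Pt d → Vc m} {θ : ℝ}
    (h : HasTraceReg Ω w θ) (hT : IsPolytopal T) (hΩ : IsPolytopal Ω) (hTΩ : T ⊆ Ω)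
    {x₀ n : Pt d} {r : ℝ} (hf : IsFlatAt T Ω x₀ n r) {g : Pt d → Vc m}
    (hg : ContinuousOn g (closure T)) (hg0 : ∀ y ∉ Metric.ball x₀ (r / 4), g y = 0) :
    Tendsto (fun j : ℕ => ∫ y in T, ((r / 16 * (1 / 2 : ℝ) ^ j)⁻¹ *
        bump (inner ℝ n (y - x₀) / (r / 16 * (1 / 2 : ℝ) ^ j))) • (inner ℂ (g y) (w y) : ℂ)) atTop
      (𝓝 (∫ x in frontier T, inner ℂ (g x) (trace Ω w x) ∂surf d)) := by
  have hr := hf.pos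
  obtain ⟨B, hB0, hB⟩ := exists_bump_le
  set ρ : ℕ → ℝ := fun j => r / 16 * (1 / 2 : ℝ) ^ j with hρ
  have hρ0 : ∀ j, 0 < ρ j := fun j => by positivity
  have hρr : ∀ j, ρ j ≤ r / 16 := fun j =>
    mul_le_of_le_one_right (by positivity) (pow_le_one₀ (by norm_num) (by norm_num))
  set c : ℝ := inner ℝ n x₀ with hc
  set E := T ∩ Metric.ball x₀ r with hE
  set S := Metric.ball x₀ (r / 2) with hS
  have hSm : MeasurableSet S := Metric.isOpen_ball.measurableSet
  have hTm := hT.isOpen.measurableSet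
  have hEo : IsOpen E := hT.isOpen.inter Metric.isOpen_ball
  have hEc : Convex ℝ E := by rw [hE, hf.half]; exact convex_half_ball x₀ n r
  have hEΩ : E ⊆ Ω := inter_subset_left.trans hTΩ
  set C : ℝ := ((volume : Measure (ℝ ∙ n)ᗮ).real (Metric.ball 0 1))⁻¹ * B * 4 ^ d with hC
  have hC0 : 0 ≤ C := by
    have := volume_ball_orthogonal_pos n
    positivity
  set k : ℕ → Pt d → Pt d → ℝ := fun j x y => layerKernel n (ρ j) (y - x) with hk
  have hk0 : ∀ j x y, 0 ≤ k j x y := fun j x y => layerKernel_nonneg n (hρ0 j) _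
  have hker : ∀ j, ∀ x ∈ hyp n c ∩ S, IsKernel E x (r / 4 * (1 / 2) ^ j) C (k j x) :=
    fun j x hx => hf.isKernel_layer hd hx.2
      (by rw [inner_sub_right, sub_eq_zero]; exact hx.1) hB0.le hB j
  have hwT : IntegrableOn w T := h.integrableOn hΩ.isBounded hTΩ
  have hwE : IntegrableOn w E := h.integrableOn hΩ.isBounded hEΩ
  obtain ⟨G, hG⟩ := (Metric.isCompact_of_isClosed_isBounded isClosed_closure
    hT.isBounded.closure).exists_bound_of_continuousOn hg
  have hG0 : 0 ≤ G := by
    have : x₀ ∈ closure T := frontier_subset_closure (hf.hyp_subset_frontier hT.isOpen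
      (Metric.mem_ball_self hr) (by simp))
    exact (norm_nonneg _).trans (hG _ this)
  have hgm : AEStronglyMeasurable g (volume.restrict T) :=
    (hg.mono subset_closure).aestronglyMeasurable hTm
  set F : Pt d → ℂ := fun y => inner ℂ (g y) (w y) with hF
  have hFle : ∀ y ∈ T, ‖F y‖ ≤ G * ‖w y‖ := fun y hy =>
    (norm_inner_le_norm _ _).trans (by gcongr; exact hG y (subset_closure hy))
  have hFi : IntegrableOn F T := by
    refine (hwT.norm.const_mul G).mono' (hgm.inner h.meas.aestronglyMeasurable) ?_
    filter_upwards [ae_restrict_mem hTm] with y hy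
    exact hFle y hy
  set ν := (surf d).restrict (hyp n c ∩ S) with hν
  have hνle : ν ≤ (surf d).restrict (hyp n c) := Measure.restrict_mono inter_subset_left le_rfl
  have hνfin : IsFiniteMeasure ν := by
    refine ⟨?_⟩
    rw [hν, Measure.restrict_apply_univ, inter_comm, ← Measure.restrict_apply hSm]
    refine (surf_hyp_ball_le hf.unit x₀ (half_pos hr)).trans_lt ?_
    exact ENNReal.mul_lt_top ENNReal.ofReal_lt_top measure_ball_lt_top
  have hνm := ((isClosed_hyp n c).measurableSet).inter hSm
  -- the layer integrals are integrals over the hyperplane of averages against the kernels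
  have hstep1 : ∀ j, ∫ y in T, ((ρ j)⁻¹ * bump (inner ℝ n (y - x₀) / ρ j)) • F y =
      ∫ x, (∫ y in T, k j x y • F y) ∂ν := fun j => by
    have h1 : ∀ y ∈ T, ((ρ j)⁻¹ * bump (inner ℝ n (y - x₀) / ρ j)) • F y =
        ∫ x, k j x y • F y ∂ν := by
      intro y hy
      rw [integral_smul_const]
      by_cases hyb : y ∈ Metric.ball x₀ (r / 4)
      · rw [inner_sub_right, ← integral_hyp_layerKernel hf.unit c (hρ0 j) hSm]
        refine Metric.ball_subset_ball' ?_
        have h2 : y - (inner ℝ n y - c) • n - x₀ = (y - x₀) - (inner ℝ n (y - x₀) : ℝ) • n := by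
          rw [inner_sub_right]; abel
        rw [dist_eq_norm, h2]
        have h3 := norm_sub_inner_smul_le hf.unit (y - x₀)
        rw [Metric.mem_ball, dist_eq_norm] at hyb
        linarith [hρr j]
      · have : F y = 0 := by simp [hF, hg0 y hyb]
        rw [this, smul_zero, smul_zero]
    rw [setIntegral_congr_fun hTm h1]
    refine integral_integral_swap ?_
    have h2 : Integrable (fun p : Pt d × Pt d => F p.1) ((volume.restrict T).prod ν) :=
      hFi.comp_fst ν
    have h3 : Integrable (fun p : Pt d × Pt d => k j p.2 p.1 • F p.1)
        ((volume.restrict T).prod ν) := by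
      refine Integrable.bdd_smul (𝕜 := ℝ) (φ := fun p : Pt d × Pt d => k j p.2 p.1) h2
        (((volume : Measure (ℝ ∙ n)ᗮ).real (Metric.ball 0 1))⁻¹ * B *
        (ρ j ^ d)⁻¹) ?_ (Eventually.of_forall fun p => ?_)
      · exact ((measurable_layerKernel n (ρ j)).comp
          (measurable_fst.sub measurable_snd)).aestronglyMeasurable
      · rw [Real.norm_of_nonneg (hk0 _ _ _)]
        exact layerKernel_le hd n (hρ0 j) hB _
    exact h3
  -- uniform bound of the averages
  set a : ℝ≥0∞ := ENNReal.ofReal (C * ((r / 4) ^ d)⁻¹) * ∫⁻ y in E, ‖w y‖ₑ with ha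
  set M : Pt d → ℝ≥0∞ := fun x => a + ENNReal.ofReal (C * C * 16 ^ d) * oscSum E w (r / 4) x with hM
  have hat : a ≠ ⊤ := ENNReal.mul_ne_top ENNReal.ofReal_ne_top hwE.2.ne
  have hMt : ∀ x, oscSum E w (r / 4) x < ⊤ → M x ≠ ⊤ := fun x hx =>
    ENNReal.add_ne_top.2 ⟨hat, ENNReal.mul_ne_top ENNReal.ofReal_ne_top hx.ne⟩
  have hkw : ∀ x ∈ hyp n c ∩ S, oscSum E w (r / 4) x < ⊤ → ∀ j,
      ∫ y, k j x y * ‖w y‖ ≤ (M x).toReal := by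
    intro x hx hosc j
    obtain ⟨-, -, -, hb⟩ := exists_hasKernelLimit hEo.measurableSet h.meas.norm hwE.norm
      (by positivity) ((oscSum_norm_le E w (r / 4) x).trans_lt hosc) hC0 (j₀ := 0)
      (fun j _ => hker j x hx)
    have h1 := hb j (Nat.zero_le _)
    have h2 : ‖∫ y, k 0 x y • ‖w y‖‖ₑ ≤ a := by
      refine (enorm_integral_le_lintegral_enorm _).trans ?_
      rw [ha, ← lintegral_const_mul' _ _ ENNReal.ofReal_ne_top, ← lintegral_indicator hEo.measurableSet]
      refine lintegral_mono fun y => ?_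
      have hk1 := hker 0 x hx
      by_cases hy : k 0 x y = 0
      · simp [hy]
      · rw [indicator_of_mem (hk1.supp y hy).2, enorm_smul, enorm_norm]
        gcongr
        rw [← ofReal_norm]
        refine ENNReal.ofReal_le_ofReal ?_
        simpa using hk1.bound y
    have h3 : ‖∫ y, k j x y • ‖w y‖‖ₑ ≤ M x :=
      h1.trans (add_le_add h2 (by gcongr; exact oscSum_norm_le _ _ _ _))
    have h4 := ENNReal.toReal_mono (hMt x hosc) h3
    rw [toReal_enorm] at h4
    exact (Real.le_norm_self _).trans h4
  have hint : ∀ x ∈ hyp n c ∩ S, ∀ j, Integrable fun y => k j x y * ‖w y‖ := fun x hx j =>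
    (hker j x hx).integrable_smul hEo.measurableSet hwE.norm
  have hle : ∀ x ∈ hyp n c ∩ S, oscSum E w (r / 4) x < ⊤ → ∀ (u : Pt d → Vc m) (K : ℝ) (j : ℕ),
      0 ≤ K → (∀ y ∈ T, k j x y ≠ 0 → ‖u y‖ ≤ K) →
      ‖∫ y in T, k j x y • (inner ℂ (u y) (w y) : ℂ)‖ ≤ K * (M x).toReal := by
    intro x hx hosc u K j hK hu
    calc ‖∫ y in T, k j x y • (inner ℂ (u y) (w y) : ℂ)‖ ≤ ∫ y in T, K * (k j x y * ‖w y‖) := by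
          refine norm_integral_le_of_norm_le ((hint x hx j).integrableOn.const_mul K) ?_
          filter_upwards [ae_restrict_mem hTm] with y hy
          rw [norm_smul, Real.norm_of_nonneg (hk0 _ _ _)]
          by_cases h0 : k j x y = 0
          · simp [h0]
          · have h1 : ‖(inner ℂ (u y) (w y) : ℂ)‖ ≤ K * ‖w y‖ :=
              (norm_inner_le_norm _ _).trans (by gcongr; exact hu y hy h0)
            calc k j x y * ‖(inner ℂ (u y) (w y) : ℂ)‖ ≤ k j x y * (K * ‖w y‖) :=
                  mul_le_mul_of_nonneg_left h1 (hk0 _ _ _)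
              _ = _ := by ring
      _ ≤ ∫ y, K * (k j x y * ‖w y‖) :=
          setIntegral_le_integral ((hint x hx j).const_mul K)
            (Eventually.of_forall fun y => mul_nonneg hK (mul_nonneg (hk0 _ _ _) (norm_nonneg _)))
      _ ≤ K * (M x).toReal := by
          rw [integral_const_mul]
          gcongr
          exact hkw x hx hosc j
  have hosc : ∀ᵐ x ∂ν, oscSum E w (r / 4) x < ⊤ :=
    ae_mono hνle (h.ae_oscSum_lt_top hd hEΩ hEo hEc hf.unit c (by positivity))
  have hmem : ∀ᵐ x ∂ν, x ∈ hyp n c ∩ S := ae_restrict_mem hνm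
  have htr := ae_mono hνle (h.ae_trace_of_isFlatAt hd hΩ.isOpen hΩ.isBounded hf)
  -- the integral of the trace only involves the hyperplane
  have hlim : ∫ x in frontier T, inner ℂ (g x) (trace Ω w x) ∂surf d =
      ∫ x, (inner ℂ (g x) (trace Ω w x) : ℂ) ∂ν := by
    have h1 : frontier T ∩ S = hyp n c ∩ S := by
      ext x
      constructor
      · rintro ⟨h1, h2⟩
        have := hf.frontier_subset hT.isOpen (Metric.ball_subset_ball (by linarith) h2) h1
        rw [inner_sub_right, sub_eq_zero] at this
        exact ⟨this, h2⟩
      · rintro ⟨h1, h2⟩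
        refine ⟨hf.hyp_subset_frontier hT.isOpen (Metric.ball_subset_ball (by linarith) h2) ?_, h2⟩
        rw [inner_sub_right, sub_eq_zero]; exact h1
    rw [hν, ← h1, inter_comm, ← Measure.restrict_restrict hSm]
    refine (setIntegral_eq_integral_of_forall_compl_eq_zero fun x hx => ?_).symm
    rw [hg0 x fun hx' => hx (Metric.ball_subset_ball (by linarith) hx'), inner_zero_left]
  rw [hlim]
  -- dominated convergence, with a multiple of `M` as the dominating function
  refine (tendsto_congr hstep1).2 ?_
  refine tendsto_integral_of_dominated_convergence (fun x => G * (M x).toReal) (fun j => ?_) ?_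
    (fun j => ?_) ?_
  · have h2 : AEStronglyMeasurable (fun p : Pt d × Pt d => k j p.1 p.2 • F p.2)
        (ν.prod (volume.restrict T)) := by
      refine AEStronglyMeasurable.smul (f := fun p : Pt d × Pt d => k j p.1 p.2)
        (g := fun p : Pt d × Pt d => F p.2) ?_ (hFi.1.comp_snd)
      exact ((measurable_layerKernel n (ρ j)).comp
        (measurable_snd.sub measurable_fst)).aestronglyMeasurable
    exact h2.integral_prod_right'
  · refine Integrable.const_mul (integrable_toReal_of_lintegral_ne_top ?_ ?_) G
    · exact ((measurable_oscSum E h.meas _).const_mul _).const_add _ |>.aemeasurable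
    · rw [lintegral_add_left measurable_const, lintegral_const,
        lintegral_const_mul' _ _ ENNReal.ofReal_ne_top]
      refine ENNReal.add_ne_top.2 ⟨ENNReal.mul_ne_top hat (measure_ne_top _ _),
        ENNReal.mul_ne_top ENNReal.ofReal_ne_top ?_⟩
      have h1 : ∫⁻ x, oscSum E w (r / 4) x ^ 2 ∂ν < ⊤ :=
        (lintegral_mono' hνle le_rfl).trans_lt
          (h.lintegral_sq_oscSum_lt_top hd hEΩ hEo hEc hf.unit c (by positivity))
      have h2 : ∫⁻ x, oscSum E w (r / 4) x ∂ν ≤ ∫⁻ x, (1 + oscSum E w (r / 4) x ^ 2) ∂ν := by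
        refine lintegral_mono fun x => ?_
        rcases le_total (oscSum E w (r / 4) x) 1 with h3 | h3
        · exact h3.trans le_self_add
        · exact (le_self_pow₀ h3 two_ne_zero).trans le_add_self
      refine (h2.trans_lt ?_).ne
      rw [lintegral_add_left measurable_const, lintegral_const]
      exact ENNReal.add_lt_top.2 ⟨ENNReal.mul_lt_top ENNReal.one_lt_top (measure_lt_top _ _), h1⟩
  · filter_upwards [hosc, hmem] with x hx hxm
    exact hle x hxm hx g G j hG0 fun y hy _ => hG y (subset_closure hy)
  · filter_upwards [hosc, hmem, htr] with x hx hxm hxt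
    have hxn : inner ℝ n (x - x₀) = 0 := by
      rw [inner_sub_right, sub_eq_zero]; exact hxm.1
    have hxT : x ∈ closure T := frontier_subset_closure (hf.hyp_subset_frontier hT.isOpen
      (Metric.ball_subset_ball (by linarith) hxm.2) hxn)
    have hkl : HasKernelLimit E w x (trace Ω w x) :=
      (hxt hxm.2).1.mono zero_lt_one (inter_subset_right.trans hEΩ)
    have hρ4 := tendsto_half_pow (R := r / 4) (by positivity)
    have h1 : Tendsto (fun j => ∫ y, k j x y • w y) atTop (𝓝 (trace Ω w x)) :=
      hkl C _ _ hC0 (Eventually.of_forall fun j => hker j x hxm) hρ4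
    -- freeze `g` at `x`; the remainder is small by continuity of `g`
    have h2 : ∀ j, ∫ y in T, k j x y • F y = inner ℂ (g x) (∫ y, k j x y • w y) +
        ∫ y in T, k j x y • (inner ℂ (g y - g x) (w y) : ℂ) := fun j => by
      have hi : Integrable fun y => k j x y • w y :=
        (hker j x hxm).integrable_smul hEo.measurableSet hwE
      have h3 : ∫ y, k j x y • w y = ∫ y in T, k j x y • w y := by
        refine (setIntegral_eq_integral_of_forall_compl_eq_zero fun y hy => ?_).symm
        by_contra h0
        exact hy ((hker j x hxm).supp y fun h' => h0 (by rw [h', zero_smul])).2.1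
      rw [h3, ← integral_inner hi.integrableOn, ← integral_add]
      · refine integral_congr_ae (Eventually.of_forall fun y => ?_)
        simp only [hF, inner_sub_left, inner_smul_right_eq_smul]
        rw [← smul_add, add_sub_cancel]
      · exact hi.integrableOn.const_inner _
      · have h4 : IntegrableOn (fun y => (inner ℂ (g y - g x) (w y) : ℂ)) T := by
          refine (hwT.norm.const_mul (G + G)).mono'
            ((hgm.sub aestronglyMeasurable_const).inner h.meas.aestronglyMeasurable) ?_
          filter_upwards [ae_restrict_mem hTm] with y hy
          refine (norm_inner_le_norm _ _).trans ?_
          gcongr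
          exact (norm_sub_le _ _).trans (add_le_add (hG y (subset_closure hy)) (hG x hxT))
        exact h4.bdd_smul (C * ((r / 4 * (1 / 2) ^ j) ^ d)⁻¹)
          (hker j x hxm).measurable.aestronglyMeasurable
          (Eventually.of_forall (hker j x hxm).bound)
    simp_rw [h2]
    have h3 : Tendsto (fun j => ∫ y in T, k j x y • (inner ℂ (g y - g x) (w y) : ℂ)) atTop (𝓝 0) := by
      rw [Metric.tendsto_atTop]
      intro ε hε
      set K := ε / ((M x).toReal + 1) with hK
      have hM0 : 0 ≤ (M x).toReal := ENNReal.toReal_nonneg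
      have hK0 : 0 < K := by positivity
      obtain ⟨δ, hδ, hδg⟩ := Metric.continuousWithinAt_iff.1 (hg x hxT) K hK0
      obtain ⟨J, hJ⟩ := eventually_atTop.1 (hρ4 (Ioo_mem_nhdsGT hδ))
      refine ⟨J, fun j hj => ?_⟩
      rw [dist_zero_right]
      refine (hle x hxm hx (fun y => g y - g x) K j hK0.le fun y hy hy0 => ?_).trans_lt ?_
      · have h4 := ((hker j x hxm).supp y hy0).1
        have h5 : r / 4 * (1 / 2) ^ j < δ := (hJ j hj).2
        have := hδg (subset_closure hy) (lt_trans h4 h5)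
        rw [dist_eq_norm] at this
        exact this.le
      · rw [hK, div_mul_eq_mul_div, div_lt_iff₀ (by positivity)]
        nlinarith
    have h4 : Tendsto (fun j => (inner ℂ (g x) (∫ y, k j x y • w y) : ℂ)) atTop
        (𝓝 (inner ℂ (g x) (trace Ω w x))) := tendsto_const_nhds.inner h1
    simpa using h4.add h3

/-! ### Matrix fields and normals -/

theorem act_zero (B : Mat m) : act B 0 = 0 := map_zero _

theorem act_add (B : Mat m) (u v : Vc m) : act B (u + v) = act B u + act B v := map_add _ _ _

theorem act_sub (B : Mat m) (u v : Vc m) : act B (u - v) = act B u - act B v := map_sub _ _ _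

theorem act_smul (B : Mat m) (c : ℂ) (v : Vc m) : act B (c • v) = c • act B v := map_smul _ _ _

theorem act_real_smul (B : Mat m) (c : ℝ) (v : Vc m) : act B (c • v) = c • act B v := by
  rw [RCLike.real_smul_eq_coe_smul (K := ℂ), RCLike.real_smul_eq_coe_smul (K := ℂ), act_smul]

theorem add_act (B B' : Mat m) (v : Vc m) : act (B + B') v = act B v + act B' v := by
  simp [act]

theorem sub_act (B B' : Mat m) (v : Vc m) : act (B - B') v = act B v - act B' v := by
  simp [act]

theorem smul_act (c : ℂ) (B : Mat m) (v : Vc m) : act (c • B) v = c • act B v := by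
  simp [act]

theorem sum_act {ι : Type*} (s : Finset ι) (B : ι → Mat m) (v : Vc m) :
    act (∑ i ∈ s, B i) v = ∑ i ∈ s, act (B i) v := by
  simp [act]

theorem norm_act_le (B : Mat m) (v : Vc m) : ‖act B v‖ ≤ ‖B‖ * ‖v‖ := by
  rw [Matrix.cstar_norm_def]; exact ContinuousLinearMap.le_opNorm _ _

theorem inner_act_left (B : Mat m) (u v : Vc m) :
    inner ℂ (act B u) v = inner ℂ u (act Bᴴ v) := by
  have h : Matrix.toEuclideanCLM (n := Fin m) (𝕜 := ℂ) Bᴴ =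
      ContinuousLinearMap.adjoint (Matrix.toEuclideanCLM (n := Fin m) (𝕜 := ℂ) B) := by
    rw [← Matrix.star_eq_conjTranspose, map_star]; rfl
  rw [act, act, h, ContinuousLinearMap.adjoint_inner_right]

theorem continuous_toEuclideanCLM :
    Continuous fun B : Mat m => Matrix.toEuclideanCLM (n := Fin m) (𝕜 := ℂ) B :=
  (AddMonoidHomClass.isometry_of_norm (Matrix.toEuclideanCLM (n := Fin m) (𝕜 := ℂ))
    fun _ => rfl).continuous

/-- The matrix `∑ n_i A^i`. -/
def System.normalField {Ω : Set (Pt d)} (𝓢 : System Ω m) (n x : Pt d) : Mat m :=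
  ∑ i, (n i : ℂ) • 𝓢.A i x

section

variable {Ω : Set (Pt d)} (𝓢 : System Ω m)

theorem System.continuousOn_A (i : Fin d) : ContinuousOn (𝓢.A i) (closure Ω) := by
  obtain ⟨C, hC⟩ := 𝓢.A_holder i
  exact hC.continuousOn (by norm_num)

theorem System.isHermitian_A (i : Fin d) {x : Pt d} (hx : x ∈ closure Ω) :
    (𝓢.A i x).IsHermitian := by
  have h1 : ContinuousOn (fun x => (𝓢.A i x)ᴴ) (closure Ω) :=
    continuous_star.comp_continuousOn (𝓢.continuousOn_A i)
  have h2 : EqOn (fun x => (𝓢.A i x)ᴴ) (𝓢.A i) (closure Ω) :=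
    EqOn.of_subset_closure (s := Ω) (fun x hx => 𝓢.A_hermitian i x hx) h1 (𝓢.continuousOn_A i)
      subset_closure subset_rfl
  exact h2 hx

theorem System.isHermitian_normalField (n : Pt d) {x : Pt d} (hx : x ∈ closure Ω) :
    (𝓢.normalField n x).IsHermitian := by
  unfold System.normalField Matrix.IsHermitian
  rw [Matrix.conjTranspose_sum]
  refine Finset.sum_congr rfl fun i _ => ?_
  rw [Matrix.conjTranspose_smul, (𝓢.isHermitian_A i hx).eq]
  simp

theorem System.normalField_act (n x : Pt d) (v : Vc m) :
    act (𝓢.normalField n x) v = ∑ i, n i • act (𝓢.A i x) v := by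
  rw [System.normalField, sum_act]
  refine Finset.sum_congr rfl fun i _ => ?_
  rw [smul_act, RCLike.real_smul_eq_coe_smul (K := ℂ)]
  rfl

theorem System.continuousOn_normalField (n : Pt d) :
    ContinuousOn (𝓢.normalField n) (closure Ω) := by
  unfold System.normalField
  exact continuousOn_finsetSum _ fun i _ => (𝓢.continuousOn_A i).const_smul (n i : ℂ)

/-- An outward normal of a set at a point is unique, so that `outwardNormal` is meaningful. -/
theorem isOutwardNormal_unique {S : Set (Pt d)} {x n n' : Pt d} (h : IsOutwardNormal S x n)
    (h' : IsOutwardNormal S x n') : n = n' := by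
  obtain ⟨hn, r, hr, h1⟩ := h
  obtain ⟨hn', r', hr', h1'⟩ := h'
  by_contra hne
  have h2 : inner ℝ n n' < 1 := (inner_lt_one_iff_real_of_norm_eq_one hn hn').2 hne
  -- a small multiple of `n' - n` points inside according to `n`, but not according to `n'`
  obtain ⟨t, ht, htr⟩ : ∃ t > 0, t * ‖n' - n‖ < min r r' := by
    have : 0 < ‖n' - n‖ := norm_pos_iff.2 (sub_ne_zero.2 (Ne.symm hne))
    refine ⟨min r r' / (2 * ‖n' - n‖), by positivity, ?_⟩
    have h3 : 0 < min r r' := lt_min hr hr'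
    rw [div_mul_eq_mul_div, div_lt_iff₀ (by positivity)]
    nlinarith
  set y := x + t • (n' - n) with hy
  have hyx : y - x = t • (n' - n) := by rw [hy]; abel
  have hb : dist y x < min r r' := by
    rw [dist_eq_norm, hyx, norm_smul, Real.norm_of_nonneg ht.le]; exact htr
  have h4 : y ∈ S ∩ Metric.ball x r := by
    rw [h1]
    refine ⟨lt_of_lt_of_le hb (min_le_left _ _), ?_⟩
    rw [hyx, inner_smul_right, inner_sub_right, real_inner_self_eq_norm_sq, hn]
    nlinarith
  have h5 : y ∈ S ∩ Metric.ball x r' := ⟨h4.1, lt_of_lt_of_le hb (min_le_right _ _)⟩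
  rw [h1'] at h5
  have h6 := h5.2
  rw [hyx, inner_smul_right, inner_sub_right, real_inner_self_eq_norm_sq, hn', real_inner_comm] at h6
  nlinarith

theorem outwardNormal_eq {S : Set (Pt d)} {x n : Pt d} (h : IsOutwardNormal S x n) :
    outwardNormal S x = n := by
  have hex : ∃ n, IsOutwardNormal S x n := ⟨n, h⟩
  rw [outwardNormal, dif_pos hex]
  exact isOutwardNormal_unique hex.choose_spec h

theorem IsFlatAt.outwardNormal_eq {T Ω : Set (Pt d)} {x₀ n : Pt d} {r : ℝ}
    (h : IsFlatAt T Ω x₀ n r) (hT : IsOpen T) {x : Pt d} (hx : x ∈ Metric.ball x₀ r)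
    (hxT : x ∈ frontier T) : outwardNormal T x = n := by
  have hxn := h.frontier_subset hT hx hxT
  refine Friedrichs.outwardNormal_eq ⟨h.unit, r - dist x x₀, sub_pos.2 hx, ?_⟩
  have hsub : Metric.ball x (r - dist x x₀) ⊆ Metric.ball x₀ r :=
    Metric.ball_subset_ball' (by linarith)
  have hiff : ∀ y, inner ℝ n (y - x₀) = inner ℝ n (y - x) := fun y => by
    have : y - x₀ = (y - x) + (x - x₀) := by abel
    rw [this, inner_add_right, hxn, add_zero]
  ext y
  constructor
  · rintro ⟨h1, h2⟩
    exact ⟨h2, hiff y ▸ h.inner_of_mem (hsub h2) h1⟩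
  · rintro ⟨h1, h2⟩
    exact ⟨(h.mem_of_neg (hsub h1) (by rw [hiff]; exact h2)).1, h1⟩

/-! ### Integration by parts near a flat boundary point -/

/-- The formal adjoint `φ ↦ (∇·A) φ + A_1 φ` of `-A_1`. -/
def System.adj (φ : Pt d → Vc m) (x : Pt d) : Vc m := act (𝓢.divA x) (φ x) + 𝓢.A1 φ x

theorem System.memLp_A1 {φ : Pt d → Vc m} (h : ContDiff ℝ ∞ φ) (hc : HasCompactSupport φ) :
    MemLp (𝓢.A1 φ) 2 (volume.restrict Ω) := by
  have h' : IsTest univ φ := ⟨h, hc, subset_univ _⟩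
  refine memLp_finsetSum _ fun i _ => memLp_act (𝓢.A_mem i) ?_
  exact (h'.memLp_partialD i).mono_measure (Measure.restrict_mono (subset_univ _) le_rfl)

theorem System.memLp_adj {φ : Pt d → Vc m} (h : ContDiff ℝ ∞ φ) (hc : HasCompactSupport φ) :
    MemLp (𝓢.adj φ) 2 (volume.restrict Ω) :=
  (memLp_act 𝓢.divA_mem (h.continuous.memLp_of_hasCompactSupport hc)).add (𝓢.memLp_A1 h hc)

theorem partialD_smul {η : Pt d → ℝ} {φ : Pt d → Vc m} {x : Pt d} (hη : DifferentiableAt ℝ η x)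
    (hφ : DifferentiableAt ℝ φ x) (i : Fin d) :
    partialD i (fun y => η y • φ y) x = η x • partialD i φ x + partialD i η x • φ x := by
  unfold partialD
  rw [show (fun y => η y • φ y) = η • φ from rfl, fderiv_smul hη hφ]
  simp

theorem System.adj_smul {η : Pt d → ℝ} {φ : Pt d → Vc m} {x : Pt d} (hη : DifferentiableAt ℝ η x)
    (hφ : DifferentiableAt ℝ φ x) :
    𝓢.adj (fun y => η y • φ y) x =
      η x • 𝓢.adj φ x + ∑ i, partialD i η x • act (𝓢.A i x) (φ x) := by
  simp only [System.adj, System.A1, partialD_smul hη hφ, act_real_smul, act_add,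
    Finset.sum_add_distrib, smul_add, Finset.smul_sum]
  abel

theorem partialD_of_notMem_tsupport {F : Type*} [NormedAddCommGroup F] [NormedSpace ℝ F]
    {φ : Pt d → F} {x : Pt d} (hx : x ∉ tsupport φ) (i : Fin d) : partialD i φ x = 0 := by
  unfold partialD
  have : x ∉ tsupport (fderiv ℝ φ) := fun h => hx (tsupport_fderiv_subset ℝ h)
  rw [image_eq_zero_of_notMem_tsupport this]
  rfl

theorem System.adj_of_notMem_tsupport {φ : Pt d → Vc m} {x : Pt d} (hx : x ∉ tsupport φ) :
    𝓢.adj φ x = 0 := by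
  simp [System.adj, System.A1, partialD_of_notMem_tsupport hx, act_zero,
    image_eq_zero_of_notMem_tsupport hx]

/-- The integration by parts formula for `w` and `φ` in the part `T` of `Ω`. -/
def System.HasIBP (w : 𝓢.graphSpace) (T : Set (Pt d)) (φ : Pt d → Vc m) : Prop :=
  ip (volume.restrict T) (𝓢.weakA1 w) φ + ip (volume.restrict T) w.1 (𝓢.adj φ) =
    ip ((surf d).restrict (frontier T))
      (fun x => act (𝓢.normalField (outwardNormal T x) x) (trace Ω w.1 x)) φ

theorem System.isWeakA1_weakA1 (w : 𝓢.graphSpace) : 𝓢.IsWeakA1 w.1 (𝓢.weakA1 w) :=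
  Classical.choose_spec (show ∃ g : Lp (Vc m) 2 (volume.restrict Ω), 𝓢.IsWeakA1 w.1 g from w.2)

theorem setIntegral_eq_of_tsupport {T : Set (Pt d)} (hΩ : MeasurableSet Ω)
    (hTΩ : T ⊆ Ω) {F : Pt d → ℂ} (hF : ∀ x ∈ Ω, x ∉ T → F x = 0) :
    ∫ x in Ω, F x = ∫ x in T, F x :=
  setIntegral_eq_of_subset_of_forall_sdiff_eq_zero hΩ hTΩ fun x hx => hF x hx.1 hx.2

/-- The integral over `T` of the weak definition of `A_1 w`, for test functions supported in `T`. -/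
theorem System.weakA1_test (w : 𝓢.graphSpace) {T : Set (Pt d)} (hΩ : MeasurableSet Ω)
    (hTΩ : T ⊆ Ω) {φ : Pt d → Vc m} (hφ : IsTest T φ) :
    ip (volume.restrict T) (𝓢.weakA1 w) φ + ip (volume.restrict T) w.1 (𝓢.adj φ) = 0 := by
  have h := 𝓢.isWeakA1_weakA1 w φ ⟨hφ.1, hφ.2.1, hφ.2.2.trans hTΩ⟩
  have h1 : ∀ x ∈ Ω, x ∉ T → x ∉ tsupport φ := fun x _ hx hx' => hx (hφ.2.2 hx')
  unfold ip at h ⊢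
  rw [setIntegral_eq_of_tsupport hΩ hTΩ fun x hx hxT => by
      rw [image_eq_zero_of_notMem_tsupport (h1 x hx hxT), inner_zero_left],
    setIntegral_eq_of_tsupport hΩ hTΩ fun x hx hxT => by
      rw [show (fun x => act (𝓢.divA x) (φ x) + 𝓢.A1 φ x) x = 𝓢.adj φ x from rfl,
        𝓢.adj_of_notMem_tsupport (h1 x hx hxT), inner_zero_left]] at h
  rw [h]
  exact neg_add_cancel _

theorem System.hasIBP_of_isTest (w : 𝓢.graphSpace) {T : Set (Pt d)} (hΩ : MeasurableSet Ω)
    (hT : IsOpen T) (hTΩ : T ⊆ Ω) {φ : Pt d → Vc m} (hφ : IsTest T φ) : 𝓢.HasIBP w T φ := by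
  rw [System.HasIBP, 𝓢.weakA1_test w hΩ hTΩ hφ, ip]
  symm
  refine setIntegral_eq_zero_of_forall_eq_zero fun x hx => ?_
  rw [frontier, hT.interior_eq] at hx
  rw [image_eq_zero_of_notMem_tsupport fun h => hx.2 (hφ.2.2 h), inner_zero_left]

theorem System.hasIBP_of_tsupport_subset_compl (w : 𝓢.graphSpace) {T : Set (Pt d)}
    {φ : Pt d → Vc m} (hφ : tsupport φ ⊆ (closure T)ᶜ) : 𝓢.HasIBP w T φ := by
  have h1 : ∀ x ∈ closure T, x ∉ tsupport φ := fun x hx h => hφ h hx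
  have h2 : ∀ x ∈ closure T, φ x = 0 := fun x hx => image_eq_zero_of_notMem_tsupport (h1 x hx)
  unfold System.HasIBP ip
  rw [setIntegral_eq_zero_of_forall_eq_zero fun x hx => by
      rw [h2 x (subset_closure hx), inner_zero_left],
    setIntegral_eq_zero_of_forall_eq_zero fun x hx => by
      rw [𝓢.adj_of_notMem_tsupport (h1 x (subset_closure hx)), inner_zero_left],
    setIntegral_eq_zero_of_forall_eq_zero fun x hx => by
      rw [h2 x (frontier_subset_closure hx), inner_zero_left], add_zero]

end

/-- A cut-off of a layer along the hyperplane through `x₀` orthogonal to `n`. -/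
def layerCut (n x₀ : Pt d) (ρ : ℝ) (y : Pt d) : ℝ := step (inner ℝ n (y - x₀) / ρ)

theorem contDiff_layerCut (n x₀ : Pt d) (ρ : ℝ) : ContDiff ℝ ∞ (layerCut n x₀ ρ) := by
  have h : ContDiff ℝ ∞ fun y : Pt d => (inner ℝ n (y - x₀) : ℝ) / ρ :=
    (contDiff_const.inner ℝ (contDiff_id.sub contDiff_const)).div_const _
  exact contDiff_step.comp h

theorem partialD_layerCut (n x₀ : Pt d) (ρ : ℝ) (i : Fin d) (y : Pt d) :
    partialD i (layerCut n x₀ ρ) y = -(ρ⁻¹ * bump (inner ℝ n (y - x₀) / ρ)) * n i := by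
  have h1 : HasFDerivAt (fun y : Pt d => (inner ℝ n (y - x₀) : ℝ) / ρ)
      (ρ⁻¹ • innerSL ℝ n) y := by
    have h2 : HasFDerivAt (fun y : Pt d => ρ⁻¹ * (innerSL ℝ n y - innerSL ℝ n x₀))
        (ρ⁻¹ • innerSL ℝ n) y :=
      ((innerSL ℝ n).hasFDerivAt.sub_const _).const_mul _
    refine h2.congr_of_eventuallyEq (Eventually.of_forall fun z => ?_)
    simp [inner_sub_right, div_eq_inv_mul]
  have h3 := (hasDerivAt_step (inner ℝ n (y - x₀) / ρ)).comp_hasFDerivAt y h1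
  have h4 : fderiv ℝ (layerCut n x₀ ρ) y = _ := h3.fderiv
  rw [partialD, h4]
  simp [EuclideanSpace.inner_single_right]
  ring

theorem tendsto_layerCut {n x₀ y : Pt d} {ρ : ℕ → ℝ} (hρ : Tendsto ρ atTop (𝓝[>] 0))
    (hy : inner ℝ n (y - x₀) < 0) : Tendsto (fun j => layerCut n x₀ (ρ j) y) atTop (𝓝 1) := by
  refine tendsto_const_nhds.congr' ?_
  have h1 : 0 < -inner ℝ n (y - x₀) / 2 := by linarith
  filter_upwards [hρ (Ioo_mem_nhdsGT h1)] with j hj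
  have h2 : ρ j < -inner ℝ n (y - x₀) / 2 := hj.2
  rw [layerCut, step_of_le]
  rw [div_le_iff₀ hj.1]
  linarith

theorem IsFlatAt.isTest_layerCut_smul {T Ω : Set (Pt d)} {x₀ n : Pt d} {r : ℝ}
    (h : IsFlatAt T Ω x₀ n r) {φ : Pt d → Vc m} (hφ : ContDiff ℝ ∞ φ) (hφc : HasCompactSupport φ)
    (hφs : tsupport φ ⊆ Metric.ball x₀ r) {ρ : ℝ} (hρ : 0 < ρ) :
    IsTest T fun y => layerCut n x₀ ρ y • φ y := by
  refine ⟨(contDiff_layerCut n x₀ ρ).smul hφ,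
    HasCompactSupport.smul_left (f := layerCut n x₀ ρ) (f' := φ) hφc, ?_⟩
  have h1 : tsupport (fun y => layerCut n x₀ ρ y • φ y) ⊆
      tsupport φ ∩ {y | inner ℝ n (y - x₀) ≤ -ρ} := by
    refine closure_minimal ?_ ((isClosed_tsupport φ).inter (isClosed_le (by fun_prop)
      continuous_const))
    intro y hy
    have hy' : layerCut n x₀ ρ y • φ y ≠ 0 := hy
    refine ⟨subset_tsupport φ fun h => hy' (by rw [h, smul_zero]), ?_⟩
    by_contra h
    have h2 : layerCut n x₀ ρ y = 0 := by
      rw [layerCut, step_of_ge]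
      rw [le_div_iff₀ hρ]
      simp only [mem_ofPred_eq, not_le] at h
      linarith
    exact hy' (by rw [h2, zero_smul])
  intro y hy
  obtain ⟨h2, h3⟩ := h1 hy
  have h4 : inner ℝ n (y - x₀) ≤ -ρ := h3
  exact (h.mem_of_neg (hφs h2) (by linarith)).1

/-- Dominated convergence for uniformly bounded scalar weights converging to one. -/
theorem tendsto_ip_of_tendsto_one {μ : Measure (Pt d)} {η : ℕ → Pt d → ℝ}
    (hη : ∀ j, Continuous (η j)) (h0 : ∀ j y, 0 ≤ η j y) (h1 : ∀ j y, η j y ≤ 1)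
    {a b : Pt d → Vc m} (ha : MemLp a 2 μ) (hb : MemLp b 2 μ)
    (hlim : ∀ᵐ y ∂μ, b y ≠ 0 → Tendsto (fun j => η j y) atTop (𝓝 1)) :
    Tendsto (fun j => ∫ y, η j y • (inner ℂ (b y) (a y) : ℂ) ∂μ) atTop (𝓝 (ip μ a b)) := by
  have hi := ip_integrable ha hb
  refine tendsto_integral_of_dominated_convergence (fun y => ‖(inner ℂ (b y) (a y) : ℂ)‖)
    (fun j => (hη j).aestronglyMeasurable.smul hi.1) hi.norm (fun j => ?_) ?_
  · refine Eventually.of_forall fun y => ?_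
    rw [norm_smul, Real.norm_of_nonneg (h0 j y)]
    exact mul_le_of_le_one_left (norm_nonneg _) (h1 j y)
  · filter_upwards [hlim] with y hy
    by_cases hb0 : b y = 0
    · simp [hb0]
    · simpa using (hy hb0).smul_const (inner ℂ (b y) (a y) : ℂ)

section

variable {Ω : Set (Pt d)} (𝓢 : System Ω m)

theorem System.continuousOn_normalField_act (n : Pt d) {φ : Pt d → Vc m} (hφ : Continuous φ) :
    ContinuousOn (fun y => act (𝓢.normalField n y) (φ y)) (closure Ω) := by
  have h := continuous_toEuclideanCLM.comp_continuousOn (𝓢.continuousOn_normalField n)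
  exact h.clm_apply hφ.continuousOn

/-- Integration by parts against functions supported near a flat boundary point. The weak
definition of `A_1 w` is tested with `φ` cut off in thinner and thinner layers along the boundary;
the gradients of the cut-offs produce layer integrals, which converge to the boundary term. -/
theorem System.hasIBP_of_isFlatAt (hd : 1 ≤ d) (w : 𝓢.graphSpace) {θ : ℝ}
    (hw : HasTraceReg Ω w.1 θ) {T : Set (Pt d)} (hT : IsPolytopal T) (hΩ : IsPolytopal Ω)
    (hTΩ : T ⊆ Ω) {x₀ n : Pt d} {r : ℝ} (hf : IsFlatAt T Ω x₀ n r) {φ : Pt d → Vc m}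
    (hφ : ContDiff ℝ ∞ φ) (hφs : tsupport φ ⊆ Metric.ball x₀ (r / 4)) : 𝓢.HasIBP w T φ := by
  have hr := hf.pos
  have hTm := hT.isOpen.measurableSet
  have hφc : HasCompactSupport φ := HasCompactSupport.of_support_subset_isCompact
    (isCompact_closedBall x₀ (r / 4))
    (subset_tsupport φ |>.trans (hφs.trans Metric.ball_subset_closedBall))
  have hrT : volume.restrict T ≤ volume.restrict Ω := Measure.restrict_mono hTΩ le_rfl
  -- `g` is the flux of the test function across the hyperplane
  set g : Pt d → Vc m := fun y => act (𝓢.normalField n y) (φ y) with hg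
  have hg0 : ∀ y ∉ Metric.ball x₀ (r / 4), g y = 0 := fun y hy => by
    rw [hg]; dsimp only
    rw [image_eq_zero_of_notMem_tsupport fun h => hy (hφs h), act_zero]
  have hgc : ContinuousOn g (closure T) :=
    (𝓢.continuousOn_normalField_act n hφ.continuous).mono (closure_mono hTΩ)
  have hlay := hw.tendsto_layer hd hT hΩ hTΩ hf hgc hg0
  set ρ : ℕ → ℝ := fun j => r / 16 * (1 / 2 : ℝ) ^ j with hρ
  have hρ0 : ∀ j, 0 < ρ j := fun j => by positivity
  have hρt : Tendsto ρ atTop (𝓝[>] 0) := tendsto_half_pow (by positivity)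
  have hηc : ∀ j, ContDiff ℝ ∞ (layerCut n x₀ (ρ j)) := fun j => contDiff_layerCut n x₀ (ρ j)
  have htest : ∀ j, IsTest T fun y => layerCut n x₀ (ρ j) y • φ y := fun j =>
    hf.isTest_layerCut_smul hφ hφc (hφs.trans (Metric.ball_subset_ball (by linarith))) (hρ0 j)
  have hwL : MemLp w.1 2 (volume.restrict T) := hw.memLp.mono_measure hrT
  have haL : MemLp (𝓢.weakA1 w) 2 (volume.restrict T) := (Lp.memLp _).mono_measure hrT
  have hφL : MemLp φ 2 (volume.restrict T) := hφ.continuous.memLp_of_hasCompactSupport hφc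
  have hdL : MemLp (𝓢.adj φ) 2 (volume.restrict T) := (𝓢.memLp_adj hφ hφc).mono_measure hrT
  have hone : ∀ᵐ y ∂volume.restrict T, y ∈ tsupport φ →
      Tendsto (fun j => layerCut n x₀ (ρ j) y) atTop (𝓝 1) := by
    filter_upwards [ae_restrict_mem hTm] with y hy hyφ
    exact tendsto_layerCut hρt
      (hf.inner_of_mem (Metric.ball_subset_ball (by linarith) (hφs hyφ)) hy)
  have hlim := (tendsto_ip_of_tendsto_one (fun j => (hηc j).continuous)
      (fun _ _ => step_nonneg _) (fun _ _ => step_le_one _) haL hφL (by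
        filter_upwards [hone] with y hy h0
        exact hy (subset_tsupport φ h0))).add
    (tendsto_ip_of_tendsto_one (fun j => (hηc j).continuous)
      (fun _ _ => step_nonneg _) (fun _ _ => step_le_one _) hwL hdL (by
        filter_upwards [hone] with y hy h0
        exact hy (by_contra fun h => h0 (𝓢.adj_of_notMem_tsupport h))))
  -- the product rule: the derivative of the cut-off gives the layer integral of the flux
  have heq : ∀ j, (∫ y in T, layerCut n x₀ (ρ j) y • (inner ℂ (φ y) (𝓢.weakA1 w y) : ℂ)) +
      (∫ y in T, layerCut n x₀ (ρ j) y • (inner ℂ (𝓢.adj φ y) (w.1 y) : ℂ)) =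
      ∫ y in T, ((ρ j)⁻¹ * bump (inner ℝ n (y - x₀) / ρ j)) • (inner ℂ (g y) (w.1 y) : ℂ) := by
    intro j
    have h1 := 𝓢.weakA1_test w hΩ.isOpen.measurableSet hTΩ (htest j)
    have h2 : ∀ y, 𝓢.adj (fun y => layerCut n x₀ (ρ j) y • φ y) y = layerCut n x₀ (ρ j) y • 𝓢.adj φ y -
        ((ρ j)⁻¹ * bump (inner ℝ n (y - x₀) / ρ j)) • g y := by
      intro y
      rw [𝓢.adj_smul ((hηc j).differentiable (by simp) y) (hφ.differentiable (by simp) y), hg]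
      dsimp only
      rw [𝓢.normalField_act, sub_eq_add_neg, Finset.smul_sum, ← Finset.sum_neg_distrib]
      congr 1
      refine Finset.sum_congr rfl fun i _ => ?_
      rw [partialD_layerCut, mul_smul, neg_smul]
    have hgL : MemLp g 2 (volume.restrict T) := by
      have : IsCompact (closure T) :=
        Metric.isCompact_of_isClosed_isBounded isClosed_closure hT.isBounded.closure
      obtain ⟨G, hG⟩ := this.exists_bound_of_continuousOn hgc
      have hfin : IsFiniteMeasure (volume.restrict T) :=
        ⟨by rw [Measure.restrict_apply_univ]; exact hT.isBounded.measure_lt_top⟩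
      refine MemLp.of_bound ((hgc.mono subset_closure).aestronglyMeasurable hTm) G ?_
      filter_upwards [ae_restrict_mem hTm] with y hy
      exact hG y (subset_closure hy)
    have hi1 : Integrable (fun y => layerCut n x₀ (ρ j) y • (inner ℂ (𝓢.adj φ y) (w.1 y) : ℂ))
        (volume.restrict T) :=
      (ip_integrable hwL hdL).bdd_smul 1 (hηc j).continuous.aestronglyMeasurable
        (Eventually.of_forall fun y => by
          rw [layerCut, Real.norm_of_nonneg (step_nonneg _)]; exact step_le_one _)
    obtain ⟨B, -, hB⟩ := exists_bump_le
    have hi2 : Integrable (fun y => ((ρ j)⁻¹ * bump (inner ℝ n (y - x₀) / ρ j)) •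
        (inner ℂ (g y) (w.1 y) : ℂ)) (volume.restrict T) := by
      refine Integrable.bdd_smul (𝕜 := ℝ) (φ := fun y =>
        (ρ j)⁻¹ * bump (inner ℝ n (y - x₀) / ρ j)) (ip_integrable hwL hgL) ((ρ j)⁻¹ * B) ?_ (Eventually.of_forall fun y => ?_)
      · have : Continuous fun y : Pt d => (ρ j)⁻¹ * bump (inner ℝ n (y - x₀) / ρ j) :=
          continuous_const.mul (continuous_bump.comp (by fun_prop))
        exact this.aestronglyMeasurable
      · have := bump_nonneg (inner ℝ n (y - x₀) / ρ j)
        have h3 := (hρ0 j).le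
        rw [Real.norm_of_nonneg (by positivity)]
        gcongr
        exact hB _
    unfold ip at h1
    simp only [h2, inner_sub_left, inner_smul_left_eq_smul] at h1
    rw [integral_sub hi1 hi2] at h1
    linear_combination h1
  have hfin := tendsto_nhds_unique (hlim.congr heq) hlay
  rw [System.HasIBP, hfin, ip]
  refine setIntegral_congr_fun isClosed_frontier.measurableSet fun x hx => ?_
  by_cases hxφ : x ∈ tsupport φ
  · have h1 := hf.outwardNormal_eq hT.isOpen (Metric.ball_subset_ball (by linarith) (hφs hxφ)) hx
    rw [h1, hg, inner_act_left, (𝓢.isHermitian_normalField n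
      (closure_mono hTΩ (frontier_subset_closure hx))).eq]
  · simp [hg, image_eq_zero_of_notMem_tsupport hxφ, act_zero]

end

/-! ### Integration by parts away from the edges -/

theorem ip_add_right {μ : Measure (Pt d)} {a b b' : Pt d → Vc m} (ha : MemLp a 2 μ)
    (hb : MemLp b 2 μ) (hb' : MemLp b' 2 μ) :
    ip μ a (fun x => b x + b' x) = ip μ a b + ip μ a b' := by
  unfold ip
  rw [← integral_add (ip_integrable ha hb) (ip_integrable ha hb')]
  simp [inner_add_left]

/-- An additive property of test functions that holds locally near every point holds globally. -/
theorem forall_test_of_local {P : (Pt d → Vc m) → Prop} (h0 : P 0)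
    (hadd : ∀ φ ψ, ContDiff ℝ ∞ φ → HasCompactSupport φ → ContDiff ℝ ∞ ψ → HasCompactSupport ψ →
      P φ → P ψ → P fun x => φ x + ψ x)
    {φ : Pt d → Vc m} (hφ : ContDiff ℝ ∞ φ) (hφc : HasCompactSupport φ)
    (hloc : ∀ x ∈ tsupport φ, ∃ δ > 0, ∀ ψ : Pt d → Vc m, ContDiff ℝ ∞ ψ →
      tsupport ψ ⊆ Metric.ball x δ → tsupport ψ ⊆ tsupport φ → P ψ) : P φ := by
  choose! δ hδ hP using hloc
  obtain ⟨t, hcov⟩ := hφc.isCompact.elim_nhds_subcover' (fun x _ => Metric.ball x (δ x))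
    (fun x hx => Metric.ball_mem_nhds x (hδ x hx))
  obtain ⟨f, hf⟩ := SmoothPartitionOfUnity.exists_isSubordinate (modelWithCornersSelf ℝ (Pt d))
    (isClosed_tsupport φ) (fun x : t => Metric.ball (x.1 : Pt d) (δ x.1))
    (fun _ => Metric.isOpen_ball) (by
      intro y hy
      have h1 := hcov hy
      simp only [mem_iUnion] at h1 ⊢
      obtain ⟨x, hx, hy⟩ := h1
      exact ⟨⟨x, hx⟩, hy⟩)
  have hfs : ∀ i, ContDiff ℝ ∞ (f i) := fun i => contMDiff_iff_contDiff.1 (f i).contMDiff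
  have hsum : φ = fun x => ∑ i, f i x • φ x := by
    funext x
    by_cases hx : x ∈ tsupport φ
    · have h1 := f.sum_eq_one hx
      rw [finsum_eq_sum_of_fintype] at h1
      rw [← Finset.sum_smul, h1, one_smul]
    · simp [image_eq_zero_of_notMem_tsupport hx]
  have hs : ∀ i, ContDiff ℝ ∞ fun x => f i x • φ x := fun i => (hfs i).smul hφ
  have hc : ∀ i, HasCompactSupport fun x => f i x • φ x := fun i =>
    HasCompactSupport.smul_left (f := f i) (f' := φ) hφc
  have hfin : ∀ s : Finset t, P fun x => ∑ i ∈ s, f i x • φ x := by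
    classical
    intro s
    induction s using Finset.induction_on with
    | empty => simp only [Finset.sum_empty]; exact h0
    | insert i s hi ih =>
      simp only [Finset.sum_insert hi]
      refine hadd _ _ (hs i) (hc i) (ContDiff.sum fun j _ => hs j) ?_ ?_ ih
      · refine hφc.mono' fun x hx => subset_tsupport φ fun h => hx ?_
        simp [h]
      · refine hP i.1.1 i.1.2 _ (hs i) ?_ ?_
        · exact (tsupport_smul_subset_left _ _).trans (hf i)
        · exact tsupport_smul_subset_right _ _
  rw [hsum]
  exact hfin Finset.univ

theorem isClosed_edgeSet {N : Set (Pt d × ℝ)} (hN : N.Finite) : IsClosed (edgeSet N) := by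
  have : edgeSet N = ⋃ ℓ ∈ N, ⋃ ℓ' ∈ {ℓ' ∈ N | ℓ'.1 ≠ ℓ.1 ∧ ℓ'.1 ≠ -ℓ.1},
      hyp ℓ.1 ℓ.2 ∩ hyp ℓ'.1 ℓ'.2 := by
    ext x
    simp only [edgeSet, mem_iUnion, mem_ofPred_eq, mem_inter_iff, mem_hyp_iff_side, exists_prop]
    constructor
    · rintro ⟨ℓ, hℓ, ℓ', hℓ', h1, h2, h3, h4⟩
      exact ⟨ℓ, hℓ, ℓ', ⟨hℓ', h1, h2⟩, h3, h4⟩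
    · rintro ⟨ℓ, hℓ, ℓ', ⟨hℓ', h1, h2⟩, h3, h4⟩
      exact ⟨ℓ, hℓ, ℓ', hℓ', h1, h2, h3, h4⟩
  rw [this]
  refine hN.isClosed_biUnion fun ℓ _ => (hN.subset (sep_subset _ _)).isClosed_biUnion fun ℓ' _ => ?_
  exact (isClosed_hyp _ _).inter (isClosed_hyp _ _)

section

variable {Ω : Set (Pt d)} (𝓢 : System Ω m)

theorem System.exists_norm_A_le (hΩ : Bornology.IsBounded Ω) :
    ∃ G, 0 ≤ G ∧ ∀ i, ∀ x ∈ closure Ω, ‖𝓢.A i x‖ ≤ G := by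
  have hc : IsCompact (closure Ω) :=
    Metric.isCompact_of_isClosed_isBounded isClosed_closure hΩ.closure
  choose G hG using fun i => hc.exists_bound_of_continuousOn (𝓢.continuousOn_A i)
  refine ⟨∑ i, |G i|, by positivity, fun i x hx => (hG i x hx).trans ((le_abs_self _).trans ?_)⟩
  exact Finset.single_le_sum (f := fun i => |G i|) (fun _ _ => abs_nonneg _) (Finset.mem_univ i)

theorem System.norm_normalField_le {G : ℝ} (hG : ∀ i, ∀ x ∈ closure Ω, ‖𝓢.A i x‖ ≤ G)
    {n x : Pt d} (hn : ‖n‖ ≤ 1) (hx : x ∈ closure Ω) : ‖𝓢.normalField n x‖ ≤ d * G := by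
  refine (norm_sum_le _ _).trans ?_
  calc ∑ i, ‖(n i : ℂ) • 𝓢.A i x‖ ≤ ∑ _i : Fin d, G := by
        refine Finset.sum_le_sum fun i _ => ?_
        rw [norm_smul]
        have h1 : ‖(n i : ℂ)‖ ≤ 1 := by
          rw [Complex.norm_real]
          exact (PiLp.norm_apply_le n i).trans hn
        exact (mul_le_of_le_one_left (norm_nonneg _) h1).trans (hG i x hx)
    _ = d * G := by simp

theorem norm_outwardNormal_le (S : Set (Pt d)) (x : Pt d) : ‖outwardNormal S x‖ ≤ 1 := by
  unfold outwardNormal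
  split_ifs with h
  · exact h.choose_spec.1.le
  · simp

/-- The normal field of a polytopal set is locally constant away from the edges. -/
theorem aestronglyMeasurable_outwardNormal (hd : 1 ≤ d) {T : Set (Pt d)} (hT : IsPolytopal T) :
    AEStronglyMeasurable (outwardNormal T) ((surf d).restrict (frontier T)) := by
  obtain ⟨N, hN, hu, hflat⟩ := exists_isFlatAt hd hT hT subset_rfl
  have h1 : ContinuousOn (outwardNormal T) (frontier T \ edgeSet N) := by
    rintro x₀ ⟨hx₀, he⟩
    obtain ⟨ℓ, -, -, n, -, r, hf⟩ := hflat x₀ hx₀ he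
    have h2 : ContinuousWithinAt (fun _ => n) (frontier T \ edgeSet N) x₀ :=
      continuousWithinAt_const
    refine h2.congr_of_eventuallyEq ?_
      (hf.outwardNormal_eq hT.isOpen (Metric.mem_ball_self hf.pos) hx₀)
    filter_upwards [self_mem_nhdsWithin,
      mem_nhdsWithin_of_mem_nhds (Metric.ball_mem_nhds x₀ hf.pos)] with y hy hyb
    exact hf.outwardNormal_eq hT.isOpen hyb hy.1
  have h3 := h1.aestronglyMeasurable (μ := surf d)
    (isClosed_frontier.measurableSet.diff (isClosed_edgeSet hN).measurableSet)
  have h4 : (frontier T \ edgeSet N : Set (Pt d)) =ᵐ[surf d] frontier T :=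
    sdiff_null_ae_eq_self (surf_edgeSet hN hu)
  rwa [Measure.restrict_congr_set h4] at h3

/-- The boundary flux of `w` is square integrable. -/
theorem System.memLp_normalField_trace (hd : 1 ≤ d) {w : Pt d → Vc m} {θ : ℝ}
    (hw : HasTraceReg Ω w θ) {T : Set (Pt d)} (hT : IsPolytopal T) (hΩ : IsPolytopal Ω)
    (hTΩ : T ⊆ Ω) :
    MemLp (fun x => act (𝓢.normalField (outwardNormal T x) x) (trace Ω w x)) 2
      ((surf d).restrict (frontier T)) := by
  have htr := hw.memLp_trace hd hT hΩ hTΩ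
  have hsub : frontier T ⊆ closure Ω := frontier_subset_closure.trans (closure_mono hTΩ)
  obtain ⟨G, hG0, hG⟩ := 𝓢.exists_norm_A_le hΩ.isBounded
  have hn := aestronglyMeasurable_outwardNormal hd hT
  have hm : AEStronglyMeasurable (fun x => act (𝓢.normalField (outwardNormal T x) x)
      (trace Ω w x)) ((surf d).restrict (frontier T)) := by
    simp only [System.normalField_act]
    refine Finset.aestronglyMeasurable_fun_sum _ fun i _ => AEStronglyMeasurable.smul
      (f := fun x => outwardNormal T x i) (g := fun x => act (𝓢.A i x) (trace Ω w x)) ?_ ?_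
    · exact (EuclideanSpace.proj (𝕜 := ℝ) i).continuous.comp_aestronglyMeasurable hn
    · have hA : AEStronglyMeasurable (𝓢.A i) ((surf d).restrict (frontier T)) :=
        ((𝓢.continuousOn_A i).mono hsub).aestronglyMeasurable isClosed_frontier.measurableSet
      exact isBoundedBilinearMap_apply.continuous.comp_aestronglyMeasurable
        ((continuous_toEuclideanCLM.comp_aestronglyMeasurable hA).prodMk htr.1)
  refine MemLp.of_le_mul (c := d * G) htr hm ?_
  filter_upwards [ae_restrict_mem isClosed_frontier.measurableSet] with x hx
  refine (norm_act_le _ _).trans ?_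
  gcongr
  exact 𝓢.norm_normalField_le hG (norm_outwardNormal_le _ _) (hsub hx)

theorem System.adj_add {φ ψ : Pt d → Vc m} (hφ : Differentiable ℝ φ) (hψ : Differentiable ℝ ψ) :
    𝓢.adj (fun x => φ x + ψ x) = fun x => 𝓢.adj φ x + 𝓢.adj ψ x := by
  funext x
  have h1 : ∀ i, partialD i (fun x => φ x + ψ x) x = partialD i φ x + partialD i ψ x := fun i => by
    unfold partialD
    rw [show (fun x => φ x + ψ x) = φ + ψ from rfl, fderiv_add (hφ x) (hψ x)]
    rfl
  simp only [System.adj, System.A1, h1, act_add, Finset.sum_add_distrib]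
  abel

theorem System.HasIBP.add (hd : 1 ≤ d) {w : 𝓢.graphSpace} {θ : ℝ} (hw : HasTraceReg Ω w.1 θ)
    {T : Set (Pt d)} (hT : IsPolytopal T) (hΩ : IsPolytopal Ω) (hTΩ : T ⊆ Ω) {φ ψ : Pt d → Vc m}
    (hφ : ContDiff ℝ ∞ φ) (hφc : HasCompactSupport φ) (hψ : ContDiff ℝ ∞ ψ)
    (hψc : HasCompactSupport ψ) (h : 𝓢.HasIBP w T φ) (h' : 𝓢.HasIBP w T ψ) :
    𝓢.HasIBP w T fun x => φ x + ψ x := by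
  have hrT : volume.restrict T ≤ volume.restrict Ω := Measure.restrict_mono hTΩ le_rfl
  have hfin := hT.isFiniteMeasure_frontier hd
  have hfinc : IsFiniteMeasureOnCompacts ((surf d).restrict (frontier T)) := inferInstance
  have hwL : MemLp w.1 2 (volume.restrict T) := hw.memLp.mono_measure hrT
  have haL : MemLp (𝓢.weakA1 w) 2 (volume.restrict T) := (Lp.memLp _).mono_measure hrT
  unfold System.HasIBP at h h' ⊢
  rw [𝓢.adj_add (hφ.differentiable (by simp)) (hψ.differentiable (by simp)),
    ip_add_right haL (hφ.continuous.memLp_of_hasCompactSupport hφc)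
      (hψ.continuous.memLp_of_hasCompactSupport hψc),
    ip_add_right hwL ((𝓢.memLp_adj hφ hφc).mono_measure hrT)
      ((𝓢.memLp_adj hψ hψc).mono_measure hrT),
    ip_add_right (𝓢.memLp_normalField_trace hd hw hT hΩ hTΩ)
      (hφ.continuous.memLp_of_hasCompactSupport hφc)
      (hψ.continuous.memLp_of_hasCompactSupport hψc), ← h, ← h']
  ring

theorem System.hasIBP_zero (w : 𝓢.graphSpace) (T : Set (Pt d)) : 𝓢.HasIBP w T 0 := by
  have : 𝓢.adj 0 = 0 := by
    funext x
    exact 𝓢.adj_of_notMem_tsupport (by simp)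
  simp [System.HasIBP, this, ip]

/-- Integration by parts against test functions that vanish near the edges. -/
theorem System.hasIBP_of_disjoint_edgeSet (hd : 1 ≤ d) {w : 𝓢.graphSpace} {θ : ℝ}
    (hw : HasTraceReg Ω w.1 θ) {T : Set (Pt d)} (hT : IsPolytopal T) (hΩ : IsPolytopal Ω)
    (hTΩ : T ⊆ Ω) {N : Set (Pt d × ℝ)} (hflat : ∀ x ∈ frontier T, x ∉ edgeSet N →
      ∃ n r, IsFlatAt T Ω x n r) {φ : Pt d → Vc m}
    (hφ : ContDiff ℝ ∞ φ) (hφc : HasCompactSupport φ) (hφN : Disjoint (tsupport φ) (edgeSet N)) :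
    𝓢.HasIBP w T φ := by
  refine forall_test_of_local (𝓢.hasIBP_zero w T)
    (fun φ ψ hφ hφc hψ hψc h h' => h.add 𝓢 hd hw hT hΩ hTΩ hφ hφc hψ hψc h') hφ hφc fun x hx => ?_
  by_cases hxT : x ∈ T
  · obtain ⟨δ, hδ, hb⟩ := Metric.isOpen_iff.1 hT.isOpen x hxT
    exact ⟨δ, hδ, fun ψ hψ hψb hψφ => 𝓢.hasIBP_of_isTest w hΩ.isOpen.measurableSet hT.isOpen hTΩ
      ⟨hψ, hφc.of_isClosed_subset (isClosed_tsupport ψ) hψφ, hψb.trans hb⟩⟩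
  by_cases hxc : x ∈ closure T
  · obtain ⟨n, r, hf⟩ := hflat x (by rw [frontier, hT.isOpen.interior_eq]; exact ⟨hxc, hxT⟩)
      (disjoint_left.1 hφN hx)
    exact ⟨r / 4, by linarith [hf.pos], fun ψ hψ hψb _ =>
      𝓢.hasIBP_of_isFlatAt hd w hw hT hΩ hTΩ hf hψ hψb⟩
  · obtain ⟨δ, hδ, hb⟩ := Metric.isOpen_iff.1 isClosed_closure.isOpen_compl x hxc
    exact ⟨δ, hδ, fun ψ _ hψb _ => 𝓢.hasIBP_of_tsupport_subset_compl w (hψb.trans hb)⟩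

end

/-! ### Removal of the edges -/

/-- The square of the distances to two hyperplanes, up to equivalence that to their
intersection. -/
def edgeSq (ℓ ℓ' : Pt d × ℝ) (x : Pt d) : ℝ := side ℓ x ^ 2 + side ℓ' x ^ 2

/-- A cut-off that vanishes at distance about `1 / N` from the intersection of two hyperplanes. -/
def edgeCut (ℓ ℓ' : Pt d × ℝ) (N : ℕ) (x : Pt d) : ℝ := step (-((N : ℝ) ^ 2 * edgeSq ℓ ℓ' x))

theorem contDiff_side (ℓ : Pt d × ℝ) : ContDiff ℝ ∞ (side ℓ) :=
  (contDiff_const.inner ℝ contDiff_id).sub contDiff_const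

theorem hasFDerivAt_side (ℓ : Pt d × ℝ) (x : Pt d) : HasFDerivAt (side ℓ) (innerSL ℝ ℓ.1) x :=
  (innerSL ℝ ℓ.1).hasFDerivAt.sub_const _

theorem contDiff_edgeCut (ℓ ℓ' : Pt d × ℝ) (N : ℕ) : ContDiff ℝ ∞ (edgeCut ℓ ℓ' N) := by
  have h : ContDiff ℝ ∞ fun x => -((N : ℝ) ^ 2 * edgeSq ℓ ℓ' x) :=
    (contDiff_const.mul (((contDiff_side ℓ).pow 2).add ((contDiff_side ℓ').pow 2))).neg
  exact contDiff_step.comp h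

theorem partialD_edgeCut (ℓ ℓ' : Pt d × ℝ) (N : ℕ) (i : Fin d) (x : Pt d) :
    partialD i (edgeCut ℓ ℓ' N) x = bump (-((N : ℝ) ^ 2 * edgeSq ℓ ℓ' x)) *
      ((N : ℝ) ^ 2 * (2 * side ℓ x * ℓ.1 i + 2 * side ℓ' x * ℓ'.1 i)) := by
  have h1 : HasFDerivAt (fun x => -((N : ℝ) ^ 2 * edgeSq ℓ ℓ' x))
      (-((N : ℝ) ^ 2 • ((2 * side ℓ x) • innerSL ℝ ℓ.1 + (2 * side ℓ' x) • innerSL ℝ ℓ'.1))) x := by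
    have h2 := (hasFDerivAt_side ℓ x).pow 2
    have h3 := (hasFDerivAt_side ℓ' x).pow 2
    have h4 := ((h2.add h3).const_mul ((N : ℝ) ^ 2)).neg
    refine h4.congr_fderiv ?_
    ext v
    simp
  have h3 := (hasDerivAt_step (-((N : ℝ) ^ 2 * edgeSq ℓ ℓ' x))).comp_hasFDerivAt x h1
  have h4 : fderiv ℝ (edgeCut ℓ ℓ' N) x = _ := h3.fderiv
  rw [partialD, h4]
  simp [EuclideanSpace.inner_single_right]
  ring

/-- The support of the gradients of the cut-offs. -/
def edgeNhd (ℓ ℓ' : Pt d × ℝ) (N : ℕ) : Set (Pt d) := {x | (N : ℝ) ^ 2 * edgeSq ℓ ℓ' x ≤ 2}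

theorem continuous_edgeSq (ℓ ℓ' : Pt d × ℝ) : Continuous (edgeSq ℓ ℓ') :=
  ((continuous_side ℓ).pow 2).add ((continuous_side ℓ').pow 2)

theorem isClosed_edgeNhd (ℓ ℓ' : Pt d × ℝ) (N : ℕ) : IsClosed (edgeNhd ℓ ℓ' N) :=
  isClosed_le (continuous_const.mul (continuous_edgeSq ℓ ℓ')) continuous_const

theorem abs_side_le_of_mem_edgeNhd {ℓ ℓ' : Pt d × ℝ} {N : ℕ} (hN : 0 < N) {x : Pt d}
    (hx : x ∈ edgeNhd ℓ ℓ' N) : |side ℓ x| ≤ 2 / N ∧ |side ℓ' x| ≤ 2 / N := by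
  have hN' : (0 : ℝ) < N := by exact_mod_cast hN
  have hx' : (N : ℝ) ^ 2 * (side ℓ x ^ 2 + side ℓ' x ^ 2) ≤ 2 := hx
  constructor <;>
  · refine abs_le_of_sq_le_sq ?_ (by positivity)
    rw [div_pow, le_div_iff₀ (by positivity)]
    nlinarith [sq_nonneg (side ℓ x), sq_nonneg (side ℓ' x),
      mul_nonneg (sq_nonneg (N : ℝ)) (sq_nonneg (side ℓ x)),
      mul_nonneg (sq_nonneg (N : ℝ)) (sq_nonneg (side ℓ' x))]

/-- The gradient of the cut-off is of order `N` and lives in the neighbourhood of width `1 / N`.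
-/
theorem abs_partialD_edgeCut_le {ℓ ℓ' : Pt d × ℝ} (hu : ‖ℓ.1‖ = 1) (hu' : ‖ℓ'.1‖ = 1) {B : ℝ}
    (hB : ∀ τ, bump τ ≤ B) {N : ℕ} (hN : 0 < N) (i : Fin d) (x : Pt d) :
    |partialD i (edgeCut ℓ ℓ' N) x| ≤ (edgeNhd ℓ ℓ' N).indicator (fun _ => 8 * B * N) x := by
  have hN' : (0 : ℝ) < N := by exact_mod_cast hN
  by_cases hx : x ∈ edgeNhd ℓ ℓ' N
  · rw [indicator_of_mem hx, partialD_edgeCut, abs_mul, abs_mul, abs_of_nonneg (bump_nonneg _),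
      abs_of_nonneg (by positivity : (0 : ℝ) ≤ (N : ℝ) ^ 2)]
    obtain ⟨h1, h2⟩ := abs_side_le_of_mem_edgeNhd hN hx
    have h3 : |ℓ.1 i| ≤ 1 := (PiLp.norm_apply_le ℓ.1 i).trans hu.le
    have h4 : |ℓ'.1 i| ≤ 1 := (PiLp.norm_apply_le ℓ'.1 i).trans hu'.le
    have h5 : |2 * side ℓ x * ℓ.1 i + 2 * side ℓ' x * ℓ'.1 i| ≤ 8 / N := by
      refine (abs_add_le _ _).trans ?_
      rw [abs_mul, abs_mul, abs_mul, abs_mul, abs_two]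
      have h6 : |side ℓ x| * |ℓ.1 i| ≤ 2 / N * 1 := by gcongr
      have h7 : |side ℓ' x| * |ℓ'.1 i| ≤ 2 / N * 1 := by gcongr
      have h8 : (8 : ℝ) / N = 2 * (2 / N * 1) + 2 * (2 / N * 1) := by ring
      rw [h8]
      linarith
    have hB0 : 0 ≤ B := (bump_nonneg 0).trans (hB 0)
    calc bump (-((N : ℝ) ^ 2 * edgeSq ℓ ℓ' x)) *
          ((N : ℝ) ^ 2 * |2 * side ℓ x * ℓ.1 i + 2 * side ℓ' x * ℓ'.1 i|)
        ≤ B * ((N : ℝ) ^ 2 * (8 / N)) := by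
          gcongr
          exact hB _
      _ = 8 * B * N := by field_simp
  · rw [indicator_of_notMem hx, partialD_edgeCut, bump_eq_zero, zero_mul, abs_zero]
    simp only [edgeNhd, mem_ofPred_eq, not_le] at hx
    simp only [mem_Icc, not_and_or, not_le]
    left; linarith

/-- A neighbourhood of width `1 / N` of the intersection of two transversal hyperplanes has
measure of order `1 / N ^ 2`: there is room for `N ^ 2` disjoint translates of it. -/
theorem exists_volume_edgeNhd_le {ℓ ℓ' : Pt d × ℝ} (hu : ‖ℓ.1‖ = 1) (hu' : ‖ℓ'.1‖ = 1)
    (h1 : ℓ'.1 ≠ ℓ.1) (h2 : ℓ'.1 ≠ -ℓ.1) (R : ℝ) :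
    ∃ C : ℝ≥0∞, C ≠ ⊤ ∧ ∀ N : ℕ, 0 < N →
      (N : ℝ≥0∞) ^ 2 * volume (edgeNhd ℓ ℓ' N ∩ Metric.ball 0 R) ≤ C := by
  set a : ℝ := inner ℝ ℓ.1 ℓ'.1 with ha
  have ha1 : a < 1 := (inner_lt_one_iff_real_of_norm_eq_one hu hu').2 h1.symm
  have ha2 : -1 < a := by
    have h3 : inner ℝ ℓ.1 (-ℓ'.1) < 1 := (inner_lt_one_iff_real_of_norm_eq_one hu
      (by rwa [norm_neg])).2 fun h => h2 (by rw [h, neg_neg])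
    rw [inner_neg_right] at h3
    linarith
  have ha3 : 0 < 1 - a ^ 2 := by nlinarith
  -- `u`, `u'` is the basis dual to the two normals in their span
  set u : Pt d := (1 - a ^ 2)⁻¹ • (ℓ.1 - a • ℓ'.1) with hudef
  set u' : Pt d := (1 - a ^ 2)⁻¹ • (ℓ'.1 - a • ℓ.1) with hudef'
  have i1 : inner ℝ ℓ.1 u = 1 := by
    rw [hudef, inner_smul_right, inner_sub_right, inner_smul_right, real_inner_self_eq_norm_sq, hu, ← ha]
    field_simp
  have i2 : inner ℝ ℓ.1 u' = 0 := by
    rw [hudef', inner_smul_right, inner_sub_right, inner_smul_right, real_inner_self_eq_norm_sq, hu, ← ha]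
    ring
  have i3 : inner ℝ ℓ'.1 u = 0 := by
    rw [hudef, inner_smul_right, inner_sub_right, inner_smul_right, real_inner_self_eq_norm_sq, hu',
      real_inner_comm, ← ha]
    ring
  have i4 : inner ℝ ℓ'.1 u' = 1 := by
    rw [hudef', inner_smul_right, inner_sub_right, inner_smul_right, real_inner_self_eq_norm_sq, hu',
      real_inner_comm, ← ha]
    field_simp
  refine ⟨volume (Metric.ball (0 : Pt d) (R + 5 * (‖u‖ + ‖u'‖))), measure_ball_lt_top.ne,
    fun N hN => ?_⟩
  have hN' : (0 : ℝ) < N := by exact_mod_cast hN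
  set V := edgeNhd ℓ ℓ' N ∩ Metric.ball 0 R with hV
  have hVm : MeasurableSet V :=
    (isClosed_edgeNhd ℓ ℓ' N).measurableSet.inter Metric.isOpen_ball.measurableSet
  -- translations by multiples of `5 / N`, more than the width `4 / N` of the neighbourhood
  set v : ℕ × ℕ → Pt d := fun p => (5 * p.1 / N : ℝ) • u + (5 * p.2 / N : ℝ) • u' with hv
  set s := Finset.range N ×ˢ Finset.range N with hs
  set W : ℕ × ℕ → Set (Pt d) := fun p => (fun x => x + -v p) ⁻¹' V with hW
  have hside : ∀ p x, side ℓ (x + -v p) = side ℓ x - 5 * p.1 / N ∧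
      side ℓ' (x + -v p) = side ℓ' x - 5 * p.2 / N := by
    intro p x
    constructor
    · simp only [side, hv, inner_add_right, inner_neg_right, inner_smul_right, i1, i2]; ring
    · simp only [side, hv, inner_add_right, inner_neg_right, inner_smul_right, i3, i4]; ring
  have hsep : ∀ (b : ℝ) (i j : ℕ), |b - 5 * i / N| ≤ 2 / N → |b - 5 * j / N| ≤ 2 / N → i = j := by
    intro b i j hi hj
    have h3 : |(5 * i / N : ℝ) - 5 * j / N| ≤ 4 / N := by
      have : (5 * i / N : ℝ) - 5 * j / N = (b - 5 * j / N) - (b - 5 * i / N) := by ring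
      rw [this]
      refine (abs_sub _ _).trans ?_
      have : (4 / N : ℝ) = 2 / N + 2 / N := by ring
      linarith
    rw [← sub_div, ← mul_sub, abs_div, abs_of_pos hN', div_le_div_iff_of_pos_right hN', abs_mul] at h3
    have h4 : |((i : ℤ) - (j : ℤ) : ℝ)| < 1 := by
      rw [abs_of_pos (by norm_num : (0 : ℝ) < 5)] at h3
      push_cast
      linarith
    have h5 : |(i : ℤ) - (j : ℤ)| < 1 := by exact_mod_cast h4
    have h6 := Int.abs_lt_one_iff.1 h5
    omega
  have hdisj : (s : Set (ℕ × ℕ)).PairwiseDisjoint W := by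
    intro p _ q _ hpq
    refine disjoint_left.2 fun x hxp hxq => hpq ?_
    have h3 := abs_side_le_of_mem_edgeNhd hN (show x + -v p ∈ V from hxp).1
    have h4 := abs_side_le_of_mem_edgeNhd hN (show x + -v q ∈ V from hxq).1
    rw [(hside p x).1, (hside p x).2] at h3
    rw [(hside q x).1, (hside q x).2] at h4
    exact Prod.ext (hsep _ _ _ h3.1 h4.1) (hsep _ _ _ h3.2 h4.2)
  -- the `N ^ 2` disjoint translates all lie in one ball
  have hsum := measure_biUnion_finset (μ := (volume : Measure (Pt d))) hdisj
    fun p _ => hVm.preimage (measurable_add_const _)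
  have hvol : ∀ p, volume (W p) = volume V := fun p => measure_preimage_add_right _ _ _
  simp only [hvol, Finset.sum_const, hs, Finset.card_product, Finset.card_range, nsmul_eq_mul] at hsum
  rw [show (N : ℝ≥0∞) ^ 2 * volume V = ((N * N : ℕ) : ℝ≥0∞) * volume V by push_cast; ring, ← hsum]
  refine measure_mono (iUnion₂_subset fun p hp x hx => ?_)
  have h3 : x + -v p ∈ Metric.ball (0 : Pt d) R := (show x + -v p ∈ V from hx).2
  rw [Finset.mem_product, Finset.mem_range, Finset.mem_range] at hp
  have hle : ∀ i : ℕ, i < N → (5 * i / N : ℝ) ≤ 5 := fun i hi => by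
    rw [div_le_iff₀ hN']
    have : (i : ℝ) ≤ N := by exact_mod_cast hi.le
    linarith
  have h4 : ‖v p‖ ≤ 5 * (‖u‖ + ‖u'‖) := by
    refine (norm_add_le _ _).trans ?_
    have h5 : ∀ (i : ℕ) (z : Pt d), i < N → ‖(5 * i / N : ℝ) • z‖ ≤ 5 * ‖z‖ := fun i z hi => by
      rw [norm_smul, Real.norm_of_nonneg (by positivity)]
      gcongr
      exact hle i hi
    rw [mul_add]
    exact add_le_add (h5 _ _ hp.1) (h5 _ _ hp.2)
  rw [mem_ball_zero_iff] at h3 ⊢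
  calc ‖x‖ = ‖(x + -v p) + v p‖ := by rw [neg_add_cancel_right]
    _ ≤ ‖x + -v p‖ + ‖v p‖ := norm_add_le _ _
    _ < _ := by linarith

section

variable {Ω : Set (Pt d)} (𝓢 : System Ω m)

theorem tendsto_edgeCut {ℓ ℓ' : Pt d × ℝ} {x : Pt d} (hx : 0 < edgeSq ℓ ℓ' x) :
    Tendsto (fun j : ℕ => edgeCut ℓ ℓ' (j + 1) x) atTop (𝓝 1) := by
  have h1 : Tendsto (fun j : ℕ => ((j + 1 : ℕ) : ℝ) ^ 2 * edgeSq ℓ ℓ' x) atTop atTop :=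
    (((tendsto_pow_atTop two_ne_zero).comp tendsto_natCast_atTop_atTop).comp
      (tendsto_add_atTop_nat 1)).atTop_mul_const hx
  refine tendsto_const_nhds.congr' ?_
  filter_upwards [h1.eventually_ge_atTop 2] with j hj
  rw [edgeCut, step_of_le]
  linarith

theorem tsupport_edgeCut_smul (ℓ ℓ' : Pt d × ℝ) {N : ℕ} (φ : Pt d → Vc m) :
    tsupport (fun x => edgeCut ℓ ℓ' N x • φ x) ⊆
      tsupport φ ∩ {x | 1 ≤ (N : ℝ) ^ 2 * edgeSq ℓ ℓ' x} := by
  refine closure_minimal ?_ ((isClosed_tsupport φ).inter (isClosed_le continuous_const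
    (continuous_const.mul (continuous_edgeSq ℓ ℓ'))))
  intro y hy
  have hy' : edgeCut ℓ ℓ' N y • φ y ≠ 0 := hy
  refine ⟨subset_tsupport φ fun h => hy' (by rw [h, smul_zero]), ?_⟩
  by_contra h
  simp only [mem_ofPred_eq, not_le] at h
  exact hy' (by rw [edgeCut, step_of_ge (by linarith), zero_smul])

theorem edgeSq_pos_iff {ℓ ℓ' : Pt d × ℝ} {x : Pt d} :
    0 < edgeSq ℓ ℓ' x ↔ ¬ (side ℓ x = 0 ∧ side ℓ' x = 0) := by
  have : 0 ≤ edgeSq ℓ ℓ' x := add_nonneg (sq_nonneg _) (sq_nonneg _)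
  rw [this.lt_iff_ne', ne_eq, not_iff_not, edgeSq, add_eq_zero_iff_of_nonneg (sq_nonneg _)
    (sq_nonneg _), sq_eq_zero_iff, sq_eq_zero_iff]

/-- The terms with the gradients of the cut-offs disappear in the limit: the gradients are of
order `N` on a set of measure of order `1 / N ^ 2`, hence bounded in `L²`, while the square
integral of `w` over this set goes to zero. -/
theorem System.tendsto_gradient_edgeCut {w : Pt d → Vc m} {T : Set (Pt d)} (hT : IsPolytopal T)
    (hΩb : Bornology.IsBounded Ω) (hTΩ : T ⊆ Ω) (hw : MemLp w 2 (volume.restrict T))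
    {ℓ ℓ' : Pt d × ℝ} (hu : ‖ℓ.1‖ = 1) (hu' : ‖ℓ'.1‖ = 1) (h1 : ℓ'.1 ≠ ℓ.1) (h2 : ℓ'.1 ≠ -ℓ.1)
    {φ : Pt d → Vc m} (hφ : Continuous φ) (hφc : HasCompactSupport φ) :
    Tendsto (fun j : ℕ => ∫ x in T, (inner ℂ (∑ i, partialD i (edgeCut ℓ ℓ' (j + 1)) x •
      act (𝓢.A i x) (φ x)) (w x) : ℂ)) atTop (𝓝 0) := by
  obtain ⟨G, hG0, hG⟩ := 𝓢.exists_norm_A_le hΩb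
  obtain ⟨D, hD⟩ := hφ.bounded_above_of_compact_support hφc
  have hD0 : 0 ≤ D := (norm_nonneg _).trans (hD 0)
  obtain ⟨B, hB0, hB⟩ := exists_bump_le
  obtain ⟨R, hR⟩ := hT.isBounded.subset_ball (0 : Pt d)
  obtain ⟨C, hC, hvol⟩ := exists_volume_edgeNhd_le hu hu' h1 h2 R
  have hTm := hT.isOpen.measurableSet
  set L : ℝ := d * (8 * B * (G * D)) with hL
  have hL0 : 0 ≤ L := by positivity
  set V : ℕ → Set (Pt d) := fun j => edgeNhd ℓ ℓ' (j + 1) with hV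
  have hVm : ∀ j, MeasurableSet (V j) := fun j => (isClosed_edgeNhd _ _ _).measurableSet
  -- the indicator is doubled, for the Cauchy-Schwarz inequality
  have hpt : ∀ j, ∀ x ∈ T, ‖(inner ℂ (∑ i, partialD i (edgeCut ℓ ℓ' (j + 1)) x •
      act (𝓢.A i x) (φ x)) (w x) : ℂ)‖ₑ ≤
      (V j).indicator (fun _ => ENNReal.ofReal (L * (j + 1))) x * (V j).indicator (fun x => ‖w x‖ₑ) x := by
    intro j x hx
    have h3 : ‖∑ i, partialD i (edgeCut ℓ ℓ' (j + 1)) x • act (𝓢.A i x) (φ x)‖ ≤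
        (V j).indicator (fun _ => L * (j + 1)) x := by
      refine (norm_sum_le _ _).trans ?_
      calc ∑ i, ‖partialD i (edgeCut ℓ ℓ' (j + 1)) x • act (𝓢.A i x) (φ x)‖
          ≤ ∑ _i : Fin d, (V j).indicator (fun _ => 8 * B * ((j + 1 : ℕ) : ℝ)) x * (G * D) := by
            refine Finset.sum_le_sum fun i _ => ?_
            rw [norm_smul, Real.norm_eq_abs]
            gcongr
            · exact indicator_nonneg (fun _ _ => by positivity) _
            · exact abs_partialD_edgeCut_le hu hu' hB (Nat.succ_pos j) i x
            · refine (norm_act_le _ _).trans ?_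
              gcongr
              · exact hG i x (subset_closure (hTΩ hx))
              · exact hD x
        _ = (V j).indicator (fun _ => L * (j + 1)) x := by
            by_cases hxV : x ∈ V j
            · simp only [indicator_of_mem hxV, Finset.sum_const, Finset.card_univ, Fintype.card_fin,
                nsmul_eq_mul, hL]
              push_cast; ring
            · simp [hxV]
    by_cases hxV : x ∈ V j
    · rw [indicator_of_mem hxV] at h3
      rw [indicator_of_mem hxV, indicator_of_mem hxV, ← ofReal_norm, ← ofReal_norm (w x),
        ← ENNReal.ofReal_mul (by positivity)]
      refine ENNReal.ofReal_le_ofReal ((norm_inner_le_norm _ _).trans ?_)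
      gcongr
    · rw [indicator_of_notMem hxV] at h3
      have h4 := norm_le_zero_iff.1 h3
      rw [h4]
      simp
  set I : ℕ → ℂ := fun j => ∫ x in T, (inner ℂ (∑ i, partialD i (edgeCut ℓ ℓ' (j + 1)) x •
      act (𝓢.A i x) (φ x)) (w x) : ℂ) with hI
  have hsq : ∀ j, ‖I j‖ₑ ^ 2 ≤ ENNReal.ofReal (L ^ 2) * C * ∫⁻ x in V j, ‖w x‖ₑ ^ 2 ∂volume.restrict T := by
    intro j
    have h3 : ‖I j‖ₑ ≤ ∫⁻ x in T, (V j).indicator (fun _ => ENNReal.ofReal (L * (j + 1))) x *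
        (V j).indicator (fun x => ‖w x‖ₑ) x := by
      refine (enorm_integral_le_lintegral_enorm _).trans (setLIntegral_mono' hTm fun x hx => hpt j x hx)
    refine (pow_le_pow_left₀ zero_le h3 2).trans ?_
    refine (sq_lintegral_mul_le (measurable_const.indicator (hVm j)).aemeasurable
      (hw.1.enorm.indicator (hVm j))).trans ?_
    refine mul_le_mul' ?_ ?_
    · have h4 : ∀ x, (V j).indicator (fun _ => ENNReal.ofReal (L * (j + 1))) x ^ 2 =
          (V j).indicator (fun _ => ENNReal.ofReal (L ^ 2) * (((j + 1 : ℕ) : ℝ≥0∞)) ^ 2) x := fun x => by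
        by_cases hxV : x ∈ V j
        · rw [indicator_of_mem hxV, indicator_of_mem hxV, ← ENNReal.ofReal_pow (by positivity), mul_pow,
            ENNReal.ofReal_mul (by positivity), ENNReal.ofReal_pow (by positivity : (0 : ℝ) ≤ j + 1)]
          congr 2
          rw [← ENNReal.ofReal_natCast]
          push_cast; rfl
        · simp [hxV]
      simp_rw [h4]
      rw [lintegral_indicator (hVm j), lintegral_const, mul_assoc, Measure.restrict_apply_univ,
        Measure.restrict_apply (hVm j)]
      gcongr
      refine le_trans ?_ (hvol (j + 1) (Nat.succ_pos j))
      gcongr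
    · rw [← lintegral_indicator (hVm j)]
      refine lintegral_mono fun x => ?_
      by_cases hxV : x ∈ V j <;> simp [hxV]
  have hV0 : Tendsto (fun j => (volume.restrict T) (V j)) atTop (𝓝 0) := by
    have h3 : ∀ j : ℕ, (volume.restrict T) (V j) ≤ C * (((j + 1 : ℕ) : ℝ≥0∞))⁻¹ := by
      intro j
      have hj1 : (1 : ℝ≥0∞) ≤ ((j + 1 : ℕ) : ℝ≥0∞) := by exact_mod_cast Nat.succ_pos j
      rw [Measure.restrict_apply (hVm j), ← div_eq_mul_inv,
        ENNReal.le_div_iff_mul_le (Or.inl (by positivity)) (Or.inl (ENNReal.natCast_ne_top _)), mul_comm]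
      refine le_trans ?_ (hvol (j + 1) (Nat.succ_pos j))
      gcongr
      exact le_self_pow₀ hj1 two_ne_zero
    have h4 : Tendsto (fun j : ℕ => C * (((j + 1 : ℕ) : ℝ≥0∞))⁻¹) atTop (𝓝 0) := by
      have := ENNReal.Tendsto.const_mul (a := C) (ENNReal.tendsto_inv_nat_nhds_zero.comp (tendsto_add_atTop_nat 1))
        (Or.inr hC)
      simpa using this
    exact tendsto_of_tendsto_of_tendsto_of_le_of_le tendsto_const_nhds h4 (fun _ => zero_le) h3
  have hlim := tendsto_setLIntegral_zero (μ := volume.restrict T)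
    (MemLp.lintegral_enorm_sq_lt_top hw).ne hV0
  have hlim2 : Tendsto (fun j => ‖I j‖ₑ ^ 2) atTop (𝓝 0) := by
    have h3 := ENNReal.Tendsto.const_mul (a := ENNReal.ofReal (L ^ 2) * C) hlim
      (Or.inr (ENNReal.mul_ne_top ENNReal.ofReal_ne_top hC))
    rw [mul_zero] at h3
    exact tendsto_of_tendsto_of_tendsto_of_le_of_le tendsto_const_nhds h3 (fun _ => zero_le) hsq
  rw [tendsto_zero_iff_norm_tendsto_zero]
  have h5 := (ENNReal.tendsto_toReal ENNReal.zero_ne_top).comp hlim2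
  have h6 : Tendsto (fun j => Real.sqrt (‖I j‖ ^ 2)) atTop (𝓝 (Real.sqrt 0)) := by
    refine (Real.continuous_sqrt.tendsto 0).comp ?_
    refine h5.congr fun j => ?_
    simp
  simpa using h6

/-- If integration by parts holds for `φ` cut off near the intersection of two transversal
hyperplanes, then it holds for `φ`, since this intersection is a null set in the domain and on its
boundary. -/
theorem System.hasIBP_of_edgeCut (hd : 1 ≤ d) {w : 𝓢.graphSpace} {θ : ℝ}
    (hw : HasTraceReg Ω w.1 θ) {T : Set (Pt d)} (hT : IsPolytopal T) (hΩ : IsPolytopal Ω)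
    (hTΩ : T ⊆ Ω) {ℓ ℓ' : Pt d × ℝ} (hu : ‖ℓ.1‖ = 1) (hu' : ‖ℓ'.1‖ = 1)
    (h1 : ℓ'.1 ≠ ℓ.1) (h2 : ℓ'.1 ≠ -ℓ.1) {φ : Pt d → Vc m} (hφ : ContDiff ℝ ∞ φ)
    (hφc : HasCompactSupport φ)
    (h : ∀ j : ℕ, 𝓢.HasIBP w T fun x => edgeCut ℓ ℓ' (j + 1) x • φ x) : 𝓢.HasIBP w T φ := by
  have hrT : volume.restrict T ≤ volume.restrict Ω := Measure.restrict_mono hTΩ le_rfl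
  have hfin := hT.isFiniteMeasure_frontier hd
  have hwL : MemLp w.1 2 (volume.restrict T) := hw.memLp.mono_measure hrT
  have haL : MemLp (𝓢.weakA1 w) 2 (volume.restrict T) := (Lp.memLp _).mono_measure hrT
  have hdL : MemLp (𝓢.adj φ) 2 (volume.restrict T) := (𝓢.memLp_adj hφ hφc).mono_measure hrT
  have hφL : MemLp φ 2 (volume.restrict T) := hφ.continuous.memLp_of_hasCompactSupport hφc
  have hφS : MemLp φ 2 ((surf d).restrict (frontier T)) :=
    hφ.continuous.memLp_of_hasCompactSupport hφc
  have hNL := 𝓢.memLp_normalField_trace hd hw hT hΩ hTΩ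
  have hχ : ∀ j, Continuous (edgeCut ℓ ℓ' (j + 1)) := fun j => (contDiff_edgeCut _ _ _).continuous
  have hae : ∀ {μ : Measure (Pt d)}, μ (hyp ℓ.1 ℓ.2 ∩ hyp ℓ'.1 ℓ'.2) = 0 →
      ∀ {b : Pt d → Vc m}, ∀ᵐ x ∂μ, b x ≠ 0 →
        Tendsto (fun j : ℕ => edgeCut ℓ ℓ' (j + 1) x) atTop (𝓝 1) := by
    intro μ hμ b
    have h3 : ∀ᵐ x ∂μ, x ∉ hyp ℓ.1 ℓ.2 ∩ hyp ℓ'.1 ℓ'.2 := measure_eq_zero_iff_ae_notMem.1 hμ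
    filter_upwards [h3] with x hx _
    refine tendsto_edgeCut (edgeSq_pos_iff.2 fun h4 => hx ?_)
    exact ⟨mem_hyp_iff_side.2 h4.1, mem_hyp_iff_side.2 h4.2⟩
  have hv0 : (volume.restrict T) (hyp ℓ.1 ℓ.2 ∩ hyp ℓ'.1 ℓ'.2) = 0 :=
    measure_mono_null inter_subset_left
      (le_antisymm ((Measure.restrict_apply_le _ _).trans (volume_hyp hu _).le) zero_le)
  have hs0 : ((surf d).restrict (frontier T)) (hyp ℓ.1 ℓ.2 ∩ hyp ℓ'.1 ℓ'.2) = 0 :=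
    le_antisymm ((Measure.restrict_apply_le _ _).trans (surf_hyp_inter hu hu' h1 h2 _ _).le) zero_le
  have l1 := tendsto_ip_of_tendsto_one hχ (fun _ _ => step_nonneg _) (fun _ _ => step_le_one _)
    haL hφL (hae hv0)
  have l2 := tendsto_ip_of_tendsto_one hχ (fun _ _ => step_nonneg _) (fun _ _ => step_le_one _)
    hwL hdL (hae hv0)
  have l3 := tendsto_ip_of_tendsto_one hχ (fun _ _ => step_nonneg _) (fun _ _ => step_le_one _)
    hNL hφS (hae hs0)
  have l4 := 𝓢.tendsto_gradient_edgeCut hT hΩ.isBounded hTΩ hwL hu hu' h1 h2 hφ.continuous hφc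
  have heq : ∀ j : ℕ, (∫ x in T, edgeCut ℓ ℓ' (j + 1) x • (inner ℂ (φ x) (𝓢.weakA1 w x) : ℂ)) +
      ((∫ x in T, edgeCut ℓ ℓ' (j + 1) x • (inner ℂ (𝓢.adj φ x) (w.1 x) : ℂ)) +
        ∫ x in T, (inner ℂ (∑ i, partialD i (edgeCut ℓ ℓ' (j + 1)) x • act (𝓢.A i x) (φ x))
          (w.1 x) : ℂ)) =
      ∫ x in frontier T, edgeCut ℓ ℓ' (j + 1) x • (inner ℂ (φ x)
        (act (𝓢.normalField (outwardNormal T x) x) (trace Ω w.1 x)) : ℂ) ∂surf d := by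
    intro j
    have hadj : 𝓢.adj (fun x => edgeCut ℓ ℓ' (j + 1) x • φ x) = fun x => edgeCut ℓ ℓ' (j + 1) x •
        𝓢.adj φ x + ∑ i, partialD i (edgeCut ℓ ℓ' (j + 1)) x • act (𝓢.A i x) (φ x) := by
      funext x
      exact 𝓢.adj_smul ((contDiff_edgeCut _ _ _).differentiable (by simp) x)
        (hφ.differentiable (by simp) x)
    have hcs : ContDiff ℝ ∞ fun x => edgeCut ℓ ℓ' (j + 1) x • φ x := (contDiff_edgeCut _ _ _).smul hφ
    have hcc : HasCompactSupport fun x => edgeCut ℓ ℓ' (j + 1) x • φ x :=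
      HasCompactSupport.smul_left (f := edgeCut ℓ ℓ' (j + 1)) (f' := φ) hφc
    have hi1 : Integrable (fun x => edgeCut ℓ ℓ' (j + 1) x • (inner ℂ (𝓢.adj φ x) (w.1 x) : ℂ))
        (volume.restrict T) :=
      (ip_integrable hwL hdL).bdd_smul 1 (hχ j).aestronglyMeasurable
        (Eventually.of_forall fun y => by
          rw [edgeCut, Real.norm_of_nonneg (step_nonneg _)]; exact step_le_one _)
    have hi2 : Integrable (fun x => (inner ℂ (∑ i, partialD i (edgeCut ℓ ℓ' (j + 1)) x •
        act (𝓢.A i x) (φ x)) (w.1 x) : ℂ)) (volume.restrict T) := by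
      have h3 := (ip_integrable hwL ((𝓢.memLp_adj hcs hcc).mono_measure hrT)).sub hi1
      refine h3.congr (Eventually.of_forall fun x => ?_)
      simp only [hadj, Pi.sub_apply, inner_add_left, inner_smul_left_eq_smul, add_sub_cancel_left]
    have h3 := h j
    unfold System.HasIBP ip at h3
    simp only [hadj, inner_add_left, inner_smul_left_eq_smul] at h3
    rw [integral_add hi1 hi2] at h3
    exact h3
  have hfin := tendsto_nhds_unique ((l1.add (l2.add l4)).congr heq) l3
  rw [add_zero] at hfin
  exact hfin

/-- Integration by parts on a polytopal set, for a function of the graph space with a trace. -/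
theorem System.hasIBP (hd : 1 ≤ d) {w : 𝓢.graphSpace} {θ : ℝ}
    (hw : HasTraceReg Ω w.1 θ) {T : Set (Pt d)} (hT : IsPolytopal T) (hΩ : IsPolytopal Ω)
    (hTΩ : T ⊆ Ω) {φ : Pt d → Vc m} (hφ : ContDiff ℝ ∞ φ) (hφc : HasCompactSupport φ) :
    𝓢.HasIBP w T φ := by
  obtain ⟨N, hN, hu, hflat⟩ := exists_isFlatAt hd hT hΩ hTΩ
  have hflat' : ∀ x ∈ frontier T, x ∉ edgeSet N → ∃ n r, IsFlatAt T Ω x n r := fun x hx he => by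
    obtain ⟨ℓ, -, -, n, -, r, hf⟩ := hflat x hx he
    exact ⟨n, r, hf⟩
  set 𝒞 : Set ((Pt d × ℝ) × (Pt d × ℝ)) :=
    {p | p.1 ∈ N ∧ p.2 ∈ N ∧ p.2.1 ≠ p.1.1 ∧ p.2.1 ≠ -p.1.1} with h𝒞
  have h𝒞f : 𝒞.Finite := (hN.prod hN).subset fun p hp => ⟨hp.1, hp.2.1⟩
  -- the edges are removed one after the other
  have key : ∀ 𝒬 : Set ((Pt d × ℝ) × (Pt d × ℝ)), 𝒬.Finite → 𝒬 ⊆ 𝒞 → ∀ φ : Pt d → Vc m,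
      ContDiff ℝ ∞ φ → HasCompactSupport φ →
      (∀ p ∈ 𝒞, p ∉ 𝒬 → ∀ x ∈ tsupport φ, 0 < edgeSq p.1 p.2 x) → 𝓢.HasIBP w T φ := by
    intro 𝒬 h𝒬
    induction 𝒬, h𝒬 using Set.Finite.induction_on with
    | empty =>
      intro _ φ hφ hφc hsupp
      refine 𝓢.hasIBP_of_disjoint_edgeSet hd hw hT hΩ hTΩ hflat' hφ hφc (disjoint_left.2 ?_)
      rintro x hx ⟨ℓ, hℓ, ℓ', hℓ', h1, h2, h3, h4⟩
      exact edgeSq_pos_iff.1 (hsupp (ℓ, ℓ') ⟨hℓ, hℓ', h1, h2⟩ (notMem_empty _) x hx) ⟨h3, h4⟩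
    | @insert p 𝒬 hp _ ih =>
      intro hsub φ hφ hφc hsupp
      obtain ⟨hp1, hp2, hp3, hp4⟩ := hsub (mem_insert p 𝒬)
      refine 𝓢.hasIBP_of_edgeCut hd hw hT hΩ hTΩ (hu _ hp1) (hu _ hp2) hp3 hp4 hφ hφc fun j => ?_
      refine ih ((subset_insert _ _).trans hsub) _ ((contDiff_edgeCut _ _ _).smul hφ)
        (HasCompactSupport.smul_left (f := edgeCut p.1 p.2 (j + 1)) (f' := φ) hφc) ?_
      intro q hq hq𝒬 x hx
      obtain ⟨hx1, hx2⟩ := tsupport_edgeCut_smul p.1 p.2 φ hx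
      by_cases hqp : q = p
      · subst hqp
        have h3 : (1 : ℝ) ≤ ((j + 1 : ℕ) : ℝ) ^ 2 * edgeSq q.1 q.2 x := hx2
        by_contra h4
        nlinarith [sq_nonneg ((j + 1 : ℕ) : ℝ)]
      · exact hsupp q hq (fun h => (mem_insert_iff.1 h).elim hqp hq𝒬) x hx1
  exact key 𝒞 h𝒞f subset_rfl φ hφ hφc fun p hp hp' => absurd hp hp'

end

/-! ### Smooth functions in the graph space -/

/-- Bounded matrix fields act on square integrable functions, for any measure. -/
theorem memLp_act' {μ : Measure (Pt d)} {B : Pt d → Mat m} {v : Pt d → Vc m}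
    (hB : MemLp B ∞ μ) (hv : MemLp v 2 μ) : MemLp (fun x => act (B x) (v x)) 2 μ := by
  have h2 := continuous_toEuclideanCLM.comp_aestronglyMeasurable hB.1
  have hm : AEStronglyMeasurable (fun x => act (B x) (v x)) μ :=
    isBoundedBilinearMap_apply.continuous.comp_aestronglyMeasurable (h2.prodMk hv.1)
  refine MemLp.of_le_mul (c := (eLpNorm B ∞ μ).toReal) hv hm ?_
  have hb : ∀ᵐ x ∂μ, ‖B x‖ₑ ≤ eLpNorm B ∞ μ := by
    rw [eLpNorm_exponent_top]; exact ae_le_eLpNormEssSup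
  filter_upwards [hb] with x hx
  have h2 := ENNReal.toReal_mono hB.2.ne hx
  rw [toReal_enorm] at h2
  exact (norm_act_le _ _).trans (by gcongr)

theorem memLp_entry {μ : Measure (Pt d)} {B : Pt d → Mat m} (hB : MemLp B ∞ μ) (a b : Fin m) :
    MemLp (fun x => B x a b) ∞ μ :=
  (LinearMap.toContinuousLinearMap (Matrix.entryLinearMap ℂ ℂ a b)).comp_memLp' hB

theorem integrable_mul_of_memLp_top {μ : Measure (Pt d)} [IsFiniteMeasureOnCompacts μ]
    {f g : Pt d → ℂ} (hf : Continuous f) (hfc : HasCompactSupport f) (hg : MemLp g ∞ μ) :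
    Integrable (fun x => f x * g x) μ :=
  (hf.integrable_of_hasCompactSupport hfc).mul_of_top_left hg

theorem partialD_clm_comp {F G : Type*} [NormedAddCommGroup F] [NormedSpace ℝ F]
    [NormedAddCommGroup G] [NormedSpace ℝ G] (L : F →L[ℝ] G) {φ : Pt d → F} {x : Pt d}
    (hφ : DifferentiableAt ℝ φ x) (i : Fin d) :
    partialD i (fun y => L (φ y)) x = L (partialD i φ x) := by
  unfold partialD
  rw [show (fun y => L (φ y)) = L ∘ φ from rfl,
    (L.hasFDerivAt.comp x hφ.hasFDerivAt).fderiv]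
  rfl

theorem continuous_partialD {F : Type*} [NormedAddCommGroup F] [NormedSpace ℝ F] {φ : Pt d → F}
    (hφ : ContDiff ℝ ∞ φ) (i : Fin d) : Continuous (partialD i φ) :=
  (hφ.continuous_fderiv (by simp)).clm_apply continuous_const

theorem HasCompactSupport.partialD {F : Type*} [NormedAddCommGroup F] [NormedSpace ℝ F]
    {φ : Pt d → F} (hφ : HasCompactSupport φ) (i : Fin d) :
    HasCompactSupport (Friedrichs.partialD i φ) := hφ.fderiv_apply (𝕜 := ℝ) _

section

variable {Ω : Set (Pt d)} (𝓢 : System Ω m)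

/-- The weak divergence may be tested against complex functions. -/
theorem System.integral_divA {χ : Pt d → ℂ} (hχ : IsTest Ω χ) (a b : Fin m) :
    ∫ x in Ω, ((∑ i, partialD i χ x * 𝓢.A i x a b) + χ x * 𝓢.divA x a b) = 0 := by
  have hre : IsTest Ω fun x => (χ x).re := ⟨Complex.reCLM.contDiff.comp hχ.1,
    hχ.2.1.comp_left (g := Complex.re) rfl,
    (tsupport_comp_subset (g := Complex.re) rfl χ).trans hχ.2.2⟩
  have him : IsTest Ω fun x => (χ x).im := ⟨Complex.imCLM.contDiff.comp hχ.1,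
    hχ.2.1.comp_left (g := Complex.im) rfl,
    (tsupport_comp_subset (g := Complex.im) rfl χ).trans hχ.2.2⟩
  -- the weak divergence is defined with real test functions; both parts of `χ` are used
  have key : ∀ ψ : Pt d → ℝ, IsTest Ω ψ →
      Integrable (fun x => (∑ i, ((partialD i ψ x : ℝ) : ℂ) * 𝓢.A i x a b) +
        (ψ x : ℂ) * 𝓢.divA x a b) (volume.restrict Ω) ∧
      ∫ x in Ω, ((∑ i, ((partialD i ψ x : ℝ) : ℂ) * 𝓢.A i x a b) +
        (ψ x : ℂ) * 𝓢.divA x a b) = 0 := by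
    intro ψ hψ
    have h1 : Integrable (fun x => ∑ i, ((partialD i ψ x : ℝ) : ℂ) * 𝓢.A i x a b)
        (volume.restrict Ω) := integrable_finsetSum _ fun i _ =>
      integrable_mul_of_memLp_top (Complex.continuous_ofReal.comp (continuous_partialD hψ.1 i))
        ((HasCompactSupport.partialD hψ.2.1 i).comp_left (g := Complex.ofReal) rfl)
        (memLp_entry (𝓢.A_mem i) a b)
    have h2 : Integrable (fun x => (ψ x : ℂ) * 𝓢.divA x a b) (volume.restrict Ω) :=
      integrable_mul_of_memLp_top (Complex.continuous_ofReal.comp hψ.1.continuous)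
        (hψ.2.1.comp_left (g := Complex.ofReal) rfl) (memLp_entry 𝓢.divA_mem a b)
    refine ⟨h1.add h2, ?_⟩
    rw [integral_add h1 h2, 𝓢.divA_weak ψ hψ a b]
    exact neg_add_cancel _
  have hd : Differentiable ℝ χ := hχ.1.differentiable (by simp)
  have heq : ∀ x, (∑ i, partialD i χ x * 𝓢.A i x a b) + χ x * 𝓢.divA x a b =
      ((∑ i, ((partialD i (fun x => (χ x).re) x : ℝ) : ℂ) * 𝓢.A i x a b) +
        (((χ x).re : ℝ) : ℂ) * 𝓢.divA x a b) +
      Complex.I * ((∑ i, ((partialD i (fun x => (χ x).im) x : ℝ) : ℂ) * 𝓢.A i x a b) +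
        (((χ x).im : ℝ) : ℂ) * 𝓢.divA x a b) := by
    intro x
    have h1 : ∀ i, partialD i χ x = ((partialD i (fun x => (χ x).re) x : ℝ) : ℂ) +
        Complex.I * ((partialD i (fun x => (χ x).im) x : ℝ) : ℂ) := fun i => by
      have h2 := partialD_clm_comp Complex.reCLM (hd x) i
      have h3 := partialD_clm_comp Complex.imCLM (hd x) i
      simp only [Complex.reCLM_apply, Complex.imCLM_apply] at h2 h3
      rw [h2, h3, mul_comm]
      exact (Complex.re_add_im _).symm
    have h4 : χ x = (((χ x).re : ℝ) : ℂ) + Complex.I * (((χ x).im : ℝ) : ℂ) := by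
      rw [mul_comm]; exact (Complex.re_add_im _).symm
    simp_rw [h1, add_mul, Finset.sum_add_distrib]
    conv_lhs => rw [h4]
    rw [mul_add, Finset.mul_sum, add_mul]
    simp_rw [mul_assoc]
    ring
  simp_rw [heq]
  rw [integral_add (key _ hre).1 ((key _ him).1.const_mul _), integral_const_mul, (key _ hre).2,
    (key _ him).2]
  simp

theorem act_apply (B : Mat m) (v : Vc m) (a : Fin m) : act B v a = ∑ b, B a b * v b := rfl

/-- For smooth functions, the weak `A_1` is the strong one. The entries of `A` being only known
through the weak divergence, this one is tested with the products of a component of `ψ` and a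
conjugate component of `φ`. -/
theorem System.ip_A1 {φ ψ : Pt d → Vc m} (hΩ : IsOpen Ω) (hφ : ContDiff ℝ ∞ φ)
    (hφc : HasCompactSupport φ) (hψ : IsTest Ω ψ) :
    ip (volume.restrict Ω) (𝓢.A1 φ) ψ = - ip (volume.restrict Ω) φ (𝓢.adj ψ) := by
  set χ : Fin m → Fin m → Pt d → ℂ := fun a b x => ψ x b * (starRingEnd ℂ) (φ x a) with hχ
  have hc : ∀ {u : Pt d → Vc m} (_ : ContDiff ℝ ∞ u) (a : Fin m), ContDiff ℝ ∞ fun x => u x a :=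
    fun hu a => ((EuclideanSpace.proj (𝕜 := ℂ) a).restrictScalars ℝ).contDiff.comp hu
  have hcc : ∀ {u : Pt d → Vc m} (_ : ContDiff ℝ ∞ u) (a : Fin m),
      ContDiff ℝ ∞ fun x => (starRingEnd ℂ) (u x a) :=
    fun hu a => Complex.conjCLE.contDiff.comp (hc hu a)
  have htest : ∀ a b, IsTest Ω (χ a b) := by
    intro a b
    refine ⟨(hc hψ.1 b).mul (hcc hφ a), ?_, ?_⟩
    · exact (hψ.2.1.comp_left (g := fun v : Vc m => v b) rfl).mul_right
    · refine (tsupport_mul_subset_left (f := fun x => ψ x b)).trans ?_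
      exact (tsupport_comp_subset (g := fun v : Vc m => v b) rfl ψ).trans hψ.2.2
  have hpd : ∀ {u : Pt d → Vc m} (_ : ContDiff ℝ ∞ u) (a : Fin m) (i : Fin d) (x : Pt d),
      partialD i (fun x => u x a) x = partialD i u x a := fun hu a i x =>
    partialD_clm_comp ((EuclideanSpace.proj (𝕜 := ℂ) a).restrictScalars ℝ)
      (hu.differentiable (by simp) x) i
  have hχd : ∀ a b i x, partialD i (χ a b) x = partialD i ψ x b * (starRingEnd ℂ) (φ x a) +
      ψ x b * (starRingEnd ℂ) (partialD i φ x a) := by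
    intro a b i x
    have h1 : partialD i (χ a b) x = ψ x b * partialD i (fun x => (starRingEnd ℂ) (φ x a)) x +
        partialD i (fun x => ψ x b) x * (starRingEnd ℂ) (φ x a) := by
      have h2 := fderiv_mul ((hc hψ.1 b).differentiable (by simp) x)
        ((hcc hφ a).differentiable (by simp) x)
      unfold partialD
      rw [show χ a b = (fun x => ψ x b) * fun x => (starRingEnd ℂ) (φ x a) from rfl, h2]
      simp [mul_comm]
    have h3 : partialD i (fun x => (starRingEnd ℂ) (φ x a)) x =
        (starRingEnd ℂ) (partialD i φ x a) := by
      have := partialD_clm_comp (Complex.conjCLE : ℂ →L[ℝ] ℂ)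
        ((hc hφ a).differentiable (by simp) x) i
      rw [hpd hφ] at this
      exact this
    rw [h1, h3, hpd hψ.1]
    ring
  have hint : ∀ a b, Integrable (fun x => (∑ i, partialD i (χ a b) x * 𝓢.A i x a b) +
      χ a b x * 𝓢.divA x a b) (volume.restrict Ω) := fun a b =>
    (integrable_finsetSum _ fun i _ => integrable_mul_of_memLp_top
      (continuous_partialD (htest a b).1 i) (HasCompactSupport.partialD (htest a b).2.1 i)
      (memLp_entry (𝓢.A_mem i) a b)).add
    (integrable_mul_of_memLp_top (htest a b).1.continuous (htest a b).2.1
      (memLp_entry 𝓢.divA_mem a b))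
  -- the integrand is the conjugate of the sum over the entries of the weak divergence identities
  have hpt : ∀ x ∈ Ω, inner ℂ (ψ x) (𝓢.A1 φ x) + inner ℂ (𝓢.adj ψ x) (φ x) =
      (starRingEnd ℂ) (∑ a, ∑ b, ((∑ i, partialD i (χ a b) x * 𝓢.A i x a b) +
        χ a b x * 𝓢.divA x a b)) := by
    intro x hx
    have h1 : inner ℂ (ψ x) (𝓢.A1 φ x) = ∑ i, inner ℂ (act (𝓢.A i x) (ψ x)) (partialD i φ x) := by
      rw [System.A1, inner_sum]
      refine Finset.sum_congr rfl fun i _ => ?_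
      rw [inner_act_left, (𝓢.A_hermitian i x hx).eq]
    rw [h1, System.adj, System.A1, inner_add_left, sum_inner]
    simp only [hχd]
    simp only [PiLp.inner_apply, RCLike.inner_apply, act_apply, map_sum, map_add, map_mul, hχ,
      Complex.conj_conj, Finset.mul_sum, Finset.sum_add_distrib, add_mul]
    have e1 : ∀ f : Fin d → Fin m → Fin m → ℂ,
        ∑ i, ∑ a, ∑ b, f i a b = ∑ a, ∑ b, ∑ i, f i a b := fun f => by
      rw [Finset.sum_comm]
      exact Finset.sum_congr rfl fun a _ => Finset.sum_comm
    rw [e1, e1, add_comm (∑ a, ∑ b, _ * _) (∑ a, ∑ b, ∑ i, _), ← add_assoc,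
      add_comm (∑ a, ∑ b, ∑ i, _) (∑ a, ∑ b, ∑ i, _)]
    congr 1
    · congr 1
      · refine Finset.sum_congr rfl fun a _ => Finset.sum_congr rfl fun b _ =>
          Finset.sum_congr rfl fun i _ => ?_
        ring
      · refine Finset.sum_congr rfl fun a _ => Finset.sum_congr rfl fun b _ =>
          Finset.sum_congr rfl fun i _ => ?_
        ring
    · refine Finset.sum_congr rfl fun a _ => Finset.sum_congr rfl fun b _ => ?_
      ring
  rw [eq_neg_iff_add_eq_zero, ip, ip, ← integral_add
    (ip_integrable (𝓢.memLp_A1 hφ hφc) (hψ.1.continuous.memLp_of_hasCompactSupport hψ.2.1))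
    (ip_integrable (hφ.continuous.memLp_of_hasCompactSupport hφc) (𝓢.memLp_adj hψ.1 hψ.2.1)),
    setIntegral_congr_fun hΩ.measurableSet hpt, integral_conj,
    integral_finsetSum _ fun a _ => integrable_finsetSum _ fun b _ => hint a b]
  simp_rw [integral_finsetSum _ fun b _ => hint _ b, 𝓢.integral_divA (htest _ _)]
  simp

/-- A function orthogonal to all the products of a scalar test function and a vector vanishes. -/
theorem ae_eq_zero_of_forall_ip {μ : Measure (Pt d)} [IsLocallyFiniteMeasure μ] {f : Pt d → Vc m}
    {U : Set (Pt d)} (hU : IsOpen U) (hf : MemLp f 2 μ)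
    (h : ∀ φ : Pt d → Vc m, IsTest U φ → ip μ f φ = 0) : ∀ᵐ x ∂μ, x ∈ U → f x = 0 := by
  have hl : LocallyIntegrable f μ := hf.locallyIntegrable (by norm_num)
  refine hU.ae_eq_zero_of_integral_contDiff_smul_eq_zero (hl.locallyIntegrableOn U)
    fun g hg hgc hgU => ?_
  refine ext_inner_left ℂ fun e => ?_
  have hi : Integrable (fun x => g x • f x) μ :=
    hl.integrable_smul_left_of_hasCompactSupport hg.continuous hgc
  rw [← integral_inner hi, inner_zero_right]
  have h1 := h (fun x => g x • e) ⟨hg.smul contDiff_const,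
    HasCompactSupport.smul_right (f := g) (f' := fun _ => e) hgc,
    (tsupport_smul_subset_left g _).trans hgU⟩
  rw [← h1, ip]
  congr 1
  funext x
  rw [inner_smul_left_eq_smul, inner_smul_right_eq_smul]

/-- The element of the graph space defined by a smooth function. -/
def System.ofSmooth (hΩ : IsOpen Ω) {φ : Pt d → Vc m} (hφ : ContDiff ℝ ∞ φ)
    (hφc : HasCompactSupport φ) : 𝓢.graphSpace :=
  ⟨(hφ.continuous.memLp_of_hasCompactSupport hφc).toLp φ, (𝓢.memLp_A1 hφ hφc).toLp _, fun ψ hψ => by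
    rw [ip_congr_left ψ (MemLp.coeFn_toLp _), ip_congr_left _ (MemLp.coeFn_toLp _)]
    exact 𝓢.ip_A1 hΩ hφ hφc hψ⟩

theorem System.coeFn_ofSmooth (hΩ : IsOpen Ω) {φ : Pt d → Vc m} (hφ : ContDiff ℝ ∞ φ)
    (hφc : HasCompactSupport φ) : (𝓢.ofSmooth hΩ hφ hφc).1 =ᵐ[volume.restrict Ω] φ :=
  MemLp.coeFn_toLp (hφ.continuous.memLp_of_hasCompactSupport hφc)

theorem System.weakA1_ofSmooth (hΩ : IsOpen Ω) {φ : Pt d → Vc m} (hφ : ContDiff ℝ ∞ φ)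
    (hφc : HasCompactSupport φ) :
    𝓢.weakA1 (𝓢.ofSmooth hΩ hφ hφc) =ᵐ[volume.restrict Ω] 𝓢.A1 φ := by
  set v := 𝓢.ofSmooth hΩ hφ hφc with hv
  have hA := 𝓢.memLp_A1 hφ hφc
  have h1 : ∀ᵐ x ∂volume.restrict Ω, x ∈ Ω → 𝓢.weakA1 v x - 𝓢.A1 φ x = 0 := by
    refine ae_eq_zero_of_forall_ip hΩ ((Lp.memLp (𝓢.weakA1 v)).sub hA) fun ψ hψ => ?_
    have h2 := 𝓢.isWeakA1_weakA1 v ψ hψ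
    rw [ip_congr_left _ (𝓢.coeFn_ofSmooth hΩ hφ hφc)] at h2
    have h3 := 𝓢.ip_A1 hΩ hφ hφc hψ
    unfold ip at h2 h3 ⊢
    simp only [inner_sub_right]
    rw [integral_sub (ip_integrable (Lp.memLp _) hψ.memLp) (ip_integrable hA hψ.memLp), h2, h3]
    exact sub_self _
  filter_upwards [h1, ae_restrict_mem hΩ.measurableSet] with x hx hxΩ
  exact sub_eq_zero.1 (hx hxΩ)

theorem trace_congr_ae {w w' : Pt d → Vc m} (h : w =ᵐ[volume.restrict Ω] w') (hΩ : MeasurableSet Ω) :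
    trace Ω w = trace Ω w' := by
  funext x
  unfold trace
  congr 1
  funext r
  refine setAverage_congr_fun (Metric.isOpen_ball.measurableSet.inter hΩ) ?_
  filter_upwards [(ae_restrict_iff' hΩ).1 h] with y hy hy'
  exact hy hy'.2

/-- The averages of a continuous function converge to its value. -/
theorem trace_of_continuous {φ : Pt d → Vc m} (hφ : Continuous φ) (hΩ : IsOpen Ω) {x : Pt d}
    (hx : x ∈ closure Ω) : trace Ω φ x = φ x := by
  refine Tendsto.limUnder_eq ?_
  rw [Metric.tendsto_nhds]
  intro ε hε
  obtain ⟨δ, hδ, hφδ⟩ := Metric.continuous_iff.1 hφ x (ε / 2) (half_pos hε)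
  filter_upwards [Ioo_mem_nhdsGT hδ] with r hr
  have hm : MeasurableSet (Metric.ball x r ∩ Ω) := Metric.isOpen_ball.measurableSet.inter hΩ.measurableSet
  have hne : (Metric.ball x r ∩ Ω).Nonempty :=
    mem_closure_iff.1 hx _ Metric.isOpen_ball (Metric.mem_ball_self hr.1)
  have hpos : volume (Metric.ball x r ∩ Ω) ≠ 0 :=
    ((Metric.isOpen_ball.inter hΩ).measure_pos _ hne).ne'
  have hfin : volume (Metric.ball x r ∩ Ω) ≠ ⊤ :=
    ((measure_mono inter_subset_left).trans_lt measure_ball_lt_top).ne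
  have hi : IntegrableOn φ (Metric.ball x r ∩ Ω) :=
    (hφ.locallyIntegrable.integrableOn_isCompact (isCompact_closedBall x r)).mono_set
      (inter_subset_left.trans Metric.ball_subset_closedBall)
  have h1 : (⨍ y in Metric.ball x r ∩ Ω, φ y) ∈ Metric.closedBall (φ x) (ε / 2) := by
    refine (convex_closedBall (φ x) (ε / 2)).set_average_mem Metric.isClosed_closedBall hpos hfin ?_ hi
    filter_upwards [ae_restrict_mem hm] with y hy
    exact (hφδ y (lt_trans hy.1 hr.2)).le
  have := Metric.mem_closedBall.1 h1
  linarith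

/-- The boundary condition satisfied by the traces of the elements of `V₀`: both `N` and `M` are
represented by boundary integrals against smooth test functions, and these are dense. -/
theorem System.MemV0.ae_act_trace_eq_zero (hd : 1 ≤ d) (hΩ : IsPolytopal Ω) {𝓑 : 𝓢.BoundaryOperator}
    {w : 𝓢.graphSpace} {θ s : ℝ} (hw : HasTraceReg Ω w.1 θ) (hs : 1 / 2 < s)
    (hws : MemSobolev Ω s w.1) (h : 𝓢.MemV0 𝓑 w) :
    ∀ᵐ x ∂(surf d).restrict (frontier Ω),
      act (𝓢.M x - 𝓢.normalField (outwardNormal Ω x) x) (trace Ω w.1 x) = 0 := by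
  have hΩo := hΩ.isOpen
  have hfin := hΩ.isFiniteMeasure_frontier hd
  have hMtr := memLp_act' 𝓢.M_mem (hw.memLp_trace hd hΩ hΩ subset_rfl)
  have hNtr := 𝓢.memLp_normalField_trace hd hw hΩ hΩ subset_rfl
  have key : ∀ᵐ x ∂(surf d).restrict (frontier Ω), x ∈ univ → act (𝓢.M x) (trace Ω w.1 x) -
      act (𝓢.normalField (outwardNormal Ω x) x) (trace Ω w.1 x) = 0 := by
    refine ae_eq_zero_of_forall_ip isOpen_univ (hMtr.sub hNtr) fun φ hφ => ?_
    obtain ⟨hφ, hφc, -⟩ := hφ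
    set v := 𝓢.ofSmooth hΩo hφ hφc with hv
    have hvφ := 𝓢.coeFn_ofSmooth hΩo hφ hφc
    have hvA := 𝓢.weakA1_ofSmooth hΩo hφ hφc
    have hφL : MemLp φ 2 (volume.restrict Ω) := hφ.continuous.memLp_of_hasCompactSupport hφc
    have hφS : MemLp φ 2 ((surf d).restrict (frontier Ω)) :=
      hφ.continuous.memLp_of_hasCompactSupport hφc
    have h1 := h v
    rw [𝓑.represented s hs w v hws
      (memSobolev_of_contDiff hd hΩo hΩ.isBounded s hφ hφc hvφ)] at h1
    have h2 : ip ((surf d).restrict (frontier Ω)) (fun x => act (𝓢.M x) (trace Ω w.1 x))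
        (trace Ω v.1) = ip ((surf d).restrict (frontier Ω))
          (fun x => act (𝓢.M x) (trace Ω w.1 x)) φ := by
      refine setIntegral_congr_fun isClosed_frontier.measurableSet fun x hx => ?_
      dsimp only
      rw [trace_congr_ae hvφ hΩo.measurableSet,
        trace_of_continuous hφ.continuous hΩo (frontier_subset_closure hx)]
    -- the terms with `K` cancel in `N`, and integration by parts gives the rest
    have h3 : 𝓢.opN w v = ip ((surf d).restrict (frontier Ω))
        (fun x => act (𝓢.normalField (outwardNormal Ω x) x) (trace Ω w.1 x)) φ := by
      have h4 : 𝓢.HasIBP w Ω φ := 𝓢.hasIBP hd hw hΩ hΩ subset_rfl hφ hφc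
      rw [← (h4 : _ = _), System.opN, ip, ip, ip, ip,
        ← integral_sub, ← integral_add (ip_integrable (Lp.memLp _) hφL)
          (ip_integrable hw.memLp (𝓢.memLp_adj hφ hφc))]
      · refine integral_congr_ae ?_
        filter_upwards [hvφ, hvA] with x hx1 hx2
        dsimp only [System.weakA, System.weakAt, System.adj]
        rw [← hv] at hx1 hx2
        rw [hx1, hx2, inner_add_right, inner_sub_left, inner_sub_left, inner_add_left,
          inner_act_left (𝓢.K x)ᴴ, Matrix.conjTranspose_conjTranspose]
        ring
      · exact ip_integrable ((memLp_act 𝓢.K_mem hw.memLp).add (Lp.memLp _)) (Lp.memLp _)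
      · have hKH : MemLp (fun x => (𝓢.K x)ᴴ) ∞ (volume.restrict Ω) := by
          refine 𝓢.K_mem.of_le (continuous_star.comp_aestronglyMeasurable 𝓢.K_mem.1)
            (Eventually.of_forall fun x => ?_)
          exact (norm_star (𝓢.K x)).le
        exact ip_integrable (Lp.memLp _) (((memLp_act hKH (Lp.memLp _)).sub
          (memLp_act 𝓢.divA_mem (Lp.memLp _))).sub (Lp.memLp _))
    rw [h2, h3] at h1
    unfold ip at h1 ⊢
    simp only [inner_sub_right]
    rwa [integral_sub (ip_integrable hMtr hφS) (ip_integrable hNtr hφS)]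
  filter_upwards [key] with x hx
  rw [sub_act]
  exact hx (mem_univ x)

end

/-! ### Geometry of polytopal meshes -/

/-- Two sets with the same outward normal at a point both contain a half-ball, hence overlap. -/
theorem IsOutwardNormal.inter_nonempty {S S' : Set (Pt d)} {x n : Pt d}
    (h : IsOutwardNormal S x n) (h' : IsOutwardNormal S' x n) : (S ∩ S').Nonempty := by
  obtain ⟨hn, r, hr, hS⟩ := h
  obtain ⟨-, r', hr', hS'⟩ := h'
  set t := min r r' / 2 with ht
  have htp : 0 < t := half_pos (lt_min hr hr')
  have htr : t < r := (half_lt_self (lt_min hr hr')).trans_le (min_le_left _ _)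
  have htr' : t < r' := (half_lt_self (lt_min hr hr')).trans_le (min_le_right _ _)
  have hin : inner ℝ n (x - t • n - x) < 0 := by
    rw [sub_sub_cancel_left, inner_neg_right, inner_smul_right, real_inner_self_eq_norm_sq, hn]
    linarith
  have hdist : dist (x - t • n) x = t := by
    rw [dist_eq_norm, sub_sub_cancel_left, norm_neg, norm_smul, hn, mul_one, Real.norm_of_nonneg
      htp.le]
  have h1 : x - t • n ∈ S ∩ Metric.ball x r := by
    rw [hS]; exact ⟨by rw [Metric.mem_ball, hdist]; exact htr, hin⟩
  have h2 : x - t • n ∈ S' ∩ Metric.ball x r' := by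
    rw [hS']; exact ⟨by rw [Metric.mem_ball, hdist]; exact htr', hin⟩
  exact ⟨_, h1.1, h2.1⟩

/-- A subset cannot lie on the other side of the tangent plane. -/
theorem IsOutwardNormal.not_neg_of_subset {S S' : Set (Pt d)} {x n : Pt d}
    (h : IsOutwardNormal S x n) (hS' : S' ⊆ S) : ¬ IsOutwardNormal S' x (-n) := by
  rintro ⟨hn', r', hr', h2⟩
  obtain ⟨hn, r, hr, hS⟩ := h
  set t := min r r' / 2 with ht
  have htp : 0 < t := half_pos (lt_min hr hr')
  have htr : t < r := (half_lt_self (lt_min hr hr')).trans_le (min_le_left _ _)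
  have htr' : t < r' := (half_lt_self (lt_min hr hr')).trans_le (min_le_right _ _)
  have hin : inner ℝ n (x + t • n - x) = t := by
    rw [add_sub_cancel_left, inner_smul_right, real_inner_self_eq_norm_sq, hn]; ring
  have hdist : dist (x + t • n) x = t := by
    rw [dist_eq_norm, add_sub_cancel_left, norm_smul, hn, mul_one, Real.norm_of_nonneg htp.le]
  have h1 : x + t • n ∈ S' ∩ Metric.ball x r' := by
    rw [h2]
    exact ⟨by rw [Metric.mem_ball, hdist]; exact htr', by rw [inner_neg_left, hin]; linarith⟩
  have h3 : x + t • n ∈ S ∩ Metric.ball x r :=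
    ⟨hS' h1.1, by rw [Metric.mem_ball, hdist]; exact htr⟩
  rw [hS] at h3
  have := h3.2
  rw [hin] at this
  linarith

namespace PolytopalMesh

variable {Ω : Set (Pt d)} (𝓜 : PolytopalMesh Ω)

theorem mem_facesOf {T : 𝓜.elems} {F : 𝓜.faces} :
    F ∈ 𝓜.facesOf T ↔ (F : Set (Pt d)) ⊆ frontier (T : Set (Pt d)) := by
  classical
  simp [facesOf]

theorem mem_bdryFaces {F : 𝓜.faces} : F ∈ 𝓜.bdryFaces ↔ (F : Set (Pt d)) ⊆ frontier Ω := by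
  classical
  simp [bdryFaces]

theorem isPolytopal (T : 𝓜.elems) : IsPolytopal (T : Set (Pt d)) := 𝓜.polytopal T.1 T.2

theorem subset_domain (hΩ : IsPolytopal Ω) (T : 𝓜.elems) : (T : Set (Pt d)) ⊆ Ω := by
  refine (interior_maximal ?_ (𝓜.isPolytopal T).isOpen).trans hΩ.interior_closure.subset
  refine LE.le.trans ?_ 𝓜.cover.superset
  exact subset_closure.trans (subset_biUnion_of_mem (u := fun T => closure T) T.2)

theorem measurableSet_elem (T : 𝓜.elems) : MeasurableSet (T : Set (Pt d)) :=
  (𝓜.isPolytopal T).isOpen.measurableSet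

theorem measurableSet_face (F : 𝓜.faces) : MeasurableSet (F : Set (Pt d)) := by
  obtain ⟨c, U, hU, hF⟩ := 𝓜.faces_hyperplane F
  rw [hF]
  exact hU.measurableSet.inter (isClosed_hyp (𝓜.normal F) c).measurableSet

theorem pairwise_disjoint_elems :
    Pairwise (Function.onFun Disjoint fun T : 𝓜.elems => (T : Set (Pt d))) :=
  fun T T' h => 𝓜.elems_disjoint T.1 T.2 T'.1 T'.2 (Subtype.coe_ne_coe.2 h)

/-- The elements cover the domain up to their boundaries, which are null sets. -/
theorem domain_ae_eq (hd : 1 ≤ d) (hΩ : IsPolytopal Ω) :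
    (⋃ T : 𝓜.elems, (T : Set (Pt d))) =ᵐ[volume] Ω := by
  have h1 : (⋃ T : 𝓜.elems, (T : Set (Pt d))) ⊆ Ω := iUnion_subset (𝓜.subset_domain hΩ)
  refine (h1.eventuallyLE).antisymm ?_
  refine ae_le_set.2 (measure_mono_null (t := ⋃ T : 𝓜.elems, frontier (T : Set (Pt d))) ?_ ?_)
  · rintro x ⟨hx, hxn⟩
    have hx' : x ∈ closure Ω := subset_closure hx
    rw [𝓜.cover] at hx'
    obtain ⟨T, hT, hxT⟩ := mem_iUnion₂.1 hx'
    refine mem_iUnion.2 ⟨⟨T, hT⟩, hxT, fun h => hxn (mem_iUnion.2 ⟨⟨T, hT⟩, interior_subset h⟩)⟩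
  · exact measure_iUnion_null fun T => (𝓜.isPolytopal T).volume_frontier hd

theorem setIntegral_domain (hd : 1 ≤ d) (hΩ : IsPolytopal Ω) {f : Pt d → ℂ}
    (hf : IntegrableOn f Ω) : ∫ x in Ω, f x = ∑ T : 𝓜.elems, ∫ x, f x ∂𝓜.vol T := by
  rw [← setIntegral_congr_set (𝓜.domain_ae_eq hd hΩ)]
  exact integral_iUnion_fintype 𝓜.measurableSet_elem 𝓜.pairwise_disjoint_elems
    fun T => hf.mono_set (𝓜.subset_domain hΩ T)

theorem srf_le_bsrf {T : 𝓜.elems} {F : 𝓜.faces} (hF : F ∈ 𝓜.facesOf T) : 𝓜.srf F ≤ 𝓜.bsrf T :=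
  Measure.restrict_mono_set _ (𝓜.mem_facesOf.1 hF)

theorem vol_le (hΩ : IsPolytopal Ω) (T : 𝓜.elems) : 𝓜.vol T ≤ volume.restrict Ω :=
  Measure.restrict_mono_set _ (𝓜.subset_domain hΩ T)

theorem exists_mem_facesOf (F : 𝓜.faces) : ∃ T, F ∈ 𝓜.facesOf T := by
  rcases 𝓜.interface_or_boundary F.1 F.2 with ⟨T, hT, T', -, -, h⟩ | ⟨T, hT, h⟩
  · exact ⟨⟨T, hT⟩, 𝓜.mem_facesOf.2 (h.trans inter_subset_left)⟩
  · exact ⟨⟨T, hT⟩, 𝓜.mem_facesOf.2 (h.trans inter_subset_left)⟩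

theorem isFiniteMeasure_vol (T : 𝓜.elems) : IsFiniteMeasure (𝓜.vol T) :=
  ⟨by rw [vol, Measure.restrict_apply_univ]; exact (𝓜.isPolytopal T).isBounded.measure_lt_top⟩

theorem isFiniteMeasure_bsrf (hd : 1 ≤ d) (T : 𝓜.elems) : IsFiniteMeasure (𝓜.bsrf T) :=
  (𝓜.isPolytopal T).isFiniteMeasure_frontier hd

theorem outwardNormal_ae_eq {T : 𝓜.elems} {F : 𝓜.faces} (hF : F ∈ 𝓜.facesOf T) :
    ∀ᵐ x ∂𝓜.srf F, outwardNormal (T : Set (Pt d)) x = 𝓜.orient T F • 𝓜.normal F := by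
  filter_upwards [𝓜.orient_normal T F (𝓜.mem_facesOf.1 hF)] with x hx
  exact Friedrichs.outwardNormal_eq hx

theorem outwardNormal_domain_ae_eq {F : 𝓜.faces} (hF : F ∈ 𝓜.bdryFaces) :
    ∀ᵐ x ∂𝓜.srf F, outwardNormal Ω x = 𝓜.normal F := by
  filter_upwards [𝓜.boundary_normal F (𝓜.mem_bdryFaces.1 hF)] with x hx
  exact Friedrichs.outwardNormal_eq hx

/-- Where the boundary of an element meets a face, both have the same normal up to sign, because
distinct hyperplanes meet in null sets. -/
theorem ae_isOutwardNormal_of_mem_frontier (hd : 1 ≤ d) (T : 𝓜.elems) (F : 𝓜.faces) :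
    ∀ᵐ x ∂𝓜.srf F, x ∈ frontier (T : Set (Pt d)) →
      IsOutwardNormal (T : Set (Pt d)) x (𝓜.normal F) ∨
      IsOutwardNormal (T : Set (Pt d)) x (-𝓜.normal F) := by
  obtain ⟨N, hN, hu, hflat⟩ := exists_isFlatAt hd (𝓜.isPolytopal T) (𝓜.isPolytopal T) subset_rfl
  obtain ⟨c, U, -, hF⟩ := 𝓜.faces_hyperplane F
  have h1 : ∀ᵐ x ∂𝓜.srf F, x ∉ edgeSet N :=
    ae_restrict_of_ae (measure_eq_zero_iff_ae_notMem.1 (surf_edgeSet hN hu))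
  have h2 : ∀ᵐ x ∂𝓜.srf F, ∀ ℓ ∈ N, ℓ.1 ≠ 𝓜.normal F → ℓ.1 ≠ -𝓜.normal F →
      x ∉ hyp (𝓜.normal F) c ∩ hyp ℓ.1 ℓ.2 := by
    refine (ae_ball_iff hN.countable).2 fun ℓ hℓ => ?_
    by_cases h : ℓ.1 ≠ 𝓜.normal F ∧ ℓ.1 ≠ -𝓜.normal F
    · have := measure_eq_zero_iff_ae_notMem.1
        (surf_hyp_inter (𝓜.normal_unit F) (hu ℓ hℓ) h.1 h.2 c ℓ.2)
      filter_upwards [ae_restrict_of_ae this] with x hx _ _ using hx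
    · exact Eventually.of_forall fun x h3 h4 => absurd ⟨h3, h4⟩ h
  filter_upwards [h1, h2, ae_restrict_mem (𝓜.measurableSet_face F)] with x hx1 hx2 hxF hxT
  obtain ⟨ℓ, hℓ, hs, n, hn, r, hf⟩ := hflat x hxT hx1
  have hon : IsOutwardNormal (T : Set (Pt d)) x n := ⟨hf.unit, r, hf.pos, hf.half⟩
  have hxc : x ∈ hyp (𝓜.normal F) c := by
    have : x ∈ (F : Set (Pt d)) := hxF
    rw [hF] at this
    exact this.2
  by_cases h3 : ℓ.1 = 𝓜.normal F
  · rw [h3] at hn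
    rcases hn with rfl | rfl
    exacts [Or.inl hon, Or.inr hon]
  by_cases h4 : ℓ.1 = -𝓜.normal F
  · rw [h4, neg_neg] at hn
    rcases hn with rfl | rfl
    exacts [Or.inr hon, Or.inl hon]
  · exact absurd ⟨hxc, mem_hyp_iff_side.2 hs⟩ (hx2 ℓ hℓ h3 h4)

theorem not_isOutwardNormal_of_ne {T T' : 𝓜.elems} (h : T ≠ T') {x n : Pt d}
    (hT : IsOutwardNormal (T : Set (Pt d)) x n) : ¬ IsOutwardNormal (T' : Set (Pt d)) x n :=
  fun hT' => (hT.inter_nonempty hT').ne_empty (𝓜.pairwise_disjoint_elems h).inter_eq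

theorem ae_isOutwardNormal_of_mem_facesOf {T : 𝓜.elems} {F : 𝓜.faces} (hF : F ∈ 𝓜.facesOf T) :
    ∀ᵐ x ∂𝓜.srf F, IsOutwardNormal (T : Set (Pt d)) x (𝓜.normal F) ∨
      IsOutwardNormal (T : Set (Pt d)) x (-𝓜.normal F) := by
  filter_upwards [𝓜.orient_normal T F (𝓜.mem_facesOf.1 hF)] with x hx
  rcases 𝓜.orient_eq T F with h | h <;> rw [h] at hx
  · left; simpa using hx
  · right; simpa using hx

/-- An element whose boundary does not contain a face meets it in a null set: the two sides of the
face are already taken by other elements, or by an element and the exterior of the domain. -/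
theorem ae_notMem_frontier (hd : 1 ≤ d) (hΩ : IsPolytopal Ω) {T : 𝓜.elems} {F : 𝓜.faces}
    (hF : F ∉ 𝓜.facesOf T) : ∀ᵐ x ∂𝓜.srf F, x ∉ frontier (T : Set (Pt d)) := by
  have h0 := 𝓜.ae_isOutwardNormal_of_mem_frontier hd T F
  rcases 𝓜.interface_or_boundary F.1 F.2 with ⟨T₁, hT₁, T₂, hT₂, hne, h⟩ | ⟨T₁, hT₁, h⟩
  · have hF1 : F ∈ 𝓜.facesOf ⟨T₁, hT₁⟩ := 𝓜.mem_facesOf.2 (h.trans inter_subset_left)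
    have hF2 : F ∈ 𝓜.facesOf ⟨T₂, hT₂⟩ := 𝓜.mem_facesOf.2 (h.trans inter_subset_right)
    have hne1 : (⟨T₁, hT₁⟩ : 𝓜.elems) ≠ T := fun h => hF (h ▸ hF1)
    have hne2 : (⟨T₂, hT₂⟩ : 𝓜.elems) ≠ T := fun h => hF (h ▸ hF2)
    have hne3 : (⟨T₁, hT₁⟩ : 𝓜.elems) ≠ ⟨T₂, hT₂⟩ := fun h => hne (congrArg Subtype.val h)
    filter_upwards [h0, 𝓜.ae_isOutwardNormal_of_mem_facesOf hF1,
      𝓜.ae_isOutwardNormal_of_mem_facesOf hF2] with x hx hx1 hx2 hxT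
    rcases hx hxT with h3 | h3 <;> rcases hx1 with h4 | h4 <;> rcases hx2 with h5 | h5 <;>
      first
      | exact 𝓜.not_isOutwardNormal_of_ne hne1 h4 h3
      | exact 𝓜.not_isOutwardNormal_of_ne hne2 h5 h3
      | exact 𝓜.not_isOutwardNormal_of_ne hne3 h4 h5
  · have hF1 : F ∈ 𝓜.facesOf ⟨T₁, hT₁⟩ := 𝓜.mem_facesOf.2 (h.trans inter_subset_left)
    have hne1 : (⟨T₁, hT₁⟩ : 𝓜.elems) ≠ T := fun h => hF (h ▸ hF1)
    filter_upwards [h0, 𝓜.ae_isOutwardNormal_of_mem_facesOf hF1,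
      𝓜.boundary_normal F (h.trans inter_subset_right)] with x hx hx1 hx2 hxT
    rcases hx hxT with h3 | h3
    · rcases hx1 with h4 | h4
      · exact 𝓜.not_isOutwardNormal_of_ne hne1 h4 h3
      · exact hx2.not_neg_of_subset (𝓜.subset_domain hΩ ⟨T₁, hT₁⟩) h4
    · exact hx2.not_neg_of_subset (𝓜.subset_domain hΩ _) h3

/-- The faces contained in the boundary of an element cover it up to a null set. -/
theorem frontier_ae_eq (hd : 1 ≤ d) (hΩ : IsPolytopal Ω) (T : 𝓜.elems) :
    (⋃ F ∈ 𝓜.facesOf T, (F : Set (Pt d))) =ᵐ[surf d] frontier (T : Set (Pt d)) := by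
  have h1 : (⋃ F ∈ 𝓜.facesOf T, (F : Set (Pt d))) ⊆ frontier (T : Set (Pt d)) :=
    iUnion₂_subset fun F hF => 𝓜.mem_facesOf.1 hF
  refine (h1.eventuallyLE).antisymm (ae_le_set.2 ?_)
  refine measure_mono_null (t := (⋃ F : 𝓜.faces, closure (F : Set (Pt d)) \ F) ∪
    ⋃ F : 𝓜.faces, ⋃ (_ : F ∉ 𝓜.facesOf T), (F : Set (Pt d)) ∩ frontier (T : Set (Pt d))) ?_ ?_
  · rintro x ⟨hx, hxn⟩
    have h2 : x ∈ ⋃ T ∈ 𝓜.elems, frontier T := mem_iUnion₂.2 ⟨T.1, T.2, hx⟩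
    rw [𝓜.skeleton] at h2
    obtain ⟨F, hF, hxF⟩ := mem_iUnion₂.1 h2
    by_cases hxF' : x ∈ F
    · right
      refine mem_iUnion₂.2 ⟨⟨F, hF⟩, fun h => hxn (mem_iUnion₂.2 ⟨_, h, hxF'⟩), hxF', hx⟩
    · exact Or.inl (mem_iUnion.2 ⟨⟨F, hF⟩, hxF, hxF'⟩)
  · refine measure_union_null (measure_iUnion_null fun F => 𝓜.faces_boundary F.1 F.2)
      (measure_iUnion_null fun F => measure_iUnion_null fun hF => ?_)
    have := 𝓜.ae_notMem_frontier hd hΩ hF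
    rw [srf, ae_restrict_iff' (𝓜.measurableSet_face F)] at this
    refine measure_eq_zero_iff_ae_notMem.2 ?_
    filter_upwards [this] with x hx hx' using hx hx'.1 hx'.2

theorem integral_bsrf {E : Type*} [NormedAddCommGroup E] [NormedSpace ℝ E] (hd : 1 ≤ d)
    (hΩ : IsPolytopal Ω) (T : 𝓜.elems) {f : Pt d → E} (hf : Integrable f (𝓜.bsrf T)) :
    ∫ x, f x ∂𝓜.bsrf T = ∑ F ∈ 𝓜.facesOf T, ∫ x, f x ∂𝓜.srf F := by
  have h1 : 𝓜.bsrf T = (surf d).restrict (⋃ F ∈ 𝓜.facesOf T, (F : Set (Pt d))) :=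
    (Measure.restrict_congr_set (𝓜.frontier_ae_eq hd hΩ T)).symm
  rw [h1]
  exact integral_biUnion_finset _ (fun F _ => 𝓜.measurableSet_face F)
    (fun F _ F' _ hne => 𝓜.faces_disjoint F.1 F.2 F'.1 F'.2 (Subtype.coe_ne_coe.2 hne))
    fun F hF => IntegrableOn.mono_set hf (𝓜.mem_facesOf.1 hF)

/-- Two elements lie on different sides of a common face. The faces of measure zero are excluded,
as their orientations are arbitrary. -/
theorem orient_ne {T T' : 𝓜.elems} (hne : T ≠ T') {F : 𝓜.faces} (hF : F ∈ 𝓜.facesOf T)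
    (hF' : F ∈ 𝓜.facesOf T') (h0 : 𝓜.srf F ≠ 0) : 𝓜.orient T F ≠ 𝓜.orient T' F := by
  intro h
  have : (ae ((surf d).restrict (F : Set (Pt d)))).NeBot := ae_neBot.2 h0
  obtain ⟨x, hx, hx'⟩ := ((𝓜.orient_normal T F (𝓜.mem_facesOf.1 hF)).and
    (𝓜.orient_normal T' F (𝓜.mem_facesOf.1 hF'))).exists
  rw [h] at hx
  exact 𝓜.not_isOutwardNormal_of_ne hne hx hx'

theorem orient_eq_one (hΩ : IsPolytopal Ω) {T : 𝓜.elems} {F : 𝓜.faces} (hF : F ∈ 𝓜.facesOf T)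
    (hb : F ∈ 𝓜.bdryFaces) (h0 : 𝓜.srf F ≠ 0) : 𝓜.orient T F = 1 := by
  refine (𝓜.orient_eq T F).resolve_right fun h => ?_
  have : (ae ((surf d).restrict (F : Set (Pt d)))).NeBot := ae_neBot.2 h0
  obtain ⟨x, hx, hx'⟩ := ((𝓜.orient_normal T F (𝓜.mem_facesOf.1 hF)).and
    (𝓜.boundary_normal F (𝓜.mem_bdryFaces.1 hb))).exists
  rw [h, neg_one_smul] at hx
  exact hx'.not_neg_of_subset (𝓜.subset_domain hΩ T) hx

/-- Single-valued face terms, weighted by the orientations, cancel on the interfaces. -/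
theorem sum_orient_mul (hΩ : IsPolytopal Ω) {c : 𝓜.faces → ℂ} (hc : ∀ F, 𝓜.srf F = 0 → c F = 0) :
    ∑ T, ∑ F ∈ 𝓜.facesOf T, (𝓜.orient T F : ℂ) * c F = ∑ F ∈ 𝓜.bdryFaces, c F := by
  classical
  have h1 : ∑ T, ∑ F ∈ 𝓜.facesOf T, (𝓜.orient T F : ℂ) * c F =
      ∑ F, ∑ T with F ∈ 𝓜.facesOf T, (𝓜.orient T F : ℂ) * c F :=
    Finset.sum_comm' (by simp)
  have h2 : ∑ F ∈ 𝓜.bdryFaces, c F = ∑ F, if F ∈ 𝓜.bdryFaces then c F else 0 := by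
    rw [Finset.sum_ite_mem, Finset.univ_inter]
  rw [h1, h2]
  refine Finset.sum_congr rfl fun F _ => ?_
  by_cases h0 : 𝓜.srf F = 0
  · simp [hc F h0]
  by_cases hb : F ∈ 𝓜.bdryFaces
  · obtain ⟨T, hT⟩ := 𝓜.exists_mem_facesOf F
    -- every adjacent element lies on the inner side of the boundary
    have h3 : (Finset.univ.filter fun T => F ∈ 𝓜.facesOf T) = {T} := by
      ext T'
      simp only [Finset.mem_filter, Finset.mem_univ, true_and, Finset.mem_singleton]
      refine ⟨fun h => by_contra fun hne => 𝓜.orient_ne hne h hT h0 ?_, fun h => h ▸ hT⟩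
      rw [𝓜.orient_eq_one hΩ h hb h0, 𝓜.orient_eq_one hΩ hT hb h0]
    rw [h3, Finset.sum_singleton, if_pos hb, 𝓜.orient_eq_one hΩ hT hb h0]
    simp
  · rw [if_neg hb]
    rcases 𝓜.interface_or_boundary F.1 F.2 with ⟨T₁, hT₁, T₂, hT₂, hne, h⟩ | ⟨T₁, hT₁, h⟩
    · have hF1 : F ∈ 𝓜.facesOf ⟨T₁, hT₁⟩ := 𝓜.mem_facesOf.2 (h.trans inter_subset_left)
      have hF2 : F ∈ 𝓜.facesOf ⟨T₂, hT₂⟩ := 𝓜.mem_facesOf.2 (h.trans inter_subset_right)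
      have hne3 : (⟨T₁, hT₁⟩ : 𝓜.elems) ≠ ⟨T₂, hT₂⟩ := fun h => hne (congrArg Subtype.val h)
      have h12 := 𝓜.orient_ne hne3 hF1 hF2 h0
      -- a third element would lie on the same side as one of the two
      have h3 : (Finset.univ.filter fun T => F ∈ 𝓜.facesOf T) =
          {(⟨T₁, hT₁⟩ : 𝓜.elems), ⟨T₂, hT₂⟩} := by
        ext T
        simp only [Finset.mem_filter, Finset.mem_univ, true_and, Finset.mem_insert,
          Finset.mem_singleton]
        constructor
        · intro hT
          by_contra! hn
          have h13 := 𝓜.orient_ne hn.1 hT hF1 h0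
          have h23 := 𝓜.orient_ne hn.2 hT hF2 h0
          rcases 𝓜.orient_eq T F with ha | ha <;> rcases 𝓜.orient_eq ⟨T₁, hT₁⟩ F with hb | hb <;>
            rcases 𝓜.orient_eq ⟨T₂, hT₂⟩ F with hc | hc <;> simp_all
        · rintro (rfl | rfl)
          exacts [hF1, hF2]
      rw [h3, Finset.sum_pair hne3, ← add_mul]
      have h4 : 𝓜.orient ⟨T₁, hT₁⟩ F + 𝓜.orient ⟨T₂, hT₂⟩ F = 0 := by
        rcases 𝓜.orient_eq ⟨T₁, hT₁⟩ F with ha | ha <;>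
          rcases 𝓜.orient_eq ⟨T₂, hT₂⟩ F with hb | hb <;> rw [ha, hb] at h12 ⊢ <;> simp_all
      rw [← Complex.ofReal_add, h4]
      simp
    · exact absurd (𝓜.mem_bdryFaces.2 (h.trans inter_subset_right)) hb

end PolytopalMesh

/-! ### The `L²`-inner product -/

theorem ip_eq_inner {μ : Measure (Pt d)} {a b : Pt d → Vc m} (ha : MemLp a 2 μ)
    (hb : MemLp b 2 μ) : ip μ a b = inner ℂ (hb.toLp b) (ha.toLp a) := by
  rw [L2.inner_def]
  refine integral_congr_ae ?_
  filter_upwards [hb.coeFn_toLp, ha.coeFn_toLp] with x h1 h2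
  rw [h1, h2]

theorem normSq_eq_re_ip (μ : Measure (Pt d)) (a : Pt d → Vc m) : normSq μ a = (ip μ a a).re := by
  have h : ip μ a a = ((normSq μ a : ℝ) : ℂ) := by
    unfold ip normSq
    rw [← integral_complex_ofReal]
    refine integral_congr_ae (Eventually.of_forall fun x => ?_)
    simp [inner_self_eq_norm_sq_to_K]
  rw [h, Complex.ofReal_re]

theorem normSq_eq {μ : Measure (Pt d)} {a : Pt d → Vc m} (ha : MemLp a 2 μ) :
    normSq μ a = ‖ha.toLp a‖ ^ 2 := by
  rw [normSq_eq_re_ip, ip_eq_inner ha ha]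
  exact inner_self_eq_norm_sq (𝕜 := ℂ) _

theorem normSq_nonneg (μ : Measure (Pt d)) (a : Pt d → Vc m) : 0 ≤ normSq μ a :=
  integral_nonneg fun _ => by positivity

theorem sqrt_normSq {μ : Measure (Pt d)} {a : Pt d → Vc m} (ha : MemLp a 2 μ) :
    Real.sqrt (normSq μ a) = ‖ha.toLp a‖ := by
  rw [normSq_eq ha, Real.sqrt_sq (norm_nonneg _)]

theorem norm_ip_le {μ : Measure (Pt d)} {a b : Pt d → Vc m} (ha : MemLp a 2 μ)
    (hb : MemLp b 2 μ) : ‖ip μ a b‖ ≤ Real.sqrt (normSq μ a) * Real.sqrt (normSq μ b) := by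
  rw [ip_eq_inner ha hb, sqrt_normSq ha, sqrt_normSq hb, mul_comm]
  exact norm_inner_le_norm _ _

theorem ip_congr_right {μ : Measure (Pt d)} (a : Pt d → Vc m) {b b' : Pt d → Vc m}
    (h : b =ᵐ[μ] b') : ip μ a b = ip μ a b' := by
  refine integral_congr_ae ?_
  filter_upwards [h] with x hx
  rw [hx]

theorem ip_sub_left {μ : Measure (Pt d)} {a a' b : Pt d → Vc m} (ha : MemLp a 2 μ)
    (ha' : MemLp a' 2 μ) (hb : MemLp b 2 μ) :
    ip μ (fun x => a x - a' x) b = ip μ a b - ip μ a' b := by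
  unfold ip
  rw [← integral_sub (ip_integrable ha hb) (ip_integrable ha' hb)]
  simp

theorem ip_sub_right {μ : Measure (Pt d)} {a b b' : Pt d → Vc m} (ha : MemLp a 2 μ)
    (hb : MemLp b 2 μ) (hb' : MemLp b' 2 μ) :
    ip μ a (fun x => b x - b' x) = ip μ a b - ip μ a b' := by
  unfold ip
  rw [← integral_sub (ip_integrable ha hb) (ip_integrable ha hb')]
  simp

theorem ip_smul_right {μ : Measure (Pt d)} (c : ℂ) (a b : Pt d → Vc m) :
    ip μ a (fun x => c • b x) = (starRingEnd ℂ) c * ip μ a b := by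
  unfold ip
  rw [← integral_const_mul]
  simp [mul_comm]

theorem ip_act_left {μ : Measure (Pt d)} (B : Pt d → Mat m) (a b : Pt d → Vc m) :
    ip μ (fun x => act (B x) (a x)) b = ip μ a fun x => act (B x)ᴴ (b x) := by
  refine integral_congr_ae (Eventually.of_forall fun x => ?_)
  simp only
  rw [inner_act_left, Matrix.conjTranspose_conjTranspose]

/-! ### Orthogonal projection on polynomials -/

section

variable {k : ℕ}

theorem contDiff_of_mem_polySpace {v : Pt d → Vc m} (hv : v ∈ polySpace d m k) :
    ContDiff ℝ ∞ v := by
  obtain ⟨p, -, hp⟩ := hv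
  refine (contDiff_piLp 2).2 fun j => ?_
  have : (fun x => v x j) = fun x => MvPolynomial.eval (fun i => ((x i : ℝ) : ℂ)) (p j) :=
    funext fun x => hp x j
  rw [this]
  induction p j using MvPolynomial.induction_on with
  | C a => simpa using contDiff_const
  | add p q h1 h2 => simpa using h1.add h2
  | mul_X p i h =>
    have h2 : ContDiff ℝ ∞ fun x : Pt d => ((x i : ℝ) : ℂ) :=
      Complex.ofRealCLM.contDiff.comp (contDiff_piLp_apply 2)
    simpa using h.mul h2

theorem continuous_poly (v : polySpace d m k) : Continuous v.1 :=
  (contDiff_of_mem_polySpace v.2).continuous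

instance finiteDimensional_polySpace : FiniteDimensional ℂ (polySpace d m k) := by
  set Φ : (Fin m → MvPolynomial.restrictTotalDegree (Fin d) ℂ k) →ₗ[ℂ] (Pt d → Vc m) :=
    { toFun := fun p x => WithLp.toLp 2 fun j =>
        MvPolynomial.eval (fun i => ((x i : ℝ) : ℂ)) (p j).1
      map_add' := fun p q => by ext x j; simp
      map_smul' := fun c p => by ext x j; simp } with hΦ
  have h : polySpace d m k ≤ LinearMap.range Φ := by
    rintro v ⟨p, hp, hv⟩
    refine ⟨fun j => ⟨p j, (MvPolynomial.mem_restrictTotalDegree _ _ _).2 (hp j)⟩, ?_⟩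
    ext x j
    simp [hΦ, hv]
  exact Submodule.finiteDimensional_of_le h

theorem memLp_restrict_of_continuousOn {E : Type*} [NormedAddCommGroup E] {p : ℝ≥0∞}
    {μ : Measure (Pt d)} {S S' : Set (Pt d)} [SecondCountableTopology E]
    (hS : MeasurableSet S) [IsFiniteMeasure (μ.restrict S)] (hS' : IsCompact S') (hSS : S ⊆ S')
    {f : Pt d → E} (hf : ContinuousOn f S') : MemLp f p (μ.restrict S) := by
  obtain ⟨C, hC⟩ := hS'.exists_bound_of_continuousOn hf
  exact MemLp.of_bound ((hf.mono hSS).aestronglyMeasurable hS) C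
    ((ae_restrict_mem hS).mono fun x hx => hC x (hSS hx))

/-- The projection on polynomials exists because the polynomials of bounded degree span a
finite-dimensional subspace of `L²`, so that the defining property of `proj` holds. -/
theorem proj_orthogonal {μ : Measure (Pt d)} (hμ : ∀ q : polySpace d m k, MemLp q.1 2 μ)
    {w : Pt d → Vc m} (hw : MemLp w 2 μ) (q : polySpace d m k) :
    ip μ (fun x => w x - (proj k μ w).1 x) q.1 = 0 := by
  have h : ∃ p : polySpace d m k, ∀ q : polySpace d m k, ip μ (fun x => w x - p.1 x) q.1 = 0 := by
    set P : polySpace d m k →ₗ[ℂ] Lp (Vc m) 2 μ :=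
      { toFun := fun q => (hμ q).toLp q.1
        map_add' := fun q q' => rfl
        map_smul' := fun c q => rfl } with hP
    obtain ⟨p, hp⟩ : (LinearMap.range P).starProjection (hw.toLp w) ∈ LinearMap.range P :=
      Submodule.starProjection_apply_mem _ _
    refine ⟨p, fun q => ?_⟩
    have h1 : ip μ (fun x => w x - p.1 x) q.1 = inner ℂ (P q) (hw.toLp w - P p) := by
      exact ip_eq_inner (hw.sub (hμ p)) (hμ q)
    rw [h1, hp]
    exact Submodule.inner_right_of_mem_orthogonal (LinearMap.mem_range_self P q)
      (Submodule.sub_starProjection_mem_orthogonal _)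
  rw [proj, dif_pos h]
  exact h.choose_spec q

/-- The Pythagorean theorem for the projection on polynomials. -/
theorem normSq_sub_eq_add {μ : Measure (Pt d)} (hμ : ∀ q : polySpace d m k, MemLp q.1 2 μ)
    {w : Pt d → Vc m} (hw : MemLp w 2 μ) (q : polySpace d m k) :
    normSq μ (fun x => w x - q.1 x) =
      normSq μ (fun x => w x - (proj k μ w).1 x) +
        normSq μ (fun x => (proj k μ w).1 x - q.1 x) := by
  set p := proj k μ w with hp
  have h1 : MemLp (fun x => w x - p.1 x) 2 μ := hw.sub (hμ p)
  have h2 : MemLp (fun x => p.1 x - q.1 x) 2 μ := (hμ p).sub (hμ q)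
  have h0 : ip μ (fun x => w x - p.1 x) (fun x => p.1 x - q.1 x) = 0 :=
    proj_orthogonal hμ hw (p - q)
  have h4 : MemLp (fun x => w x - q.1 x) 2 μ := hw.sub (hμ q)
  rw [normSq_eq h4, normSq_eq h1, normSq_eq h2]
  rw [ip_eq_inner h1 h2] at h0
  have h3 : h4.toLp (fun x => w x - q.1 x) = h2.toLp _ + h1.toLp _ := by
    rw [← MemLp.toLp_add]
    refine MemLp.toLp_congr _ _ (Eventually.of_forall fun x => ?_)
    simp
  rw [h3, add_comm (‖h1.toLp _‖ ^ 2), sq, sq, sq]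
  exact norm_add_sq_eq_norm_sq_add_norm_sq_of_inner_eq_zero _ _ h0

theorem normSq_sub_proj_le {μ : Measure (Pt d)} (hμ : ∀ q : polySpace d m k, MemLp q.1 2 μ)
    {w : Pt d → Vc m} (hw : MemLp w 2 μ) (q : polySpace d m k) :
    normSq μ (fun x => w x - (proj k μ w).1 x) ≤ normSq μ fun x => w x - q.1 x := by
  rw [normSq_sub_eq_add hμ hw q]
  exact le_add_of_nonneg_right (normSq_nonneg _ _)

theorem normSq_proj_sub_le {μ : Measure (Pt d)} (hμ : ∀ q : polySpace d m k, MemLp q.1 2 μ)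
    {w : Pt d → Vc m} (hw : MemLp w 2 μ) (q : polySpace d m k) :
    normSq μ (fun x => (proj k μ w).1 x - q.1 x) ≤ normSq μ fun x => w x - q.1 x := by
  rw [normSq_sub_eq_add hμ hw q]
  exact le_add_of_nonneg_left (normSq_nonneg _ _)

variable {Ω : Set (Pt d)} (𝓜 : PolytopalMesh Ω)

theorem PolytopalMesh.face_subset (hΩ : IsPolytopal Ω) (F : 𝓜.faces) :
    (F : Set (Pt d)) ⊆ closure Ω := by
  obtain ⟨T, hT⟩ := 𝓜.exists_mem_facesOf F
  exact ((𝓜.mem_facesOf.1 hT).trans frontier_subset_closure).trans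
    (closure_mono (𝓜.subset_domain hΩ T))

theorem IsPolytopal.isCompact_closure (hΩ : IsPolytopal Ω) : IsCompact (closure Ω) :=
  Metric.isCompact_of_isClosed_isBounded isClosed_closure hΩ.isBounded.closure

theorem PolytopalMesh.memLp_vol (hΩ : IsPolytopal Ω) {E : Type*} [NormedAddCommGroup E]
    [SecondCountableTopology E] {p : ℝ≥0∞} {f : Pt d → E} (hf : ContinuousOn f (closure Ω))
    (T : 𝓜.elems) : MemLp f p (𝓜.vol T) := by
  have : IsFiniteMeasure (volume.restrict (T : Set (Pt d))) := 𝓜.isFiniteMeasure_vol T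
  exact memLp_restrict_of_continuousOn (𝓜.measurableSet_elem T) hΩ.isCompact_closure
    ((𝓜.subset_domain hΩ T).trans subset_closure) hf

theorem PolytopalMesh.memLp_bsrf (hd : 1 ≤ d) (hΩ : IsPolytopal Ω) {E : Type*}
    [NormedAddCommGroup E] [SecondCountableTopology E] {p : ℝ≥0∞} {f : Pt d → E}
    (hf : ContinuousOn f (closure Ω)) (T : 𝓜.elems) : MemLp f p (𝓜.bsrf T) := by
  have : IsFiniteMeasure ((surf d).restrict (frontier (T : Set (Pt d)))) :=
    𝓜.isFiniteMeasure_bsrf hd T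
  exact memLp_restrict_of_continuousOn isClosed_frontier.measurableSet hΩ.isCompact_closure
    (frontier_subset_closure.trans (closure_mono (𝓜.subset_domain hΩ T))) hf

theorem PolytopalMesh.memLp_srf (hd : 1 ≤ d) (hΩ : IsPolytopal Ω) {E : Type*}
    [NormedAddCommGroup E] [SecondCountableTopology E] {p : ℝ≥0∞} {f : Pt d → E}
    (hf : ContinuousOn f (closure Ω)) (F : 𝓜.faces) : MemLp f p (𝓜.srf F) := by
  obtain ⟨T, hT⟩ := 𝓜.exists_mem_facesOf F
  exact (𝓜.memLp_bsrf hd hΩ hf T).mono_measure (𝓜.srf_le_bsrf hT)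

theorem memLp_faceN (hd : 1 ≤ d) (hΩ : IsPolytopal Ω) (𝓢 : System Ω m) (F : 𝓜.faces) :
    MemLp (faceN 𝓜 𝓢 F) ∞ (𝓜.srf F) :=
  𝓜.memLp_srf hd hΩ (𝓢.continuousOn_normalField (𝓜.normal F)) F

end

/-! ### Integration by parts on the elements -/

section

variable {Ω : Set (Pt d)} {k : ℕ} (𝓜 : PolytopalMesh Ω) (𝓢 : System Ω m)

/-- Functions of `H^s`, `s > 1/2`, satisfy the hypotheses of the trace theory. -/
theorem exists_hasTraceReg (hd : 1 ≤ d) (hΩ : IsPolytopal Ω) {s : ℝ} (hs : 1 / 2 < s)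
    {w : Lp (Vc m) 2 (volume.restrict Ω)} (hw : MemSobolev Ω s w) : ∃ θ, HasTraceReg Ω w θ := by
  obtain ⟨θ, h1, -, h2⟩ := hw.exists_slobodeckijSq_lt_top hd hΩ.isOpen hΩ.isBounded hs
    (Lp.stronglyMeasurable w)
  exact ⟨θ, Lp.stronglyMeasurable w, Lp.memLp w, h1, h2⟩

/-- Polynomials may be cut off outside the domain. -/
theorem IsPolytopal.exists_compactSupport_eventuallyEq (hΩ : IsPolytopal Ω) {φ : Pt d → Vc m}
    (hφ : ContDiff ℝ ∞ φ) : ∃ ψ : Pt d → Vc m, ContDiff ℝ ∞ ψ ∧ HasCompactSupport ψ ∧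
      ∀ x ∈ closure Ω, ψ =ᶠ[𝓝 x] φ := by
  obtain ⟨R, hR⟩ := hΩ.isCompact_closure.isBounded.subset_ball (0 : Pt d)
  have hR' : 0 < max R 1 := by positivity
  set χ : ContDiffBump (0 : Pt d) := ⟨max R 1, max R 1 + 1, hR', lt_add_one _⟩
  refine ⟨fun x => χ x • φ x, χ.contDiff.smul hφ,
    HasCompactSupport.smul_right (f := χ) (f' := φ) χ.hasCompactSupport, fun x hx => ?_⟩
  have hx' : x ∈ Metric.ball (0 : Pt d) (max R 1) :=
    Metric.ball_subset_ball (le_max_left _ _) (hR hx)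
  filter_upwards [Metric.isOpen_ball.mem_nhds hx'] with y hy
  rw [χ.one_of_mem_closedBall (Metric.ball_subset_closedBall hy), one_smul]

theorem System.A1_congr {φ ψ : Pt d → Vc m} {x : Pt d} (h : ψ =ᶠ[𝓝 x] φ) :
    𝓢.A1 ψ x = 𝓢.A1 φ x := by
  simp [System.A1, partialD, h.fderiv_eq]

theorem System.adj_congr {φ ψ : Pt d → Vc m} {x : Pt d} (h : ψ =ᶠ[𝓝 x] φ) :
    𝓢.adj ψ x = 𝓢.adj φ x := by
  rw [System.adj, System.adj, 𝓢.A1_congr h, h.eq_of_nhds]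

theorem PolytopalMesh.ae_vol_mem (T : 𝓜.elems) : ∀ᵐ x ∂𝓜.vol T, x ∈ (T : Set (Pt d)) :=
  ae_restrict_mem (𝓜.measurableSet_elem T)

theorem PolytopalMesh.ae_srf_mem (F : 𝓜.faces) : ∀ᵐ x ∂𝓜.srf F, x ∈ (F : Set (Pt d)) :=
  ae_restrict_mem (𝓜.measurableSet_face F)

theorem System.memLp_A1_vol (hΩ : IsPolytopal Ω) {φ : Pt d → Vc m} (hφ : ContDiff ℝ ∞ φ)
    (T : 𝓜.elems) : MemLp (𝓢.A1 φ) 2 (𝓜.vol T) := by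
  refine memLp_finsetSum _ fun i _ => memLp_act' ((𝓢.A_mem i).mono_measure (𝓜.vol_le hΩ T)) ?_
  exact 𝓜.memLp_vol hΩ (continuous_partialD hφ i).continuousOn T

theorem System.memLp_adj_vol (hΩ : IsPolytopal Ω) {φ : Pt d → Vc m} (hφ : ContDiff ℝ ∞ φ)
    (T : 𝓜.elems) : MemLp (𝓢.adj φ) 2 (𝓜.vol T) :=
  (memLp_act' (𝓢.divA_mem.mono_measure (𝓜.vol_le hΩ T))
    (𝓜.memLp_vol hΩ hφ.continuous.continuousOn T)).add (𝓢.memLp_A1_vol 𝓜 hΩ hφ T)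

theorem HasTraceReg.memLp_srf (hd : 1 ≤ d) (hΩ : IsPolytopal Ω) {w : Pt d → Vc m} {θ : ℝ}
    (hw : HasTraceReg Ω w θ) (F : 𝓜.faces) : MemLp (trace Ω w) 2 (𝓜.srf F) := by
  obtain ⟨T, hT⟩ := 𝓜.exists_mem_facesOf F
  exact (hw.memLp_trace hd (𝓜.isPolytopal T) hΩ (𝓜.subset_domain hΩ T)).mono_measure
    (𝓜.srf_le_bsrf hT)

/-- Integration by parts on an element, with the boundary term split into the faces. -/
theorem System.ip_weakA1_add_ip_adj (hd : 1 ≤ d) (hΩ : IsPolytopal Ω) {w : 𝓢.graphSpace} {θ : ℝ}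
    (hw : HasTraceReg Ω w.1 θ) {φ : Pt d → Vc m} (hφ : ContDiff ℝ ∞ φ) (T : 𝓜.elems) :
    ip (𝓜.vol T) (𝓢.weakA1 w) φ + ip (𝓜.vol T) w.1 (𝓢.adj φ) =
      ∑ F ∈ 𝓜.facesOf T, (𝓜.orient T F : ℂ) *
        ip (𝓜.srf F) (fun x => act (faceN 𝓜 𝓢 F x) (trace Ω w.1 x)) φ := by
  obtain ⟨ψ, hψ, hψc, hψφ⟩ := hΩ.exists_compactSupport_eventuallyEq hφ
  have hTΩ := 𝓜.subset_domain hΩ T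
  have h := 𝓢.hasIBP hd hw (𝓜.isPolytopal T) hΩ hTΩ hψ hψc
  have hv : ∀ᵐ x ∂𝓜.vol T, x ∈ closure Ω := by
    filter_upwards [𝓜.ae_vol_mem T] with x hx using subset_closure (hTΩ hx)
  have h1 : ψ =ᵐ[𝓜.vol T] φ := hv.mono fun x hx => (hψφ x hx).eq_of_nhds
  have h2 : 𝓢.adj ψ =ᵐ[𝓜.vol T] 𝓢.adj φ := hv.mono fun x hx => 𝓢.adj_congr (hψφ x hx)
  have hm1 := 𝓢.memLp_normalField_trace hd hw (𝓜.isPolytopal T) hΩ hTΩ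
  have hm2 : MemLp ψ 2 (𝓜.bsrf T) := 𝓜.memLp_bsrf hd hΩ hψ.continuous.continuousOn T
  unfold System.HasIBP at h
  change ip (𝓜.vol T) _ _ + ip (𝓜.vol T) _ _ = ip (𝓜.bsrf T) _ _ at h
  rw [ip_congr_right _ h1, ip_congr_right _ h2] at h
  rw [h]
  refine (𝓜.integral_bsrf hd hΩ T (ip_integrable hm1 hm2)).trans
    (Finset.sum_congr rfl fun F hF => ?_)
  rw [ip, ← integral_const_mul]
  refine integral_congr_ae ?_
  filter_upwards [𝓜.outwardNormal_ae_eq hF, 𝓜.ae_srf_mem F] with x hx hxF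
  have h3 : 𝓢.normalField (𝓜.orient T F • 𝓜.normal F) x =
      (𝓜.orient T F : ℂ) • faceN 𝓜 𝓢 F x := by
    simp only [System.normalField, faceN, Finset.smul_sum, smul_smul, PiLp.smul_apply, smul_eq_mul,
      Complex.ofReal_mul]
  rw [hx, h3, smul_act, inner_smul_right, (hψφ x (𝓜.face_subset hΩ F hxF)).eq_of_nhds]

/-- Integration by parts of two smooth functions on an element: after a cut-off, `p` is an element
of the graph space, and its trace is its restriction. -/
theorem System.ip_A1_add_ip_adj (hd : 1 ≤ d) (hΩ : IsPolytopal Ω) {p φ : Pt d → Vc m}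
    (hp : ContDiff ℝ ∞ p) (hφ : ContDiff ℝ ∞ φ) (T : 𝓜.elems) :
    ip (𝓜.vol T) (𝓢.A1 p) φ + ip (𝓜.vol T) p (𝓢.adj φ) =
      ∑ F ∈ 𝓜.facesOf T, (𝓜.orient T F : ℂ) *
        ip (𝓜.srf F) (fun x => act (faceN 𝓜 𝓢 F x) (p x)) φ := by
  obtain ⟨ψ, hψ, hψc, hψp⟩ := hΩ.exists_compactSupport_eventuallyEq hp
  set u := 𝓢.ofSmooth hΩ.isOpen hψ hψc with hu
  have hueq := 𝓢.coeFn_ofSmooth hΩ.isOpen hψ hψc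
  obtain ⟨θ, hθ⟩ := exists_hasTraceReg hd hΩ (by norm_num : (1 : ℝ) / 2 < 1)
    (memSobolev_of_contDiff hd hΩ.isOpen hΩ.isBounded 1 hψ hψc hueq)
  have hv : ∀ᵐ x ∂𝓜.vol T, x ∈ closure Ω := by
    filter_upwards [𝓜.ae_vol_mem T] with x hx using subset_closure (𝓜.subset_domain hΩ T hx)
  have hac := Measure.absolutelyContinuous_of_le (𝓜.vol_le hΩ T)
  have h1 : u.1 =ᵐ[𝓜.vol T] p := by
    filter_upwards [hac.ae_le hueq, hv] with x hx hx' using hx.trans (hψp x hx').eq_of_nhds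
  have h2 : 𝓢.weakA1 u =ᵐ[𝓜.vol T] 𝓢.A1 p := by
    filter_upwards [hac.ae_le (𝓢.weakA1_ofSmooth hΩ.isOpen hψ hψc), hv] with x hx hx'
      using hx.trans (𝓢.A1_congr (hψp x hx'))
  rw [← ip_congr_left _ h1, ← ip_congr_left _ h2, 𝓢.ip_weakA1_add_ip_adj 𝓜 hd hΩ hθ hφ T]
  refine Finset.sum_congr rfl fun F _ => ?_
  congr 1
  refine ip_congr_left _ ?_
  filter_upwards [𝓜.ae_srf_mem F] with x hx
  have hxΩ := 𝓜.face_subset hΩ F hx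
  rw [trace_congr_ae hueq hΩ.isOpen.measurableSet, trace_of_continuous hψ.continuous hΩ.isOpen hxΩ,
    (hψp x hxΩ).eq_of_nhds]

/-! ### The consistency error -/

theorem broken_of_mem (v : HybridSpace 𝓜 m k) {T : 𝓜.elems} {x : Pt d}
    (hx : x ∈ (T : Set (Pt d))) : broken 𝓜 v x = (v.1 T).1 x := by
  classical
  unfold broken
  rw [Finset.sum_eq_single T, if_pos hx]
  · intro T' _ hne
    rw [if_neg fun h => disjoint_left.1 (𝓜.pairwise_disjoint_elems hne) h hx]
  · simp

theorem memLp_broken (hΩ : IsPolytopal Ω) (v : HybridSpace 𝓜 m k) :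
    MemLp (broken 𝓜 v) 2 (volume.restrict Ω) := by
  have : IsFiniteMeasure (volume.restrict Ω) :=
    ⟨by rw [Measure.restrict_apply_univ]; exact hΩ.isBounded.measure_lt_top⟩
  refine memLp_finsetSum _ fun T _ => ?_
  exact MemLp.indicator (𝓜.measurableSet_elem T)
    (memLp_restrict_of_continuousOn hΩ.isOpen.measurableSet hΩ.isCompact_closure subset_closure
      (continuous_poly (v.1 T)).continuousOn)

theorem System.memLp_weakA (w : 𝓢.graphSpace) : MemLp (𝓢.weakA w) 2 (volume.restrict Ω) :=
  (memLp_act 𝓢.K_mem (Lp.memLp w.1)).add (Lp.memLp (𝓢.weakA1 w))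

theorem System.ip_weakA_broken (hd : 1 ≤ d) (hΩ : IsPolytopal Ω) (w : 𝓢.graphSpace)
    (v : HybridSpace 𝓜 m k) : ip (volume.restrict Ω) (𝓢.weakA w) (broken 𝓜 v) =
      ∑ T, ip (𝓜.vol T) (𝓢.weakA w) (v.1 T).1 := by
  refine (𝓜.setIntegral_domain hd hΩ (ip_integrable (𝓢.memLp_weakA w)
    (memLp_broken 𝓜 hΩ v))).trans (Finset.sum_congr rfl fun T _ => ?_)
  refine ip_congr_right _ ?_
  filter_upwards [𝓜.ae_vol_mem T] with x hx using broken_of_mem 𝓜 v hx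

/-- The formal adjoint `Ã v = K^H v - (∇·A) v - A_1 v` for smooth `v`. -/
def System.opAt (φ : Pt d → Vc m) (x : Pt d) : Vc m := act (𝓢.K x)ᴴ (φ x) - 𝓢.adj φ x

theorem memLp_conjTranspose {μ : Measure (Pt d)} {B : Pt d → Mat m} (hB : MemLp B ∞ μ) :
    MemLp (fun x => (B x)ᴴ) ∞ μ := by
  refine hB.congr_norm ((continuous_id.matrix_conjTranspose).comp_aestronglyMeasurable hB.1)
    (Eventually.of_forall fun x => ?_)
  exact (Matrix.l2_opNorm_conjTranspose (B x)).symm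

/-- The contribution of an element to the consistency error, after integration by parts. -/
theorem System.ip_weakA_sub_ip_opA (hd : 1 ≤ d) (hΩ : IsPolytopal Ω) {w : 𝓢.graphSpace} {θ : ℝ}
    (hw : HasTraceReg Ω w.1 θ) {p φ : Pt d → Vc m} (hp : ContDiff ℝ ∞ p) (hφ : ContDiff ℝ ∞ φ)
    (T : 𝓜.elems) :
    ip (𝓜.vol T) (𝓢.weakA w) φ - ip (𝓜.vol T) (𝓢.opA p) φ =
      ip (𝓜.vol T) (fun x => w.1 x - p x) (𝓢.opAt φ) + ∑ F ∈ 𝓜.facesOf T, (𝓜.orient T F : ℂ) *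
        ip (𝓜.srf F) (fun x => act (faceN 𝓜 𝓢 F x) (trace Ω w.1 x - p x)) φ := by
  have hle := 𝓜.vol_le hΩ T
  have hK := 𝓢.K_mem.mono_measure hle
  have hwT := (Lp.memLp w.1).mono_measure hle
  have hA1w := (Lp.memLp (𝓢.weakA1 w)).mono_measure hle
  have hpT : MemLp p 2 (𝓜.vol T) := 𝓜.memLp_vol hΩ hp.continuous.continuousOn T
  have hφT : MemLp φ 2 (𝓜.vol T) := 𝓜.memLp_vol hΩ hφ.continuous.continuousOn T
  have hadj := 𝓢.memLp_adj_vol 𝓜 hΩ hφ T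
  have hKφ := memLp_act' (memLp_conjTranspose hK) hφT
  have h1 : ip (𝓜.vol T) (𝓢.weakA w) φ = ip (𝓜.vol T) w.1 (fun x => act (𝓢.K x)ᴴ (φ x)) +
      ip (𝓜.vol T) (𝓢.weakA1 w) φ := by
    rw [← ip_act_left]
    exact ip_add_left (memLp_act' hK hwT) hA1w hφT
  have h2 : ip (𝓜.vol T) (𝓢.opA p) φ = ip (𝓜.vol T) p (fun x => act (𝓢.K x)ᴴ (φ x)) +
      ip (𝓜.vol T) (𝓢.A1 p) φ := by
    rw [← ip_act_left]
    exact ip_add_left (memLp_act' hK hpT) (𝓢.memLp_A1_vol 𝓜 hΩ hp T) hφT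
  have h3 : ip (𝓜.vol T) (fun x => w.1 x - p x) (𝓢.opAt φ) =
      ip (𝓜.vol T) w.1 (fun x => act (𝓢.K x)ᴴ (φ x)) - ip (𝓜.vol T) w.1 (𝓢.adj φ) -
      (ip (𝓜.vol T) p (fun x => act (𝓢.K x)ᴴ (φ x)) - ip (𝓜.vol T) p (𝓢.adj φ)) := by
    have hm : MemLp (𝓢.opAt φ) 2 (𝓜.vol T) := hKφ.sub hadj
    rw [ip_sub_left hwT hpT hm, ← ip_sub_right hwT hKφ hadj,
      ← ip_sub_right hpT hKφ hadj]
    rfl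
  have h4 : ∑ F ∈ 𝓜.facesOf T, (𝓜.orient T F : ℂ) *
        ip (𝓜.srf F) (fun x => act (faceN 𝓜 𝓢 F x) (trace Ω w.1 x - p x)) φ =
      ∑ F ∈ 𝓜.facesOf T, (𝓜.orient T F : ℂ) *
        ip (𝓜.srf F) (fun x => act (faceN 𝓜 𝓢 F x) (trace Ω w.1 x)) φ -
      ∑ F ∈ 𝓜.facesOf T, (𝓜.orient T F : ℂ) *
        ip (𝓜.srf F) (fun x => act (faceN 𝓜 𝓢 F x) (p x)) φ := by
    rw [← Finset.sum_sub_distrib]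
    refine Finset.sum_congr rfl fun F _ => ?_
    have hN := memLp_faceN 𝓜 hd hΩ 𝓢 F
    rw [← mul_sub, ← ip_sub_left (memLp_act' hN (hw.memLp_srf 𝓜 hd hΩ F))
      (memLp_act' hN (𝓜.memLp_srf hd hΩ hp.continuous.continuousOn F))
      (𝓜.memLp_srf hd hΩ hφ.continuous.continuousOn F)]
    simp only [act_sub]
  rw [h1, h2, h3, h4, ← 𝓢.ip_weakA1_add_ip_adj 𝓜 hd hΩ hw hφ T,
    ← 𝓢.ip_A1_add_ip_adj 𝓜 hd hΩ hp hφ T]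
  ring

/-- The algebra of the face terms. With `a = w - p_T`, `b = w - p_F`, `u = v_T`, `v = v_F` and `B
= N_F`, all that is left besides pairings with the jump `v_F - v_T` is a term which does not
depend on the element. -/
theorem ip_face_identity {μ : Measure (Pt d)} {B : Pt d → Mat m} (hB : MemLp B ∞ μ)
    {a b u v : Pt d → Vc m} (ha : MemLp a 2 μ) (hb : MemLp b 2 μ) (hu : MemLp u 2 μ)
    (hv : MemLp v 2 μ) :
    ip μ (fun x => act (B x) (a x)) u -
        ip μ (fun x => act (B x) (a x - b x)) (fun x => (1 / 2 : ℂ) • (v x + u x)) =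
      ip μ (fun x => act (B x) (b x)) v -
        (1 / 2) * ip μ (fun x => act (B x) (a x)) (fun x => v x - u x) -
        (1 / 2) * ip μ (fun x => act (B x) (b x)) (fun x => v x - u x) := by
  have hBa := memLp_act' hB ha
  have hBb := memLp_act' hB hb
  have h1 : (starRingEnd ℂ) (1 / 2 : ℂ) = 1 / 2 := by
    rw [map_div₀, map_one, map_ofNat]
  have hm : MemLp (fun x => (1 / 2 : ℂ) • (v x + u x)) 2 μ := (hv.add hu).const_smul (1 / 2 : ℂ)
  simp only [act_sub]
  rw [ip_sub_left hBa hBb hm, ip_smul_right, ip_smul_right,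
    ip_add_right hBa hv hu, ip_add_right hBb hv hu, ip_sub_right hBa hv hu, ip_sub_right hBb hv hu,
    h1]
  ring

theorem System.memLp_M (F : 𝓜.faces) (hF : F ∈ 𝓜.bdryFaces) : MemLp 𝓢.M ∞ (𝓜.srf F) :=
  𝓢.M_mem.mono_measure (Measure.restrict_mono_set _ (𝓜.mem_bdryFaces.1 hF))

variable {𝓜 𝓢} {CS : ℝ} (𝓙 : Stabilization 𝓜 𝓢 k CS)

/-- On a boundary face the trace of `w ∈ V₀` is in the kernel of `M + S^b - N`, so that a discrete
function may be replaced there by its distance to the trace. -/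
theorem Stabilization.ip_bdry_identity (hd : 1 ≤ d) (hΩ : IsPolytopal Ω) {F : 𝓜.faces}
    (hF : F ∈ 𝓜.bdryFaces) {t : Pt d → Vc m} (ht : MemLp t 2 (𝓜.srf F))
    (htr : ∀ᵐ x ∂𝓜.srf F, act (𝓢.M x - faceN 𝓜 𝓢 F x) (t x) = 0) {p v : Pt d → Vc m}
    (hp : MemLp p 2 (𝓜.srf F)) (hv : MemLp v 2 (𝓜.srf F)) :
    ip (𝓜.srf F) (fun x => act (𝓢.M x + 𝓙.Sb F x - faceN 𝓜 𝓢 F x) (p x)) v =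
      2 * ip (𝓜.srf F) (fun x => act (faceN 𝓜 𝓢 F x) (t x - p x)) v -
        ip (𝓜.srf F) (fun x => act (𝓢.M x + 𝓙.Sb F x + faceN 𝓜 𝓢 F x) (t x - p x)) v := by
  have hN := memLp_faceN 𝓜 hd hΩ 𝓢 F
  have hMS := (𝓢.memLp_M 𝓜 F hF).add (𝓙.Sb_mem F hF)
  have he : MemLp (fun x => t x - p x) 2 (𝓜.srf F) := ht.sub hp
  have h1 : MemLp (fun x => (2 : ℂ) • act (faceN 𝓜 𝓢 F x) (t x - p x)) 2 (𝓜.srf F) :=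
    (memLp_act' hN he).const_smul (2 : ℂ)
  have h2 : MemLp (fun x => act (𝓢.M x + 𝓙.Sb F x + faceN 𝓜 𝓢 F x) (t x - p x)) 2 (𝓜.srf F) :=
    memLp_act' (hMS.add hN) he
  have h3 := ip_smul_left (μ := 𝓜.srf F) 2 (fun x => act (faceN 𝓜 𝓢 F x) (t x - p x)) v
  rw [← h3]
  refine Eq.trans (ip_congr_left v ?_) (ip_sub_left h1 h2 hv)
  filter_upwards [htr, 𝓙.Sb_ker F hF] with x hx hx'
  have h4 := hx' (t x) hx
  simp only [act_sub, add_act, sub_act, Pi.smul_apply] at h4 ⊢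
  linear_combination (norm := module) (1 : ℂ) • h4

/-- The error identity: all the terms pair a best approximation error of `w` with a part of `v`
that is controlled by its norm. -/
theorem System.ip_weakA_sub_ah (hd : 1 ≤ d) (hΩ : IsPolytopal Ω) {w : 𝓢.graphSpace} {θ : ℝ}
    (hw : HasTraceReg Ω w.1 θ) (htr : ∀ᵐ x ∂(surf d).restrict (frontier Ω),
      act (𝓢.M x - 𝓢.normalField (outwardNormal Ω x) x) (trace Ω w.1 x) = 0)
    (p v : HybridSpace 𝓜 m k) :
    ip (volume.restrict Ω) (𝓢.weakA w) (broken 𝓜 v) - ah 𝓙 p v =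
      (∑ T, ip (𝓜.vol T) (fun x => w.1 x - (p.1 T).1 x) (𝓢.opAt (v.1 T).1))
      - (1 / 2) * (∑ T, ∑ F ∈ 𝓜.facesOf T, (𝓜.orient T F : ℂ) * ip (𝓜.srf F)
          (fun x => act (faceN 𝓜 𝓢 F x) (trace Ω w.1 x - (p.1 T).1 x)) (jump 𝓜 v T F))
      - (1 / 2) * (∑ T, ∑ F ∈ 𝓜.facesOf T, (𝓜.orient T F : ℂ) * ip (𝓜.srf F)
          (fun x => act (faceN 𝓜 𝓢 F x) (trace Ω w.1 x - (p.2 F).1 x)) (jump 𝓜 v T F))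
      - (𝓢.rflat : ℂ) * (∑ T, (𝓜.h T : ℂ) *
          ∑ F ∈ 𝓜.facesOf T, ip (𝓜.srf F) (jump 𝓜 p T F) (jump 𝓜 v T F))
      + (1 / 2) * (∑ F ∈ 𝓜.bdryFaces, ip (𝓜.srf F)
          (fun x => act (𝓢.M x + 𝓙.Sb F x + faceN 𝓜 𝓢 F x) (trace Ω w.1 x - (p.2 F).1 x))
          (v.2 F).1)
      - jh 𝓙 p v := by
  have hpoly : ∀ (q : polySpace d m k) F, MemLp q.1 2 (𝓜.srf F) := fun q F =>
    𝓜.memLp_srf hd hΩ (continuous_poly q).continuousOn F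
  have hvol : (∑ T, ip (𝓜.vol T) (𝓢.weakA w) (v.1 T).1) -
      ∑ T, ip (𝓜.vol T) (𝓢.opA (p.1 T).1) (v.1 T).1 =
      (∑ T, ip (𝓜.vol T) (fun x => w.1 x - (p.1 T).1 x) (𝓢.opAt (v.1 T).1)) +
      ∑ T, ∑ F ∈ 𝓜.facesOf T, (𝓜.orient T F : ℂ) * ip (𝓜.srf F)
        (fun x => act (faceN 𝓜 𝓢 F x) (trace Ω w.1 x - (p.1 T).1 x)) (v.1 T).1 := by
    rw [← Finset.sum_sub_distrib, ← Finset.sum_add_distrib]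
    exact Finset.sum_congr rfl fun T _ => 𝓢.ip_weakA_sub_ip_opA 𝓜 hd hΩ hw
      (contDiff_of_mem_polySpace (p.1 T).2) (contDiff_of_mem_polySpace (v.1 T).2) T
  have hface : (∑ T, ∑ F ∈ 𝓜.facesOf T, (𝓜.orient T F : ℂ) * ip (𝓜.srf F)
        (fun x => act (faceN 𝓜 𝓢 F x) (trace Ω w.1 x - (p.1 T).1 x)) (v.1 T).1) -
      (∑ T, ∑ F ∈ 𝓜.facesOf T, (𝓜.orient T F : ℂ) *
        ip (𝓜.srf F) (fun x => act (faceN 𝓜 𝓢 F x) (jump 𝓜 p T F x))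
          (fun x => (1 / 2 : ℂ) • ((v.2 F).1 x + (v.1 T).1 x))) =
      (∑ T, ∑ F ∈ 𝓜.facesOf T, (𝓜.orient T F : ℂ) * ip (𝓜.srf F)
        (fun x => act (faceN 𝓜 𝓢 F x) (trace Ω w.1 x - (p.2 F).1 x)) (v.2 F).1)
      - (1 / 2) * (∑ T, ∑ F ∈ 𝓜.facesOf T, (𝓜.orient T F : ℂ) * ip (𝓜.srf F)
          (fun x => act (faceN 𝓜 𝓢 F x) (trace Ω w.1 x - (p.1 T).1 x)) (jump 𝓜 v T F))
      - (1 / 2) * (∑ T, ∑ F ∈ 𝓜.facesOf T, (𝓜.orient T F : ℂ) * ip (𝓜.srf F)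
          (fun x => act (faceN 𝓜 𝓢 F x) (trace Ω w.1 x - (p.2 F).1 x)) (jump 𝓜 v T F)) := by
    simp only [Finset.mul_sum, ← Finset.sum_sub_distrib]
    refine Finset.sum_congr rfl fun T _ => Finset.sum_congr rfl fun F _ => ?_
    have ht := hw.memLp_srf 𝓜 hd hΩ F
    have h := ip_face_identity (memLp_faceN 𝓜 hd hΩ 𝓢 F) (ht.sub (hpoly (p.1 T) F))
      (ht.sub (hpoly (p.2 F) F)) (hpoly (v.1 T) F) (hpoly (v.2 F) F)
    simp only [Pi.sub_apply, sub_sub_sub_cancel_left] at h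
    unfold jump
    linear_combination (𝓜.orient T F : ℂ) * h
  have hcancel := 𝓜.sum_orient_mul hΩ (c := fun F => ip (𝓜.srf F)
    (fun x => act (faceN 𝓜 𝓢 F x) (trace Ω w.1 x - (p.2 F).1 x)) (v.2 F).1)
    fun F h => by simp only [ip, h, integral_zero_measure]
  have hbdry : ∑ F ∈ 𝓜.bdryFaces, ip (𝓜.srf F)
        (fun x => act (𝓢.M x + 𝓙.Sb F x - faceN 𝓜 𝓢 F x) ((p.2 F).1 x)) (v.2 F).1 =
      2 * (∑ F ∈ 𝓜.bdryFaces, ip (𝓜.srf F)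
        (fun x => act (faceN 𝓜 𝓢 F x) (trace Ω w.1 x - (p.2 F).1 x)) (v.2 F).1) -
      ∑ F ∈ 𝓜.bdryFaces, ip (𝓜.srf F)
        (fun x => act (𝓢.M x + 𝓙.Sb F x + faceN 𝓜 𝓢 F x) (trace Ω w.1 x - (p.2 F).1 x))
        (v.2 F).1 := by
    rw [Finset.mul_sum, ← Finset.sum_sub_distrib]
    refine Finset.sum_congr rfl fun F hF => ?_
    refine 𝓙.ip_bdry_identity hd hΩ hF (hw.memLp_srf 𝓜 hd hΩ F) ?_ (hpoly _ F) (hpoly _ F)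
    have h1 := ae_restrict_of_ae_restrict_of_subset (𝓜.mem_bdryFaces.1 hF) htr
    filter_upwards [h1, 𝓜.outwardNormal_domain_ae_eq hF] with x hx hx'
    rwa [hx'] at hx
  rw [𝓢.ip_weakA_broken 𝓜 hd hΩ, ah]
  linear_combination hvol + hface + hcancel - (1 / 2) * hbdry

end

/-! ### Estimate of the consistency error -/

/-- The Cauchy-Schwarz inequality for sums of terms that are each estimated by a product. -/
theorem norm_sum_le_sqrt_mul_sqrt {ι : Type*} (s : Finset ι) {c : ι → ℂ} {A B : ι → ℝ}
    (hA : ∀ i ∈ s, 0 ≤ A i) (hB : ∀ i ∈ s, 0 ≤ B i)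
    (hc : ∀ i ∈ s, ‖c i‖ ≤ Real.sqrt (A i) * Real.sqrt (B i)) :
    ‖∑ i ∈ s, c i‖ ≤ Real.sqrt (∑ i ∈ s, A i) * Real.sqrt (∑ i ∈ s, B i) := by
  refine (norm_sum_le _ _).trans ((Finset.sum_le_sum hc).trans ?_)
  refine (Real.sum_mul_le_sqrt_mul_sqrt _ _ _).trans_eq ?_
  rw [Finset.sum_congr rfl fun i hi => Real.sq_sqrt (hA i hi),
    Finset.sum_congr rfl fun i hi => Real.sq_sqrt (hB i hi)]

theorem sqrt_normSq_sub_le {μ : Measure (Pt d)} {a b : Pt d → Vc m} (ha : MemLp a 2 μ)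
    (hb : MemLp b 2 μ) : Real.sqrt (normSq μ fun x => a x - b x) ≤
      Real.sqrt (normSq μ a) + Real.sqrt (normSq μ b) := by
  have hab : MemLp (fun x => a x - b x) 2 μ := ha.sub hb
  rw [sqrt_normSq ha, sqrt_normSq hb, sqrt_normSq hab]
  exact norm_sub_le (ha.toLp a) (hb.toLp b)

theorem normSq_le_mul {μ : Measure (Pt d)} {a b : Pt d → Vc m} (hb : MemLp b 2 μ) {C : ℝ}
    (h : ∀ᵐ x ∂μ, ‖a x‖ ≤ C * ‖b x‖) : normSq μ a ≤ C ^ 2 * normSq μ b := by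
  unfold normSq
  rw [← integral_const_mul]
  refine integral_mono_of_nonneg (Eventually.of_forall fun x => by positivity)
    ((hb.integrable_norm_pow (by norm_num)).const_mul _) ?_
  filter_upwards [h] with x hx
  calc ‖a x‖ ^ 2 ≤ (C * ‖b x‖) ^ 2 := by gcongr
    _ = _ := mul_pow _ _ _

theorem _root_.Matrix.PosSemidef.re_inner_act_nonneg {B : Mat m} (hB : B.PosSemidef) (ξ : Vc m) :
    0 ≤ (inner ℂ ξ (act B ξ)).re := by
  have h := (Matrix.isPositive_toEuclideanLin_iff.2 hB).re_inner_nonneg_right ξ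
  exact h

theorem re_ip_act_nonneg {μ : Measure (Pt d)} {B : Pt d → Mat m} (hB : MemLp B ∞ μ)
    {v : Pt d → Vc m} (hv : MemLp v 2 μ)
    (h : ∀ᵐ x ∂μ, 0 ≤ (inner ℂ (v x) (act (B x) (v x))).re) :
    0 ≤ (ip μ (fun x => act (B x) (v x)) v).re := by
  have h1 : (ip μ (fun x => act (B x) (v x)) v).re =
      ∫ x, (inner ℂ (v x) (act (B x) (v x))).re ∂μ :=
    (integral_re (ip_integrable (memLp_act' hB hv) hv)).symm
  rw [h1]
  exact integral_nonneg_of_ae h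

/-- The Cauchy-Schwarz inequality for the form of a nonnegative matrix field. -/
theorem norm_ip_act_le {k : ℕ} {μ : Measure (Pt d)} (hμ : ∀ q : polySpace d m k, MemLp q.1 2 μ)
    {B : Pt d → Mat m} (hB : MemLp B ∞ μ) (hpos : ∀ᵐ x ∂μ, (B x).PosSemidef)
    (p q : polySpace d m k) : ‖ip μ (fun x => act (B x) (p.1 x)) q.1‖ ≤
      Real.sqrt (ip μ (fun x => act (B x) (p.1 x)) p.1).re *
        Real.sqrt (ip μ (fun x => act (B x) (q.1 x)) q.1).re := by
  let core : PreInnerProductSpace.Core ℂ (polySpace d m k) :=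
    { inner := fun q p => ip μ (fun x => act (B x) (p.1 x)) q.1
      conj_inner_symm := fun q p => by
        unfold ip
        rw [← integral_conj]
        refine integral_congr_ae ?_
        filter_upwards [hpos] with x hx
        rw [inner_conj_symm, inner_act_left, hx.isHermitian.eq]
      re_inner_nonneg := fun p => re_ip_act_nonneg hB (hμ p)
        (hpos.mono fun x hx => hx.re_inner_act_nonneg _)
      add_left := fun q q' p => ip_add_right (memLp_act' hB (hμ p)) (hμ q) (hμ q')
      smul_left := fun q p c => ip_smul_right c _ _ }
  have h := InnerProductSpace.Core.norm_inner_le_norm (𝕜 := ℂ) q p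
  rw [mul_comm] at h
  exact h

section

variable {Ω : Set (Pt d)} {k : ℕ} {𝓜 : PolytopalMesh Ω} {𝓢 : System Ω m}

theorem ae_norm_le_supNorm {B : Pt d → Mat m} (hB : MemLp B ∞ (volume.restrict Ω)) :
    ∀ᵐ x ∂volume.restrict Ω, ‖B x‖ ≤ supNorm Ω B := by
  have hb : ∀ᵐ x ∂volume.restrict Ω, ‖B x‖ₑ ≤ eLpNorm B ∞ (volume.restrict Ω) := by
    rw [eLpNorm_exponent_top]; exact ae_le_eLpNormEssSup
  filter_upwards [hb] with x hx
  have := ENNReal.toReal_mono hB.2.ne hx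
  rwa [toReal_enorm] at this

theorem supNorm_nonneg (S : Set (Pt d)) (B : Pt d → Mat m) : 0 ≤ supNorm S B :=
  ENNReal.toReal_nonneg

theorem System.rsharp_nonneg : 0 ≤ 𝓢.rsharp := add_nonneg (supNorm_nonneg _ _) (supNorm_nonneg _ _)

theorem System.rho_nonneg : 0 ≤ 𝓢.rho := div_nonneg 𝓢.rsharp_nonneg 𝓢.rflat_pos.le

theorem Aref_nonneg (T : 𝓜.elems) : 0 ≤ Aref 𝓜 𝓢 T :=
  Real.iSup_nonneg fun _ => supNorm_nonneg _ _

theorem PolytopalMesh.h_nonneg (T : 𝓜.elems) : 0 ≤ 𝓜.h T := Metric.diam_nonneg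

theorem tT_pos (T : 𝓜.elems) : 0 < tT 𝓜 𝓢 T :=
  inv_pos.2 (lt_max_of_lt_right 𝓢.rflat_pos)

/-- The zeroth-order part of the formal adjoint is bounded by `𝔯_♯`. -/
theorem System.sqrt_normSq_opAt_le (hΩ : IsPolytopal Ω) {φ : Pt d → Vc m} (hφ : ContDiff ℝ ∞ φ)
    (T : 𝓜.elems) : Real.sqrt (normSq (𝓜.vol T) (𝓢.opAt φ)) ≤
      𝓢.rsharp * Real.sqrt (normSq (𝓜.vol T) φ) + Real.sqrt (normSq (𝓜.vol T) (𝓢.A1 φ)) := by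
  have hle := 𝓜.vol_le hΩ T
  have hφT : MemLp φ 2 (𝓜.vol T) := 𝓜.memLp_vol hΩ hφ.continuous.continuousOn T
  have h1 : MemLp (fun x => act (𝓢.K x)ᴴ (φ x) - act (𝓢.divA x) (φ x)) 2 (𝓜.vol T) :=
    (memLp_act' (memLp_conjTranspose (𝓢.K_mem.mono_measure hle)) hφT).sub
      (memLp_act' (𝓢.divA_mem.mono_measure hle) hφT)
  have h2 : 𝓢.opAt φ = fun x => (act (𝓢.K x)ᴴ (φ x) - act (𝓢.divA x) (φ x)) - 𝓢.A1 φ x := by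
    funext x
    rw [System.opAt, System.adj, sub_sub]
  rw [h2]
  refine (sqrt_normSq_sub_le h1 (𝓢.memLp_A1_vol 𝓜 hΩ hφ T)).trans ?_
  gcongr
  rw [← Real.sqrt_sq 𝓢.rsharp_nonneg, ← Real.sqrt_mul (sq_nonneg _)]
  refine Real.sqrt_le_sqrt (normSq_le_mul hφT ?_)
  filter_upwards [ae_mono hle (ae_norm_le_supNorm 𝓢.K_mem),
    ae_mono hle (ae_norm_le_supNorm 𝓢.divA_mem)] with x hK hD
  have hK' : ‖(𝓢.K x)ᴴ‖ ≤ supNorm Ω 𝓢.K := by rwa [Matrix.l2_opNorm_conjTranspose]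
  calc _ ≤ ‖(𝓢.K x)ᴴ‖ * ‖φ x‖ + ‖𝓢.divA x‖ * ‖φ x‖ :=
        (norm_sub_le _ _).trans (add_le_add (norm_act_le _ _) (norm_act_le _ _))
    _ ≤ supNorm Ω 𝓢.K * ‖φ x‖ + supNorm Ω 𝓢.divA * ‖φ x‖ := by gcongr
    _ = 𝓢.rsharp * ‖φ x‖ := by rw [System.rsharp, add_mul]

theorem PolytopalMesh.normSq_bsrf (hd : 1 ≤ d) (hΩ : IsPolytopal Ω) (T : 𝓜.elems)
    {a : Pt d → Vc m} (ha : MemLp a 2 (𝓜.bsrf T)) :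
    normSq (𝓜.bsrf T) a = ∑ F ∈ 𝓜.facesOf T, normSq (𝓜.srf F) a :=
  𝓜.integral_bsrf hd hΩ T (ha.integrable_norm_pow (by norm_num))

/-- The volume terms of the error identity, by a weighted Cauchy-Schwarz inequality. -/
theorem norm_sum_ip_opAt_le (hΩ : IsPolytopal Ω) {e : 𝓜.elems → Pt d → Vc m}
    (he : ∀ T, MemLp (e T) 2 (𝓜.vol T)) (v : 𝓜.elems → polySpace d m k) :
    ‖∑ T, ip (𝓜.vol T) (e T) (𝓢.opAt (v T).1)‖ ≤
      Real.sqrt (∑ T, (𝓢.rsharp * 𝓢.rho + (tT 𝓜 𝓢 T)⁻¹) * normSq (𝓜.vol T) (e T)) *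
      Real.sqrt (∑ T, (𝓢.rflat * normSq (𝓜.vol T) (v T).1 +
        tT 𝓜 𝓢 T * normSq (𝓜.vol T) (𝓢.A1 (v T).1))) := by
  have hr := 𝓢.rflat_pos
  have hR : ∀ T, 0 ≤ 𝓢.rsharp * 𝓢.rho + (tT 𝓜 𝓢 T)⁻¹ := fun T =>
    add_nonneg (mul_nonneg 𝓢.rsharp_nonneg 𝓢.rho_nonneg) (inv_nonneg.2 (tT_pos T).le)
  refine norm_sum_le_sqrt_mul_sqrt _ (fun T _ => mul_nonneg (hR T) (normSq_nonneg _ _))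
    (fun T _ => ?_) fun T _ => ?_
  · exact add_nonneg (mul_nonneg hr.le (normSq_nonneg _ _))
      (mul_nonneg (tT_pos T).le (normSq_nonneg _ _))
  have hv := contDiff_of_mem_polySpace (v T).2
  have hvT : MemLp (v T).1 2 (𝓜.vol T) := 𝓜.memLp_vol hΩ hv.continuous.continuousOn T
  have hop : MemLp (𝓢.opAt (v T).1) 2 (𝓜.vol T) :=
    (memLp_act' (memLp_conjTranspose (𝓢.K_mem.mono_measure (𝓜.vol_le hΩ T))) hvT).sub
      (𝓢.memLp_adj_vol 𝓜 hΩ hv T)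
  refine (norm_ip_le (he T) hop).trans ?_
  rw [Real.sqrt_mul (hR T), mul_comm (Real.sqrt (_ + _)), mul_assoc]
  gcongr
  refine (𝓢.sqrt_normSq_opAt_le hΩ hv T).trans ?_
  rw [← Real.sqrt_mul (hR T)]
  refine Real.le_sqrt_of_sq_le ?_
  set x := Real.sqrt (normSq (𝓜.vol T) (v T).1)
  set y := Real.sqrt (normSq (𝓜.vol T) (𝓢.A1 (v T).1))
  rw [← Real.sq_sqrt (normSq_nonneg (𝓜.vol T) (v T).1),
    ← Real.sq_sqrt (normSq_nonneg (𝓜.vol T) (𝓢.A1 (v T).1))]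
  change (𝓢.rsharp * x + y) ^ 2 ≤
    (𝓢.rsharp * (𝓢.rsharp / 𝓢.rflat) + (tT 𝓜 𝓢 T)⁻¹) * (𝓢.rflat * x ^ 2 + tT 𝓜 𝓢 T * y ^ 2)
  have ht := tT_pos (𝓢 := 𝓢) T
  generalize tT 𝓜 𝓢 T = t at ht
  generalize 𝓢.rsharp = R
  generalize 𝓢.rflat = r at hr
  -- the weighted Cauchy-Schwarz inequality, with its defect as a square
  have h1 : (R * (R / r) + t⁻¹) * (r * x ^ 2 + t * y ^ 2) - (R * x + y) ^ 2 =
      (R * t * y - r * x) ^ 2 / (r * t) := by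
    field_simp
    ring
  have h2 : 0 ≤ (R * t * y - r * x) ^ 2 / (r * t) := by positivity
  linarith

variable {CS : ℝ} (𝓙 : Stabilization 𝓜 𝓢 k CS)

theorem PolytopalMesh.memLp_poly_srf (hd : 1 ≤ d) (hΩ : IsPolytopal Ω) (q : polySpace d m k)
    (F : 𝓜.faces) : MemLp q.1 2 (𝓜.srf F) :=
  𝓜.memLp_srf hd hΩ (continuous_poly q).continuousOn F

theorem memLp_jump (hd : 1 ≤ d) (hΩ : IsPolytopal Ω) (v : HybridSpace 𝓜 m k) (T : 𝓜.elems)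
    (F : 𝓜.faces) : MemLp (jump 𝓜 v T F) 2 (𝓜.srf F) :=
  𝓜.memLp_poly_srf hd hΩ (v.2 F - v.1 T) F

theorem Stabilization.re_ip_Si_nonneg {T : 𝓜.elems} {F : 𝓜.faces} (hF : F ∈ 𝓜.facesOf T)
    {v : Pt d → Vc m} (hv : MemLp v 2 (𝓜.srf F)) :
    0 ≤ (ip (𝓜.srf F) (fun x => act (𝓙.Si T F x) (v x)) v).re :=
  re_ip_act_nonneg (𝓙.Si_mem T F hF) hv
    ((𝓙.Si_pos T F hF).mono fun _ hx => hx.re_inner_act_nonneg _)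

theorem Stabilization.re_ip_bdry_nonneg {F : 𝓜.faces} (hF : F ∈ 𝓜.bdryFaces)
    {v : Pt d → Vc m} (hv : MemLp v 2 (𝓜.srf F)) :
    0 ≤ (ip (𝓜.srf F) (fun x => act (𝓢.M x + 𝓙.Sb F x) (v x)) v).re := by
  refine re_ip_act_nonneg ((𝓢.memLp_M 𝓜 F hF).add (𝓙.Sb_mem F hF)) hv ?_
  have h1 := ae_restrict_of_ae_restrict_of_subset (𝓜.mem_bdryFaces.1 hF) 𝓢.M_nonneg
  filter_upwards [h1, 𝓙.Sb_pos F hF] with x hx hx'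
  rw [Pi.add_apply, add_act, inner_add_right, Complex.add_re]
  exact add_nonneg (hx _) (hx'.re_inner_act_nonneg _)

theorem re_jh (v : HybridSpace 𝓜 m k) : (jh 𝓙 v v).re = ∑ T, ∑ F ∈ 𝓜.facesOf T,
    (ip (𝓜.srf F) (fun x => act (𝓙.Si T F x) (jump 𝓜 v T F x)) (jump 𝓜 v T F)).re := by
  simp [jh, Complex.re_sum]

/-- The orientation-weighted face terms are controlled by the stabilization. -/
theorem norm_sum_orient_ip_faceN_le (hd : 1 ≤ d) (hΩ : IsPolytopal Ω)
    {e : 𝓜.elems → 𝓜.faces → Pt d → Vc m} (he : ∀ T F, MemLp (e T F) 2 (𝓜.srf F))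
    (v : HybridSpace 𝓜 m k) :
    ‖∑ T, ∑ F ∈ 𝓜.facesOf T, (𝓜.orient T F : ℂ) *
      ip (𝓜.srf F) (fun x => act (faceN 𝓜 𝓢 F x) (e T F x)) (jump 𝓜 v T F)‖ ≤
      |CS| * Real.sqrt (∑ T, Aref 𝓜 𝓢 T * ∑ F ∈ 𝓜.facesOf T, normSq (𝓜.srf F) (e T F)) *
        Real.sqrt (jh 𝓙 v v).re := by
  have hA : ∀ T F, 0 ≤ CS ^ 2 * (Aref 𝓜 𝓢 T * normSq (𝓜.srf F) (e T F)) := fun T F =>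
    mul_nonneg (sq_nonneg _) (mul_nonneg (Aref_nonneg T) (normSq_nonneg _ _))
  have hB : ∀ T, ∀ F ∈ 𝓜.facesOf T, 0 ≤
      (ip (𝓜.srf F) (fun x => act (𝓙.Si T F x) (jump 𝓜 v T F x)) (jump 𝓜 v T F)).re :=
    fun T F hF => 𝓙.re_ip_Si_nonneg hF (memLp_jump hd hΩ v T F)
  have h1 : |CS| * Real.sqrt (∑ T, Aref 𝓜 𝓢 T * ∑ F ∈ 𝓜.facesOf T, normSq (𝓜.srf F) (e T F)) =
      Real.sqrt (∑ T, ∑ F ∈ 𝓜.facesOf T, CS ^ 2 * (Aref 𝓜 𝓢 T * normSq (𝓜.srf F) (e T F))) := by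
    rw [← Real.sqrt_sq_eq_abs, ← Real.sqrt_mul (sq_nonneg CS)]
    simp only [Finset.mul_sum]
  rw [h1, re_jh]
  refine norm_sum_le_sqrt_mul_sqrt _ (fun T _ => Finset.sum_nonneg fun F _ => hA T F)
    (fun T _ => Finset.sum_nonneg (hB T)) fun T _ =>
      norm_sum_le_sqrt_mul_sqrt _ (fun F _ => hA T F) (hB T) fun F hF => ?_
  have ho : ‖(𝓜.orient T F : ℂ)‖ = 1 := by
    rcases 𝓜.orient_eq T F with h | h <;> simp [h]
  -- `N_F` is moved to the jump, which is the argument that the stabilization controls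
  have hherm : ip (𝓜.srf F) (fun x => act (faceN 𝓜 𝓢 F x) (e T F x)) (jump 𝓜 v T F) =
      ip (𝓜.srf F) (e T F) (fun x => act (faceN 𝓜 𝓢 F x) (jump 𝓜 v T F x)) := by
    rw [ip_act_left]
    refine ip_congr_right _ ?_
    filter_upwards [𝓜.ae_srf_mem F] with x hx
    have : (faceN 𝓜 𝓢 F x).IsHermitian :=
      𝓢.isHermitian_normalField (𝓜.normal F) (𝓜.face_subset hΩ F hx)
    rw [this.eq]
  rw [norm_mul, ho, one_mul, hherm]
  refine (𝓙.Si_control T F hF _ _ (he T F) (memLp_jump hd hΩ v T F)).trans ?_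
  rw [Real.sqrt_mul (sq_nonneg CS), Real.sqrt_mul (Aref_nonneg T), Real.sqrt_sq_eq_abs,
    mul_assoc |CS|]
  gcongr
  exact le_abs_self CS

/-- The penalty terms of the error identity. -/
theorem norm_sum_h_ip_jump_le (hd : 1 ≤ d) (hΩ : IsPolytopal Ω) (p v : HybridSpace 𝓜 m k) :
    ‖(𝓢.rflat : ℂ) * (∑ T, (𝓜.h T : ℂ) *
      ∑ F ∈ 𝓜.facesOf T, ip (𝓜.srf F) (jump 𝓜 p T F) (jump 𝓜 v T F))‖ ≤
      Real.sqrt (∑ T, 𝓢.rflat * 𝓜.h T *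
        ∑ F ∈ 𝓜.facesOf T, normSq (𝓜.srf F) (jump 𝓜 p T F)) *
      Real.sqrt (∑ T, 𝓢.rflat * 𝓜.h T *
        ∑ F ∈ 𝓜.facesOf T, normSq (𝓜.srf F) (jump 𝓜 v T F)) := by
  have hrh : ∀ T, 0 ≤ 𝓢.rflat * 𝓜.h T := fun T =>
    mul_nonneg 𝓢.rflat_pos.le (PolytopalMesh.h_nonneg T)
  have hA : ∀ (p : HybridSpace 𝓜 m k) T F,
      0 ≤ 𝓢.rflat * 𝓜.h T * normSq (𝓜.srf F) (jump 𝓜 p T F) := fun p T F =>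
    mul_nonneg (hrh T) (normSq_nonneg _ _)
  simp only [Finset.mul_sum, ← mul_assoc]
  refine norm_sum_le_sqrt_mul_sqrt _ (fun T _ => Finset.sum_nonneg fun F _ => hA p T F)
    (fun T _ => Finset.sum_nonneg fun F _ => hA v T F) fun T _ =>
      norm_sum_le_sqrt_mul_sqrt _ (fun F _ => hA p T F) (fun F _ => hA v T F) fun F hF => ?_
  rw [← Complex.ofReal_mul, norm_mul, Complex.norm_real, Real.norm_of_nonneg (hrh T),
    Real.sqrt_mul (hrh T), Real.sqrt_mul (hrh T), mul_mul_mul_comm, Real.mul_self_sqrt (hrh T)]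
  exact mul_le_mul_of_nonneg_left (norm_ip_le (memLp_jump hd hΩ p T F) (memLp_jump hd hΩ v T F))
    (hrh T)

/-- The stabilization terms of the error identity; the stabilization is bounded on polynomials,
such as the jumps of the interpolant. -/
theorem norm_jh_le (hd : 1 ≤ d) (hΩ : IsPolytopal Ω) (p v : HybridSpace 𝓜 m k) :
    ‖jh 𝓙 p v‖ ≤ Real.sqrt |CS| * Real.sqrt (∑ T, Aref 𝓜 𝓢 T *
        ∑ F ∈ 𝓜.facesOf T, normSq (𝓜.srf F) (jump 𝓜 p T F)) * Real.sqrt (jh 𝓙 v v).re := by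
  have hA : ∀ T F, 0 ≤ |CS| * (Aref 𝓜 𝓢 T * normSq (𝓜.srf F) (jump 𝓜 p T F)) := fun T F =>
    mul_nonneg (abs_nonneg _) (mul_nonneg (Aref_nonneg T) (normSq_nonneg _ _))
  have hB : ∀ T, ∀ F ∈ 𝓜.facesOf T, 0 ≤
      (ip (𝓜.srf F) (fun x => act (𝓙.Si T F x) (jump 𝓜 v T F x)) (jump 𝓜 v T F)).re :=
    fun T F hF => 𝓙.re_ip_Si_nonneg hF (memLp_jump hd hΩ v T F)
  rw [← Real.sqrt_mul (abs_nonneg CS), re_jh]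
  simp only [Finset.mul_sum]
  refine norm_sum_le_sqrt_mul_sqrt _ (fun T _ => Finset.sum_nonneg fun F _ => hA T F)
    (fun T _ => Finset.sum_nonneg (hB T)) fun T _ =>
      norm_sum_le_sqrt_mul_sqrt _ (fun F _ => hA T F) (hB T) fun F hF => ?_
  refine (norm_ip_act_le (fun q => 𝓜.memLp_poly_srf hd hΩ q F) (𝓙.Si_mem T F hF)
    (𝓙.Si_pos T F hF) (p.2 F - p.1 T) (v.2 F - v.1 T)).trans ?_
  refine mul_le_mul_of_nonneg_right (Real.sqrt_le_sqrt ?_) (Real.sqrt_nonneg _)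
  refine (𝓙.Si_bounded T F hF (p.2 F - p.1 T)).trans ?_
  exact mul_le_mul_of_nonneg_right (le_abs_self CS)
    (mul_nonneg (Aref_nonneg T) (normSq_nonneg _ _))

/-- A sum over the boundary faces is part of the sum over all the faces of all the elements. -/
theorem PolytopalMesh.sum_bdryFaces_le {f : 𝓜.elems → 𝓜.faces → ℝ} (hf : ∀ T F, 0 ≤ f T F)
    {τ : 𝓜.faces → 𝓜.elems} (hτ : ∀ F, F ∈ 𝓜.facesOf (τ F)) :
    ∑ F ∈ 𝓜.bdryFaces, f (τ F) F ≤ ∑ T, ∑ F ∈ 𝓜.facesOf T, f T F := by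
  classical
  have h1 : ∑ T, ∑ F ∈ 𝓜.facesOf T, f T F = ∑ F, ∑ T with F ∈ 𝓜.facesOf T, f T F :=
    Finset.sum_comm' (by simp)
  rw [h1]
  refine (Finset.sum_le_univ_sum_of_nonneg fun F => hf _ _).trans (Finset.sum_le_sum fun F _ => ?_)
  exact Finset.single_le_sum (f := fun T => f T F) (fun T _ => hf T F) (by simpa using hτ F)

/-- The boundary terms of the error identity. -/
theorem norm_sum_ip_bdry_le (hd : 1 ≤ d) (hΩ : IsPolytopal Ω) {e : 𝓜.faces → Pt d → Vc m}
    (he : ∀ F, MemLp (e F) 2 (𝓜.srf F)) (v : 𝓜.faces → polySpace d m k) :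
    ‖∑ F ∈ 𝓜.bdryFaces, ip (𝓜.srf F)
      (fun x => act (𝓢.M x + 𝓙.Sb F x + faceN 𝓜 𝓢 F x) (e F x)) (v F).1‖ ≤
      |CS| * Real.sqrt (∑ T, Aref 𝓜 𝓢 T * ∑ F ∈ 𝓜.facesOf T, normSq (𝓜.srf F) (e F)) *
        Real.sqrt (∑ F ∈ 𝓜.bdryFaces,
          (ip (𝓜.srf F) (fun x => act (𝓢.M x + 𝓙.Sb F x) ((v F).1 x)) (v F).1).re) := by
  -- any choice of an element adjacent to each face will do
  choose τ hτ using 𝓜.exists_mem_facesOf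
  have hA : ∀ T F, 0 ≤ CS ^ 2 * (Aref 𝓜 𝓢 T * normSq (𝓜.srf F) (e F)) := fun T F =>
    mul_nonneg (sq_nonneg _) (mul_nonneg (Aref_nonneg T) (normSq_nonneg _ _))
  have hvF : ∀ F, MemLp (v F).1 2 (𝓜.srf F) := fun F => 𝓜.memLp_poly_srf hd hΩ (v F) F
  refine (norm_sum_le_sqrt_mul_sqrt _ (fun F _ => hA (τ F) F)
    (fun F hF => 𝓙.re_ip_bdry_nonneg hF (hvF F)) fun F hF => ?_).trans ?_
  · refine (𝓙.Sb_control (τ F) F hF (hτ F) _ _ (he F) (hvF F)).trans ?_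
    rw [Real.sqrt_mul (sq_nonneg CS), Real.sqrt_mul (Aref_nonneg _), Real.sqrt_sq_eq_abs,
      mul_assoc |CS|]
    gcongr
    exact le_abs_self CS
  · gcongr
    rw [← Real.sqrt_sq_eq_abs, ← Real.sqrt_mul (sq_nonneg CS)]
    refine Real.sqrt_le_sqrt ((PolytopalMesh.sum_bdryFaces_le hA hτ).trans_eq ?_)
    simp only [Finset.mul_sum]

end

section

variable {Ω : Set (Pt d)} {k : ℕ} {𝓜 : PolytopalMesh Ω} {𝓢 : System Ω m} {CS : ℝ}
  (𝓙 : Stabilization 𝓜 𝓢 k CS)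

/-- The square of the norm, split into the parts that control the terms of the error identity. -/
theorem tnormSq_eq (v : HybridSpace 𝓜 m k) : tnormSq 𝓙 v =
    (∑ T, (𝓢.rflat * normSq (𝓜.vol T) (v.1 T).1 +
      tT 𝓜 𝓢 T * normSq (𝓜.vol T) (𝓢.A1 (v.1 T).1)))
    + (∑ T, 𝓢.rflat * 𝓜.h T * ∑ F ∈ 𝓜.facesOf T, normSq (𝓜.srf F) (jump 𝓜 v T F))
    + (1 / 2) * (∑ F ∈ 𝓜.bdryFaces,
      (ip (𝓜.srf F) (fun x => act (𝓢.M x + 𝓙.Sb F x) ((v.2 F).1 x)) (v.2 F).1).re)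
    + (jh 𝓙 v v).re := by
  rw [tnormSq]
  simp only [Finset.sum_add_distrib, mul_add, Finset.mul_sum, mul_assoc]
  ring

/-- The consistency error of the hybrid scheme is bounded, against the norm of hybrid vectors, by
the distances of `w` to its elementwise projections. The face errors `w - π_F w` and `π_F w - π_T
w` are dominated by `w - π_T w`, as `π_F w` is the best approximation on the face. -/
theorem norm_consistencyError_le (hd : 1 ≤ d) (hΩ : IsPolytopal Ω) {𝓑 : 𝓢.BoundaryOperator}
    {s : ℝ} (hs : 1 / 2 < s) {w : 𝓢.graphSpace} (h : 𝓢.MemV0 𝓑 w) (hws : MemSobolev Ω s w.1)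
    (v : HybridSpace 𝓜 m k) :
    ‖consistencyError 𝓙 w v‖ ≤ 3 * (1 + |CS|) * Real.sqrt (
      (∑ T : 𝓜.elems, (𝓢.rsharp * 𝓢.rho + (tT 𝓜 𝓢 T)⁻¹) *
        normSq (𝓜.vol T) (fun x => w.1 x - (proj k (𝓜.vol T) w.1).1 x))
      + ∑ T : 𝓜.elems, (Aref 𝓜 𝓢 T + 𝓢.rflat * 𝓜.h T) *
        normSq (𝓜.bsrf T) (fun x => trace Ω w.1 x - (proj k (𝓜.vol T) w.1).1 x)) *
      tnorm 𝓙 v := by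
  obtain ⟨θ, hw⟩ := exists_hasTraceReg hd hΩ hs hws
  set p := interp 𝓜 k w.1 with hp
  set E : ℝ := ∑ T : 𝓜.elems, (𝓢.rsharp * 𝓢.rho + (tT 𝓜 𝓢 T)⁻¹) *
    normSq (𝓜.vol T) (fun x => w.1 x - (proj k (𝓜.vol T) w.1).1 x) with hE
  set D : ℝ := ∑ T : 𝓜.elems, (Aref 𝓜 𝓢 T + 𝓢.rflat * 𝓜.h T) *
    normSq (𝓜.bsrf T) (fun x => trace Ω w.1 x - (proj k (𝓜.vol T) w.1).1 x) with hD
  set Y := Real.sqrt (E + D) with hY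
  set X := tnorm 𝓙 v with hX
  have hpoly := fun (q : polySpace d m k) F => 𝓜.memLp_poly_srf hd hΩ q F
  have ht := hw.memLp_srf 𝓜 hd hΩ
  have hwT := fun T => (Lp.memLp w.1).mono_measure (𝓜.vol_le hΩ T)
  have hrh : ∀ T, 0 ≤ 𝓢.rflat * 𝓜.h T := fun T =>
    mul_nonneg 𝓢.rflat_pos.le (PolytopalMesh.h_nonneg T)
  have hR : ∀ T, 0 ≤ 𝓢.rsharp * 𝓢.rho + (tT 𝓜 𝓢 T)⁻¹ := fun T =>
    add_nonneg (mul_nonneg 𝓢.rsharp_nonneg 𝓢.rho_nonneg) (inv_nonneg.2 (tT_pos T).le)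
  have hE0 : 0 ≤ E := Finset.sum_nonneg fun T _ => mul_nonneg (hR T) (normSq_nonneg _ _)
  have hD0 : 0 ≤ D := Finset.sum_nonneg fun T _ =>
    mul_nonneg (add_nonneg (Aref_nonneg T) (hrh T)) (normSq_nonneg _ _)
  have hX0 : 0 ≤ X := Real.sqrt_nonneg _
  have hY0 : 0 ≤ Y := Real.sqrt_nonneg _
  -- the four parts of the norm of `v` are nonnegative
  set V₁ : ℝ := ∑ T, (𝓢.rflat * normSq (𝓜.vol T) (v.1 T).1 +
    tT 𝓜 𝓢 T * normSq (𝓜.vol T) (𝓢.A1 (v.1 T).1)) with hV₁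
  set V₂ : ℝ := ∑ T, 𝓢.rflat * 𝓜.h T *
    ∑ F ∈ 𝓜.facesOf T, normSq (𝓜.srf F) (jump 𝓜 v T F) with hV₂
  set V₃ : ℝ := ∑ F ∈ 𝓜.bdryFaces,
    (ip (𝓜.srf F) (fun x => act (𝓢.M x + 𝓙.Sb F x) ((v.2 F).1 x)) (v.2 F).1).re with hV₃
  have hv1 : 0 ≤ V₁ := Finset.sum_nonneg fun T _ =>
    add_nonneg (mul_nonneg 𝓢.rflat_pos.le (normSq_nonneg _ _))
      (mul_nonneg (tT_pos T).le (normSq_nonneg _ _))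
  have hv2 : 0 ≤ V₂ := Finset.sum_nonneg fun T _ =>
    mul_nonneg (hrh T) (Finset.sum_nonneg fun F _ => normSq_nonneg _ _)
  have hv3 : 0 ≤ V₃ := Finset.sum_nonneg fun F hF => 𝓙.re_ip_bdry_nonneg hF (hpoly _ F)
  have hv4 : 0 ≤ (jh 𝓙 v v).re := by
    rw [re_jh]
    exact Finset.sum_nonneg fun T _ => Finset.sum_nonneg fun F hF =>
      𝓙.re_ip_Si_nonneg hF (memLp_jump hd hΩ v T F)
  have hv : tnormSq 𝓙 v = V₁ + V₂ + (1 / 2) * V₃ + (jh 𝓙 v v).re := tnormSq_eq 𝓙 v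
  have hX1 : Real.sqrt V₁ ≤ X := Real.sqrt_le_sqrt (by linarith)
  have hX2 : Real.sqrt V₂ ≤ X := Real.sqrt_le_sqrt (by linarith)
  -- the boundary part enters the squared norm with the factor `1/2`; a factor 4 is ample
  have hX3 : Real.sqrt V₃ ≤ 2 * X := by
    have h4 : Real.sqrt 4 = 2 := by
      rw [show (4 : ℝ) = 2 ^ 2 by norm_num, Real.sqrt_sq (by norm_num)]
    rw [← h4, hX, tnorm, ← Real.sqrt_mul (by norm_num)]
    exact Real.sqrt_le_sqrt (by linarith)
  have hX4 : Real.sqrt (jh 𝓙 v v).re ≤ X := Real.sqrt_le_sqrt (by linarith)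
  -- all the face errors are dominated by the error of the projection on the element
  have hface : ∀ T, normSq (𝓜.bsrf T) (fun x => trace Ω w.1 x - (p.1 T).1 x) =
      ∑ F ∈ 𝓜.facesOf T, normSq (𝓜.srf F) fun x => trace Ω w.1 x - (p.1 T).1 x := fun T =>
    PolytopalMesh.normSq_bsrf hd hΩ T ((hw.memLp_trace hd (𝓜.isPolytopal T) hΩ
      (𝓜.subset_domain hΩ T)).sub (𝓜.memLp_bsrf hd hΩ (continuous_poly _).continuousOn T))
  have hA : ∀ f : 𝓜.elems → 𝓜.faces → Pt d → Vc m,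
      (∀ T F, normSq (𝓜.srf F) (f T F) ≤
        normSq (𝓜.srf F) fun x => trace Ω w.1 x - (p.1 T).1 x) →
      Real.sqrt (∑ T, Aref 𝓜 𝓢 T * ∑ F ∈ 𝓜.facesOf T, normSq (𝓜.srf F) (f T F)) ≤ Y ∧
      Real.sqrt (∑ T, 𝓢.rflat * 𝓜.h T * ∑ F ∈ 𝓜.facesOf T, normSq (𝓜.srf F) (f T F)) ≤ Y := by
    intro f hf
    have hsum : ∀ T, ∑ F ∈ 𝓜.facesOf T, normSq (𝓜.srf F) (f T F) ≤
        normSq (𝓜.bsrf T) fun x => trace Ω w.1 x - (p.1 T).1 x := fun T => by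
      rw [hface T]
      exact Finset.sum_le_sum fun F _ => hf T F
    constructor
    · refine Real.sqrt_le_sqrt (le_add_of_nonneg_of_le hE0 (Finset.sum_le_sum fun T _ => ?_))
      exact mul_le_mul (le_add_of_nonneg_right (hrh T)) (hsum T)
        (Finset.sum_nonneg fun F _ => normSq_nonneg _ _) (add_nonneg (Aref_nonneg T) (hrh T))
    · refine Real.sqrt_le_sqrt (le_add_of_nonneg_of_le hE0 (Finset.sum_le_sum fun T _ => ?_))
      exact mul_le_mul (le_add_of_nonneg_left (Aref_nonneg T)) (hsum T)
        (Finset.sum_nonneg fun F _ => normSq_nonneg _ _) (add_nonneg (Aref_nonneg T) (hrh T))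
  have hYT := (hA (fun T F x => trace Ω w.1 x - (p.1 T).1 x) fun T F => le_rfl).1
  have hYF := (hA (fun T F x => trace Ω w.1 x - (p.2 F).1 x) fun T F =>
    normSq_sub_proj_le (fun q => hpoly q F) (ht F) (p.1 T)).1
  have hYJ := hA (fun T F => jump 𝓜 p T F) fun T F =>
    normSq_proj_sub_le (fun q => hpoly q F) (ht F) (p.1 T)
  -- the terms of the error identity
  have htr := h.ae_act_trace_eq_zero 𝓢 hd hΩ hw hs hws
  have b1 := norm_sum_ip_opAt_le (𝓢 := 𝓢) hΩ (e := fun T x => w.1 x - (p.1 T).1 x)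
    (fun T => (hwT T).sub (𝓜.memLp_vol hΩ (continuous_poly _).continuousOn T)) v.1
  have b2 := norm_sum_orient_ip_faceN_le 𝓙 hd hΩ (e := fun T F x => trace Ω w.1 x - (p.1 T).1 x)
    (fun T F => (ht F).sub (hpoly _ F)) v
  have b3 := norm_sum_orient_ip_faceN_le 𝓙 hd hΩ (e := fun T F x => trace Ω w.1 x - (p.2 F).1 x)
    (fun T F => (ht F).sub (hpoly _ F)) v
  have b4 := norm_sum_h_ip_jump_le (𝓢 := 𝓢) hd hΩ p v
  have b5 := norm_sum_ip_bdry_le 𝓙 hd hΩ (e := fun F x => trace Ω w.1 x - (p.2 F).1 x)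
    (fun F => (ht F).sub (hpoly _ F)) v.2
  have b6 := norm_jh_le 𝓙 hd hΩ p v
  have hc := abs_nonneg CS
  have hYE : Real.sqrt E ≤ Y := Real.sqrt_le_sqrt (le_add_of_nonneg_right hD0)
  have hs1 : Real.sqrt |CS| ≤ 1 + |CS| :=
    Real.sqrt_le_iff.2 ⟨by linarith, by nlinarith⟩
  have c1 := b1.trans (mul_le_mul hYE hX1 (Real.sqrt_nonneg _) hY0)
  have c2 := b2.trans (mul_le_mul (mul_le_mul_of_nonneg_left hYT hc) hX4 (Real.sqrt_nonneg _)
    (mul_nonneg hc hY0))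
  have c3 := b3.trans (mul_le_mul (mul_le_mul_of_nonneg_left hYF hc) hX4 (Real.sqrt_nonneg _)
    (mul_nonneg hc hY0))
  have c4 := b4.trans (mul_le_mul hYJ.2 hX2 (Real.sqrt_nonneg _) hY0)
  have c5 := b5.trans (mul_le_mul (mul_le_mul_of_nonneg_left hYF hc) hX3 (Real.sqrt_nonneg _)
    (mul_nonneg hc hY0))
  have c6 := b6.trans (mul_le_mul (mul_le_mul hs1 hYJ.1 (Real.sqrt_nonneg _) (by linarith)) hX4
    (Real.sqrt_nonneg _) (mul_nonneg (by linarith) hY0))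
  rw [consistencyError, 𝓢.ip_weakA_sub_ah 𝓙 hd hΩ hw htr p v]
  have hhalf : ‖(1 / 2 : ℂ)‖ = 1 / 2 := by norm_num
  refine (norm_sub_le _ _).trans ((add_le_add_left ((norm_add_le _ _).trans (add_le_add_left
    ((norm_sub_le _ _).trans (add_le_add_left ((norm_sub_le _ _).trans (add_le_add_left
      (norm_sub_le _ _) _)) _)) _)) _).trans ?_)
  rw [norm_mul (1 / 2 : ℂ), norm_mul (1 / 2 : ℂ), norm_mul (1 / 2 : ℂ), hhalf]
  -- the total of the six estimates
  have hXY : 3 * (1 + |CS|) * Y * X = Y * X + (1 / 2) * (|CS| * Y * X) + (1 / 2) * (|CS| * Y * X) +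
    Y * X + (1 / 2) * (|CS| * Y * (2 * X)) + (1 + |CS|) * Y * X := by ring
  rw [hXY]
  gcongr

end

end Friedrichs

end

theorem mainTheorem3 (CS : ℝ) :
    ∃ C : ℝ, 0 < C ∧
      ∀ (d m k : ℕ), 1 ≤ d → 0 < m →
      ∀ (Ω : Set (Pt d)), IsPolytopal Ω → IsConnected Ω →
      ∀ (𝓢 : System Ω m) (𝓑 : 𝓢.BoundaryOperator) (𝓜 : PolytopalMesh Ω)
        (𝓙 : Stabilization 𝓜 𝓢 k CS)
        (s : ℝ), 1 / 2 < s →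
      ∀ w : 𝓢.graphSpace, 𝓢.MemV0 𝓑 w → MemSobolev Ω s w.1 →
        dualNorm 𝓙 (consistencyError 𝓙 w) ≤
          ENNReal.ofReal (C * Real.sqrt (
            (∑ T : 𝓜.elems, (𝓢.rsharp * 𝓢.rho + (tT 𝓜 𝓢 T)⁻¹) *
              normSq (𝓜.vol T) (fun x => w.1 x - (proj k (𝓜.vol T) w.1).1 x))
            + ∑ T : 𝓜.elems, (Aref 𝓜 𝓢 T + 𝓢.rflat * 𝓜.h T) *
              normSq (𝓜.bsrf T)
                (fun x => trace Ω w.1 x - (proj k (𝓜.vol T) w.1).1 x))) := by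
  refine ⟨3 * (1 + |CS|), by positivity, fun d m k hd _ Ω hΩ _ 𝓢 𝓑 𝓜 𝓙 s hs w hw hws => ?_⟩
  refine iSup_le fun v => ENNReal.div_le_of_le_mul ?_
  have h := norm_consistencyError_le 𝓙 hd hΩ hs hw hws v
  rw [← ofReal_norm, ← ENNReal.ofReal_mul (by positivity)]
  exact ENNReal.ofReal_le_ofReal h
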